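/- Let $l\ge 1$ be an odd integer, $q$ a primitive $2l$-th root of unity in a field $\Bbbk$ of characteristic $0$ (for instance $q=e^{\pi i m/l}$ and $\Bbbk=\mathbb{Q}(q)$), and let $U_q(\mathfrak{sl}_2)$ be Lusztig's big quantum group (with divided powers) over $\Bbbk$: the specialization at $v=q$ of the $\mathbb{Z}[v,v^{-1}]$-subalgebra of $U_v(\mathfrak{sl}_2)$ generated by all $E^n/[n]!$, $F^n/[n]!$ and $K^{\pm1}$. For $k\ge 0$ let $T(k)$ be the indecomposable tilting $U_q(\mathfrak{sl}_2)$-module (of type $\mathbf 1$) of highest weight $k$, so that $T(1)$ is the two-dimensional simple module, and let $M_k(N)$ be the multiplicity of $T(k)$ in the $N$-th tensor power of $T(1)$. That is, modules $T(k)$ and multiplicities $M_k(N)$ with $$T(1)^{\otimes N}\cong\bigoplus_{k\ge 0}T(k)^{\oplus M_k(N)}\qquad(N\ge 0)$$ exist, and the following holds for any such choice of them. The Plancherel measure $$p_N(k)=\frac{M_k(N)\,\dim T(k)}{(\dim T(1))^N},\qquad k\in\mathbb{Z}_{\ge0},$$ is a probability measure on $\mathbb{Z}_{\ge 0}$ for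 every $N$. Fix $N_0\in\mathbb{Z}_{\ge 0}$ and put $N=2lN_1+N_0$. Let $k$ be random with law $p_N$, and write $k=k_1l+k_0$ with $0\le k_0\le l-1$ and $\alpha=k_1/\sqrt{2N_1}$. As $N_1\to\infty$, the law of $(k_0,\alpha)$ on $\{0,\dots,l-1\}\times\mathbb{R}_{\ge0}$ converges weakly to the product probability measure $p_1\otimes p_2$, where $p_1$ is the probability measure on $\{0,\dots,l-1\}$ with $$p_1(k_0)=\begin{cases}\dfrac{2(l-1-k_0)}{l^2},&0\le k_0\le l-2,\\[2mm] \dfrac1l,&k_0=l-1,\end{cases}$$ and $p_2$ is the probability measure on $\mathbb{R}_{\ge0}$ with density $$p_2(\alpha)=\sqrt{\tfrac{2}{\pi}}\;l^{3/2}\,\alpha^2e^{-\alpha^2l/2}$$ with respect to Lebesgue measure. -/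

import Mathlib

open scoped LaurentPolynomial TensorProduct DirectSum NNReal
open MeasureTheory

universe u

namespace QuantumSL2

/-! ### The quantized enveloping algebra over `ℚ(v)` -/

/-- The ring `ℤ[v, v⁻¹]`; the variable `v` is `LaurentPolynomial.T 1`. -/
abbrev Zv : Type := ℤ[T;T⁻¹]

/-- The field `ℚ(v)`. -/
abbrev Qv : Type := FractionRing Zv

/-- The indeterminate `v` in `ℚ(v)`. -/
noncomputable def v : Qv := algebraMap Zv Qv (LaurentPolynomial.T 1)

/-- Names of the generators; `Ki` stands for `K⁻¹`. -/
inductive Gen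
  | E | F | K | Ki

/-- The defining relations of `U_v(sl₂)`. -/
inductive Rel : FreeAlgebra Qv Gen → FreeAlgebra Qv Gen → Prop
  | K_Ki : Rel (FreeAlgebra.ι Qv Gen.K * FreeAlgebra.ι Qv Gen.Ki) 1
  | Ki_K : Rel (FreeAlgebra.ι Qv Gen.Ki * FreeAlgebra.ι Qv Gen.K) 1
  | K_E : Rel (FreeAlgebra.ι Qv Gen.K * FreeAlgebra.ι Qv Gen.E)
      (v ^ (2 : ℤ) • (FreeAlgebra.ι Qv Gen.E * FreeAlgebra.ι Qv Gen.K))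
  | K_F : Rel (FreeAlgebra.ι Qv Gen.K * FreeAlgebra.ι Qv Gen.F)
      (v ^ (-2 : ℤ) • (FreeAlgebra.ι Qv Gen.F * FreeAlgebra.ι Qv Gen.K))
  | E_F : Rel (FreeAlgebra.ι Qv Gen.E * FreeAlgebra.ι Qv Gen.F
        - FreeAlgebra.ι Qv Gen.F * FreeAlgebra.ι Qv Gen.E)
      ((v - v⁻¹)⁻¹ • (FreeAlgebra.ι Qv Gen.K - FreeAlgebra.ι Qv Gen.Ki))

/-- The `ℚ(v)`-algebra `U_v(sl₂)`. -/
def Uv : Type := RingQuot Rel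

noncomputable instance : Ring Uv := inferInstanceAs (Ring (RingQuot Rel))

noncomputable instance : Algebra Qv Uv := inferInstanceAs (Algebra Qv (RingQuot Rel))

noncomputable instance : Algebra Zv Uv := inferInstanceAs (Algebra Zv (RingQuot Rel))

instance : IsScalarTower Zv Qv Uv := inferInstanceAs (IsScalarTower Zv Qv (RingQuot Rel))

/-- The quotient map from the free algebra. -/
noncomputable def mk : FreeAlgebra Qv Gen →ₐ[Qv] Uv := RingQuot.mkAlgHom Qv Rel

/-- A generator, as an element of `U_v(sl₂)`. -/
noncomputable def gen (g : Gen) : Uv := mk (FreeAlgebra.ι Qv g)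

theorem mk_rel {x y : FreeAlgebra Qv Gen} (h : Rel x y) : mk x = mk y :=
  RingQuot.mkAlgHom_rel Qv h

theorem K_Ki : gen Gen.K * gen Gen.Ki = 1 := by
  simpa only [gen, map_mul, map_one] using mk_rel Rel.K_Ki

theorem Ki_K : gen Gen.Ki * gen Gen.K = 1 := by
  simpa only [gen, map_mul, map_one] using mk_rel Rel.Ki_K

theorem K_E : gen Gen.K * gen Gen.E = v ^ (2 : ℤ) • (gen Gen.E * gen Gen.K) := by
  simpa only [gen, map_mul, map_smul] using mk_rel Rel.K_E

theorem K_F : gen Gen.K * gen Gen.F = v ^ (-2 : ℤ) • (gen Gen.F * gen Gen.K) := by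
  simpa only [gen, map_mul, map_smul] using mk_rel Rel.K_F

theorem E_F : gen Gen.E * gen Gen.F - gen Gen.F * gen Gen.E
    = (v - v⁻¹)⁻¹ • (gen Gen.K - gen Gen.Ki) := by
  simpa only [gen, map_mul, map_sub, map_smul] using mk_rel Rel.E_F

/-- The algebra map out of `U_v(sl₂)` given by images of the generators that satisfy the
relations. -/
noncomputable def liftUv {B : Type*} [Ring B] [Algebra Qv B] (f : Gen → B)
    (h1 : f Gen.K * f Gen.Ki = 1) (h2 : f Gen.Ki * f Gen.K = 1)
    (h3 : f Gen.K * f Gen.E = v ^ (2 : ℤ) • (f Gen.E * f Gen.K))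
    (h4 : f Gen.K * f Gen.F = v ^ (-2 : ℤ) • (f Gen.F * f Gen.K))
    (h5 : f Gen.E * f Gen.F - f Gen.F * f Gen.E = (v - v⁻¹)⁻¹ • (f Gen.K - f Gen.Ki)) :
    Uv →ₐ[Qv] B :=
  (RingQuot.liftAlgHom Qv ⟨FreeAlgebra.lift Qv f, by
    intro x y hxy
    cases hxy <;> simp only [map_mul, map_sub, map_smul, map_one, FreeAlgebra.lift_ι_apply]
    · exact h1
    · exact h2
    · exact h3
    · exact h4
    · exact h5⟩ : RingQuot Rel →ₐ[Qv] B)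

@[simp]
theorem liftUv_gen {B : Type*} [Ring B] [Algebra Qv B] (f : Gen → B) (h1 h2 h3 h4 h5) (g : Gen) :
    liftUv f h1 h2 h3 h4 h5 (gen g) = f g := by
  have : liftUv f h1 h2 h3 h4 h5 (gen g) = FreeAlgebra.lift Qv f (FreeAlgebra.ι Qv g) :=
    RingQuot.liftAlgHom_mkAlgHom_apply ..
  rw [this, FreeAlgebra.lift_ι_apply]

theorem v_ne_zero : v ≠ 0 := by
  have : (LaurentPolynomial.T 1 : Zv) ≠ 0 := (LaurentPolynomial.isUnit_T 1).ne_zero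
  simpa [v] using this

theorem v_zpow (n : ℤ) : v ^ n = algebraMap Zv Qv (LaurentPolynomial.T n) := by
  have hn : ∀ k : ℕ, v ^ k = algebraMap Zv Qv (LaurentPolynomial.T k) := by
    intro k
    rw [v, ← map_pow, LaurentPolynomial.T_pow, mul_one]
  obtain ⟨k, rfl | rfl⟩ := n.eq_nat_or_neg
  · simpa using hn k
  · rw [zpow_neg, zpow_natCast]
    refine inv_eq_of_mul_eq_one_left ?_
    rw [hn, ← map_mul, ← LaurentPolynomial.T_add]
    simp

theorem v_zpow_mem (n : ℤ) : v ^ n ∈ (Algebra.ofId Zv Qv).range :=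
  ⟨LaurentPolynomial.T n, (v_zpow n).symm⟩

/-- The coproduct `Δ E = E ⊗ 1 + K ⊗ E`, `Δ F = F ⊗ K⁻¹ + 1 ⊗ F`, `Δ K = K ⊗ K`. -/
noncomputable def comul : Uv →ₐ[Qv] Uv ⊗[Qv] Uv :=
  liftUv (fun g => match g with
    | Gen.E => gen Gen.E ⊗ₜ 1 + gen Gen.K ⊗ₜ gen Gen.E
    | Gen.F => gen Gen.F ⊗ₜ gen Gen.Ki + 1 ⊗ₜ gen Gen.F
    | Gen.K => gen Gen.K ⊗ₜ gen Gen.K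
    | Gen.Ki => gen Gen.Ki ⊗ₜ gen Gen.Ki)
    (by simp [K_Ki, Algebra.TensorProduct.one_def])
    (by simp [Ki_K, Algebra.TensorProduct.one_def])
    (by
      simp only [mul_add, add_mul, Algebra.TensorProduct.tmul_mul_tmul, K_E, one_mul, mul_one,
        smul_add, TensorProduct.smul_tmul', TensorProduct.tmul_smul])
    (by
      have h : gen Gen.K * gen Gen.Ki = gen Gen.Ki * gen Gen.K := by rw [K_Ki, Ki_K]
      simp only [mul_add, add_mul, Algebra.TensorProduct.tmul_mul_tmul, K_F, one_mul, mul_one,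
        smul_add, TensorProduct.smul_tmul', TensorProduct.tmul_smul, h])
    (by
      have h : gen Gen.E * gen Gen.Ki = v ^ (2 : ℤ) • (gen Gen.Ki * gen Gen.E) := by
        have := congrArg (fun x => gen Gen.Ki * x * gen Gen.Ki) K_E
        simp only [mul_smul_comm, smul_mul_assoc, mul_assoc, K_Ki, mul_one] at this
        rw [← this, ← mul_assoc, Ki_K, one_mul]
      have h2 : (gen Gen.K * gen Gen.F) ⊗ₜ[Qv] (gen Gen.E * gen Gen.Ki)
          = (gen Gen.F * gen Gen.K) ⊗ₜ[Qv] (gen Gen.Ki * gen Gen.E) := by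
        rw [h, K_F, TensorProduct.tmul_smul, TensorProduct.smul_tmul', smul_smul,
          ← zpow_add₀ v_ne_zero]
        simp
      have h3 : (gen Gen.E * gen Gen.F) ⊗ₜ[Qv] gen Gen.Ki - (gen Gen.F * gen Gen.E) ⊗ₜ[Qv] gen Gen.Ki
          = (v - v⁻¹)⁻¹ • (gen Gen.K ⊗ₜ[Qv] gen Gen.Ki - gen Gen.Ki ⊗ₜ[Qv] gen Gen.Ki) := by
        rw [← TensorProduct.sub_tmul, E_F, ← TensorProduct.smul_tmul', TensorProduct.sub_tmul]
      have h4 : gen Gen.K ⊗ₜ[Qv] (gen Gen.E * gen Gen.F) - gen Gen.K ⊗ₜ[Qv] (gen Gen.F * gen Gen.E)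
          = (v - v⁻¹)⁻¹ • (gen Gen.K ⊗ₜ[Qv] gen Gen.K - gen Gen.K ⊗ₜ[Qv] gen Gen.Ki) := by
        rw [← TensorProduct.tmul_sub, E_F, TensorProduct.tmul_smul, TensorProduct.tmul_sub]
      simp only [mul_add, add_mul, Algebra.TensorProduct.tmul_mul_tmul, one_mul, mul_one]
      rw [h2]
      have h5 := congrArg₂ (· + ·) h3 h4
      rw [← smul_add, sub_add_sub_cancel'] at h5
      rw [← h5]
      abel)

/-- The counit. -/
noncomputable def counit : Uv →ₐ[Qv] Qv :=
  liftUv (fun g => match g with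
    | Gen.E => 0
    | Gen.F => 0
    | Gen.K => 1
    | Gen.Ki => 1) (by simp) (by simp) (by simp) (by simp) (by simp)

/-- The antipode `S E = -K⁻¹ E`, `S F = -F K`, `S K = K⁻¹`, as an algebra map to the opposite
algebra. -/
noncomputable def antipode : Uv →ₐ[Qv] Uvᵐᵒᵖ :=
  liftUv (fun g => match g with
    | Gen.E => MulOpposite.op (-(gen Gen.Ki * gen Gen.E))
    | Gen.F => MulOpposite.op (-(gen Gen.F * gen Gen.K))
    | Gen.K => MulOpposite.op (gen Gen.Ki)
    | Gen.Ki => MulOpposite.op (gen Gen.K))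
    (by simp only [← MulOpposite.op_mul, K_Ki, MulOpposite.op_one])
    (by simp only [← MulOpposite.op_mul, Ki_K, MulOpposite.op_one])
    (by
      have h : gen Gen.E * gen Gen.Ki = v ^ (2 : ℤ) • (gen Gen.Ki * gen Gen.E) := by
        have := congrArg (fun x => gen Gen.Ki * x * gen Gen.Ki) K_E
        simp only [mul_smul_comm, smul_mul_assoc, mul_assoc, K_Ki, mul_one] at this
        rw [← this, ← mul_assoc, Ki_K, one_mul]
      simp only [← MulOpposite.op_mul, ← MulOpposite.op_smul]
      congr 1
      rw [neg_mul, mul_assoc, h, mul_smul_comm, mul_neg, smul_neg])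
    (by
      have h : gen Gen.Ki * gen Gen.F = v ^ (2 : ℤ) • (gen Gen.F * gen Gen.Ki) := by
        have := congrArg (fun x => gen Gen.Ki * x * gen Gen.Ki) K_F
        simp only [mul_smul_comm, smul_mul_assoc, mul_assoc, K_Ki, mul_one] at this
        rw [← mul_assoc, Ki_K, one_mul] at this
        rw [this, smul_smul, ← zpow_add₀ v_ne_zero]
        simp
      simp only [← MulOpposite.op_mul, ← MulOpposite.op_smul]
      congr 1
      rw [neg_mul, mul_neg, ← mul_assoc, h, smul_mul_assoc, smul_neg, smul_smul,
        ← zpow_add₀ v_ne_zero, mul_assoc, mul_assoc, Ki_K, K_Ki]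
      simp)
    (by
      have h : gen Gen.Ki * gen Gen.E * (gen Gen.F * gen Gen.K)
          = gen Gen.E * gen Gen.F := by
        have h1 : gen Gen.E * gen Gen.F * gen Gen.K = gen Gen.K * (gen Gen.E * gen Gen.F) := by
          rw [← mul_assoc (gen Gen.K), K_E, smul_mul_assoc, mul_assoc (gen Gen.E) (gen Gen.K), K_F, mul_smul_comm, smul_smul,
            ← zpow_add₀ v_ne_zero, mul_assoc]
          simp
        rw [mul_assoc, ← mul_assoc (gen Gen.E), h1, ← mul_assoc, Ki_K, one_mul]
      have h' : gen Gen.F * gen Gen.K * (gen Gen.Ki * gen Gen.E)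
          = gen Gen.F * gen Gen.E := by
        rw [mul_assoc, ← mul_assoc (gen Gen.K), K_Ki, one_mul]
      simp only [← MulOpposite.op_mul, ← MulOpposite.op_sub, ← MulOpposite.op_smul, neg_mul_neg]
      congr 1
      rw [h, h', ← neg_sub, E_F, ← smul_neg, neg_sub])

/-! ### Divided powers and the integral form -/

/-- The quantum integer `[n] = (vⁿ - v⁻ⁿ)/(v - v⁻¹)`. -/
noncomputable def qint (n : ℤ) : Qv := (v ^ n - v ^ (-n)) / (v - v⁻¹)

/-- The quantum factorial `[n]! = [1][2]⋯[n]`. -/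
noncomputable def qfact (n : ℕ) : Qv := ∏ i ∈ Finset.range n, qint (i + 1)

/-- The divided power `x⁽ⁿ⁾ = xⁿ/[n]!`. -/
noncomputable def divPow {B : Type*} [Ring B] [Algebra Qv B] (x : B) (n : ℕ) : B :=
  (qfact n)⁻¹ • x ^ n

/-- Lusztig's form: the `ℤ[v, v⁻¹]`-subalgebra of `U_v(sl₂)` generated by all divided powers of
`E` and `F` and by `K`, `K⁻¹`. -/
noncomputable def UA : Subalgebra Zv Uv :=
  Algebra.adjoin Zv (Set.range (divPow (gen Gen.E)) ∪ Set.range (divPow (gen Gen.F))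
    ∪ {gen Gen.K, gen Gen.Ki})

theorem divPow_E_mem (n : ℕ) : divPow (gen Gen.E) n ∈ UA :=
  Algebra.subset_adjoin (Or.inl (Or.inl ⟨n, rfl⟩))

theorem divPow_F_mem (n : ℕ) : divPow (gen Gen.F) n ∈ UA :=
  Algebra.subset_adjoin (Or.inl (Or.inr ⟨n, rfl⟩))

theorem K_mem : gen Gen.K ∈ UA := Algebra.subset_adjoin (Or.inr (by simp))

theorem Ki_mem : gen Gen.Ki ∈ UA := Algebra.subset_adjoin (Or.inr (by simp))

/-- To check that the integral form is mapped into a subalgebra it suffices to check the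
generators. -/
theorem UA_map_mem {B : Type*} [Ring B] [Algebra Qv B] [Algebra Zv B] [IsScalarTower Zv Qv B]
    (f : Uv →ₐ[Qv] B) (S : Subalgebra Zv B)
    (hE : ∀ n, divPow (f (gen Gen.E)) n ∈ S) (hF : ∀ n, divPow (f (gen Gen.F)) n ∈ S)
    (hK : f (gen Gen.K) ∈ S) (hKi : f (gen Gen.Ki) ∈ S) {u : Uv} (hu : u ∈ UA) : f u ∈ S := by
  have h : UA ≤ S.comap (f.restrictScalars Zv) := by
    refine Algebra.adjoin_le ?_
    rintro x ((⟨n, rfl⟩ | ⟨n, rfl⟩) | rfl | rfl)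
    · simpa [divPow] using hE n
    · simpa [divPow] using hF n
    · exact hK
    · exact hKi
  exact h hu

theorem v_zpow_smul_mem {B : Type*} [Ring B] [Algebra Qv B] [Algebra Zv B] [IsScalarTower Zv Qv B]
    (S : Subalgebra Zv B) (n : ℤ) {x : B} (hx : x ∈ S) : v ^ n • x ∈ S := by
  rw [v_zpow, algebraMap_smul]
  exact S.smul_mem hx _

theorem v_sub_ne_zero (n : ℤ) (hn : n ≠ 0) : v ^ n - v ^ (-n) ≠ 0 := by
  rw [v_zpow, v_zpow, ← map_sub]
  have hinj : Function.Injective (algebraMap Zv Qv) := IsFractionRing.injective Zv Qv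
  rw [Ne, map_eq_zero_iff _ hinj, sub_eq_zero]
  intro h
  have h2 := congrArg (fun p : Zv => p.coeff n) h
  have h3 : -n ≠ n := by omega
  simp [LaurentPolynomial.T_apply, h3] at h2

theorem v_sub_inv_ne_zero : v - v⁻¹ ≠ 0 := by
  simpa using v_sub_ne_zero 1 one_ne_zero

theorem qint_ne_zero (n : ℤ) (hn : n ≠ 0) : qint n ≠ 0 :=
  div_ne_zero (v_sub_ne_zero n hn) v_sub_inv_ne_zero

@[simp]
theorem qint_zero : qint 0 = 0 := by simp [qint]

@[simp]
theorem qint_one : qint 1 = 1 := by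
  simpa [qint] using div_self v_sub_inv_ne_zero

theorem qint_add (a b : ℤ) : qint (a + b) = v ^ a * qint b + v ^ (-b) * qint a := by
  have ha := zpow_ne_zero a v_ne_zero
  have hb := zpow_ne_zero b v_ne_zero
  simp only [qint, mul_div_assoc', ← add_div, zpow_neg, zpow_add₀ v_ne_zero]
  congr 1
  field_simp
  ring

theorem qfact_succ (n : ℕ) : qfact (n + 1) = qfact n * qint (n + 1) :=
  Finset.prod_range_succ _ _

theorem qfact_ne_zero (n : ℕ) : qfact n ≠ 0 :=
  Finset.prod_ne_zero_iff.mpr fun i _ => qint_ne_zero _ (by omega)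

section

variable {B : Type*} [Ring B] [Algebra Qv B]

@[simp]
theorem divPow_zero (x : B) : divPow x 0 = 1 := by simp [divPow, qfact]

theorem mul_divPow (x : B) (n : ℕ) : x * divPow x n = qint (n + 1) • divPow x (n + 1) := by
  rw [divPow, divPow, mul_smul_comm, ← pow_succ', smul_smul, qfact_succ, mul_inv_rev, ← mul_assoc,
    mul_inv_cancel₀ (qint_ne_zero _ (by omega)), one_mul]

theorem mul_pow_of_comm {x y : B} {c : Qv} (h : x * y = c • (y * x)) (n : ℕ) :
    x * y ^ n = c ^ n • (y ^ n * x) := by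
  induction n with
  | zero => simp
  | succ n ih =>
    rw [pow_succ, ← mul_assoc, ih, smul_mul_assoc, mul_assoc, h, mul_smul_comm, smul_smul,
      ← pow_succ, mul_assoc]

theorem mul_divPow_of_comm {x y : B} {c : Qv} (h : x * y = c • (y * x)) (n : ℕ) :
    x * divPow y n = c ^ n • (divPow y n * x) := by
  rw [divPow, mul_smul_comm, mul_pow_of_comm h, smul_mul_assoc, smul_comm]

/-- The quantum binomial formula. -/
theorem divPow_add {x y : B} (h : x * y = v ^ (2 : ℤ) • (y * x)) (n : ℕ) :
    divPow (x + y) n = ∑ p ∈ Finset.HasAntidiagonal.antidiagonal n,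
      v ^ ((p.1 : ℤ) * p.2) • (divPow y p.1 * divPow x p.2) := by
  induction n with
  | zero => simp
  | succ n ih =>
    have hn : qint (n + 1) ≠ 0 := qint_ne_zero _ (by omega)
    have key : qint (n + 1) • divPow (x + y) (n + 1) = qint (n + 1) •
        ∑ p ∈ Finset.HasAntidiagonal.antidiagonal (n + 1),
          v ^ ((p.1 : ℤ) * p.2) • (divPow y p.1 * divPow x p.2) := by
      rw [← mul_divPow, ih, add_mul, Finset.mul_sum, Finset.mul_sum, Finset.smul_sum]
      have hsplit : ∀ p ∈ Finset.HasAntidiagonal.antidiagonal (n + 1),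
          qint (n + 1) • v ^ ((p.1 : ℤ) * p.2) • (divPow y p.1 * divPow x p.2)
          = (v ^ (p.1 : ℤ) * qint p.2 * v ^ ((p.1 : ℤ) * p.2)) • (divPow y p.1 * divPow x p.2)
          + (v ^ (-(p.2 : ℤ)) * qint p.1 * v ^ ((p.1 : ℤ) * p.2))
            • (divPow y p.1 * divPow x p.2) := by
        intro p hp
        have hp' : (n : ℤ) + 1 = p.1 + p.2 := by
          have := Finset.HasAntidiagonal.mem_antidiagonal.mp hp
          omega
        rw [hp', qint_add, smul_smul, ← add_smul, add_mul]
      rw [Finset.sum_congr rfl hsplit, Finset.sum_add_distrib]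
      congr 1
      · rw [Finset.Nat.sum_antidiagonal_succ']
        simp only [Nat.cast_zero, qint_zero, mul_zero, zero_mul, zero_smul, zero_add]
        refine Finset.sum_congr rfl fun p _ => ?_
        rw [mul_smul_comm, ← mul_assoc, mul_divPow_of_comm h, smul_mul_assoc, mul_assoc, mul_divPow,
          mul_smul_comm, smul_smul, smul_smul]
        congr 1
        have e1 : (v ^ (2 : ℤ)) ^ p.1 = v ^ (2 * (p.1 : ℤ)) := by
          rw [← zpow_natCast, ← zpow_mul]
        rw [e1]
        push_cast
        rw [mul_add, mul_one, zpow_add₀ v_ne_zero, two_mul, zpow_add₀ v_ne_zero]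
        ring
      · rw [Finset.Nat.sum_antidiagonal_succ]
        simp only [Nat.cast_zero, qint_zero, mul_zero, zero_mul, zero_smul, zero_add]
        refine Finset.sum_congr rfl fun p _ => ?_
        rw [mul_smul_comm, ← mul_assoc, mul_divPow, smul_mul_assoc, smul_smul]
        congr 1
        push_cast
        rw [add_mul, one_mul, zpow_add₀ v_ne_zero, zpow_neg]
        have := zpow_ne_zero (p.2 : ℤ) v_ne_zero
        field_simp
    exact smul_right_injective B hn key

end

theorem comul_mem {u : Uv} (hu : u ∈ UA) :
    comul u ∈ Algebra.adjoin Zv {w : Uv ⊗[Qv] Uv | ∃ a ∈ UA, ∃ b ∈ UA, w = a ⊗ₜ b} := by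
  have sub : ∀ {a b : Uv}, a ∈ UA → b ∈ UA →
      a ⊗ₜ[Qv] b ∈ Algebra.adjoin Zv {w : Uv ⊗[Qv] Uv | ∃ a ∈ UA, ∃ b ∈ UA, w = a ⊗ₜ b} :=
    fun ha hb => Algebra.subset_adjoin ⟨_, ha, _, hb, rfl⟩
  have dp1 : ∀ (a b : Uv) (n : ℕ), divPow (a ⊗ₜ[Qv] b) n = divPow a n ⊗ₜ (b ^ n) := by
    intro a b n
    rw [divPow, divPow, Algebra.TensorProduct.tmul_pow, TensorProduct.smul_tmul']
  have dp2 : ∀ (a b : Uv) (n : ℕ), divPow (a ⊗ₜ[Qv] b) n = (a ^ n) ⊗ₜ divPow b n := by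
    intro a b n
    rw [divPow, divPow, Algebra.TensorProduct.tmul_pow, TensorProduct.tmul_smul]
  refine UA_map_mem comul _ (fun n => ?_) (fun n => ?_) ?_ ?_ hu
  · have hc : comul (gen Gen.E) = gen Gen.K ⊗ₜ gen Gen.E + gen Gen.E ⊗ₜ 1 := by
      rw [comul, liftUv_gen, add_comm]
    rw [hc, divPow_add]
    · refine Subalgebra.sum_mem _ fun p _ => v_zpow_smul_mem _ _ ?_
      rw [dp1, dp2, one_pow]
      exact Subalgebra.mul_mem _ (sub (divPow_E_mem _) (one_mem _))
        (sub (pow_mem K_mem _) (divPow_E_mem _))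
    · rw [Algebra.TensorProduct.tmul_mul_tmul, Algebra.TensorProduct.tmul_mul_tmul, K_E,
        TensorProduct.smul_tmul', one_mul, mul_one]
  · have hc : comul (gen Gen.F) = gen Gen.F ⊗ₜ gen Gen.Ki + 1 ⊗ₜ gen Gen.F := by
      rw [comul, liftUv_gen]
    have h : gen Gen.Ki * gen Gen.F = v ^ (2 : ℤ) • (gen Gen.F * gen Gen.Ki) := by
      have := congrArg (fun x => gen Gen.Ki * x * gen Gen.Ki) K_F
      simp only [mul_smul_comm, smul_mul_assoc, mul_assoc, K_Ki, mul_one] at this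
      rw [← mul_assoc, Ki_K, one_mul] at this
      rw [this, smul_smul, ← zpow_add₀ v_ne_zero]
      simp
    rw [hc, divPow_add]
    · refine Subalgebra.sum_mem _ fun p _ => v_zpow_smul_mem _ _ ?_
      rw [dp2 1 (gen Gen.F), dp1 (gen Gen.F) (gen Gen.Ki), one_pow]
      exact Subalgebra.mul_mem _ (sub (one_mem _) (divPow_F_mem _))
        (sub (divPow_F_mem _) (pow_mem Ki_mem _))
    · rw [Algebra.TensorProduct.tmul_mul_tmul, Algebra.TensorProduct.tmul_mul_tmul, h,
        TensorProduct.tmul_smul, one_mul, mul_one]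
  · rw [comul, liftUv_gen]
    exact sub K_mem K_mem
  · rw [comul, liftUv_gen]
    exact sub Ki_mem Ki_mem

theorem mul_pow_eq {x y : Uv} {c : ℤ} (h : x * y = v ^ c • (y * x)) (n : ℕ) :
    ∃ d : ℤ, (y * x) ^ n = v ^ d • (y ^ n * x ^ n) := by
  induction n with
  | zero => exact ⟨0, by simp⟩
  | succ n ih =>
    obtain ⟨d, hd⟩ := ih
    have hx := mul_pow_of_comm h n
    refine ⟨c * n + d, ?_⟩
    rw [pow_succ', hd, mul_smul_comm, mul_assoc y x, ← mul_assoc x, hx, smul_mul_assoc,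
      mul_smul_comm, smul_smul, zpow_add₀ v_ne_zero, zpow_mul, zpow_natCast, mul_assoc,
      ← pow_succ', ← mul_assoc, ← pow_succ', mul_comm]

theorem antipode_mem {u : Uv} (hu : u ∈ UA) : (antipode u).unop ∈ UA := by
  have h : antipode u ∈ UA.op := by
    refine UA_map_mem antipode _ (fun n => ?_) (fun n => ?_) ?_ ?_ hu
    · have hc : gen Gen.E * gen Gen.Ki = v ^ (2 : ℤ) • (gen Gen.Ki * gen Gen.E) := by
        have := congrArg (fun x => gen Gen.Ki * x * gen Gen.Ki) K_E
        simp only [mul_smul_comm, smul_mul_assoc, mul_assoc, K_Ki, mul_one] at this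
        rw [← this, ← mul_assoc, Ki_K, one_mul]
      obtain ⟨d, hd⟩ := mul_pow_eq hc n
      rw [antipode, liftUv_gen]
      simp only
      rw [Subalgebra.mem_op, divPow, MulOpposite.unop_smul, MulOpposite.unop_pow,
        MulOpposite.unop_op, neg_pow, hd, mul_smul_comm, smul_comm, ← mul_assoc, ← mul_smul_comm]
      exact v_zpow_smul_mem _ _ (mul_mem (mul_mem (pow_mem (neg_mem (one_mem _)) _)
        (pow_mem Ki_mem _)) (divPow_E_mem n))
    · have hc : gen Gen.K * gen Gen.F = v ^ (-2 : ℤ) • (gen Gen.F * gen Gen.K) := K_F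
      obtain ⟨d, hd⟩ := mul_pow_eq hc n
      rw [antipode, liftUv_gen]
      simp only
      rw [Subalgebra.mem_op, divPow, MulOpposite.unop_smul, MulOpposite.unop_pow,
        MulOpposite.unop_op, neg_pow, hd, mul_smul_comm, smul_comm, ← mul_smul_comm,
        ← smul_mul_assoc (qfact n)⁻¹]
      exact v_zpow_smul_mem _ _ (mul_mem (pow_mem (neg_mem (one_mem _)) _)
        (mul_mem (divPow_F_mem n) (pow_mem K_mem _)))
    · rw [antipode, liftUv_gen]
      exact Ki_mem
    · rw [antipode, liftUv_gen]
      exact K_mem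
  exact h

/-! ### Integral representations and their specializations -/

/-- Matrices with entries in `ℤ[v, v⁻¹]`, as a subalgebra of the matrices over `ℚ(v)`. -/
noncomputable def integralMatrices (ι : Type) [Fintype ι] [DecidableEq ι] :
    Subalgebra Zv (Matrix ι ι Qv) :=
  (Algebra.ofId Zv Qv).mapMatrix.range

theorem mem_integralMatrices {ι : Type} [Fintype ι] [DecidableEq ι] {M : Matrix ι ι Qv} :
    M ∈ integralMatrices ι ↔ ∀ i j, M i j ∈ (Algebra.ofId Zv Qv).range := by
  constructor
  · rintro ⟨P, rfl⟩ i j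
    exact ⟨P i j, rfl⟩
  · intro h
    choose P hP using h
    exact ⟨Matrix.of P, by ext i j; exact hP i j⟩

/-- A representation of `U_v(sl₂)` on `ℚ(v)^ι` (by matrices acting on column vectors) such that
the integral form preserves the lattice `ℤ[v, v⁻¹]^ι`. -/
structure LatticeRep where
  ι : Type
  [fin : Fintype ι]
  [dec : DecidableEq ι]
  ρ : Uv →ₐ[Qv] Matrix ι ι Qv
  integral : ∀ u ∈ UA, ρ u ∈ integralMatrices ι

attribute [instance] LatticeRep.fin LatticeRep.dec

namespace LatticeRep

/-- The trivial representation. -/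
noncomputable def triv : LatticeRep where
  ι := Unit
  ρ := (Algebra.ofId Qv (Matrix Unit Unit Qv)).comp counit
  integral u hu := by
    have h1 : counit u ∈ (Algebra.ofId Zv Qv).range := by
      have h0 : ∀ n, divPow (0 : Qv) n ∈ (Algebra.ofId Zv Qv).range := by
        rintro (_ | n)
        · simp
        · simp [divPow]
      refine UA_map_mem counit _ (fun n => ?_) (fun n => ?_) ?_ ?_ hu <;>
        rw [counit, liftUv_gen]
      · exact h0 n
      · exact h0 n
      · exact one_mem _
      · exact one_mem _
    obtain ⟨a, ha⟩ := h1
    rw [AlgHom.comp_apply, ← ha]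
    change algebraMap Qv (Matrix Unit Unit Qv) (algebraMap Zv Qv a) ∈ _
    rw [← IsScalarTower.algebraMap_apply]
    exact Subalgebra.algebraMap_mem _ a

/-- The action of a pure tensor `a ⊗ b` by the Kronecker product of the matrices of `a` and `b`. -/
noncomputable def kronHom (R S : LatticeRep) :
    Uv ⊗[Qv] Uv →ₐ[Qv] Matrix (R.ι × S.ι) (R.ι × S.ι) Qv :=
  ((Algebra.TensorProduct.lmul' Qv (S := Qv)).mapMatrix.comp
    (Matrix.kroneckerTMulAlgEquiv R.ι S.ι Qv Qv Qv Qv).toAlgHom).comp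
    (Algebra.TensorProduct.map R.ρ S.ρ)

theorem kronHom_tmul (R S : LatticeRep) (a b : Uv) :
    kronHom R S (a ⊗ₜ b) = Matrix.kronecker (R.ρ a) (S.ρ b) := by
  ext i j
  simp [kronHom, Matrix.kroneckerMap_apply]

/-- The tensor product of representations, through the coproduct. -/
noncomputable def tensor (R S : LatticeRep) : LatticeRep where
  ι := R.ι × S.ι
  ρ := (kronHom R S).comp comul
  integral u hu := by
    have h : Algebra.adjoin Zv {w : Uv ⊗[Qv] Uv | ∃ a ∈ UA, ∃ b ∈ UA, w = a ⊗ₜ b}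
        ≤ (integralMatrices (R.ι × S.ι)).comap ((kronHom R S).restrictScalars Zv) := by
      refine Algebra.adjoin_le ?_
      rintro _ ⟨a, ha, b, hb, rfl⟩
      change kronHom R S (a ⊗ₜ b) ∈ integralMatrices (R.ι × S.ι)
      rw [kronHom_tmul, mem_integralMatrices]
      intro i j
      exact mul_mem (mem_integralMatrices.mp (R.integral a ha) i.1 j.1)
        (mem_integralMatrices.mp (S.integral b hb) i.2 j.2)
    exact h (comul_mem hu)

/-- The dual representation: `u` acts by the transpose of the action of the antipode of `u`. -/
noncomputable def dual (R : LatticeRep) : LatticeRep where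
  ι := R.ι
  ρ := ((Matrix.transposeAlgEquiv R.ι Qv Qv).symm.toAlgHom.comp (AlgHom.op R.ρ)).comp antipode
  integral u hu := by
    rw [mem_integralMatrices]
    intro i j
    exact mem_integralMatrices.mp (R.integral _ (antipode_mem hu)) j i

/-- The tensor powers of a representation, `V^{⊗(N+1)} = V ⊗ V^{⊗N}`. -/
noncomputable def tensorPow (R : LatticeRep) : ℕ → LatticeRep
  | 0 => triv
  | N + 1 => tensor R (tensorPow R N)

end LatticeRep

/-! ### Weyl modules -/

/-- The matrix of `E` in the basis `x, F⁽¹⁾x, …, F⁽ᵐ⁾x` of the Weyl module of highest weight `m`: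
`E F⁽ᵗ⁾x = [m - t + 1] F⁽ᵗ⁻¹⁾x`. -/
noncomputable def weylE (m : ℕ) : Matrix (Fin (m + 1)) (Fin (m + 1)) Qv :=
  Matrix.of fun i j => if (i : ℕ) + 1 = j then qint (m - j + 1) else 0

/-- The matrix of `F`: `F F⁽ᵗ⁾x = [t + 1] F⁽ᵗ⁺¹⁾x`. -/
noncomputable def weylF (m : ℕ) : Matrix (Fin (m + 1)) (Fin (m + 1)) Qv :=
  Matrix.of fun i j => if (i : ℕ) = j + 1 then qint (j + 1) else 0

/-- The matrix of `K`: `K F⁽ᵗ⁾x = v^(m - 2t) F⁽ᵗ⁾x`. -/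
noncomputable def weylK (m : ℕ) : Matrix (Fin (m + 1)) (Fin (m + 1)) Qv :=
  Matrix.diagonal fun i => v ^ ((m : ℤ) - 2 * i)

/-- The matrix of `K⁻¹`. -/
noncomputable def weylKi (m : ℕ) : Matrix (Fin (m + 1)) (Fin (m + 1)) Qv :=
  Matrix.diagonal fun i => v ^ (-((m : ℤ) - 2 * i))

theorem weyl_E_F (m : ℕ) : weylE m * weylF m - weylF m * weylE m
    = (v - v⁻¹)⁻¹ • (weylK m - weylKi m) := by
  have h1 : weylE m * weylF m
      = Matrix.diagonal fun i : Fin (m + 1) => qint (m - i) * qint (i + 1) := by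
    ext i j
    rw [Matrix.mul_apply, Matrix.diagonal_apply]
    by_cases hi : (i : ℕ) < m
    · rw [Finset.sum_eq_single (⟨i + 1, by omega⟩ : Fin (m + 1))]
      · simp only [weylE, weylF, Matrix.of_apply, if_true]
        by_cases hij : i = j
        · subst hij
          have e : (m : ℤ) - ((i : ℕ) + 1) + 1 = m - i := by ring
          simp [e]
        · have : (i : ℕ) ≠ j := fun h => hij (Fin.ext h)
          simp [hij, this]
      · intro k _ hk
        have : ¬ (i : ℕ) + 1 = k := fun h => hk (Fin.ext h.symm)
        simp [weylE, this]
      · simp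
    · have him : (i : ℕ) = m := by omega
      rw [Finset.sum_eq_zero]
      · simp [him]
      · intro k _
        have : ¬ (i : ℕ) + 1 = k := by omega
        simp [weylE, this]
  have h2 : weylF m * weylE m
      = Matrix.diagonal fun i : Fin (m + 1) => qint (m - i + 1) * qint i := by
    ext i j
    rw [Matrix.mul_apply, Matrix.diagonal_apply]
    by_cases hi : 0 < (i : ℕ)
    · rw [Finset.sum_eq_single (⟨i - 1, by omega⟩ : Fin (m + 1))]
      · have hc : (i : ℕ) - 1 + 1 = i := by omega
        simp only [weylE, weylF, Matrix.of_apply, hc, if_true]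
        have hc' : (((i : ℕ) - 1 : ℕ) : ℤ) + 1 = i := by omega
        rw [hc']
        by_cases hij : i = j
        · subst hij
          simp [mul_comm]
        · have : (i : ℕ) ≠ j := fun h => hij (Fin.ext h)
          simp [hij, this]
      · intro k _ hk
        have : ¬ (i : ℕ) = k + 1 := fun h => hk (Fin.ext (by simp only; omega))
        simp [weylF, this]
      · simp
    · have him : (i : ℕ) = 0 := by omega
      rw [Finset.sum_eq_zero]
      · simp [him]
      · intro k _
        have : ¬ (i : ℕ) = k + 1 := by omega
        simp [weylF, this]
  rw [h1, h2, weylK, weylKi, Matrix.diagonal_sub, Matrix.diagonal_sub, ← Matrix.diagonal_smul]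
  congr 1
  ext i
  have hv := v_ne_zero
  have hm := zpow_ne_zero (m : ℤ) hv
  have hi := zpow_ne_zero (i : ℤ) hv
  have hd := v_sub_inv_ne_zero
  simp only [Pi.smul_apply, smul_eq_mul, qint]
  generalize hdd : v - v⁻¹ = d at hd ⊢
  have e : v * v⁻¹ = 1 := mul_inv_cancel₀ hv
  field_simp
  rw [← hdd]
  simp only [neg_sub, neg_add_rev, zpow_add₀ hv, zpow_sub₀ hv, zpow_neg, zpow_one, two_mul]
  field_simp
  ring

theorem weylE_pow (m n : ℕ) (i j : Fin (m + 1)) : (weylE m ^ n) i j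
    = if (i : ℕ) + n = j then ∏ s ∈ Finset.range n, qint (((m - j : ℕ) : ℤ) + s + 1) else 0 := by
  induction n generalizing j with
  | zero => simp [Matrix.one_apply, Fin.ext_iff]
  | succ n ih =>
    rw [pow_succ, Matrix.mul_apply]
    by_cases hj : (i : ℕ) + (n + 1) = j
    · rw [Finset.sum_eq_single (⟨i + n, by omega⟩ : Fin (m + 1))]
      · have hc : (i : ℕ) + n + 1 = j := by omega
        have e1 : ((m - (i + n) : ℕ) : ℤ) = ((m - j : ℕ) : ℤ) + 1 := by omega
        have e2 : (m : ℤ) - j = ((m - j : ℕ) : ℤ) := by omega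
        rw [ih, if_pos hj, Finset.prod_range_succ']
        simp only [weylE, Matrix.of_apply, if_true, hc, e1, e2]
        simp only [Nat.cast_add, Nat.cast_one, Nat.cast_zero, add_zero]
        congr 1
        refine Finset.prod_congr rfl fun s _ => ?_
        congr 1
        ring
      · intro k _ hk
        have : ¬ (i : ℕ) + n = k := fun h => hk (Fin.ext h.symm)
        simp [ih, this]
      · simp
    · rw [if_neg hj, Finset.sum_eq_zero]
      intro k _
      rw [ih]
      by_cases hk : (i : ℕ) + n = k
      · have : ¬ (k : ℕ) + 1 = j := by omega
        simp [weylE, this]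
      · simp [hk]

theorem weylF_pow (m n : ℕ) (i j : Fin (m + 1)) : (weylF m ^ n) i j
    = if (i : ℕ) = j + n then ∏ s ∈ Finset.range n, qint (((j : ℕ) : ℤ) + s + 1) else 0 := by
  induction n generalizing i with
  | zero => simp [Matrix.one_apply, Fin.ext_iff]
  | succ n ih =>
    rw [pow_succ', Matrix.mul_apply]
    by_cases hj : (i : ℕ) = j + (n + 1)
    · rw [Finset.sum_eq_single (⟨j + n, by omega⟩ : Fin (m + 1))]
      · have hc : (i : ℕ) = j + n + 1 := by omega
        rw [ih, if_pos hj, Finset.prod_range_succ, mul_comm]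
        simp [weylF, hc]
      · intro k _ hk
        have : ¬ (k : ℕ) = j + n := fun h => hk (Fin.ext h)
        simp [ih, this]
      · simp
    · rw [if_neg hj, Finset.sum_eq_zero]
      intro k _
      rw [ih]
      by_cases hk : (k : ℕ) = j + n
      · have : ¬ (i : ℕ) = k + 1 := by omega
        simp [weylF, this]
      · simp [hk]

/-- Quantum binomial coefficients are Laurent polynomials. -/
theorem qbinom_mem (a n : ℕ) : (qfact n)⁻¹ * ∏ s ∈ Finset.range n, qint ((a : ℤ) + s + 1)
    ∈ (Algebra.ofId Zv Qv).range := by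
  induction n generalizing a with
  | zero => simp [qfact]
  | succ n ihn =>
    induction a with
    | zero =>
      have : ∏ s ∈ Finset.range (n + 1), qint (((0 : ℕ) : ℤ) + s + 1) = qfact (n + 1) := by
        simp [qfact]
      rw [this, inv_mul_cancel₀ (qfact_ne_zero _)]
      exact one_mem _
    | succ a iha =>
      have key : (qfact (n + 1))⁻¹ * ∏ s ∈ Finset.range (n + 1), qint (((a + 1 : ℕ) : ℤ) + s + 1)
          = v ^ ((n : ℤ) + 1)
              * ((qfact (n + 1))⁻¹ * ∏ s ∈ Finset.range (n + 1), qint ((a : ℤ) + s + 1))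
            + v ^ (-((a : ℤ) + 1))
              * ((qfact n)⁻¹ * ∏ s ∈ Finset.range n, qint (((a + 1 : ℕ) : ℤ) + s + 1)) := by
        have hq := qfact_ne_zero n
        have hn : qint ((n : ℤ) + 1) ≠ 0 := qint_ne_zero _ (by omega)
        have e : ∏ s ∈ Finset.range (n + 1), qint ((a : ℤ) + s + 1)
            = (∏ s ∈ Finset.range n, qint (((a + 1 : ℕ) : ℤ) + s + 1)) * qint (a + 1) := by
          rw [Finset.prod_range_succ']
          simp only [Nat.cast_add, Nat.cast_one, Nat.cast_zero, add_zero]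
          congr 1
          refine Finset.prod_congr rfl fun s _ => ?_
          congr 1
          ring
        have e2 : qint (((a + 1 : ℕ) : ℤ) + n + 1)
            = v ^ ((n : ℤ) + 1) * qint (a + 1) + v ^ (-((a : ℤ) + 1)) * qint (n + 1) := by
          rw [← qint_add]
          congr 1
          push_cast
          ring
        rw [e, Finset.prod_range_succ, e2, qfact_succ]
        field_simp
      rw [key]
      exact add_mem (mul_mem (v_zpow_mem _) iha) (mul_mem (v_zpow_mem _) (ihn _))

/-- The Weyl representation of highest weight `m`, with its lattice. -/
noncomputable def weylRep (m : ℕ) : LatticeRep where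
  ι := Fin (m + 1)
  ρ := liftUv (fun g => match g with
    | Gen.E => weylE m
    | Gen.F => weylF m
    | Gen.K => weylK m
    | Gen.Ki => weylKi m)
    (by simp [weylK, weylKi, Matrix.diagonal_mul_diagonal, ← zpow_add₀ v_ne_zero])
    (by simp [weylK, weylKi, Matrix.diagonal_mul_diagonal, ← zpow_add₀ v_ne_zero])
    (by
      ext i j
      simp only [weylK, weylE, Matrix.diagonal_mul, Matrix.smul_apply, Matrix.mul_diagonal,
        Matrix.of_apply, smul_eq_mul]
      split_ifs with h
      · rw [mul_comm (qint _), ← mul_assoc, ← zpow_add₀ v_ne_zero, ← h]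
        congr 2
        push_cast
        ring
      · simp)
    (by
      ext i j
      simp only [weylK, weylF, Matrix.diagonal_mul, Matrix.smul_apply, Matrix.mul_diagonal,
        Matrix.of_apply, smul_eq_mul]
      split_ifs with h
      · rw [mul_comm (qint _), ← mul_assoc, ← zpow_add₀ v_ne_zero, h]
        congr 2
        push_cast
        ring
      · simp)
    (weyl_E_F m)
  integral u hu := by
    have hdiag : ∀ f : Fin (m + 1) → ℤ, (Matrix.diagonal fun i => v ^ f i)
        ∈ integralMatrices (Fin (m + 1)) := by
      intro f
      rw [mem_integralMatrices]
      intro i j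
      rw [Matrix.diagonal_apply]
      split_ifs
      · exact v_zpow_mem _
      · exact zero_mem _
    refine UA_map_mem _ _ (fun n => ?_) (fun n => ?_) ?_ ?_ hu <;> rw [liftUv_gen]
    · rw [mem_integralMatrices]
      intro i j
      simp only [divPow, Matrix.smul_apply, weylE_pow, smul_eq_mul]
      split_ifs
      · exact qbinom_mem _ _
      · simp
    · rw [mem_integralMatrices]
      intro i j
      simp only [divPow, Matrix.smul_apply, weylF_pow, smul_eq_mul]
      split_ifs
      · exact qbinom_mem _ _
      · simp
    · exact hdiag _
    · exact hdiag _

section Specialization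

variable (𝕜 : Type u) [Field 𝕜] [Algebra Zv 𝕜]

/-- The big quantum group `U_q(sl₂) = 𝕜 ⊗ U_A`, where `𝕜` is a `ℤ[v, v⁻¹]`-algebra through
`v ↦ q`. -/
abbrev Uq : Type u := 𝕜 ⊗[Zv] UA

namespace LatticeRep

variable (R : LatticeRep)

theorem integralMatrices_injective (ι : Type) [Fintype ι] [DecidableEq ι] :
    Function.Injective ((Algebra.ofId Zv Qv).mapMatrix : Matrix ι ι Zv →ₐ[Zv] Matrix ι ι Qv) := by
  intro M N h
  ext1 i j
  exact IsFractionRing.injective Zv Qv (congrFun (congrFun h i) j)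

/-- The action of the integral form on the lattice `ℤ[v, v⁻¹]^ι`. -/
noncomputable def ρA : UA →ₐ[Zv] Matrix R.ι R.ι Zv :=
  (AlgEquiv.ofInjective _ (integralMatrices_injective R.ι)).symm.toAlgHom.comp
    (((R.ρ.restrictScalars Zv).comp UA.val).codRestrict (integralMatrices R.ι)
      (fun u => R.integral u u.2))

/-- `ρA` is the restriction of `ρ`. -/
theorem ρA_map (x : UA) : (R.ρA x).map (algebraMap Zv Qv) = R.ρ x :=
  congrArg Subtype.val ((AlgEquiv.ofInjective _ (integralMatrices_injective R.ι)).apply_symm_apply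
    ((((R.ρ.restrictScalars Zv).comp UA.val).codRestrict (integralMatrices R.ι)
      (fun u => R.integral u u.2)) x))

/-- The specialized action of `U_q(sl₂)` on `𝕜^ι`. -/
noncomputable def ρq : Uq 𝕜 →ₐ[𝕜] Matrix R.ι R.ι 𝕜 :=
  Algebra.TensorProduct.lift (Algebra.ofId 𝕜 _) ((Algebra.ofId Zv 𝕜).mapMatrix.comp R.ρA)
    (fun c _ => Algebra.commutes c _)

theorem ρq_tmul (c : 𝕜) (x : UA) :
    R.ρq 𝕜 (c ⊗ₜ x) = c • (R.ρA x).map (algebraMap Zv 𝕜) := by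
  simp only [ρq, Algebra.smul_def]
  rfl

/-- The `U_q(sl₂)`-module `𝕜 ⊗ ℤ[v, v⁻¹]^ι = 𝕜^ι`. -/
def Spec : Type u := R.ι → 𝕜

noncomputable instance : AddCommGroup (R.Spec 𝕜) := inferInstanceAs (AddCommGroup (R.ι → 𝕜))

noncomputable instance : Module 𝕜 (R.Spec 𝕜) := inferInstanceAs (Module 𝕜 (R.ι → 𝕜))

noncomputable instance : Module (Uq 𝕜) (R.Spec 𝕜) :=
  Module.compHom (R.ι → 𝕜) ((Matrix.toLinAlgEquiv'.toAlgHom.comp (R.ρq 𝕜)).toRingHom :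
    Uq 𝕜 →+* Module.End 𝕜 (R.ι → 𝕜))

theorem smul_def (x : Uq 𝕜) (w : R.Spec 𝕜) : x • w = (R.ρq 𝕜 x).mulVec w := rfl

end LatticeRep

/-- The Weyl module `W(m)` over `U_q(sl₂)`. -/
abbrev Weyl (m : ℕ) : Type u := (weylRep m).Spec 𝕜

/-- The dual Weyl module `W*(m)`. -/
abbrev DualWeyl (m : ℕ) : Type u := (weylRep m).dual.Spec 𝕜

/-- The module `T(1)^{⊗N}`, where `T(1) = L(1) = W(1)` is the two-dimensional simple module. -/
abbrev TensorPower (N : ℕ) : Type u := ((weylRep 1).tensorPow N).Spec 𝕜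

end Specialization

/-! ### Tilting modules -/

section Tilting

/-- `0 = S 0 ⊆ S 1 ⊆ ⋯ ⊆ S n = M` is a filtration by submodules with
`S (i+1) / S i ≅ X (k i)`. -/
def IsFiltration {U : Type u} [Ring U] (X : ℕ → Type u) [∀ k, AddCommGroup (X k)]
    [∀ k, Module U (X k)] (M : Type u) [AddCommGroup M] [Module U M]
    {n : ℕ} (S : Fin (n + 1) → Submodule U M) (k : Fin n → ℕ) : Prop :=
  Monotone S ∧ S 0 = ⊥ ∧ S (Fin.last n) = ⊤ ∧
    ∀ i : Fin n, Nonempty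
      ((S i.succ ⧸ (S i.castSucc).comap (S i.succ).subtype) ≃ₗ[U] X (k i))

/-- Indecomposable modules: nonzero, and not a direct sum of two nonzero submodules. -/
def IsIndecomposable (U : Type u) [Ring U] (M : Type u) [AddCommGroup M] [Module U M] : Prop :=
  Nontrivial M ∧ ∀ P Q : Submodule U M, IsCompl P Q → P = ⊥ ∨ Q = ⊥

variable (𝕜 : Type u) [Field 𝕜] [Algebra Zv 𝕜]

/-- A tilting module (of type 1): it has a finite filtration by Weyl modules and a finite
filtration by dual Weyl modules. -/
def IsTilting (M : Type u) [AddCommGroup M] [Module (Uq 𝕜) M] : Prop :=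
  (∃ (n : ℕ) (S : Fin (n + 1) → Submodule (Uq 𝕜) M) (k : Fin n → ℕ),
    IsFiltration (Weyl 𝕜) M S k) ∧
  (∃ (n : ℕ) (S : Fin (n + 1) → Submodule (Uq 𝕜) M) (k : Fin n → ℕ),
    IsFiltration (DualWeyl 𝕜) M S k)

/-- `M` is the indecomposable tilting module `T(k)`: it is tilting and indecomposable, and in a
Weyl filtration `W(k)` occurs exactly once and every other factor is `W(k')` with `k' < k`. -/
def IsT (k : ℕ) (M : Type u) [AddCommGroup M] [Module (Uq 𝕜) M] : Prop :=
  IsTilting 𝕜 M ∧ IsIndecomposable (Uq 𝕜) M ∧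
    ∃ (n : ℕ) (S : Fin (n + 1) → Submodule (Uq 𝕜) M) (a : Fin n → ℕ),
      IsFiltration (Weyl 𝕜) M S a ∧ (∃! i, a i = k) ∧ ∀ i, a i ≤ k

/-- `T k` is the indecomposable tilting module of highest weight `k` for every `k`, and `M N k` is
its multiplicity in the `N`-th tensor power:
`T(1)^{⊗N} ≅ ⨁ₖ T(k)^{⊕ M N k}`. -/
def IsTiltingDecomposition (T : ℕ → ModuleCat.{u} (Uq 𝕜)) (M : ℕ → ℕ → ℕ) : Prop :=
  (∀ k, IsT 𝕜 k (T k)) ∧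
    ∀ N, Nonempty (TensorPower 𝕜 N ≃ₗ[Uq 𝕜] ⨁ k : ℕ, (Fin (M N k) → T k))

/-- The dimension over `𝕜` of a `U_q(sl₂)`-module. -/
noncomputable def dim (M : ModuleCat.{u} (Uq 𝕜)) : ℕ :=
  Module.finrank 𝕜 (RestrictScalars 𝕜 (Uq 𝕜) M)

end Tilting

/-! ### The Plancherel measure and its limit -/

/-- The measure on the weights `k` with mass `M k * d k / (d 1) ^ N` at `k`, where `M k` is the
multiplicity of `T(k)` in the `N`-th tensor power and `d k = dim T(k)`. -/
noncomputable def plancherel (M d : ℕ → ℕ) (N : ℕ) : Measure ℕ :=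
  Measure.sum fun k => ENNReal.ofReal ((M k : ℝ) * d k / (d 1 : ℝ) ^ N) • Measure.dirac k

/-- The pair `(k₀, k₁/√(2N₁))`, where `k = k₁ l + k₀` with `0 ≤ k₀ < l`. -/
noncomputable def rescale (l : ℕ) (hl : 0 < l) (N₁ k : ℕ) : Fin l × ℝ≥0 :=
  (⟨k % l, Nat.mod_lt k hl⟩, ((k / l : ℕ) : ℝ≥0) / NNReal.sqrt (2 * N₁))

/-- The point masses of the limit law of `k₀`. -/
noncomputable def p₁ (l k₀ : ℕ) : ℝ :=
  if k₀ = l - 1 then 1 / l else 2 * ((l : ℝ) - 1 - k₀) / (l : ℝ) ^ 2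

/-- The density of the limit law of `α`. -/
noncomputable def p₂ (l : ℕ) (α : ℝ) : ℝ :=
  √(2 / Real.pi) * (l : ℝ) ^ (3 / 2 : ℝ) * α ^ 2 * Real.exp (-(α ^ 2 * l / 2))

/-- The limit law of `k₀`. -/
noncomputable def limitLaw₁ (l : ℕ) : Measure (Fin l) :=
  Measure.sum fun k₀ : Fin l => ENNReal.ofReal (p₁ l k₀) • Measure.dirac k₀

/-- The limit law of `α`: density `p₂` with respect to Lebesgue measure on `[0, ∞)`. -/
noncomputable def limitLaw₂ (l : ℕ) : Measure ℝ≥0 :=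
  (Measure.comap ((↑) : ℝ≥0 → ℝ) volume).withDensity fun α => ENNReal.ofReal (p₂ l α)

end QuantumSL2

/-!
Write `V` for `T(1)`. The proof has an algebraic half, which determines the multiplicities through
a character identity, and an analytic half, which extracts the limit law from that identity.

**Tilting modules.** The functor `V ⊗ -` is modelled by pairs of elements (`VT`), and the quantum
Casimir element cuts `V ⊗ M` into blocks (`eb`). The Weyl module of dimension `n` has Casimir
eigenvalue `qⁿ + q⁻ⁿ`, so dimensions that are reflections of each other in a multiple of `l` are
linked. For `n ≤ l` or `l ∣ n` the Weyl module of dimension `n` is simple and self-dual. Starting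
from the one of dimension `K l` and translating `r < l` times to the upper block gives modules
`tiltX K r` with two-step filtrations by Weyl modules and by dual Weyl modules (`IsRoot.ses_tiltX`).
They are indecomposable: for `r = 1` by a computation of endomorphisms through the adjunction of
`V ⊗ -` with itself (`IsRoot.indec_one`), and for larger `r` because translating back is faithful
and gives back the previous module (`IsRoot.indec_succ`, `IsRoot.downX_succ`). The input is that the
partial traces of the block idempotents are nonzero scalars away from the walls (`theta_eb_smul`).
At the wall `r = l` the module splits into two simple ones (`IsRoot.tiltX_wall`). This gives the
fusion rule `IsRoot.exists_VT_tiltT`: tensoring with `V` multiplies characters by `2 cos φ`, and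
`T(k + 1)` is a direct summand of `V ⊗ T(k)`.

**Uniqueness.** For an arbitrary decomposition as in the statement, `T(k)` is a direct summand of
`V^{⊗k}`, and hence isomorphic to a member of the given family by the cancellation argument of the
Krull-Schmidt theorem (`exists_equiv_of_retract`); the highest weight is seen by the traces of
`F⁽ⁿ⁾ E⁽ⁿ⁾` (`IsT.tr`), which form a unitriangular array and therefore also determine the
multiplicities. The result is `IsRoot.exists_multiplicities`, the identity
`∑ M_k(N) χ_k(φ) = sin φ (2 cos φ)^N`, in which `χ_k`, the character of `T(k)` multiplied by
`sin φ`, is `2 sin (K l φ) cos (r φ)` for `k + 1 = K l + r` with `K > 0` and `0 < r < l`, and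
`sin ((k + 1) φ)` otherwise.

**Asymptotics.** Sum the identity over the angles `ε + 2πj/l`, `j < l`, with the weights `1` or
`sin ((l - r) φ)`: the sum isolates the weights with `k + 1 ≡ r` modulo `l`, and equals
`∑ M_k(N) sin (K l ε)` up to an explicit factor (`sum_tiltChar`, `sum_sin_mul_tiltChar`). On the
right hand side only `j = 0` matters, because `l` is odd and the other cosines are less than `1` in
absolute value. As `dim T(k)` is proportional to `K`, taking `ε = s / (l √(2 N₁))` gives the limits
of the expectations of `sinc (s α)` on each residue class (`tendsto_sinc`). Averaging over `s`
against `s² e^{-s²/2}`, which turns `sinc (a s)` into `e^{-a²/2}`, gives the limits of the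
expectations of `e^{-c α²/2}` (`tendsto_exp_cls`). Such functions detect weak convergence on finitely
many half-lines (`tendsto_of_testFun`): they prevent the escape of mass, and their span together
with the indicators of the components is an algebra that separates points.
-/

namespace QuantumSL2

/-! ### Short exact sequences of modules -/

section Modules

/-- `M` is an extension of `B` by `A`: there is a short exact sequence `0 → A → M → B → 0`. -/
def SES (U A M B : Type*) [Ring U] [AddCommGroup A] [Module U A] [AddCommGroup M] [Module U M]
    [AddCommGroup B] [Module U B] : Prop :=
  ∃ (f : A →ₗ[U] M) (g : M →ₗ[U] B),
    Function.Injective f ∧ Function.Exact f g ∧ Function.Surjective g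

variable {U : Type*} [Ring U]
variable {A M B A' M' B' : Type*} [AddCommGroup A] [Module U A] [AddCommGroup M] [Module U M]
  [AddCommGroup B] [Module U B] [AddCommGroup A'] [Module U A'] [AddCommGroup M'] [Module U M']
  [AddCommGroup B'] [Module U B']

theorem SES.congr (h : SES U A M B) (eA : A ≃ₗ[U] A') (eM : M ≃ₗ[U] M') (eB : B ≃ₗ[U] B') :
    SES U A' M' B' := by
  obtain ⟨f, g, hf, hfg, hg⟩ := h
  refine ⟨eM.toLinearMap ∘ₗ f ∘ₗ eA.symm.toLinearMap, eB.toLinearMap ∘ₗ g ∘ₗ eM.symm.toLinearMap,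
    ?_, ?_, ?_⟩
  · simpa using hf
  · intro y
    have := hfg (eM.symm y)
    simp only [LinearMap.coe_comp, LinearEquiv.coe_coe, Function.comp_apply,
      LinearEquiv.map_eq_zero_iff, Set.mem_range] at this ⊢
    rw [this]
    constructor
    · rintro ⟨a, ha⟩
      exact ⟨eA a, by simp [ha]⟩
    · rintro ⟨a, rfl⟩
      exact ⟨eA.symm a, by simp⟩
  · simpa using hg

theorem SES.equiv_left (h : SES U A M B) [Subsingleton B] : Nonempty (M ≃ₗ[U] A) := by
  obtain ⟨f, g, hf, hfg, hg⟩ := h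
  exact ⟨(LinearEquiv.ofBijective f
    ⟨hf, fun y => (hfg y).mp (Subsingleton.elim _ _)⟩).symm⟩

theorem SES.equiv_right (h : SES U A M B) [Subsingleton A] : Nonempty (M ≃ₗ[U] B) := by
  obtain ⟨f, g, hf, hfg, hg⟩ := h
  refine ⟨LinearEquiv.ofBijective g ⟨?_, hg⟩⟩
  rw [injective_iff_map_eq_zero]
  intro x hx
  obtain ⟨a, rfl⟩ := (hfg x).mp hx
  rw [Subsingleton.elim a 0, map_zero]

/-- An extension splits if its projection becomes bijective on some module mapping to it. -/
theorem prod_of_section {f : A →ₗ[U] M} {g : M →ₗ[U] B} (hf : Function.Injective f)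
    (hfg : Function.Exact f g) (s : B →ₗ[U] M) (hs : Function.Bijective (g ∘ₗ s)) :
    Nonempty (M ≃ₗ[U] A × B) := by
  refine ⟨(LinearEquiv.ofBijective (f.coprod s) ⟨?_, ?_⟩).symm⟩
  · rw [injective_iff_map_eq_zero]
    rintro ⟨a, b⟩ hab
    rw [LinearMap.coprod_apply] at hab
    have h0 : g (f a) = 0 := hfg.apply_apply_eq_zero a
    have hb : b = 0 := by
      apply hs.1
      have := congrArg g hab
      simpa [h0] using this
    subst hb
    rw [map_zero, add_zero] at hab
    have ha : a = 0 := (map_eq_zero_iff f hf).mp hab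
    rw [ha, Prod.mk_zero_zero]
  · intro x
    obtain ⟨b, hb⟩ := hs.2 (g x)
    obtain ⟨a, ha⟩ := (hfg (x - s b)).mp (by
      rw [map_sub, sub_eq_zero]; exact hb.symm)
    exact ⟨(a, b), by simp [ha]⟩

/-- An extension splits if its inclusion becomes bijective in some module it maps to. -/
theorem prod_of_retraction {f : A →ₗ[U] M} {g : M →ₗ[U] B} (hfg : Function.Exact f g)
    (hg : Function.Surjective g) (r : M →ₗ[U] A) (hr : Function.Bijective (r ∘ₗ f)) :
    Nonempty (M ≃ₗ[U] A × B) := by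
  refine ⟨LinearEquiv.ofBijective (r.prod g) ⟨?_, ?_⟩⟩
  · rw [injective_iff_map_eq_zero]
    intro x hx
    have h1 : r x = 0 := congrArg Prod.fst hx
    obtain ⟨a, rfl⟩ := (hfg x).mp (congrArg Prod.snd hx)
    have h2 : a = 0 := hr.1 (by simpa using h1)
    rw [h2, map_zero]
  · rintro ⟨a, b⟩
    obtain ⟨x, hx⟩ := hg b
    obtain ⟨a', ha'⟩ := hr.2 (a - r x)
    refine ⟨f a' + x, ?_⟩
    have h0 : g (f a') = 0 := hfg.apply_apply_eq_zero a'
    simp only [LinearMap.coe_comp, Function.comp_apply] at ha'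
    exact Prod.ext (by simp [ha']) (by simp [h0, hx])

/-- An extension of the simple module `B` by the simple module `A` splits if `B` also embeds and
`A` is not isomorphic to `B`. -/
theorem SES.split_of_embedding (h : SES U A M B) [IsSimpleModule U A] [IsSimpleModule U B]
    (hAB : ¬ Nonempty (B ≃ₗ[U] A)) {j : B →ₗ[U] M} (hj : Function.Injective j) :
    Nonempty (M ≃ₗ[U] A × B) := by
  obtain ⟨f, g, hf, hfg, hg⟩ := h
  rcases LinearMap.bijective_or_eq_zero (g ∘ₗ j) with h | h
  · exact prod_of_section hf hfg j h
  · exfalso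
    have hmem : ∀ b, j b ∈ LinearMap.range f := fun b => (hfg _).mp (LinearMap.congr_fun h b)
    let k : B →ₗ[U] A :=
      (LinearEquiv.ofInjective f hf).symm.toLinearMap ∘ₗ j.codRestrict (LinearMap.range f) hmem
    have hk : Function.Injective k := by
      intro x y hxy
      exact hj (congrArg Subtype.val ((LinearEquiv.ofInjective f hf).symm.injective hxy))
    rcases LinearMap.bijective_or_eq_zero k with h | h
    · exact hAB ⟨LinearEquiv.ofBijective k h⟩
    · have := IsSimpleModule.nontrivial U B
      obtain ⟨b, hb⟩ := exists_ne (0 : B)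
      exact hb (hk (by simp [h]))

/-- An extension of a simple module `S` by itself splits if `S` is a retract of it. -/
theorem SES.split_of_retract {S : Type*} [AddCommGroup S] [Module U S] [IsSimpleModule U S]
    (h : SES U S M S) (a : S →ₗ[U] M) (b : M →ₗ[U] S) (hab : Function.Bijective (b ∘ₗ a)) :
    Nonempty (M ≃ₗ[U] S × S) := by
  obtain ⟨f, g, hf, hfg, hg⟩ := h
  rcases LinearMap.bijective_or_eq_zero (g ∘ₗ a) with h | h
  · exact prod_of_section hf hfg a h
  · rcases LinearMap.bijective_or_eq_zero (b ∘ₗ f) with h' | h'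
    · exact prod_of_retraction hfg hg b h'
    · exfalso
      have := IsSimpleModule.nontrivial U S
      obtain ⟨s, hs⟩ := exists_ne (0 : S)
      obtain ⟨t, ht⟩ := (hfg (a s)).mp (LinearMap.congr_fun h s)
      refine hs (hab.1 ?_)
      rw [map_zero, LinearMap.comp_apply, ← ht]
      exact LinearMap.congr_fun h' t

/-! ### Blocks cut out by central elements -/

variable {R : Type*} [CommRing R] [Algebra R U]

/-- The fixed submodule of a central element `e`. When `e` acts idempotently, this is the block
`e M`. -/
def blk (e : Subalgebra.center R U) (M : Type*) [AddCommGroup M] [Module U M] :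
    Submodule U M where
  carrier := {x | (e : U) • x = x}
  add_mem' {x y} hx hy := by
    simp only [Set.mem_ofPred_eq] at *
    rw [smul_add, hx, hy]
  zero_mem' := smul_zero _
  smul_mem' u x hx := by
    simp only [Set.mem_ofPred_eq] at *
    rw [smul_smul, (Subalgebra.mem_center_iff.mp e.2 u).symm, mul_smul, hx]

theorem mem_blk {e : Subalgebra.center R U} {x : M} : x ∈ blk e M ↔ (e : U) • x = x := Iff.rfl

/-- The central element `e` acts as an idempotent on `M`. -/
def IdemOn (e : Subalgebra.center R U) (M : Type*) [AddCommGroup M] [Module U M] : Prop :=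
  ∀ x : M, (e : U) • (e : U) • x = (e : U) • x

/-- A linear map restricts to blocks. -/
def blkMap (e : Subalgebra.center R U) (f : A →ₗ[U] M) : blk e A →ₗ[U] blk e M :=
  f.restrict fun x hx => by rw [mem_blk, ← map_smul, mem_blk.mp hx]

@[simp]
theorem blkMap_coe (e : Subalgebra.center R U) (f : A →ₗ[U] M) (x : blk e A) :
    (blkMap e f x : M) = f x := rfl

theorem SES.blk {e : Subalgebra.center R U} (h : SES U A M B) (he : IdemOn e M) :
    SES U (blk e A) (blk e M) (blk e B) := by
  obtain ⟨f, g, hf, hfg, hg⟩ := h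
  refine ⟨blkMap e f, blkMap e g, ?_, ?_, ?_⟩
  · intro x y hxy
    exact Subtype.ext (hf (congrArg Subtype.val hxy))
  · intro y
    constructor
    · intro hy
      obtain ⟨a, ha⟩ := (hfg y).mp (congrArg Subtype.val hy)
      refine ⟨⟨a, ?_⟩, Subtype.ext ha⟩
      apply hf
      rw [map_smul, ha, mem_blk.mp y.2]
    · rintro ⟨a, rfl⟩
      exact Subtype.ext (hfg.apply_apply_eq_zero a.1)
  · intro b
    obtain ⟨m, hm⟩ := hg b
    refine ⟨⟨(e : U) • m, he m⟩, Subtype.ext ?_⟩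
    rw [blkMap_coe, map_smul, hm, mem_blk.mp b.2]

/-- A block on which the central element acts as `1` is everything. -/
def blkEquivOfOne {e : Subalgebra.center R U} (h : ∀ x : M, (e : U) • x = x) :
    blk e M ≃ₗ[U] M :=
  LinearEquiv.ofTop _ (eq_top_iff.mpr fun x _ => h x)

theorem blk_subsingleton {e : Subalgebra.center R U} (h : ∀ x : M, (e : U) • x = 0) :
    Subsingleton (blk e M) :=
  ⟨fun x y => Subtype.ext (by rw [← mem_blk.mp x.2, ← mem_blk.mp y.2, h, h])⟩

/-- A module is the product of the blocks of two complementary central idempotents. -/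
theorem blk_prod {e e' : Subalgebra.center R U} (hee : e + e' = 1) (he : IdemOn e M) :
    Nonempty (M ≃ₗ[U] blk e M × blk e' M) := by
  have h' : ∀ x : M, (e' : U) • x = x - (e : U) • x := fun x => by
    have : (e' : U) = 1 - e := by
      rw [eq_sub_iff_add_eq', ← Subalgebra.coe_add, hee, Subalgebra.coe_one]
    rw [this, sub_smul, one_smul]
  refine ⟨(LinearEquiv.ofBijective ((blk e M).subtype.coprod (blk e' M).subtype) ⟨?_, ?_⟩).symm⟩
  · rw [injective_iff_map_eq_zero]
    rintro ⟨⟨x, hx⟩, ⟨y, hy⟩⟩ hxy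
    rw [mem_blk] at hx hy
    simp only [LinearMap.coprod_apply, Submodule.subtype_apply] at hxy
    rw [h', sub_eq_self] at hy
    have h2 := congrArg (fun z => (e : U) • z) hxy
    simp only [smul_add, hx, hy, add_zero, smul_zero] at h2
    subst h2
    rw [zero_add] at hxy
    subst hxy
    rfl
  · intro x
    refine ⟨(⟨(e : U) • x, he x⟩, ⟨x - (e : U) • x, ?_⟩), ?_⟩
    · rw [mem_blk, h', smul_sub, he x, sub_self, sub_zero]
    · simp

/-! ### Indecomposable modules -/

/-- Decompositions of a module correspond to its idempotent endomorphisms. -/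
theorem isIndecomposable_iff {U : Type u} [Ring U] {M : Type u} [AddCommGroup M] [Module U M] :
    IsIndecomposable U M ↔ Nontrivial M ∧
      ∀ p : M →ₗ[U] M, p ∘ₗ p = p → p = 0 ∨ p = LinearMap.id := by
  refine and_congr_right fun _ => ⟨fun h p hp => ?_, fun h P Q hPQ => ?_⟩
  · have hp' : ∀ x, p (p x) = p x := LinearMap.congr_fun hp
    have hc : IsCompl (LinearMap.range p) (LinearMap.ker p) := by
      constructor
      · rw [Submodule.disjoint_def]
        rintro _ ⟨x, rfl⟩ hx
        rw [LinearMap.mem_ker, hp'] at hx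
        exact hx
      · rw [codisjoint_iff, eq_top_iff]
        intro x _
        rw [← add_sub_cancel (p x) x]
        exact Submodule.add_mem_sup ⟨x, rfl⟩ (by simp [hp'])
    rcases h _ _ hc with h | h
    · exact Or.inl (LinearMap.range_eq_bot.mp h)
    · right
      ext x
      have : p x - x ∈ LinearMap.ker p := by simp [hp']
      rw [h, Submodule.mem_bot, sub_eq_zero] at this
      exact this
  · have hid := h (P.projection Q hPQ) (by
      ext x
      exact Submodule.projection_apply_of_mem_left hPQ (Submodule.projection_apply_mem hPQ x))
    rcases hid with hid | hid
    · left
      rw [eq_bot_iff]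
      intro x hx
      have := LinearMap.congr_fun hid x
      rwa [Submodule.projection_apply_of_mem_left hPQ hx] at this
    · right
      rw [eq_bot_iff]
      intro x hx
      refine (Submodule.disjoint_def.mp hPQ.disjoint) x ?_ hx
      rw [← LinearMap.id_apply (R := U) x, ← hid]
      exact Submodule.projection_apply_mem hPQ x

theorem isIndecomposable_congr {U : Type u} [Ring U] {M M' : Type u} [AddCommGroup M] [Module U M]
    [AddCommGroup M'] [Module U M'] (e : M ≃ₗ[U] M') (h : IsIndecomposable U M) :
    IsIndecomposable U M' := by
  obtain ⟨h1, h2⟩ := h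
  refine ⟨e.symm.toEquiv.nontrivial, fun P Q hPQ => ?_⟩
  have := h2 _ _ (hPQ.map (Submodule.orderIsoMapComap e.symm))
  simpa using this

theorem isIndecomposable_of_simple {U : Type u} [Ring U] {M : Type u} [AddCommGroup M] [Module U M]
    [IsSimpleModule U M] : IsIndecomposable U M := by
  refine ⟨IsSimpleModule.nontrivial U M, fun P Q hPQ => ?_⟩
  rcases eq_bot_or_eq_top P with h | h
  · exact Or.inl h
  · right
    have := hPQ.disjoint
    rwa [h, top_disjoint] at this

/-- Fitting's lemma: the endomorphism ring of an indecomposable module of finite length is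
local. -/
theorem isLocalRing_end {U : Type u} [Ring U] {M : Type u} [AddCommGroup M] [Module U M]
    [IsNoetherian U M] [IsArtinian U M] (h : IsIndecomposable U M) :
    IsLocalRing (Module.End U M) := by
  obtain ⟨h1, h2⟩ := h
  refine IsLocalRing.of_isUnit_or_isUnit_one_sub_self fun f => ?_
  obtain ⟨n, hn, hn'⟩ := ((LinearMap.eventually_isCompl_ker_pow_range_pow f).and
    (Filter.eventually_ge_atTop 1)).exists
  rcases h2 _ _ hn with h | h
  · left
    have hinj : Function.Injective f := by
      rw [← LinearMap.ker_eq_bot, eq_bot_iff]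
      intro x hx
      rw [← h, LinearMap.mem_ker, ← Nat.sub_add_cancel hn', pow_succ, Module.End.mul_apply,
        LinearMap.mem_ker.mp hx, map_zero]
    exact (Module.End.isUnit_iff f).mpr (IsArtinian.bijective_of_injective_endomorphism f hinj)
  · right
    have : IsNilpotent f := ⟨n, LinearMap.range_eq_bot.mp h⟩
    exact this.isUnit_one_sub

/-- The cancellation step of the Krull-Schmidt theorem: an indecomposable module of finite length
that is a retract of a finite product of indecomposable modules is one of the factors. -/
theorem exists_equiv_of_retract {U : Type u} [Ring U] {X : Type u} [AddCommGroup X] [Module U X]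
    [IsNoetherian U X] [IsArtinian U X] (hX : IsIndecomposable U X) {J : Type*} [Fintype J]
    {Y : J → Type u} [∀ j, AddCommGroup (Y j)] [∀ j, Module U (Y j)]
    (hY : ∀ j, IsIndecomposable U (Y j)) (i : X →ₗ[U] ∀ j, Y j) (p : (∀ j, Y j) →ₗ[U] X)
    (hpi : p ∘ₗ i = LinearMap.id) : ∃ j, Nonempty (X ≃ₗ[U] Y j) := by
  classical
  have := isLocalRing_end hX
  let a : ∀ j, X →ₗ[U] Y j := fun j => LinearMap.proj j ∘ₗ i
  let b : ∀ j, Y j →ₗ[U] X := fun j => p ∘ₗ LinearMap.single U Y j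
  have hsum : ∑ j, (b j ∘ₗ a j : Module.End U X) = 1 := by
    ext x
    have h1 : ∑ j, Pi.single j (i x j) = i x := Finset.univ_sum_single (i x)
    have h2 := LinearMap.congr_fun hpi x
    simp only [LinearMap.comp_apply, LinearMap.id_apply] at h2
    rw [LinearMap.sum_apply, Module.End.one_apply]
    conv_rhs => rw [← h2, ← h1, map_sum]
    rfl
  -- the `b j ∘ a j` add up to the identity, and a sum of nonunits of a local ring is a nonunit
  obtain ⟨j, hj⟩ : ∃ j, IsUnit (b j ∘ₗ a j : Module.End U X) := by
    by_contra! hcon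
    have hmem : ∀ s : Finset J, ∑ j ∈ s, (b j ∘ₗ a j : Module.End U X) ∈ nonunits _ := by
      intro s
      induction s using Finset.induction_on with
      | empty => simp
      | insert j s hjs ih =>
        rw [Finset.sum_insert hjs]
        exact IsLocalRing.nonunits_add (hcon j) ih
    exact hmem Finset.univ (hsum ▸ isUnit_one)
  obtain ⟨t, ht⟩ := hj
  refine ⟨j, ⟨LinearEquiv.ofBijective (a j) ⟨?_, ?_⟩⟩⟩
  · have : Function.Injective (b j ∘ₗ a j) :=
      ((Module.End.isUnit_iff _).mp ⟨t, ht⟩).1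
    exact Function.Injective.of_comp (f := b j) this
  · -- `a j ∘ (b j ∘ a j)⁻¹ ∘ b j` is a nonzero idempotent
    let e : Y j →ₗ[U] Y j := a j ∘ₗ ((t⁻¹ : (Module.End U X)ˣ) : Module.End U X) ∘ₗ b j
    have h1 : ∀ x, ((t⁻¹ : (Module.End U X)ˣ) : Module.End U X) (b j (a j x)) = x := by
      intro x
      have := LinearMap.congr_fun t.inv_mul x
      rw [ht] at this
      exact this
    have he : e ∘ₗ e = e := by
      ext y
      simp only [e, LinearMap.comp_apply, h1]
    rcases (isIndecomposable_iff.mp (hY j)).2 e he with h | h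
    · exfalso
      have := hX.1
      obtain ⟨x, hx⟩ := exists_ne (0 : X)
      apply hx
      rw [← h1 x, ← h1 (((t⁻¹ : (Module.End U X)ˣ) : Module.End U X) (b j (a j x)))]
      have := LinearMap.congr_fun h (a j x)
      simp only [e, LinearMap.comp_apply, LinearMap.zero_apply] at this
      rw [this, map_zero, map_zero]
    · intro y
      exact ⟨_, LinearMap.congr_fun h y⟩

end Modules


/-! ### Traces and dimensions -/

section Trace

/-- The trace is additive on short exact sequences of finite-dimensional vector spaces with
endomorphisms. -/
theorem trace_exact {𝕜 A M B : Type*} [Field 𝕜] [AddCommGroup A] [Module 𝕜 A] [AddCommGroup M]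
    [Module 𝕜 M] [AddCommGroup B] [Module 𝕜 B] [Module.Finite 𝕜 A] [Module.Finite 𝕜 B]
    {f : A →ₗ[𝕜] M} {g : M →ₗ[𝕜] B} (hf : Function.Injective f) (hfg : Function.Exact f g)
    (hg : Function.Surjective g) :
    Module.Finite 𝕜 M ∧ Module.finrank 𝕜 M = Module.finrank 𝕜 A + Module.finrank 𝕜 B ∧
      ∀ (a : Module.End 𝕜 A) (m : Module.End 𝕜 M) (b : Module.End 𝕜 B), (∀ x, m (f x) = f (a x)) →
        (∀ x, g (m x) = b (g x)) →
        LinearMap.trace 𝕜 M m = LinearMap.trace 𝕜 A a + LinearMap.trace 𝕜 B b := by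
  obtain ⟨s, hs⟩ := g.exists_rightInverse_of_surjective (LinearMap.range_eq_top.mpr hg)
  have hs' : ∀ y, g (s y) = y := LinearMap.congr_fun hs
  have h0 : ∀ x, g (f x) = 0 := hfg.apply_apply_eq_zero
  -- a linear section of `g` identifies `M` with `A × B`, where `m` becomes block triangular
  let e : (A × B) ≃ₗ[𝕜] M := LinearEquiv.ofBijective (f.coprod s) (by
    constructor
    · rw [injective_iff_map_eq_zero]
      rintro ⟨x, y⟩ hxy
      rw [LinearMap.coprod_apply] at hxy
      have hy : y = 0 := by simpa [h0, hs'] using congrArg g hxy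
      subst hy
      have hx : x = 0 := (map_eq_zero_iff f hf).mp (by simpa using hxy)
      rw [hx, Prod.mk_zero_zero]
    · intro z
      obtain ⟨x, hx⟩ := (hfg (z - s (g z))).mp (by rw [map_sub, hs', sub_self])
      exact ⟨(x, g z), by simp [hx]⟩)
  have he : ∀ x y, e (x, y) = f x + s y := fun _ _ => rfl
  refine ⟨Module.Finite.equiv e, ?_, ?_⟩
  · rw [← e.finrank_eq, Module.finrank_prod]
  intro a m b ha hb
  have hconj : e.symm.conj m = LinearMap.prodMap a b
      + LinearMap.inl 𝕜 A B ∘ₗ (LinearMap.fst 𝕜 A B ∘ₗ e.symm.toLinearMap ∘ₗ m ∘ₗ s)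
        ∘ₗ LinearMap.snd 𝕜 A B := by
    have hsnd : ∀ z, (e.symm z).2 = g z := by
      intro z
      obtain ⟨⟨x, y⟩, rfl⟩ := e.surjective z
      rw [e.symm_apply_apply, he, map_add, h0, hs', zero_add]
    have hsymm : ∀ x, e.symm (f x) = (x, 0) := by
      intro x
      rw [LinearEquiv.symm_apply_eq, he, map_zero, add_zero]
    refine LinearMap.ext fun ⟨x, y⟩ => ?_
    rw [LinearEquiv.conj_apply_apply, LinearEquiv.symm_symm, he, map_add, ha, map_add, hsymm]
    refine Prod.ext ?_ ?_
    · simp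
    · simp [hsnd, hb, hs']
  rw [← LinearMap.trace_conj' m e.symm, hconj, map_add, LinearMap.trace_prodMap',
    LinearMap.trace_comp_comm', add_eq_left]
  have : ((LinearMap.fst 𝕜 A B ∘ₗ e.symm.toLinearMap ∘ₗ m ∘ₗ s) ∘ₗ LinearMap.snd 𝕜 A B)
      ∘ₗ LinearMap.inl 𝕜 A B = 0 := by
    ext x
    simp
  rw [this, map_zero]

variable (𝕜 U : Type*) [Field 𝕜] [Ring U] [Algebra 𝕜 U]

/-- A module over a `𝕜`-algebra `U`, regarded as a vector space over `𝕜`. -/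
def Rs (_𝕜 U : Type*) [Field _𝕜] [Ring U] [Algebra _𝕜 U] (M : Type*) [AddCommGroup M]
    [Module U M] : Type _ :=
  M

instance (M : Type*) [AddCommGroup M] [Module U M] : AddCommGroup (Rs 𝕜 U M) :=
  inferInstanceAs (AddCommGroup M)

instance (M : Type*) [AddCommGroup M] [Module U M] : Module 𝕜 (Rs 𝕜 U M) :=
  Module.compHom M (algebraMap 𝕜 U)

/-- Finite-dimensionality of a module over a `𝕜`-algebra. -/
def FD (M : Type*) [AddCommGroup M] [Module U M] : Prop :=
  Module.Finite 𝕜 (Rs 𝕜 U M)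

/-- The dimension over `𝕜` of a module over a `𝕜`-algebra. -/
noncomputable def rk (M : Type*) [AddCommGroup M] [Module U M] : ℕ :=
  Module.finrank 𝕜 (Rs 𝕜 U M)

variable {U}

/-- The action of `u` on a module, as a `𝕜`-linear map. -/
def rsSmul (M : Type*) [AddCommGroup M] [Module U M] (u : U) : Module.End 𝕜 (Rs 𝕜 U M) where
  toFun x := id (α := M) (u • id (α := M) x)
  map_add' x y := smul_add (M := U) (A := M) u x y
  map_smul' c x := by
    change u • (algebraMap 𝕜 U c • id (α := M) x) = algebraMap 𝕜 U c • (u • id (α := M) x)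
    rw [smul_smul, smul_smul, Algebra.commutes]

/-- The trace of the action of `u` on a module. -/
noncomputable def tr (u : U) (M : Type*) [AddCommGroup M] [Module U M] : 𝕜 :=
  LinearMap.trace 𝕜 (Rs 𝕜 U M) (rsSmul 𝕜 M u)

variable {A M B : Type*} [AddCommGroup A] [Module U A] [AddCommGroup M] [Module U M]
  [AddCommGroup B] [Module U B]

/-- A `U`-linear map, as a `𝕜`-linear map. -/
def rsMap (f : A →ₗ[U] M) : Rs 𝕜 U A →ₗ[𝕜] Rs 𝕜 U M where
  toFun := f
  map_add' := f.map_add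
  map_smul' c x := f.map_smul (algebraMap 𝕜 U c) x

/-- A `U`-linear equivalence, as a `𝕜`-linear equivalence. -/
def rsEquiv (f : A ≃ₗ[U] M) : Rs 𝕜 U A ≃ₗ[𝕜] Rs 𝕜 U M :=
  { rsMap 𝕜 f.toLinearMap, f.toEquiv with }

variable {𝕜}

theorem FD.congr (h : FD 𝕜 U A) (e : A ≃ₗ[U] M) : FD 𝕜 U M := by
  unfold FD at *
  exact Module.Finite.equiv (rsEquiv 𝕜 e)

theorem rk_congr (e : A ≃ₗ[U] M) : rk 𝕜 U A = rk 𝕜 U M := (rsEquiv 𝕜 e).finrank_eq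

theorem tr_congr (e : A ≃ₗ[U] M) (u : U) : tr 𝕜 u A = tr 𝕜 u M := by
  rw [tr, tr, ← LinearMap.trace_conj' _ (rsEquiv 𝕜 e)]
  congr 1
  refine LinearMap.ext fun x => ?_
  obtain ⟨y, rfl⟩ := (rsEquiv 𝕜 e).surjective x
  rw [LinearEquiv.conj_apply_apply, LinearEquiv.symm_apply_apply]
  exact e.map_smul u y

theorem SES.fd (h : SES U A M B) (hA : FD 𝕜 U A) (hB : FD 𝕜 U B) : FD 𝕜 U M := by
  obtain ⟨f, g, hf, hfg, hg⟩ := h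
  unfold FD at *
  exact (trace_exact (f := rsMap 𝕜 f) (g := rsMap 𝕜 g) hf hfg hg).1

theorem SES.rk (h : SES U A M B) (hA : FD 𝕜 U A) (hB : FD 𝕜 U B) :
    rk 𝕜 U M = rk 𝕜 U A + QuantumSL2.rk 𝕜 U B := by
  obtain ⟨f, g, hf, hfg, hg⟩ := h
  unfold FD at *
  exact (trace_exact (f := rsMap 𝕜 f) (g := rsMap 𝕜 g) hf hfg hg).2.1

theorem SES.tr (h : SES U A M B) (hA : FD 𝕜 U A) (hB : FD 𝕜 U B) (u : U) :
    tr 𝕜 u M = tr 𝕜 u A + QuantumSL2.tr 𝕜 u B := by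
  obtain ⟨f, g, hf, hfg, hg⟩ := h
  unfold FD at *
  exact (trace_exact (f := rsMap 𝕜 f) (g := rsMap 𝕜 g) hf hfg hg).2.2 _ _ _
    (fun x => (f.map_smul u x).symm) (fun x => g.map_smul u x)

theorem bijective_of_injective_of_rk (hA : FD 𝕜 U A) (hM : FD 𝕜 U M) (hr : rk 𝕜 U A = rk 𝕜 U M)
    {f : A →ₗ[U] M} (hf : Function.Injective f) : Function.Bijective f := by
  unfold FD at *
  exact ⟨hf, (LinearMap.injective_iff_surjective_of_finrank_eq_finrank
    (f := rsMap 𝕜 f) hr).mp hf⟩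

/-- The lattice of `U`-submodules embeds into the lattice of subspaces. -/
def rsSubmodule (P : Submodule U M) : Submodule 𝕜 (Rs 𝕜 U M) where
  carrier := P.carrier
  add_mem' := P.add_mem'
  zero_mem' := P.zero_mem'
  smul_mem' c _ hx := P.smul_mem' (algebraMap 𝕜 U c) hx

theorem FD.isNoetherian (hM : FD 𝕜 U M) : IsNoetherian U M := by
  unfold FD at hM
  rw [isNoetherian_iff']
  have hw : WellFoundedGT (Submodule 𝕜 (Rs 𝕜 U M)) := inferInstance
  exact ⟨(InvImage.wf (rsSubmodule (𝕜 := 𝕜)) hw.wf)⟩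

theorem FD.isArtinian (hM : FD 𝕜 U M) : IsArtinian U M := by
  unfold FD at hM
  have hw : WellFoundedLT (Submodule 𝕜 (Rs 𝕜 U M)) := inferInstance
  exact ⟨(InvImage.wf (rsSubmodule (𝕜 := 𝕜)) hw.wf)⟩

theorem FD.of_subsingleton [Subsingleton M] : FD 𝕜 U M := by
  have : Subsingleton (Rs 𝕜 U M) := ‹Subsingleton M›
  unfold FD
  infer_instance

theorem tr_of_subsingleton [Subsingleton M] (u : U) : tr 𝕜 u M = 0 := by
  have : Subsingleton (Rs 𝕜 U M) := ‹Subsingleton M›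
  rw [tr, Subsingleton.elim (rsSmul 𝕜 M u) 0, map_zero]

theorem rk_of_subsingleton [Subsingleton M] : rk 𝕜 U M = 0 := by
  have : Subsingleton (Rs 𝕜 U M) := ‹Subsingleton M›
  exact Module.finrank_zero_of_subsingleton

theorem tr_one (hM : FD 𝕜 U M) : tr 𝕜 (1 : U) M = rk 𝕜 U M := by
  unfold FD at hM
  have : rsSmul 𝕜 M (1 : U) = 1 := LinearMap.ext fun x => one_smul U (id (α := M) x)
  rw [tr, this, LinearMap.trace_one]
  rfl

end Trace

/-! ### Finite products and direct sums of the members of a sequence of modules -/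

section Sums

variable {U : Type u} [Ring U] {T : ℕ → Type u} [∀ k, AddCommGroup (T k)] [∀ k, Module U (T k)]

variable {X Y : Type u} [AddCommGroup X] [Module U X] [AddCommGroup Y] [Module U Y]

/-- A direct sum whose terms vanish outside a finite set is a finite product. -/
theorem directSum_equiv_pi {Z : ℕ → Type u} [∀ k, AddCommGroup (Z k)] [∀ k, Module U (Z k)]
    (F : Finset ℕ) (hF : ∀ k ∉ F, Subsingleton (Z k)) :
    Nonempty ((⨁ k, Z k) ≃ₗ[U] ∀ k : F, Z k) := by
  classical
  refine ⟨LinearEquiv.ofBijective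
    (LinearMap.pi fun k : F => DirectSum.component U ℕ Z k) ⟨?_, ?_⟩⟩
  · intro x y hxy
    refine DirectSum.ext_component U fun k => ?_
    by_cases hk : k ∈ F
    · exact congrFun hxy ⟨k, hk⟩
    · have := hF k hk
      exact Subsingleton.elim _ _
  · intro y
    refine ⟨DirectSum.mk Z F fun k => y k, ?_⟩
    ext ⟨k, hk⟩
    exact DirectSum.mk_apply_of_mem hk

/-- A finite product of members of the sequence `T`, with the factors collected by index. -/
theorem pi_equiv_directSum {J : Type} [Fintype J] (κ : J → ℕ) (m : ℕ → ℕ)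
    (hm : ∀ k, m k = Fintype.card {j // κ j = k}) :
    Nonempty ((∀ j, T (κ j)) ≃ₗ[U] ⨁ k : ℕ, (Fin (m k) → T k)) := by
  classical
  let F : Finset ℕ := Finset.univ.image κ
  have hκ : ∀ j, κ j ∈ F := fun j => Finset.mem_image_of_mem _ (Finset.mem_univ j)
  obtain ⟨e⟩ := directSum_equiv_pi (U := U) (Z := fun k => Fin (m k) → T k) F (by
    intro k hk
    have : m k = 0 := by
      rw [hm, Fintype.card_eq_zero_iff]
      exact ⟨fun ⟨j, hj⟩ => hk (hj ▸ hκ j)⟩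
    rw [this]
    infer_instance)
  let g : ∀ k, Fin (m k) ≃ {j // κ j = k} := fun k => (Fintype.equivFinOfCardEq (hm k).symm).symm
  let h : (Σ k : F, Fin (m k)) ≃ J :=
    { toFun := fun p => (g p.1 p.2).1
      invFun := fun j => ⟨⟨κ j, hκ j⟩, (g (κ j)).symm ⟨j, rfl⟩⟩
      left_inv := by
        rintro ⟨⟨k, hk⟩, i⟩
        have h1 := (g k i).2
        have h2 : ∀ k' (hk' : k' ∈ F) (h : κ (g k i).1 = k'), k = k' →
            (⟨⟨k', hk'⟩, (g k').symm ⟨(g k i).1, h⟩⟩ : Σ k : F, Fin (m k)) = ⟨⟨k, hk⟩, i⟩ := by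
          rintro k' hk' h rfl
          simp
        exact h2 _ _ rfl h1.symm
      right_inv := fun j => by simp }
  have hh : ∀ p : (Σ k : F, Fin (m k)), κ (h p) = p.1 := fun p => (g p.1 p.2).2
  have cast : ∀ a b : ℕ, a = b → Nonempty (T a ≃ₗ[U] T b) := by
    rintro a _ rfl
    exact ⟨LinearEquiv.refl U _⟩
  exact ⟨((LinearEquiv.piCongrLeft U (fun j => T (κ j)) h).symm.trans
    (LinearEquiv.piCongrRight fun p => (cast _ _ (hh p)).some)).trans
    ((LinearEquiv.piCurry U (fun (k : F) (_ : Fin (m k)) => T k)).trans e.symm)⟩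

/-- A direct sum of nonzero modules that is Noetherian has finitely many terms. -/
theorem exists_pi_of_directSum [IsNoetherian U X] (hT : ∀ k, Nontrivial (T k)) (m : ℕ → ℕ)
    (e : X ≃ₗ[U] ⨁ k : ℕ, (Fin (m k) → T k)) :
    ∃ F : Finset ℕ, (∀ k ∉ F, m k = 0) ∧
      Nonempty (X ≃ₗ[U] ∀ p : (Σ k : F, Fin (m k)), T p.1) := by
  classical
  have : IsNoetherian U (⨁ k : ℕ, (Fin (m k) → T k)) := isNoetherian_of_linearEquiv e
  have hfin : {k | m k ≠ 0}.Finite := by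
    -- the submodules of elements without components in degrees `≥ n` form an ascending chain
    let S : ℕ →o Submodule U (⨁ k : ℕ, (Fin (m k) → T k)) :=
      { toFun := fun n =>
          { carrier := {x | ∀ k, n ≤ k → x k = 0}
            add_mem' := fun {x y} hx hy k hk => by rw [DirectSum.add_apply, hx k hk, hy k hk, add_zero]
            zero_mem' := fun k _ => rfl
            smul_mem' := fun c x hx k hk => by rw [DirectSum.smul_apply, hx k hk, smul_zero] }
        monotone' := fun a b hab x hx k hk => hx k (hab.trans hk) }
    have hS : ∀ n x, x ∈ S n ↔ ∀ k, n ≤ k → x k = 0 := fun n x => Iff.rfl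
    obtain ⟨n, hn⟩ := monotone_stabilizes_iff_noetherian.mpr this S
    refine (Set.finite_lt_nat n).subset fun k hk => ?_
    simp only [Set.mem_ofPred_eq] at hk ⊢
    by_contra! hnk
    have : Nonempty (Fin (m k)) := ⟨⟨0, Nat.pos_of_ne_zero hk⟩⟩
    have := hT k
    obtain ⟨x, hx⟩ := exists_ne (0 : Fin (m k) → T k)
    apply hx
    have h1 : DirectSum.lof U ℕ (fun k => Fin (m k) → T k) k x ∈ S (k + 1) := by
      rw [hS]
      intro i hi
      exact DirectSum.of_eq_of_ne _ _ _ (by omega)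
    rw [← hn (k + 1) (by omega), hn k hnk, hS] at h1
    simpa [DirectSum.lof_eq_of] using h1 k le_rfl
  obtain ⟨f⟩ := directSum_equiv_pi (U := U) (Z := fun k => Fin (m k) → T k) hfin.toFinset (by
    intro k hk
    have : m k = 0 := by simpa using hk
    rw [this]
    infer_instance)
  exact ⟨hfin.toFinset, fun k hk => by simpa using hk, ⟨(e.trans f).trans
    (LinearEquiv.piCurry U (fun (k : hfin.toFinset) (_ : Fin (m k)) => T k)).symm⟩⟩

end Sums


/-! ### Tensoring with the two-dimensional module -/

/-- To check a property of all elements of `U_v(sl₂)` that is stable under the operations it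
suffices to check the generators. -/
theorem Uv_induction {P : Uv → Prop} (hs : ∀ c : Qv, P (algebraMap Qv Uv c)) (hg : ∀ g, P (gen g))
    (hadd : ∀ x y, P x → P y → P (x + y)) (hmul : ∀ x y, P x → P y → P (x * y)) (x : Uv) : P x := by
  obtain ⟨y, rfl⟩ : ∃ y, mk y = x := RingQuot.mkAlgHom_surjective Qv Rel x
  induction y using FreeAlgebra.induction with
  | grade0 c => rw [AlgHom.commutes]; exact hs c
  | grade1 g => exact hg g
  | mul a b ha hb => rw [map_mul]; exact hmul _ _ ha hb
  | add a b ha hb => rw [map_add]; exact hadd _ _ ha hb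

/-- The action on the two-dimensional module `V`, by `2 × 2` matrices over `ℚ(v)`. -/
noncomputable def vRep : Uv →ₐ[Qv] Matrix (Fin 2) (Fin 2) Qv := (weylRep 1).ρ

theorem scalarAlgHom_apply (b : Uv) :
    (Matrix.scalarAlgHom (Fin 2) Qv : Uv →ₐ[Qv] Matrix (Fin 2) (Fin 2) Uv) b = Matrix.diagonal fun _ => b := rfl

theorem commute_vTwist (a b : Uv) : Commute (((Algebra.ofId Qv Uv).mapMatrix.comp vRep) a)
    (Matrix.scalarAlgHom (Fin 2) Qv b) := by
  rw [scalarAlgHom_apply, commute_iff_eq]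
  ext i j
  rw [Matrix.mul_diagonal, Matrix.diagonal_mul]
  exact Algebra.commutes (R := Qv) (A := Uv) _ b

/-- The algebra map sending `a ⊗ b` to the matrix of `a` on `V`, multiplied by `b`. -/
noncomputable def vTwist : Uv ⊗[Qv] Uv →ₐ[Qv] Matrix (Fin 2) (Fin 2) Uv :=
  Algebra.TensorProduct.lift ((Algebra.ofId Qv Uv).mapMatrix.comp vRep)
    (Matrix.scalarAlgHom (Fin 2) Qv) commute_vTwist

/-- The coproduct followed by the action of the first factor on `V`. It makes `V ⊗ M = M²` a
module for every module `M`. -/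
noncomputable def vComul : Uv →ₐ[Qv] Matrix (Fin 2) (Fin 2) Uv := vTwist.comp comul

theorem vTwist_tmul (a b : Uv) : vTwist (a ⊗ₜ b) = (vRep a).map fun c => c • b := by
  rw [vTwist, Algebra.TensorProduct.lift_tmul, scalarAlgHom_apply]
  ext i j
  rw [Matrix.mul_diagonal, Matrix.map_apply, Algebra.smul_def]
  rfl

theorem weylRep_E (m : ℕ) : (weylRep m).ρ (gen Gen.E) = weylE m := by
  simp only [weylRep]
  exact liftUv_gen (B := Matrix (Fin (m + 1)) (Fin (m + 1)) Qv) _ _ _ _ _ _ _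

theorem weylRep_F (m : ℕ) : (weylRep m).ρ (gen Gen.F) = weylF m := by
  simp only [weylRep]
  exact liftUv_gen (B := Matrix (Fin (m + 1)) (Fin (m + 1)) Qv) _ _ _ _ _ _ _

theorem weylRep_K (m : ℕ) : (weylRep m).ρ (gen Gen.K) = weylK m := by
  simp only [weylRep]
  exact liftUv_gen (B := Matrix (Fin (m + 1)) (Fin (m + 1)) Qv) _ _ _ _ _ _ _

theorem weylRep_Ki (m : ℕ) : (weylRep m).ρ (gen Gen.Ki) = weylKi m := by
  simp only [weylRep]
  exact liftUv_gen (B := Matrix (Fin (m + 1)) (Fin (m + 1)) Qv) _ _ _ _ _ _ _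

theorem vRep_E : vRep (gen Gen.E) = !![0, 1; 0, 0] := by
  have : vRep (gen Gen.E) = weylE 1 := weylRep_E 1
  rw [this]
  ext i j
  fin_cases i <;> fin_cases j <;> simp [weylE]

theorem vRep_F : vRep (gen Gen.F) = !![0, 0; 1, 0] := by
  have : vRep (gen Gen.F) = weylF 1 := weylRep_F 1
  rw [this]
  ext i j
  fin_cases i <;> fin_cases j <;> simp [weylF]

theorem vRep_K : vRep (gen Gen.K) = !![v, 0; 0, v⁻¹] := by
  have : vRep (gen Gen.K) = weylK 1 := weylRep_K 1
  rw [this]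
  ext i j
  fin_cases i <;> fin_cases j <;> simp [weylK]

theorem vRep_Ki : vRep (gen Gen.Ki) = !![v⁻¹, 0; 0, v] := by
  have : vRep (gen Gen.Ki) = weylKi 1 := weylRep_Ki 1
  rw [this]
  ext i j
  fin_cases i <;> fin_cases j <;> simp [weylKi]

theorem vComul_E : vComul (gen Gen.E) = !![v • gen Gen.E, 1; 0, v⁻¹ • gen Gen.E] := by
  rw [vComul, AlgHom.comp_apply, comul, liftUv_gen, map_add, vTwist_tmul, vTwist_tmul, vRep_E,
    vRep_K]
  ext i j
  fin_cases i <;> fin_cases j <;> simp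

theorem vComul_F : vComul (gen Gen.F) = !![gen Gen.F, 0; gen Gen.Ki, gen Gen.F] := by
  rw [vComul, AlgHom.comp_apply, comul, liftUv_gen, map_add, vTwist_tmul, vTwist_tmul, vRep_F,
    map_one]
  ext i j
  fin_cases i <;> fin_cases j <;> simp

theorem vComul_K : vComul (gen Gen.K) = !![v • gen Gen.K, 0; 0, v⁻¹ • gen Gen.K] := by
  rw [vComul, AlgHom.comp_apply, comul, liftUv_gen, vTwist_tmul, vRep_K]
  ext i j
  fin_cases i <;> fin_cases j <;> simp

theorem vComul_Ki : vComul (gen Gen.Ki) = !![v⁻¹ • gen Gen.Ki, 0; 0, v • gen Gen.Ki] := by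
  rw [vComul, AlgHom.comp_apply, comul, liftUv_gen, vTwist_tmul, vRep_Ki]
  ext i j
  fin_cases i <;> fin_cases j <;> simp

/-- The integral form is preserved by `vComul`. -/
theorem vComul_mem {u : Uv} (hu : u ∈ UA) (i j : Fin 2) : vComul u i j ∈ UA := by
  have h : Algebra.adjoin Zv {w : Uv ⊗[Qv] Uv | ∃ a ∈ UA, ∃ b ∈ UA, w = a ⊗ₜ b}
      ≤ (UA.matrix (n := Fin 2)).comap (vTwist.restrictScalars Zv) := by
    refine Algebra.adjoin_le ?_
    rintro _ ⟨a, ha, b, hb, rfl⟩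
    change vTwist (a ⊗ₜ b) ∈ UA.matrix
    rw [vTwist_tmul]
    intro i j
    obtain ⟨c, hc⟩ := mem_integralMatrices.mp ((weylRep 1).integral a ha) i j
    have hc' : vRep a i j = algebraMap Zv Qv c := hc.symm
    rw [Matrix.map_apply, hc', algebraMap_smul]
    exact UA.smul_mem hb c
  exact h (comul_mem hu) i j

/-- The restriction of `vComul` to the integral form. -/
noncomputable def vComulA : UA →ₐ[Zv] Matrix (Fin 2) (Fin 2) UA where
  toFun u := Matrix.of fun i j => ⟨vComul u i j, vComul_mem u.2 i j⟩
  map_one' := by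
    ext i j
    have : vComul 1 i j = (1 : Matrix (Fin 2) (Fin 2) Uv) i j := by rw [map_one]
    refine this.trans ?_
    rw [Matrix.one_apply, Matrix.one_apply]
    split_ifs <;> rfl
  map_mul' x y := by
    ext i j
    simp [Matrix.mul_apply]
  map_zero' := by
    ext i j
    simp
  map_add' x y := by
    ext i j
    simp
  commutes' c := by
    ext i j
    have : vComul (algebraMap Qv Uv (algebraMap Zv Qv c)) i j
        = algebraMap Qv (Matrix (Fin 2) (Fin 2) Uv) (algebraMap Zv Qv c) i j := by
      rw [AlgHom.commutes]
    refine this.trans ?_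
    rw [Matrix.algebraMap_matrix_apply, Matrix.algebraMap_matrix_apply]
    split_ifs <;> rfl

@[simp]
theorem vComulA_coe (x : UA) (i j : Fin 2) : (vComulA x i j : Uv) = vComul x i j := rfl

section

variable (𝕜 : Type u) [Field 𝕜] [Algebra Zv 𝕜]

/-- The specialization of `vComul` to `U_q(sl₂)`. -/
noncomputable def vComulq : Uq 𝕜 →ₐ[𝕜] Matrix (Fin 2) (Fin 2) (Uq 𝕜) :=
  Algebra.TensorProduct.lift (Algebra.ofId 𝕜 _)
    ((Algebra.TensorProduct.includeRight : UA →ₐ[Zv] Uq 𝕜).mapMatrix.comp vComulA)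
    (fun c _ => commute_iff_eq _ _ |>.mpr (Algebra.commutes c _))

/-- An element of the integral form, in `U_q(sl₂)`. -/
noncomputable def inq (x : UA) : Uq 𝕜 := 1 ⊗ₜ x

variable {𝕜}

theorem tmul_eq (c : 𝕜) (x : UA) : (c ⊗ₜ x : Uq 𝕜) = c • inq 𝕜 x := by
  rw [inq, TensorProduct.smul_tmul', smul_eq_mul, mul_one]

theorem inq_mul (x y : UA) : inq 𝕜 (x * y) = inq 𝕜 x * inq 𝕜 y := by
  rw [inq, inq, inq, Algebra.TensorProduct.tmul_mul_tmul, one_mul]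

theorem inq_add (x y : UA) : inq 𝕜 (x + y) = inq 𝕜 x + inq 𝕜 y := TensorProduct.tmul_add _ _ _

theorem inq_smul (c : Zv) (x : UA) : inq 𝕜 (c • x) = algebraMap Zv 𝕜 c • inq 𝕜 x := by
  rw [inq, inq, TensorProduct.tmul_smul, algebraMap_smul]

theorem vComulq_inq (x : UA) (i j : Fin 2) : vComulq 𝕜 (inq 𝕜 x) i j = inq 𝕜 (vComulA x i j) := by
  rw [vComulq, inq, Algebra.TensorProduct.lift_tmul, map_one, one_mul]
  rfl

theorem Uq_induction {P : Uq 𝕜 → Prop} (hadd : ∀ x y, P x → P y → P (x + y))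
    (hs : ∀ (c : 𝕜) x, P (c • inq 𝕜 x)) (x : Uq 𝕜) : P x := by
  induction x using TensorProduct.induction_on with
  | zero => simpa using hs 0 0
  | tmul c x => rw [tmul_eq]; exact hs c x
  | add x y hx hy => exact hadd x y hx hy

variable (𝕜)

/-- The module `V ⊗ M`, where `V` is the two-dimensional module with basis `e₀, e₁`: the pair
`w : Fin 2 → M` stands for `e₀ ⊗ w 0 + e₁ ⊗ w 1`. -/
def VT (M : Type*) : Type _ := Fin 2 → M

instance (M : Type*) [AddCommGroup M] : AddCommGroup (VT M) :=
  inferInstanceAs (AddCommGroup (Fin 2 → M))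

noncomputable instance (M : Type*) [AddCommGroup M] [Module (Uq 𝕜) M] : Module (Uq 𝕜) (VT M) where
  smul x w := fun i => ∑ j, vComulq 𝕜 x i j • w j
  one_smul w := by
    funext i
    change ∑ j, vComulq 𝕜 1 i j • w j = w i
    rw [map_one, Finset.sum_eq_single i, Matrix.one_apply_eq, one_smul]
    · intro j _ hj
      rw [Matrix.one_apply_ne hj.symm]
      exact zero_smul (Uq 𝕜) (w j)
    · simp
  mul_smul x y w := by
    funext i
    change ∑ j, vComulq 𝕜 (x * y) i j • w j
      = ∑ j, vComulq 𝕜 x i j • ∑ k, vComulq 𝕜 y j k • w k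
    simp only [map_mul, Matrix.mul_apply, Fin.sum_univ_two, add_smul, smul_add, mul_smul]
    abel
  smul_zero x := by
    funext i
    change ∑ j, vComulq 𝕜 x i j • (0 : M) = 0
    simp
  smul_add x w w' := by
    funext i
    change ∑ j, vComulq 𝕜 x i j • (w j + w' j)
      = ∑ j, vComulq 𝕜 x i j • w j + ∑ j, vComulq 𝕜 x i j • w' j
    simp [Finset.sum_add_distrib]
  add_smul x y w := by
    funext i
    change ∑ j, vComulq 𝕜 (x + y) i j • w j
      = ∑ j, vComulq 𝕜 x i j • w j + ∑ j, vComulq 𝕜 y i j • w j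
    simp [Finset.sum_add_distrib, add_smul]
  zero_smul w := by
    funext i
    change ∑ j, vComulq 𝕜 0 i j • w j = 0
    simp only [map_zero, Matrix.zero_apply]
    exact Finset.sum_eq_zero fun j _ => zero_smul (Uq 𝕜) (w j)

variable {𝕜}

theorem VT.smul_apply {M : Type*} [AddCommGroup M] [Module (Uq 𝕜) M] (x : Uq 𝕜) (w : VT M)
    (i : Fin 2) : (x • w) i = vComulq 𝕜 x i 0 • w 0 + vComulq 𝕜 x i 1 • w 1 :=
  Fin.sum_univ_two _

end


/-! ### The functor `V ⊗ -` -/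

section VTFunctor

variable {𝕜 : Type u} [Field 𝕜] [Algebra Zv 𝕜]
/-- An element of `V ⊗ M`, from its two components. -/
def VT.of {M : Type*} (f : Fin 2 → M) : VT M := f

@[simp]
theorem VT.of_apply {M : Type*} (f : Fin 2 → M) (i : Fin 2) : VT.of f i = f i := rfl

@[ext]
theorem VT.ext {M : Type*} {w w' : VT M} (h : ∀ i, w i = w' i) : w = w' := funext h

variable {A M B : Type*} [AddCommGroup A] [Module (Uq 𝕜) A] [AddCommGroup M] [Module (Uq 𝕜) M]
  [AddCommGroup B] [Module (Uq 𝕜) B]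

/-- The functor `V ⊗ -` on linear maps. -/
noncomputable def VT.map (f : A →ₗ[Uq 𝕜] M) : VT A →ₗ[Uq 𝕜] VT M where
  toFun w := VT.of fun i => f (w i)
  map_add' w w' := funext fun i => f.map_add _ _
  map_smul' x w := VT.ext fun i => by
    simp only [VT.of_apply, RingHom.id_apply, VT.smul_apply, map_add, map_smul]

@[simp]
theorem VT.map_apply (f : A →ₗ[Uq 𝕜] M) (w : VT A) (i : Fin 2) : VT.map f w i = f (w i) := rfl

@[simp]
theorem VT.add_apply (w w' : VT M) (i : Fin 2) : (w + w') i = w i + w' i := rfl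

theorem SES.VT (h : SES (Uq 𝕜) A M B) : SES (Uq 𝕜) (VT A) (VT M) (VT B) := by
  obtain ⟨f, g, hf, hfg, hg⟩ := h
  refine ⟨VT.map f, VT.map g, fun w w' hw => funext fun i => hf (congrFun hw i), fun w => ?_,
    fun w => ?_⟩
  · constructor
    · intro hw
      choose a ha using fun i => (hfg (w i)).mp (congrFun hw i)
      exact ⟨a, funext ha⟩
    · rintro ⟨a, rfl⟩
      exact funext fun i => hfg.apply_apply_eq_zero (a i)
  · choose a ha using fun i => hg (w i)
    exact ⟨a, funext ha⟩

/-- The functor `V ⊗ -` on linear equivalences. -/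
noncomputable def VT.congr (f : A ≃ₗ[Uq 𝕜] M) : VT A ≃ₗ[Uq 𝕜] VT M :=
  LinearEquiv.ofLinearMap (VT.map f.toLinearMap) (VT.map f.symm.toLinearMap)
    (LinearMap.ext fun w => VT.ext fun i => by simp)
    (LinearMap.ext fun w => VT.ext fun i => by simp)

/-- `V ⊗ -` commutes with products. -/
def VT.piEquiv {J : Type*} (Z : J → Type*) [∀ j, AddCommGroup (Z j)] [∀ j, Module (Uq 𝕜) (Z j)] :
    VT (∀ j, Z j) ≃ₗ[Uq 𝕜] ∀ j, VT (Z j) where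
  toFun w := fun j => VT.of fun i => w i j
  invFun w := VT.of fun i j => w j i
  map_add' _ _ := rfl
  map_smul' x w := by
    refine funext fun j => VT.ext fun i => ?_
    simp only [VT.of_apply, RingHom.id_apply, VT.smul_apply, Pi.smul_apply, Pi.add_apply]
  left_inv _ := rfl
  right_inv _ := rfl

instance [Subsingleton M] : Subsingleton (VT M) := inferInstanceAs (Subsingleton (Fin 2 → M))

end VTFunctor

/-! ### Scalars and the specialized parameter -/

section Scalars

variable (𝕜 : Type u) [Field 𝕜] [Algebra Zv 𝕜]

/-- The image of `v` in `𝕜`. -/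
noncomputable def qv : 𝕜 := algebraMap Zv 𝕜 (LaurentPolynomial.T 1)

/-- A scalar, as an element of `U_q(sl₂)`. -/
noncomputable def sc : 𝕜 →+* Uq 𝕜 := algebraMap 𝕜 (Uq 𝕜)

variable {𝕜}

theorem T_zpow (n : ℤ) : algebraMap Zv 𝕜 (LaurentPolynomial.T n) = qv 𝕜 ^ n := by
  have hn : ∀ k : ℕ, qv 𝕜 ^ k = algebraMap Zv 𝕜 (LaurentPolynomial.T k) := by
    intro k
    rw [qv, ← map_pow, LaurentPolynomial.T_pow, mul_one]
  obtain ⟨k, rfl | rfl⟩ := n.eq_nat_or_neg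
  · simp [hn k]
  · rw [zpow_neg, zpow_natCast]
    refine eq_inv_of_mul_eq_one_left ?_
    rw [hn, ← map_mul, ← LaurentPolynomial.T_add]
    simp

theorem qv_ne_zero : qv 𝕜 ≠ 0 := by
  intro h
  have h1 := T_zpow (𝕜 := 𝕜) (-1)
  have h2 : algebraMap Zv 𝕜 (LaurentPolynomial.T 1 * LaurentPolynomial.T (-1)) = 1 := by
    rw [← LaurentPolynomial.T_add]
    simp
  rw [map_mul, ← qv, h, zero_mul] at h2
  exact zero_ne_one h2

theorem smul_eq_sc_mul (c : 𝕜) (x : Uq 𝕜) : c • x = sc 𝕜 c * x := Algebra.smul_def c x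

theorem sc_comm (c : 𝕜) (x : Uq 𝕜) : sc 𝕜 c * x = x * sc 𝕜 c := Algebra.commutes c x

theorem sc_smul_comm {M : Type*} [AddCommGroup M] [Module (Uq 𝕜) M] (c : 𝕜) (x : Uq 𝕜) (m : M) :
    sc 𝕜 c • x • m = x • sc 𝕜 c • m := by
  rw [smul_smul, smul_smul, sc_comm]

theorem vComulq_sc (c : 𝕜) (i j : Fin 2) :
    vComulq 𝕜 (sc 𝕜 c) i j = if i = j then sc 𝕜 c else 0 := by
  rw [sc, AlgHom.commutes, Matrix.algebraMap_matrix_apply]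

@[simp]
theorem VT.sc_smul_apply {M : Type*} [AddCommGroup M] [Module (Uq 𝕜) M] (c : 𝕜) (w : VT M)
    (i : Fin 2) : (sc 𝕜 c • w) i = sc 𝕜 c • w i := by
  rw [VT.smul_apply, vComulq_sc, vComulq_sc]
  fin_cases i
  · exact (congrArg (sc 𝕜 c • w 0 + ·) (zero_smul (Uq 𝕜) (w 1))).trans (add_zero _)
  · exact (congrArg (· + sc 𝕜 c • w 1) (zero_smul (Uq 𝕜) (w 0))).trans (zero_add _)

@[simp]
theorem sc_zero_smul {M : Type*} [AddCommGroup M] [Module (Uq 𝕜) M] (m : M) :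
    sc 𝕜 0 • m = 0 := by
  have : sc 𝕜 0 = 0 := map_zero _
  rw [this]
  exact zero_smul (Uq 𝕜) m

@[simp]
theorem sc_one_smul {M : Type*} [AddCommGroup M] [Module (Uq 𝕜) M] (m : M) :
    sc 𝕜 1 • m = m := by
  rw [map_one, one_smul]

theorem coe_T_smul (n : ℤ) (x : UA) :
    (((LaurentPolynomial.T n : Zv) • x : UA) : Uv) = v ^ n • (x : Uv) := by
  rw [v_zpow]
  exact (algebraMap_smul Qv _ (x : Uv)).symm

end Scalars

/-! ### Coevaluation and evaluation -/

section CoevEv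

/-- The coefficients of the invariant vector `e₀ ⊗ e₁ - v e₁ ⊗ e₀` of `V ⊗ V`. -/
noncomputable def coevZ : Matrix (Fin 2) (Fin 2) Zv :=
  !![0, 1; -LaurentPolynomial.T 1, 0]

/-- The coefficients `⟨eᵢ, eⱼ⟩` of the invariant bilinear form `V ⊗ V → 𝕜`, whose value on the
invariant vector is `v + v⁻¹`. -/
noncomputable def evZ : Matrix (Fin 2) (Fin 2) Zv :=
  !![0, LaurentPolynomial.T (-1); -1, 0]

/-- The vector with coefficients `coevZ` is invariant: the iterated coproduct acts on it by the
remaining tensor factor alone. -/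
theorem coev_Uv (x : Uv) (i j : Fin 2) :
    ∑ p, ∑ r, coevZ p r • vComul (vComul x i p) j r = coevZ i j • x := by
  have hT : ∀ (n : ℤ) (y : Uv), (LaurentPolynomial.T n : Zv) • y = v ^ n • y := fun n y => by
    rw [v_zpow, algebraMap_smul]
  induction x using Uv_induction generalizing i j with
  | hs c =>
    fin_cases i <;> fin_cases j <;>
      simp [coevZ, Fin.sum_univ_two, Matrix.algebraMap_matrix_apply]
  | hg g =>
    cases g <;> simp only [vComul_E, vComul_F, vComul_K, vComul_Ki, Fin.sum_univ_two] <;>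
    fin_cases i <;> fin_cases j <;>
      simp [coevZ, hT, vComul_E, vComul_F, vComul_K, vComul_Ki, v_ne_zero]
  | hadd x y hx hy =>
    simp only [map_add, Matrix.add_apply, smul_add, Finset.sum_add_distrib, hx, hy]
  | hmul x y hx hy =>
    have key : ∀ p r, vComul (vComul (x * y) i p) j r
        = ∑ s, ∑ t, vComul (vComul x i s) j t * vComul (vComul y s p) t r := by
      intro p r
      simp [Matrix.mul_apply, Fin.sum_univ_two]
    calc ∑ p, ∑ r, coevZ p r • vComul (vComul (x * y) i p) j r
        = ∑ s, ∑ t, vComul (vComul x i s) j t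
            * ∑ p, ∑ r, coevZ p r • vComul (vComul y s p) t r := by
          simp only [key, Fin.sum_univ_two, smul_add, mul_add, mul_smul_comm]
          abel
      _ = coevZ i j • (x * y) := by
          simp only [hy, mul_smul_comm]
          rw [← smul_mul_assoc, ← hx]
          simp only [Finset.sum_mul, smul_mul_assoc]

/-- The form with coefficients `evZ` is invariant. -/
theorem ev_Uv (x : Uv) (i j : Fin 2) :
    ∑ p, ∑ r, evZ p r • vComul (vComul x p i) r j = evZ i j • x := by
  have hT : ∀ (n : ℤ) (y : Uv), (LaurentPolynomial.T n : Zv) • y = v ^ n • y := fun n y => by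
    rw [v_zpow, algebraMap_smul]
  induction x using Uv_induction generalizing i j with
  | hs c =>
    fin_cases i <;> fin_cases j <;>
      simp [evZ, Fin.sum_univ_two, Matrix.algebraMap_matrix_apply]
  | hg g =>
    cases g <;> simp only [vComul_E, vComul_F, vComul_K, vComul_Ki, Fin.sum_univ_two] <;>
    fin_cases i <;> fin_cases j <;>
      simp [evZ, hT, vComul_E, vComul_F, vComul_K, vComul_Ki, v_ne_zero]
  | hadd x y hx hy =>
    simp only [map_add, Matrix.add_apply, smul_add, Finset.sum_add_distrib, hx, hy]
  | hmul x y hx hy =>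
    have key : ∀ p r, vComul (vComul (x * y) p i) r j
        = ∑ s, ∑ t, vComul (vComul x p s) r t * vComul (vComul y s i) t j := by
      intro p r
      simp [Matrix.mul_apply, Fin.sum_univ_two]
    calc ∑ p, ∑ r, evZ p r • vComul (vComul (x * y) p i) r j
        = ∑ s, ∑ t, (∑ p, ∑ r, evZ p r • vComul (vComul x p s) r t)
            * vComul (vComul y s i) t j := by
          simp only [key, Fin.sum_univ_two, smul_add, add_mul, smul_mul_assoc]
          abel
      _ = evZ i j • (x * y) := by
          simp only [hx, smul_mul_assoc]
          rw [← mul_smul_comm, ← hy]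
          simp only [Finset.mul_sum, mul_smul_comm]

variable {𝕜 : Type u} [Field 𝕜] [Algebra Zv 𝕜]

theorem coev_Uq (x : Uq 𝕜) (i j : Fin 2) :
    ∑ p, ∑ r, vComulq 𝕜 (vComulq 𝕜 x i p) j r * sc 𝕜 (algebraMap Zv 𝕜 (coevZ p r))
      = sc 𝕜 (algebraMap Zv 𝕜 (coevZ i j)) * x := by
  induction x using Uq_induction with
  | hadd x y hx hy =>
    simp only [map_add, Matrix.add_apply, add_mul, mul_add, Finset.sum_add_distrib, hx, hy]
  | hs c x =>
    have h : ∑ p, ∑ r, coevZ p r • vComulA (vComulA x i p) j r = coevZ i j • x :=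
      Subtype.ext (by simpa using coev_Uv x i j)
    have h2 := congrArg (inq 𝕜) h
    simp only [Fin.sum_univ_two, inq_add, inq_smul] at h2
    simp only [Fin.sum_univ_two, map_smul, Matrix.smul_apply, vComulq_inq, smul_mul_assoc,
      ← smul_add, ← sc_comm, ← smul_eq_sc_mul, h2]
    rw [smul_comm]

theorem ev_Uq (x : Uq 𝕜) (i j : Fin 2) :
    ∑ p, ∑ r, sc 𝕜 (algebraMap Zv 𝕜 (evZ p r)) * vComulq 𝕜 (vComulq 𝕜 x p i) r j
      = x * sc 𝕜 (algebraMap Zv 𝕜 (evZ i j)) := by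
  induction x using Uq_induction with
  | hadd x y hx hy =>
    simp only [map_add, Matrix.add_apply, add_mul, mul_add, Finset.sum_add_distrib, hx, hy]
  | hs c x =>
    have h : ∑ p, ∑ r, evZ p r • vComulA (vComulA x p i) r j = evZ i j • x :=
      Subtype.ext (by simpa using ev_Uv x i j)
    have h2 := congrArg (inq 𝕜) h
    simp only [Fin.sum_univ_two, inq_add, inq_smul] at h2
    simp only [Fin.sum_univ_two, map_smul, Matrix.smul_apply, vComulq_inq, mul_smul_comm,
      ← smul_add, ← sc_comm, ← smul_eq_sc_mul, h2]

variable (𝕜) (M : Type*) [AddCommGroup M] [Module (Uq 𝕜) M]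

/-- The coevaluation `M → V ⊗ V ⊗ M`. -/
noncomputable def coev : M →ₗ[Uq 𝕜] VT (VT M) where
  toFun m := VT.of fun i => VT.of fun j => sc 𝕜 (algebraMap Zv 𝕜 (coevZ i j)) • m
  map_add' m m' := funext fun i => funext fun j => smul_add _ _ _
  map_smul' x m := by
    refine VT.ext fun i => VT.ext fun j => ?_
    have h := congrArg (fun y : Uq 𝕜 => y • m) (coev_Uq x i j)
    simp only [RingHom.id_apply, VT.smul_apply, VT.add_apply, VT.of_apply]
    simp only [Fin.sum_univ_two, add_smul, mul_smul] at h
    exact h.symm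

/-- The evaluation `V ⊗ V ⊗ M → M`. -/
noncomputable def ev : VT (VT M) →ₗ[Uq 𝕜] M where
  toFun w := ∑ i, ∑ j, sc 𝕜 (algebraMap Zv 𝕜 (evZ i j)) • w i j
  map_add' w w' := by
    simp only [VT.add_apply, smul_add, Finset.sum_add_distrib]
  map_smul' x w := by
    have h : ∀ i j, (∑ p, ∑ r, sc 𝕜 (algebraMap Zv 𝕜 (evZ p r)) * vComulq 𝕜 (vComulq 𝕜 x p i) r j)
        • w i j = (x * sc 𝕜 (algebraMap Zv 𝕜 (evZ i j))) • w i j := fun i j => by rw [ev_Uq]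
    have h00 := h 0 0
    have h01 := h 0 1
    have h10 := h 1 0
    have h11 := h 1 1
    simp only [RingHom.id_apply, Fin.sum_univ_two, VT.smul_apply, VT.add_apply, smul_add,
      add_smul, mul_smul] at *
    rw [← h00, ← h01, ← h10, ← h11]
    abel

variable {𝕜} {M}

theorem coev_apply (m : M) (i j : Fin 2) :
    coev 𝕜 M m i j = sc 𝕜 (algebraMap Zv 𝕜 (coevZ i j)) • m := rfl

/-- The partial trace over `V` of the action of `e` on `V ⊗ M`. By `ev_coev` it is the composite of
the coevaluation `M → V ⊗ V ⊗ M`, the action of `e` on the last two factors, and the evaluation. -/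
noncomputable def theta (e : Uq 𝕜) : Uq 𝕜 :=
  sc 𝕜 (qv 𝕜)⁻¹ * vComulq 𝕜 e 1 1 + sc 𝕜 (qv 𝕜) * vComulq 𝕜 e 0 0

theorem ev_coev (e : Uq 𝕜) (m : M) : ev 𝕜 M (VT.of fun i => e • coev 𝕜 M m i) = theta e • m := by
  have hT : algebraMap Zv 𝕜 (LaurentPolynomial.T (-1)) = (qv 𝕜)⁻¹ := by
    rw [T_zpow, zpow_neg_one]
  have hT' : algebraMap Zv 𝕜 (LaurentPolynomial.T 1) = qv 𝕜 := rfl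
  change ∑ i, ∑ j, sc 𝕜 (algebraMap Zv 𝕜 (evZ i j)) • (e • coev 𝕜 M m i) j = _
  simp only [VT.smul_apply, Fin.sum_univ_two, coev_apply]
  simp only [evZ, coevZ, Matrix.of_apply, Matrix.cons_val', Matrix.cons_val_zero,
    Matrix.cons_val_one, (algebraMap Zv 𝕜).map_zero, (algebraMap Zv 𝕜).map_one, sc_zero_smul,
    sc_one_smul, map_neg, hT, hT', smul_zero, zero_add, add_zero, neg_smul, smul_neg, neg_neg,
    theta, add_smul, mul_smul, neg_zero]
  rw [← sc_smul_comm]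

theorem coev_naturality {N : Type*} [AddCommGroup N] [Module (Uq 𝕜) N] (f : M →ₗ[Uq 𝕜] N) (m : M) :
    coev 𝕜 N (f m) = VT.map (VT.map f) (coev 𝕜 M m) := by
  refine VT.ext fun i => VT.ext fun j => ?_
  rw [VT.map_apply, VT.map_apply, coev_apply, coev_apply, map_smul]

theorem theta_add (x y : Uq 𝕜) : theta (x + y) = theta x + theta y := by
  simp only [theta, map_add, Matrix.add_apply, mul_add]
  abel

theorem theta_sc_mul (c : 𝕜) (x : Uq 𝕜) : theta (sc 𝕜 c * x) = sc 𝕜 c * theta x := by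
  rw [← smul_eq_sc_mul, ← smul_eq_sc_mul]
  simp only [theta, map_smul, Matrix.smul_apply, mul_smul_comm, smul_add]

theorem theta_one : theta (1 : Uq 𝕜) = sc 𝕜 (qv 𝕜 + (qv 𝕜)⁻¹) := by
  simp only [theta, map_one, Matrix.one_apply_eq, mul_one, map_add]
  abel

end CoevEv


/-! ### The Casimir element -/

section Casimir

section ModuleIdentities

variable {k N : Type*} [Field k] [AddCommGroup N] [Module k N] {w : k}

/-- Identities in the vector space `U_v(sl₂)` that amount to the centrality of the Casimir element
and to the formula for its partial trace. -/
theorem casimir_E_aux (hw : w ≠ 0) (x y z : N) : (w - w⁻¹) ^ 2 • x + w • y + w⁻¹ • z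
    = (w - w⁻¹) ^ 2 • x + (w - w⁻¹) • (y - z) + w • w ^ (-2 : ℤ) • y
      + w⁻¹ • w ^ (2 : ℤ) • z := by
  match_scalars <;> field_simp <;> ring

theorem casimir_F_aux (hw : w ≠ 0) (x y z : N) : (w - w⁻¹) ^ 2 • x
      + (((w - w⁻¹) * w ^ (2 : ℤ)) • y - ((w - w⁻¹) * w ^ (-2 : ℤ)) • z) + w • y + w⁻¹ • z
    = (w - w⁻¹) ^ 2 • x + (w * w ^ (2 : ℤ)) • y + (w⁻¹ * w ^ (-2 : ℤ)) • z := by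
  match_scalars <;> field_simp <;> ring

theorem casimir_trace_aux (hw : w ≠ 0) (x y z : N) : w⁻¹ • (w - w⁻¹) ^ 2 • z + w⁻¹ • (w - w⁻¹) ^ 2 • w⁻¹ • x
      + w⁻¹ • w • w⁻¹ • y + w⁻¹ • w⁻¹ • w • z
      + (w • (w - w⁻¹) ^ 2 • w • x + w • w • w • y + w • w⁻¹ • w⁻¹ • z)
    = (w ^ 2 + (w ^ 2)⁻¹) • (w - w⁻¹) ^ 2 • x + (w ^ 2 + (w ^ 2)⁻¹) • w • y
      + (w ^ 2 + (w ^ 2)⁻¹) • w⁻¹ • z := by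
  match_scalars <;> field_simp <;> ring

end ModuleIdentities

theorem E_Ki : gen Gen.E * gen Gen.Ki = v ^ (2 : ℤ) • (gen Gen.Ki * gen Gen.E) := by
  have := congrArg (fun x => gen Gen.Ki * x * gen Gen.Ki) K_E
  simp only [mul_smul_comm, smul_mul_assoc, mul_assoc, K_Ki, mul_one] at this
  rw [← this, ← mul_assoc, Ki_K, one_mul]

theorem Ki_F : gen Gen.Ki * gen Gen.F = v ^ (2 : ℤ) • (gen Gen.F * gen Gen.Ki) := by
  have := congrArg (fun x => gen Gen.Ki * x * gen Gen.Ki) K_F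
  simp only [mul_smul_comm, smul_mul_assoc, mul_assoc, K_Ki, mul_one] at this
  rw [← mul_assoc, Ki_K, one_mul] at this
  rw [this, smul_smul, ← zpow_add₀ v_ne_zero]
  simp

/-- The quantum Casimir element `(v - v⁻¹)² F E + v K + v⁻¹ K⁻¹`. -/
noncomputable def cas : Uv :=
  (v - v⁻¹) ^ 2 • (gen Gen.F * gen Gen.E) + v • gen Gen.K + v⁻¹ • gen Gen.Ki

theorem EF_smul : (v - v⁻¹) ^ 2 • (gen Gen.E * gen Gen.F)
    = (v - v⁻¹) ^ 2 • (gen Gen.F * gen Gen.E) + (v - v⁻¹) • (gen Gen.K - gen Gen.Ki) := by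
  have h := congrArg (fun x => (v - v⁻¹) ^ 2 • x) E_F
  simp only [smul_smul, smul_sub ((v - v⁻¹) ^ 2) (gen Gen.E * _)] at h
  rw [sub_eq_iff_eq_add'] at h
  rw [h, sq, mul_assoc, mul_inv_cancel₀ v_sub_inv_ne_zero, mul_one]

theorem commute_cas (x : Uv) : Commute cas x := by
  have hv := v_ne_zero
  have hEK : gen Gen.E * gen Gen.K = v ^ (-2 : ℤ) • (gen Gen.K * gen Gen.E) := by
    rw [K_E, smul_smul, ← zpow_add₀ hv]
    simp
  have hFK : gen Gen.F * gen Gen.K = v ^ (2 : ℤ) • (gen Gen.K * gen Gen.F) := by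
    rw [K_F, smul_smul, ← zpow_add₀ hv]
    simp
  have hFKi : gen Gen.F * gen Gen.Ki = v ^ (-2 : ℤ) • (gen Gen.Ki * gen Gen.F) := by
    rw [Ki_F, smul_smul, ← zpow_add₀ hv]
    simp
  have hKKi : Commute (gen Gen.K) (gen Gen.Ki) := by rw [commute_iff_eq, K_Ki, Ki_K]
  have hK : Commute (gen Gen.K) (gen Gen.F * gen Gen.E) := by
    rw [commute_iff_eq, ← mul_assoc, K_F, smul_mul_assoc, mul_assoc, K_E, mul_smul_comm, smul_smul,
      ← zpow_add₀ hv, mul_assoc]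
    simp
  have hKi : Commute (gen Gen.Ki) (gen Gen.F * gen Gen.E) := by
    rw [commute_iff_eq, ← mul_assoc, Ki_F, smul_mul_assoc, mul_assoc, mul_assoc, E_Ki,
      mul_smul_comm]
  induction x using Uv_induction with
  | hs c => exact (Algebra.commutes c cas).symm
  | hadd x y hx hy => exact hx.add_right hy
  | hmul x y hx hy => exact hx.mul_right hy
  | hg g =>
    cases g with
    | E =>
      have h := congrArg (· * gen Gen.E) EF_smul
      simp only [smul_mul_assoc, add_mul, sub_mul] at h
      rw [commute_iff_eq, cas]
      simp only [add_mul, mul_add, smul_mul_assoc, mul_smul_comm, hEK, E_Ki, ← mul_assoc, h]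
      exact casimir_E_aux hv _ _ _
    | F =>
      have h := congrArg (gen Gen.F * ·) EF_smul
      simp only [mul_smul_comm, mul_add, mul_sub] at h
      rw [commute_iff_eq, cas]
      simp only [add_mul, mul_add, smul_mul_assoc, mul_smul_comm, mul_assoc, h]
      simp only [hFK, hFKi, smul_smul, smul_sub]
      exact casimir_F_aux hv _ _ _
    | K =>
      exact (((hK.smul_right _).add_right ((Commute.refl _).smul_right _)).add_right
        (hKKi.smul_right _)).symm
    | Ki =>
      exact (((hKi.smul_right _).add_right (hKKi.symm.smul_right _)).add_right
        ((Commute.refl _).smul_right _)).symm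

/-- The generators, in the integral form. -/
noncomputable def genA (g : Gen) : UA := ⟨gen g, by
  cases g with
  | E => simpa [divPow, qfact] using divPow_E_mem 1
  | F => simpa [divPow, qfact] using divPow_F_mem 1
  | K => exact K_mem
  | Ki => exact Ki_mem⟩

/-- The Casimir element, in the integral form. -/
noncomputable def casA : UA :=
  ((LaurentPolynomial.T 1 - LaurentPolynomial.T (-1)) ^ 2 : Zv) • (genA Gen.F * genA Gen.E)
    + (LaurentPolynomial.T 1 : Zv) • genA Gen.K + (LaurentPolynomial.T (-1) : Zv) • genA Gen.Ki

theorem Zv_smul (c : Zv) (x : Uv) : c • x = algebraMap Zv Qv c • x := (algebraMap_smul Qv c x).symm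

theorem alg_T (n : ℤ) : algebraMap Zv Qv (LaurentPolynomial.T n) = v ^ n := (v_zpow n).symm

theorem casA_coe : (casA : Uv) = cas := by
  have h1 : (casA : Uv) = ((LaurentPolynomial.T 1 - LaurentPolynomial.T (-1)) ^ 2 : Zv) •
      (gen Gen.F * gen Gen.E) + (LaurentPolynomial.T 1 : Zv) • gen Gen.K
        + (LaurentPolynomial.T (-1) : Zv) • gen Gen.Ki := rfl
  rw [h1, cas, Zv_smul, Zv_smul, Zv_smul, map_pow, map_sub, alg_T, alg_T, zpow_one, zpow_neg_one]

variable (𝕜 : Type u) [Field 𝕜] [Algebra Zv 𝕜]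

/-- The Casimir element of `U_q(sl₂)`. -/
noncomputable def casq : Uq 𝕜 := inq 𝕜 casA

theorem commute_casq (x : Uq 𝕜) : x * casq 𝕜 = casq 𝕜 * x := by
  induction x using Uq_induction with
  | hadd x y hx hy => rw [add_mul, mul_add, hx, hy]
  | hs c x =>
    have h : x * casA = casA * x := Subtype.ext (by
      have := (commute_cas x).eq
      rw [← casA_coe] at this
      exact this.symm)
    rw [casq, smul_mul_assoc, mul_smul_comm, ← inq_mul, ← inq_mul, h]

/-- The Casimir element, as an element of the centre. -/
noncomputable def casC : Subalgebra.center 𝕜 (Uq 𝕜) :=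
  ⟨casq 𝕜, Subalgebra.mem_center_iff.mpr fun x => commute_casq 𝕜 x⟩

variable {𝕜}

/-- The partial trace of the Casimir element over `V` is a multiple of the Casimir element. -/
theorem vComul_cas : v⁻¹ • vComul cas 1 1 + v • vComul cas 0 0 = (v ^ 2 + v⁻¹ ^ 2) • cas := by
  have hv := v_ne_zero
  have h : ∀ i j, vComul cas i j = ((v - v⁻¹) ^ 2 • (vComul (gen Gen.F) * vComul (gen Gen.E))
      + v • vComul (gen Gen.K) + v⁻¹ • vComul (gen Gen.Ki)) i j := fun i j => by
    simp only [cas, map_add, map_smul, map_mul]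
  rw [h, h, vComul_E, vComul_F, vComul_K, vComul_Ki]
  simp [cas]
  exact casimir_trace_aux hv _ _ _

theorem theta_inq (x : UA) : theta (inq 𝕜 x)
    = inq 𝕜 ((LaurentPolynomial.T (-1) : Zv) • vComulA x 1 1
      + (LaurentPolynomial.T 1 : Zv) • vComulA x 0 0) := by
  rw [theta, inq_add, inq_smul, inq_smul, T_zpow, T_zpow, zpow_neg_one, zpow_one, smul_eq_sc_mul,
    smul_eq_sc_mul, vComulq_inq, vComulq_inq]

theorem theta_casq : theta (casq 𝕜) = sc 𝕜 (qv 𝕜 ^ 2 + (qv 𝕜)⁻¹ ^ 2) * casq 𝕜 := by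
  have h : (LaurentPolynomial.T (-1) : Zv) • vComulA casA 1 1
      + (LaurentPolynomial.T 1 : Zv) • vComulA casA 0 0
      = (LaurentPolynomial.T 1 ^ 2 + LaurentPolynomial.T (-1) ^ 2 : Zv) • casA := Subtype.ext (by
    have h := vComul_cas
    rw [← casA_coe] at h
    have h3 : ((LaurentPolynomial.T 1 ^ 2 + LaurentPolynomial.T (-1) ^ 2 : Zv) • (casA : Uv))
        = (v ^ 2 + v⁻¹ ^ 2) • (casA : Uv) := by
      rw [Zv_smul, map_add, map_pow, map_pow, alg_T, alg_T, zpow_one, zpow_neg_one]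
    refine Eq.trans ?_ (h.trans h3.symm)
    refine congrArg₂ (· + ·) ((coe_T_smul _ _).trans ?_) ((coe_T_smul _ _).trans ?_)
    · rw [zpow_neg_one]; rfl
    · rw [zpow_one]; rfl)
  rw [casq, theta_inq, h, inq_smul, smul_eq_sc_mul]
  congr 2
  rw [map_add, map_pow, map_pow, T_zpow, T_zpow, zpow_one, zpow_neg_one]

end Casimir

/-! ### Blocks -/

section Blocks

open scoped Polynomial

variable {𝕜 : Type u} [Field 𝕜] [Algebra Zv 𝕜]
variable {A M B : Type*} [AddCommGroup A] [Module (Uq 𝕜) A] [AddCommGroup M] [Module (Uq 𝕜) M]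
  [AddCommGroup B] [Module (Uq 𝕜) B]

variable (𝕜) in
/-- A polynomial in the Casimir element. -/
noncomputable def pa (p : 𝕜[X]) : Uq 𝕜 := Polynomial.aeval (casq 𝕜) p

theorem pa_mul (p p' : 𝕜[X]) : pa 𝕜 (p * p') = pa 𝕜 p * pa 𝕜 p' := map_mul _ _ _

theorem pa_add (p p' : 𝕜[X]) : pa 𝕜 (p + p') = pa 𝕜 p + pa 𝕜 p' := map_add _ _ _

theorem pa_one : pa 𝕜 1 = 1 := map_one _

variable (𝕜) in
/-- A polynomial in the Casimir element, as an element of the centre. -/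
noncomputable def pol (p : 𝕜[X]) : Subalgebra.center 𝕜 (Uq 𝕜) := Polynomial.aeval (casC 𝕜) p

theorem pol_coe (p : 𝕜[X]) : (pol 𝕜 p : Uq 𝕜) = pa 𝕜 p :=
  (Polynomial.aeval_algHom_apply (Subalgebra.center 𝕜 (Uq 𝕜)).val (casC 𝕜) p).symm

/-- The polynomial `p` in the Casimir element acts by zero. -/
def Kills (p : 𝕜[X]) (M : Type*) [AddCommGroup M] [Module (Uq 𝕜) M] : Prop :=
  ∀ x : M, pa 𝕜 p • x = 0

theorem Kills.mul_left {p : 𝕜[X]} (h : Kills p M) (p' : 𝕜[X]) : Kills (p' * p) M := fun x => by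
  rw [pa_mul, mul_smul, h x, smul_zero]

theorem Kills.dvd {p p' : 𝕜[X]} (h : Kills p M) (hp : p ∣ p') : Kills p' M := by
  obtain ⟨r, rfl⟩ := hp
  rw [mul_comm]
  exact h.mul_left r

theorem SES.kills (h : SES (Uq 𝕜) A M B) {p p' : 𝕜[X]} (hA : Kills p A)
    (hB : Kills p' B) : Kills (p * p') M := by
  obtain ⟨f, g, hf, hfg, hg⟩ := h
  intro x
  obtain ⟨a, ha⟩ := (hfg (pa 𝕜 p' • x)).mp (by rw [map_smul, hB])
  rw [pa_mul, mul_smul, ← ha, ← map_smul, hA, map_zero]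

/-- The polynomial `X - a`. -/
noncomputable def cl (a : 𝕜) : 𝕜[X] := Polynomial.X - Polynomial.C a

theorem cl_smul (a : 𝕜) (x : M) : pa 𝕜 (cl a) • x = casq 𝕜 • x - sc 𝕜 a • x := by
  have : pa 𝕜 (cl a) = casq 𝕜 - sc 𝕜 a := by
    rw [pa, cl, map_sub, Polynomial.aeval_X, Polynomial.aeval_C, sc]
  rw [this, sub_smul]

theorem kills_cl_iff {a : 𝕜} : Kills (cl a) M ↔ ∀ x : M, casq 𝕜 • x = sc 𝕜 a • x := by
  unfold Kills
  simp only [cl_smul, sub_eq_zero]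

/-- The Hermite interpolation polynomial that is `1` to second order at `a` and `0` to second order
at `b`. -/
noncomputable def hermite (a b : 𝕜) : 𝕜[X] :=
  (Polynomial.C (a - b)⁻¹ * cl b) ^ 2 * (1 - 2 * (Polynomial.C (a - b)⁻¹ * cl a))

variable (𝕜) in
/-- The Hermite interpolation polynomial at `a` and `b` in the Casimir element. On a module killed
by `(c - a)² (c - b)²` it is the projection to the generalized eigenspace of `a`. -/
noncomputable def eb (a b : 𝕜) : Subalgebra.center 𝕜 (Uq 𝕜) := pol 𝕜 (hermite a b)

theorem eb_coe (a b : 𝕜) : (eb 𝕜 a b : Uq 𝕜) = pa 𝕜 (hermite a b) := pol_coe _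

theorem cl_sub {𝕜 : Type*} [Field 𝕜] {a b : 𝕜} (hab : a ≠ b) :
    Polynomial.C (a - b)⁻¹ * cl b - Polynomial.C (a - b)⁻¹ * cl a = 1 := by
  have h : Polynomial.C (a - b)⁻¹ * Polynomial.C (a - b) = 1 := by
    rw [← map_mul, inv_mul_cancel₀ (sub_ne_zero.mpr hab), map_one]
  rw [map_sub] at h
  simp only [cl]
  linear_combination h

theorem hermite_swap {𝕜 : Type*} [Field 𝕜] (a b : 𝕜) : hermite b a = (Polynomial.C (a - b)⁻¹ * cl a) ^ 2
    * (1 + 2 * (Polynomial.C (a - b)⁻¹ * cl b)) := by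
  rw [hermite, ← neg_sub a b, inv_neg, map_neg]
  ring

theorem hermite_add {𝕜 : Type*} [Field 𝕜] {a b : 𝕜} (hab : a ≠ b) : hermite a b + hermite b a = 1 := by
  have h := cl_sub hab
  rw [hermite_swap a b, hermite]
  generalize Polynomial.C (a - b)⁻¹ * cl b = x at *
  generalize Polynomial.C (a - b)⁻¹ * cl a = y at *
  obtain rfl : x = 1 + y := by linear_combination h
  ring

theorem eb_add {a b : 𝕜} (hab : a ≠ b) : eb 𝕜 a b + eb 𝕜 b a = 1 := by
  rw [eb, eb, pol, pol, ← map_add, hermite_add hab, map_one]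

theorem eb_smul_of_kills {a b : 𝕜} (h : Kills (cl b ^ 2) M) (x : M) :
    (eb 𝕜 a b : Uq 𝕜) • x = 0 := by
  rw [eb_coe]
  refine h.dvd (p' := hermite a b) ?_ x
  rw [hermite, mul_pow]
  exact (Dvd.intro_left _ rfl).mul_right _

theorem eb_smul_of_kills' {a b : 𝕜} (hab : a ≠ b) (h : Kills (cl a ^ 2) M) (x : M) :
    (eb 𝕜 a b : Uq 𝕜) • x = x := by
  have h1 := eb_smul_of_kills (a := b) h x
  rw [eb_coe] at h1
  rw [eb_coe, ← add_zero (pa 𝕜 (hermite a b) • x), ← h1, ← add_smul, ← pa_add, hermite_add hab,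
    pa_one, one_smul]

theorem idemOn_eb {a b : 𝕜} (hab : a ≠ b) (h : Kills (cl a ^ 2 * cl b ^ 2) M) :
    IdemOn (eb 𝕜 a b) M := by
  intro x
  have h2 : Kills (hermite a b * hermite b a) M := h.dvd (by
    rw [hermite_swap a b, hermite]
    refine Dvd.intro_left (Polynomial.C (a - b)⁻¹ ^ 4 *
      (1 - 2 * (Polynomial.C (a - b)⁻¹ * cl a)) *
      (1 + 2 * (Polynomial.C (a - b)⁻¹ * cl b))) ?_
    ring)
  have h3 : hermite a b = hermite a b * hermite a b + hermite a b * hermite b a := by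
    rw [← mul_add, hermite_add hab, mul_one]
  rw [eb_coe, ← mul_smul, ← pa_mul]
  conv_rhs => rw [h3, pa_add, add_smul, h2 x, add_zero]

/-- If the Casimir element has the two eigenvalues `a, b` on `V ⊗ M` and is a scalar on `M`, then
the partial trace of the projection to the eigenspace of `a` is a scalar. -/
theorem theta_eb_smul {a b ν : 𝕜} (hab : a ≠ b) (hM : Kills (cl ν) M)
    (hV : Kills (cl a * cl b) (VT M)) (m : M) : theta (eb 𝕜 a b : Uq 𝕜) • m
      = sc 𝕜 (((qv 𝕜 ^ 2 + (qv 𝕜)⁻¹ ^ 2) * ν - b * (qv 𝕜 + (qv 𝕜)⁻¹)) / (a - b)) • m := by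
  -- on `V ⊗ M` the Hermite polynomial can be replaced by the linear polynomial `(X - b) / (a - b)`
  have h1 : ∀ w : VT M, (eb 𝕜 a b : Uq 𝕜) • w
      = (sc 𝕜 (a - b)⁻¹ * (casq 𝕜 + sc 𝕜 (-b) * 1)) • w := by
    intro w
    have h2 : Kills (hermite a b - Polynomial.C (a - b)⁻¹ * cl b) (VT M) := hV.dvd (by
      have h := cl_sub hab
      refine Dvd.intro_left (-(Polynomial.C (a - b)⁻¹ ^ 2 *
        (2 * (Polynomial.C (a - b)⁻¹ * cl b) - 1))) ?_
      rw [hermite]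
      linear_combination (-(Polynomial.C (a - b)⁻¹ * cl b)) * h)
    have h3 := h2 w
    have h4 : pa 𝕜 (hermite a b - Polynomial.C (a - b)⁻¹ * cl b)
        = (eb 𝕜 a b : Uq 𝕜) - sc 𝕜 (a - b)⁻¹ * (casq 𝕜 - sc 𝕜 b) := by
      rw [eb_coe, pa, pa, cl, map_sub, map_mul, map_sub, Polynomial.aeval_X, Polynomial.aeval_C,
        Polynomial.aeval_C]
      rfl
    rw [h4, sub_smul, sub_eq_zero] at h3
    rw [h3, map_neg, mul_one, ← sub_eq_add_neg]
  rw [← ev_coev]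
  simp only [h1]
  rw [ev_coev, theta_sc_mul, theta_add, theta_sc_mul, theta_one, theta_casq, mul_smul, add_smul,
    mul_smul, mul_smul, kills_cl_iff.mp hM, ← mul_smul, ← mul_smul, ← map_mul, ← map_mul,
    ← add_smul, ← map_add, ← mul_smul, ← map_mul]
  congr 2
  rw [div_eq_inv_mul]
  ring

end Blocks


/-! ### Homomorphisms given by integral matrices -/

section LatHom

/-- A matrix that intertwines the generators intertwines the whole integral form. -/
theorem map_mulVec_eq {R S : LatticeRep} {P : Matrix S.ι R.ι Zv}
    (h : ∀ g, P.map (algebraMap Zv Qv) * R.ρ (gen g) = S.ρ (gen g) * P.map (algebraMap Zv Qv))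
    (x : UA) : P * R.ρA x = S.ρA x * P := by
  have h1 : ∀ y : Uv, P.map (algebraMap Zv Qv) * R.ρ y = S.ρ y * P.map (algebraMap Zv Qv) := by
    intro y
    induction y using Uv_induction with
    | hs c =>
      rw [AlgHom.commutes, AlgHom.commutes, Matrix.algebraMap_eq_diagonal,
        Matrix.algebraMap_eq_diagonal]
      ext i j
      simp [Matrix.mul_diagonal, Matrix.diagonal_mul, mul_comm]
    | hg g => exact h g
    | hadd a b ha hb => rw [map_add, map_add, Matrix.mul_add, Matrix.add_mul, ha, hb]
    | hmul a b ha hb => rw [map_mul, map_mul, ← Matrix.mul_assoc, ha, Matrix.mul_assoc, hb, Matrix.mul_assoc]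
  have h2 := h1 x
  rw [← R.ρA_map, ← S.ρA_map, ← Matrix.map_mul, ← Matrix.map_mul] at h2
  exact Matrix.map_injective (IsFractionRing.injective Zv Qv) h2

variable (𝕜 : Type u) [Field 𝕜] [Algebra Zv 𝕜]

/-- A matrix over `ℤ[v, v⁻¹]` that intertwines the generators of `U_v(sl₂)` gives a linear map
between the specializations. -/
noncomputable def latHom {R S : LatticeRep} (P : Matrix S.ι R.ι Zv)
    (h : ∀ g, P.map (algebraMap Zv Qv) * R.ρ (gen g) = S.ρ (gen g) * P.map (algebraMap Zv Qv)) :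
    R.Spec 𝕜 →ₗ[Uq 𝕜] S.Spec 𝕜 where
  toFun w := (P.map (algebraMap Zv 𝕜)).mulVec w
  map_add' w w' := Matrix.mulVec_add _ _ _
  map_smul' x w := by
    have key : P.map (algebraMap Zv 𝕜) * R.ρq 𝕜 x = S.ρq 𝕜 x * P.map (algebraMap Zv 𝕜) := by
      induction x using Uq_induction with
      | hadd x y hx hy => rw [map_add, map_add, Matrix.mul_add, Matrix.add_mul, hx, hy]
      | hs c x =>
        rw [← tmul_eq, LatticeRep.ρq_tmul, LatticeRep.ρq_tmul, Matrix.mul_smul, Matrix.smul_mul, ← Matrix.map_mul,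
          ← Matrix.map_mul, map_mulVec_eq h]
    let w' : R.ι → 𝕜 := w
    change (P.map (algebraMap Zv 𝕜)).mulVec ((R.ρq 𝕜 x).mulVec w')
      = (S.ρq 𝕜 x).mulVec ((P.map (algebraMap Zv 𝕜)).mulVec w')
    rw [Matrix.mulVec_mulVec, Matrix.mulVec_mulVec, key]

theorem latHom_apply {R S : LatticeRep} (P : Matrix S.ι R.ι Zv) (h) (w : R.Spec 𝕜) :
    latHom 𝕜 P h w = (P.map (algebraMap Zv 𝕜)).mulVec w := rfl

/-- `Q` is the representation `V ⊗ S`, where `e` enumerates the basis vectors `eᵢ ⊗ s`. -/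
def IsTensorV (Q S : LatticeRep) (e : Fin 2 × S.ι ≃ Q.ι) : Prop :=
  ∀ x i j s t, Q.ρ x (e (i, s)) (e (j, t)) = S.ρ (vComul x i j) s t

/-- The enumeration of the basis vectors of the tensor product with `V`. -/
def tensorIx (S : LatticeRep) : Fin 2 × S.ι ≃ ((weylRep 1).tensor S).ι := Equiv.refl _

theorem isTensorV_tensor (S : LatticeRep) : IsTensorV ((weylRep 1).tensor S) S (tensorIx S) := by
  intro x i j s t
  have h : ∀ y : Uv ⊗[Qv] Uv, LatticeRep.kronHom (weylRep 1) S y (tensorIx S (i, s))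
      (tensorIx S (j, t)) = S.ρ (vTwist y i j) s t := by
    intro y
    induction y using TensorProduct.induction_on with
    | zero =>
      simp only [map_zero, Matrix.zero_apply]
      rfl
    | tmul a b =>
      rw [LatticeRep.kronHom_tmul, vTwist_tmul, Matrix.map_apply, map_smul, Matrix.smul_apply]
      rfl
    | add a b ha hb =>
      rw [map_add, map_add, Matrix.add_apply, map_add, Matrix.add_apply, ← ha, ← hb]
      rfl
  exact h (comul x)

namespace IsTensorV

variable {Q S : LatticeRep} {e : Fin 2 × S.ι ≃ Q.ι}

theorem sum_eq {K : Type*} [AddCommMonoid K] (f : Q.ι → K) :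
    ∑ p, f p = ∑ i, ∑ s, f (e (i, s)) := by
  rw [← e.sum_comp, Fintype.sum_prod_type]

theorem ρA (h : IsTensorV Q S e) (x : UA) (i j : Fin 2) (s t : S.ι) :
    Q.ρA x (e (i, s)) (e (j, t)) = S.ρA (vComulA x i j) s t := by
  apply IsFractionRing.injective Zv Qv
  have h1 := congrFun (congrFun (Q.ρA_map x) (e (i, s))) (e (j, t))
  have h2 := congrFun (congrFun (S.ρA_map (vComulA x i j)) s) t
  exact h1.trans ((h x i j s t).trans h2.symm)

theorem ρq (h : IsTensorV Q S e) (x : Uq 𝕜) (i j : Fin 2) (s t : S.ι) :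
    Q.ρq 𝕜 x (e (i, s)) (e (j, t)) = S.ρq 𝕜 (vComulq 𝕜 x i j) s t := by
  induction x using Uq_induction with
  | hadd x y hx hy =>
    rw [map_add, map_add, Matrix.add_apply, Matrix.add_apply, map_add, Matrix.add_apply, hx, hy]
  | hs c x =>
    rw [map_smul, map_smul, Matrix.smul_apply, Matrix.smul_apply, map_smul, Matrix.smul_apply,
      vComulq_inq, inq, inq, LatticeRep.ρq_tmul, LatticeRep.ρq_tmul, one_smul, one_smul,
      Matrix.map_apply, Matrix.map_apply, h.ρA]

/-- The specialization of `V ⊗ S` is `V ⊗ -` applied to the specialization of `S`. -/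
noncomputable def equiv (h : IsTensorV Q S e) : VT (S.Spec 𝕜) ≃ₗ[Uq 𝕜] Q.Spec 𝕜 where
  toFun w := fun p => w (e.symm p).1 (e.symm p).2
  invFun w := VT.of fun i s => w (e (i, s))
  map_add' _ _ := rfl
  map_smul' x w := by
    funext p
    obtain ⟨⟨i, s⟩, rfl⟩ := e.surjective p
    let w' : Fin 2 → S.ι → 𝕜 := w
    let y : Fin 2 → S.ι → 𝕜 := x • w
    let z : Q.ι → 𝕜 := fun p => w' (e.symm p).1 (e.symm p).2
    have h1 : y i s = ∑ j, ∑ t, S.ρq 𝕜 (vComulq 𝕜 x i j) s t * w' j t :=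
      (congrFun (VT.smul_apply x w i) s).trans
        (Fin.sum_univ_two fun j => ∑ t, S.ρq 𝕜 (vComulq 𝕜 x i j) s t * w' j t).symm
    change y (e.symm (e (i, s))).1 (e.symm (e (i, s))).2 = ∑ p, Q.ρq 𝕜 x (e (i, s)) p * z p
    rw [e.symm_apply_apply, h1, sum_eq (e := e)]
    refine Finset.sum_congr rfl fun j _ => Finset.sum_congr rfl fun t _ => ?_
    rw [IsTensorV.ρq 𝕜 h]
    simp only [z, e.symm_apply_apply]
  left_inv w := VT.ext fun i => funext fun s => by
    simp only [Equiv.symm_apply_apply]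
    rfl
  right_inv w := funext fun p => congrArg w (e.apply_symm_apply p)

/-- The action on `V ⊗ S`, on coordinate vectors. -/
theorem mulVec (h : IsTensorV Q S e) (x : Uv) (w : Q.ι → Qv) (i : Fin 2) (s : S.ι) : ((Q.ρ x).mulVec w) (e (i, s))
      = ∑ j, ((S.ρ (vComul x i j)).mulVec fun t => w (e (j, t))) s := by
  simp only [Matrix.mulVec, dotProduct]
  rw [sum_eq (e := e)]
  simp only [h x i]

end IsTensorV

/-- A pair of matrices over `ℤ[v, v⁻¹]` that intertwines the generators gives a linear map to
`V ⊗ S`. -/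
theorem exists_hom_to_VT {R S : LatticeRep} (P : Fin 2 → Matrix S.ι R.ι Zv)
    (h : ∀ g i (w : R.ι → Qv), ((P i).map (algebraMap Zv Qv)).mulVec ((R.ρ (gen g)).mulVec w)
      = ∑ j, (S.ρ (vComul (gen g) i j)).mulVec (((P j).map (algebraMap Zv Qv)).mulVec w)) :
    ∃ f : R.Spec 𝕜 →ₗ[Uq 𝕜] VT (S.Spec 𝕜),
      ∀ w i, f w i = ((P i).map (algebraMap Zv 𝕜)).mulVec w := by
  obtain ⟨Q, e, hQ⟩ : ∃ (Q : LatticeRep) (e : Fin 2 × S.ι ≃ Q.ι), IsTensorV Q S e :=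
    ⟨_, _, isTensorV_tensor S⟩
  let P' : Matrix Q.ι R.ι Zv := Matrix.of fun p r => P (e.symm p).1 (e.symm p).2 r
  have hP : ∀ g, P'.map (algebraMap Zv Qv) * R.ρ (gen g)
      = Q.ρ (gen g) * P'.map (algebraMap Zv Qv) := by
    intro g
    refine Matrix.ext_of_mulVec_single fun r => ?_
    rw [← Matrix.mulVec_mulVec, ← Matrix.mulVec_mulVec]
    refine funext fun p => ?_
    obtain ⟨⟨i, s⟩, rfl⟩ := e.surjective p
    have h1 := congrFun (h g i (Pi.single r 1)) s
    rw [hQ.mulVec]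
    rw [Finset.sum_apply] at h1
    simpa [P', Matrix.mulVec, dotProduct] using h1
  refine ⟨(hQ.equiv 𝕜).symm.toLinearMap ∘ₗ latHom 𝕜 P' hP, fun w i => funext fun s => ?_⟩
  have h2 : ((hQ.equiv 𝕜).symm.toLinearMap ∘ₗ latHom 𝕜 P' hP) w i s
    = ((P'.map (algebraMap Zv 𝕜)).mulVec w) (e (i, s)) := rfl
  rw [h2]
  simp [P', Matrix.mulVec, dotProduct]

/-- A pair of matrices over `ℤ[v, v⁻¹]` that intertwines the generators gives a linear map from
`V ⊗ S`. -/
theorem exists_hom_of_VT {R S : LatticeRep} (P : Fin 2 → Matrix R.ι S.ι Zv)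
    (h : ∀ g (w : Fin 2 → S.ι → Qv), ∑ i, ((P i).map (algebraMap Zv Qv)).mulVec
        (∑ j, (S.ρ (vComul (gen g) i j)).mulVec (w j))
      = (R.ρ (gen g)).mulVec (∑ j, ((P j).map (algebraMap Zv Qv)).mulVec (w j))) :
    ∃ f : VT (S.Spec 𝕜) →ₗ[Uq 𝕜] R.Spec 𝕜,
      ∀ w, f w = ∑ j, ((P j).map (algebraMap Zv 𝕜)).mulVec (w j) := by
  obtain ⟨Q, e, hQ⟩ : ∃ (Q : LatticeRep) (e : Fin 2 × S.ι ≃ Q.ι), IsTensorV Q S e :=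
    ⟨_, _, isTensorV_tensor S⟩
  let P' : Matrix R.ι Q.ι Zv := Matrix.of fun r p => P (e.symm p).1 r (e.symm p).2
  have hP1 : ∀ w : Q.ι → Qv, (P'.map (algebraMap Zv Qv)).mulVec w
      = ∑ j, ((P j).map (algebraMap Zv Qv)).mulVec fun t => w (e (j, t)) := by
    intro w
    funext r
    rw [Finset.sum_apply]
    simp only [Matrix.mulVec, dotProduct]
    rw [IsTensorV.sum_eq (e := e)]
    simp [P']
  have hP2 : ∀ w : Q.ι → 𝕜, (P'.map (algebraMap Zv 𝕜)).mulVec w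
      = ∑ j, ((P j).map (algebraMap Zv 𝕜)).mulVec fun t => w (e (j, t)) := by
    intro w
    funext r
    rw [Finset.sum_apply]
    simp only [Matrix.mulVec, dotProduct]
    rw [IsTensorV.sum_eq (e := e)]
    simp [P']
  have hP : ∀ g, P'.map (algebraMap Zv Qv) * Q.ρ (gen g)
      = R.ρ (gen g) * P'.map (algebraMap Zv Qv) := by
    intro g
    refine Matrix.ext_of_mulVec_single fun r => ?_
    rw [← Matrix.mulVec_mulVec, ← Matrix.mulVec_mulVec, hP1, hP1]
    rw [← h g fun j t => (Pi.single r 1 : Q.ι → Qv) (e (j, t))]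
    refine Finset.sum_congr rfl fun i _ => ?_
    congr 1
    funext s
    rw [Finset.sum_apply, hQ.mulVec]
  refine ⟨latHom 𝕜 P' hP ∘ₗ (hQ.equiv 𝕜).toLinearMap, fun w => ?_⟩
  have h2 : (latHom 𝕜 P' hP ∘ₗ (hQ.equiv 𝕜).toLinearMap) w
    = (P'.map (algebraMap Zv 𝕜)).mulVec fun p => w (e.symm p).1 (e.symm p).2 := rfl
  rw [h2, hP2]
  simp only [Equiv.symm_apply_apply]
  rfl

end LatHom

/-! ### Shift matrices -/

section Shift

/-- A vector indexed by `0, …, n - 1`, extended by zero to all integers. -/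
def extz {K : Type*} [AddCommMonoid K] {n : ℕ} (w : Fin n → K) (z : ℤ) : K :=
  ∑ s : Fin n, if (s : ℤ) = z then w s else 0

variable {K : Type*} [CommRing K] {n m : ℕ}

theorem extz_apply (w : Fin n → K) (s : Fin n) : extz w s = w s := by
  rw [extz, Finset.sum_eq_single s]
  · simp
  · intro t _ ht
    rw [if_neg]
    exact fun h => ht (Fin.ext (by exact_mod_cast h))
  · simp

theorem extz_of_eq (w : Fin n → K) {z : ℤ} (s : Fin n) (h : z = s) : extz w z = w s := by
  rw [h, extz_apply]

theorem extz_eq_zero (w : Fin n → K) {z : ℤ} (h : ¬ (0 ≤ z ∧ z < n)) : extz w z = 0 := by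
  refine Finset.sum_eq_zero fun s _ => if_neg fun hs => h ?_
  have := s.2
  omega

theorem extz_res (f : ℤ → K) (z : ℤ) :
    extz (fun s : Fin n => f s) z = if 0 ≤ z ∧ z < n then f z else 0 := by
  split_ifs with h
  · rw [extz_of_eq _ ⟨z.toNat, by omega⟩ (by simp [h.1])]
    simp [h.1]
  · exact extz_eq_zero _ h

/-- The matrix with entries `c s` in the places `(s, s + d)`. -/
noncomputable def shiftMat (n m : ℕ) (c : ℤ → Zv) (d : ℤ) : Matrix (Fin n) (Fin m) Zv :=
  Matrix.of fun s r => if (r : ℤ) = s + d then c s else 0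

theorem mulVec_eq_extz {A : Matrix (Fin n) (Fin m) K} {c : ℤ → K} {d : ℤ}
    (h : ∀ s r, A s r = if (r : ℤ) = s + d then c s else 0) (w : Fin m → K) :
    A.mulVec w = fun s : Fin n => c s * extz w (s + d) := by
  funext s
  simp only [extz, Finset.mul_sum, Matrix.mulVec, dotProduct]
  refine Finset.sum_congr rfl fun r _ => ?_
  rw [h]
  split_ifs <;> simp

theorem shiftMat_mulVec [Algebra Zv K] (c : ℤ → Zv) (d : ℤ) (w : Fin m → K) :
    ((shiftMat n m c d).map (algebraMap Zv K)).mulVec w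
      = fun s : Fin n => algebraMap Zv K (c s) * extz w (s + d) :=
  mulVec_eq_extz (c := fun z => algebraMap Zv K (c z)) (fun s r => by
    simp only [shiftMat, Matrix.map_apply, Matrix.of_apply, apply_ite (algebraMap Zv K), map_zero])
    w

theorem weylE_mulVec (a : ℕ) (w : Fin (a + 1) → Qv) :
    (weylE a).mulVec w = fun s : Fin (a + 1) => qint (a - s) * extz w (s + 1) :=
  mulVec_eq_extz (c := fun z => qint (a - z)) (fun s r => by
    simp only [weylE, Matrix.of_apply]
    by_cases h : (s : ℕ) + 1 = r
    · have h' : (r : ℤ) = s + 1 := by omega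
      rw [if_pos h, if_pos h', h']
      congr 1
      ring
    · have h' : ¬ (r : ℤ) = s + 1 := by omega
      rw [if_neg h, if_neg h']) w

theorem weylF_mulVec (a : ℕ) (w : Fin (a + 1) → Qv) :
    (weylF a).mulVec w = fun s : Fin (a + 1) => qint s * extz w (s + -1) :=
  mulVec_eq_extz (c := fun z => qint z) (fun s r => by
    simp only [weylF, Matrix.of_apply]
    by_cases h : (s : ℕ) = r + 1
    · have h' : (r : ℤ) = s + -1 := by omega
      rw [if_pos h, if_pos h', h']
      congr 1
      ring
    · have h' : ¬ (r : ℤ) = s + -1 := by omega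
      rw [if_neg h, if_neg h']) w

theorem weylK_mulVec (a : ℕ) (w : Fin (a + 1) → Qv) :
    (weylK a).mulVec w = fun s : Fin (a + 1) => v ^ ((a : ℤ) - 2 * s) * w s :=
  funext fun _ => Matrix.mulVec_diagonal _ _ _

theorem weylKi_mulVec (a : ℕ) (w : Fin (a + 1) → Qv) :
    (weylKi a).mulVec w = fun s : Fin (a + 1) => v ^ (-((a : ℤ) - 2 * s)) * w s :=
  funext fun _ => Matrix.mulVec_diagonal _ _ _

theorem dual_ρ (R : LatticeRep) (x : Uv) : R.dual.ρ x = (R.ρ (antipode x).unop).transpose := rfl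

theorem dualE_mulVec (a : ℕ) (w : Fin (a + 1) → Qv) :
    ((weylRep a).dual.ρ (gen Gen.E)).mulVec w = fun s : Fin (a + 1) =>
      -(v ^ (-((a : ℤ) - 2 * s + 2)) * qint (a - s + 1)) * extz w (s + -1) := by
  have h : (weylRep a).dual.ρ (gen Gen.E) = (-(weylKi a * weylE a)).transpose := by
    rw [dual_ρ, antipode, liftUv_gen]
    change ((weylRep a).ρ (-(gen Gen.Ki * gen Gen.E))).transpose = _
    rw [map_neg, map_mul, weylRep_Ki, weylRep_E]
    rfl
  rw [h]
  refine mulVec_eq_extz (c := fun z => -(v ^ (-((a : ℤ) - 2 * z + 2)) * qint (a - z + 1)))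
    (fun s r => ?_) w
  simp only [Matrix.transpose_apply, Matrix.neg_apply, weylKi, Matrix.diagonal_mul, weylE,
    Matrix.of_apply]
  by_cases h : (r : ℕ) + 1 = s
  · have h' : (r : ℤ) = s + -1 := by omega
    rw [if_pos h, if_pos h', h']
    congr 3
    ring_nf
  · have h' : ¬ (r : ℤ) = s + -1 := by omega
    rw [if_neg h, if_neg h', mul_zero, neg_zero]

theorem dualF_mulVec (a : ℕ) (w : Fin (a + 1) → Qv) :
    ((weylRep a).dual.ρ (gen Gen.F)).mulVec w = fun s : Fin (a + 1) =>
      -(v ^ ((a : ℤ) - 2 * s) * qint (s + 1)) * extz w (s + 1) := by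
  have h : (weylRep a).dual.ρ (gen Gen.F) = (-(weylF a * weylK a)).transpose := by
    rw [dual_ρ, antipode, liftUv_gen]
    change ((weylRep a).ρ (-(gen Gen.F * gen Gen.K))).transpose = _
    rw [map_neg, map_mul, weylRep_F, weylRep_K]
    rfl
  rw [h]
  refine mulVec_eq_extz (c := fun z => -(v ^ ((a : ℤ) - 2 * z) * qint (z + 1))) (fun s r => ?_) w
  simp only [Matrix.transpose_apply, Matrix.neg_apply, weylK, Matrix.mul_diagonal, weylF,
    Matrix.of_apply]
  by_cases h : (r : ℕ) = s + 1
  · have h' : (r : ℤ) = s + 1 := by omega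
    rw [if_pos h, if_pos h', mul_comm (qint _)]
  · have h' : ¬ (r : ℤ) = s + 1 := by omega
    rw [if_neg h, if_neg h', zero_mul, neg_zero]

theorem dualK_mulVec (a : ℕ) (w : Fin (a + 1) → Qv) :
    ((weylRep a).dual.ρ (gen Gen.K)).mulVec w = fun s : Fin (a + 1) =>
      v ^ (-((a : ℤ) - 2 * s)) * w s := by
  have h : (weylRep a).dual.ρ (gen Gen.K) = (weylKi a).transpose := by
    rw [dual_ρ, antipode, liftUv_gen]
    change ((weylRep a).ρ (gen Gen.Ki)).transpose = _
    exact congrArg Matrix.transpose (weylRep_Ki a)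
  rw [h, weylKi, Matrix.diagonal_transpose]
  exact funext fun _ => Matrix.mulVec_diagonal _ _ _

theorem dualKi_mulVec (a : ℕ) (w : Fin (a + 1) → Qv) :
    ((weylRep a).dual.ρ (gen Gen.Ki)).mulVec w = fun s : Fin (a + 1) =>
      v ^ ((a : ℤ) - 2 * s) * w s := by
  have h : (weylRep a).dual.ρ (gen Gen.Ki) = (weylK a).transpose := by
    rw [dual_ρ, antipode, liftUv_gen]
    change ((weylRep a).ρ (gen Gen.K)).transpose = _
    exact congrArg Matrix.transpose (weylRep_K a)
  rw [h, weylK, Matrix.diagonal_transpose]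
  exact funext fun _ => Matrix.mulVec_diagonal _ _ _

end Shift


/-! ### Tensoring Weyl modules with the two-dimensional module -/

section Acts

/-- The operators by which the generators act on coordinate vectors. -/
structure Acts (R : LatticeRep) (fE fF fK fKi : (R.ι → Qv) → R.ι → Qv) : Prop where
  E : ∀ w, (R.ρ (gen Gen.E)).mulVec w = fE w
  F : ∀ w, (R.ρ (gen Gen.F)).mulVec w = fF w
  K : ∀ w, (R.ρ (gen Gen.K)).mulVec w = fK w
  Ki : ∀ w, (R.ρ (gen Gen.Ki)).mulVec w = fKi w

variable {R S : LatticeRep} {rE rF rK rKi : (R.ι → Qv) → R.ι → Qv}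
  {sE sF sK sKi : (S.ι → Qv) → S.ι → Qv}

/-- To give a homomorphism to `V ⊗ S` it suffices to give its two components, and to check the
relations that the coproducts of the generators impose on them. -/
theorem exists_hom_to_VT_of_acts (𝕜 : Type u) [Field 𝕜] [Algebra Zv 𝕜] (hR : Acts R rE rF rK rKi)
    (hS : Acts S sE sF sK sKi) (P0 P1 : Matrix S.ι R.ι Zv) {p0 p1 : (R.ι → Qv) → S.ι → Qv}
    (h0 : ∀ w, (P0.map (algebraMap Zv Qv)).mulVec w = p0 w)
    (h1 : ∀ w, (P1.map (algebraMap Zv Qv)).mulVec w = p1 w)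
    (hE0 : ∀ w s, p0 (rE w) s = v * sE (p0 w) s + p1 w s)
    (hE1 : ∀ w s, p1 (rE w) s = v⁻¹ * sE (p1 w) s)
    (hF0 : ∀ w s, p0 (rF w) s = sF (p0 w) s)
    (hF1 : ∀ w s, p1 (rF w) s = sKi (p0 w) s + sF (p1 w) s)
    (hK0 : ∀ w s, p0 (rK w) s = v * sK (p0 w) s) (hK1 : ∀ w s, p1 (rK w) s = v⁻¹ * sK (p1 w) s)
    (hKi0 : ∀ w s, p0 (rKi w) s = v⁻¹ * sKi (p0 w) s)
    (hKi1 : ∀ w s, p1 (rKi w) s = v * sKi (p1 w) s) :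
    ∃ f : R.Spec 𝕜 →ₗ[Uq 𝕜] VT (S.Spec 𝕜),
      (∀ w, f w 0 = (P0.map (algebraMap Zv 𝕜)).mulVec w) ∧
      ∀ w, f w 1 = (P1.map (algebraMap Zv 𝕜)).mulVec w := by
  replace hE0 : ∀ w, p0 (rE w) = v • sE (p0 w) + p1 w := fun w => funext (hE0 w)
  replace hE1 : ∀ w, p1 (rE w) = v⁻¹ • sE (p1 w) := fun w => funext (hE1 w)
  replace hF0 : ∀ w, p0 (rF w) = sF (p0 w) := fun w => funext (hF0 w)
  replace hF1 : ∀ w, p1 (rF w) = sKi (p0 w) + sF (p1 w) := fun w => funext (hF1 w)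
  replace hK0 : ∀ w, p0 (rK w) = v • sK (p0 w) := fun w => funext (hK0 w)
  replace hK1 : ∀ w, p1 (rK w) = v⁻¹ • sK (p1 w) := fun w => funext (hK1 w)
  replace hKi0 : ∀ w, p0 (rKi w) = v⁻¹ • sKi (p0 w) := fun w => funext (hKi0 w)
  replace hKi1 : ∀ w, p1 (rKi w) = v • sKi (p1 w) := fun w => funext (hKi1 w)
  suffices h : ∃ f : R.Spec 𝕜 →ₗ[Uq 𝕜] VT (S.Spec 𝕜),
      ∀ w i, f w i = ((![P0, P1] i).map (algebraMap Zv 𝕜)).mulVec w by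
    obtain ⟨f, hf⟩ := h
    exact ⟨f, fun w => hf w 0, fun w => hf w 1⟩
  refine exists_hom_to_VT 𝕜 ![P0, P1] fun g i w => ?_
  simp only [Fin.sum_univ_two, Matrix.cons_val_zero, Matrix.cons_val_one, h0, h1]
  cases g with
  | E =>
    rw [hR.E, vComul_E]
    fin_cases i
    · simp [h0, hE0, hS.E, Matrix.smul_mulVec]
    · simp [h1, hE1, hS.E, Matrix.smul_mulVec]
  | F =>
    rw [hR.F, vComul_F]
    fin_cases i
    · simp [h0, hF0, hS.F]
    · simp [h1, hF1, hS.F, hS.Ki]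
  | K =>
    rw [hR.K, vComul_K]
    fin_cases i
    · simp [h0, hK0, hS.K, Matrix.smul_mulVec]
    · simp [h1, hK1, hS.K, Matrix.smul_mulVec]
  | Ki =>
    rw [hR.Ki, vComul_Ki]
    fin_cases i
    · simp [h0, hKi0, hS.Ki, Matrix.smul_mulVec]
    · simp [h1, hKi1, hS.Ki, Matrix.smul_mulVec]

/-- To give a homomorphism from `V ⊗ S` it suffices to give its two components, and to check the
relations that the coproducts of the generators impose on them. -/
theorem exists_hom_of_VT_of_acts (𝕜 : Type u) [Field 𝕜] [Algebra Zv 𝕜] (hR : Acts R rE rF rK rKi)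
    (hS : Acts S sE sF sK sKi) (P0 P1 : Matrix R.ι S.ι Zv) {p0 p1 : (S.ι → Qv) → R.ι → Qv}
    (h0 : ∀ w, (P0.map (algebraMap Zv Qv)).mulVec w = p0 w)
    (h1 : ∀ w, (P1.map (algebraMap Zv Qv)).mulVec w = p1 w)
    (hE0 : ∀ w s, v * p0 (sE w) s = rE (p0 w) s)
    (hE1 : ∀ w s, p0 w s + v⁻¹ * p1 (sE w) s = rE (p1 w) s)
    (hF0 : ∀ w s, p0 (sF w) s + p1 (sKi w) s = rF (p0 w) s)
    (hF1 : ∀ w s, p1 (sF w) s = rF (p1 w) s)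
    (hK0 : ∀ w s, v * p0 (sK w) s = rK (p0 w) s) (hK1 : ∀ w s, v⁻¹ * p1 (sK w) s = rK (p1 w) s)
    (hKi0 : ∀ w s, v⁻¹ * p0 (sKi w) s = rKi (p0 w) s)
    (hKi1 : ∀ w s, v * p1 (sKi w) s = rKi (p1 w) s) :
    ∃ f : VT (S.Spec 𝕜) →ₗ[Uq 𝕜] R.Spec 𝕜,
      ∀ w, f w = (P0.map (algebraMap Zv 𝕜)).mulVec (w 0)
        + (P1.map (algebraMap Zv 𝕜)).mulVec (w 1) := by
  replace hE0 : ∀ w, v • p0 (sE w) = rE (p0 w) := fun w => funext (hE0 w)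
  replace hE1 : ∀ w, p0 w + v⁻¹ • p1 (sE w) = rE (p1 w) := fun w => funext (hE1 w)
  replace hF0 : ∀ w, p0 (sF w) + p1 (sKi w) = rF (p0 w) := fun w => funext (hF0 w)
  replace hF1 : ∀ w, p1 (sF w) = rF (p1 w) := fun w => funext (hF1 w)
  replace hK0 : ∀ w, v • p0 (sK w) = rK (p0 w) := fun w => funext (hK0 w)
  replace hK1 : ∀ w, v⁻¹ • p1 (sK w) = rK (p1 w) := fun w => funext (hK1 w)
  replace hKi0 : ∀ w, v⁻¹ • p0 (sKi w) = rKi (p0 w) := fun w => funext (hKi0 w)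
  replace hKi1 : ∀ w, v • p1 (sKi w) = rKi (p1 w) := fun w => funext (hKi1 w)
  suffices h : ∃ f : VT (S.Spec 𝕜) →ₗ[Uq 𝕜] R.Spec 𝕜,
      ∀ w, f w = ∑ j, ((![P0, P1] j).map (algebraMap Zv 𝕜)).mulVec (w j) by
    obtain ⟨f, hf⟩ := h
    exact ⟨f, fun w => (hf w).trans (Fin.sum_univ_two _)⟩
  have s0 : ∀ (c : Qv) w, p0 (c • w) = c • p0 w := fun c w => by
    rw [← h0, Matrix.mulVec_smul, h0]
  have s1 : ∀ (c : Qv) w, p1 (c • w) = c • p1 w := fun c w => by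
    rw [← h1, Matrix.mulVec_smul, h1]
  have z0 : p0 0 = 0 := by rw [← h0, Matrix.mulVec_zero]
  have z1 : p1 0 = 0 := by rw [← h1, Matrix.mulVec_zero]
  refine exists_hom_of_VT 𝕜 ![P0, P1] fun g w => ?_
  simp only [Fin.sum_univ_two, Matrix.cons_val_zero, Matrix.cons_val_one, Matrix.mulVec_add]
  cases g with
  | E =>
    rw [vComul_E]
    simp [s0, s1, z1, Matrix.smul_mulVec, h0, h1, hS.E, hR.E, hE0, ← hE1]
    abel
  | F =>
    rw [vComul_F]
    simp [z0, h0, h1, hS.F, hS.Ki, hR.F, ← hF0, hF1]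
    abel
  | K =>
    rw [vComul_K]
    simp [s0, s1, z0, z1, Matrix.smul_mulVec, h0, h1, hS.K, hR.K, hK0, hK1]
  | Ki =>
    rw [vComul_Ki]
    simp [s0, s1, z0, z1, Matrix.smul_mulVec, h0, h1, hS.Ki, hR.Ki, hKi0, hKi1]

/-- The restriction of a function on the integers to `0, …, n - 1`. -/
def res {K : Type*} (n : ℕ) (f : ℤ → K) : Fin n → K := fun s => f s

@[simp]
theorem res_apply {K : Type*} (n : ℕ) (f : ℤ → K) (s : Fin n) : res n f s = f s := rfl

theorem extz_res' {K : Type*} [CommRing K] (n : ℕ) (f : ℤ → K) (z : ℤ) :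
    extz (res n f) z = if 0 ≤ z ∧ z < n then f z else 0 := extz_res f z

theorem weyl_acts (a : ℕ) : Acts (weylRep a)
    (fun w : Fin (a + 1) → Qv => res (a + 1) fun z => qint (a - z) * extz w (z + 1))
    (fun w : Fin (a + 1) → Qv => res (a + 1) fun z => qint z * extz w (z + -1))
    (fun w : Fin (a + 1) → Qv => res (a + 1) fun z => v ^ (a - 2 * z) * extz w z)
    (fun w : Fin (a + 1) → Qv => res (a + 1) fun z => v ^ (-(a - 2 * z)) * extz w z) where
  E w := (congrArg (Matrix.mulVec · w) (weylRep_E a)).trans (weylE_mulVec a w)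
  F w := (congrArg (Matrix.mulVec · w) (weylRep_F a)).trans (weylF_mulVec a w)
  K w := ((congrArg (Matrix.mulVec · w) (weylRep_K a)).trans (weylK_mulVec a w)).trans
    (funext fun s => congrArg (v ^ _ * ·) (extz_apply (K := Qv) (n := a + 1) w s).symm)
  Ki w := ((congrArg (Matrix.mulVec · w) (weylRep_Ki a)).trans (weylKi_mulVec a w)).trans
    (funext fun s => congrArg (v ^ _ * ·) (extz_apply (K := Qv) (n := a + 1) w s).symm)

theorem dualWeyl_acts (a : ℕ) : Acts (weylRep a).dual
    (fun w : Fin (a + 1) → Qv => res (a + 1) fun z =>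
      -(v ^ (-((a : ℤ) - 2 * z + 2)) * qint (a - z + 1)) * extz w (z + -1))
    (fun w : Fin (a + 1) → Qv => res (a + 1) fun z =>
      -(v ^ ((a : ℤ) - 2 * z) * qint (z + 1)) * extz w (z + 1))
    (fun w : Fin (a + 1) → Qv => res (a + 1) fun z => v ^ (-(a - 2 * z)) * extz w z)
    (fun w : Fin (a + 1) → Qv => res (a + 1) fun z => v ^ (a - 2 * z) * extz w z) where
  E w := dualE_mulVec a w
  F w := dualF_mulVec a w
  K w := (dualK_mulVec a w).trans (funext fun s => congrArg (v ^ _ * ·) (extz_apply (K := Qv) (n := a + 1) w s).symm)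
  Ki w := (dualKi_mulVec a w).trans (funext fun s => congrArg (v ^ _ * ·) (extz_apply (K := Qv) (n := a + 1) w s).symm)

theorem shiftMat_mulVec' (n m : ℕ) {c : ℤ → Zv} {d : ℤ} {c' : ℤ → Qv}
    (hc : ∀ z, algebraMap Zv Qv (c z) = c' z) (w : Fin m → Qv) :
    ((shiftMat n m c d).map (algebraMap Zv Qv)).mulVec w
      = res n fun z => c' z * extz w (z + d) :=
  (shiftMat_mulVec c d w).trans (funext fun s => by rw [hc]; rfl)

end Acts

section WeylMaps

variable (𝕜 : Type u) [Field 𝕜] [Algebra Zv 𝕜]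

/-- The embedding of the Weyl module of highest weight `a + 1` in `V ⊗ Weyl a`, which sends the
highest weight vector to `e₀ ⊗ x₀`. -/
theorem exists_weyl_up (a : ℕ) : ∃ f : Weyl 𝕜 (a + 1) →ₗ[Uq 𝕜] VT (Weyl 𝕜 a),
    (∀ w, f w 0 = ((shiftMat (a + 1) (a + 2) (fun _ => 1) 0).map (algebraMap Zv 𝕜)).mulVec w) ∧
    ∀ w, f w 1 = ((shiftMat (a + 1) (a + 2) (fun z => LaurentPolynomial.T (z - a)) 1).map
        (algebraMap Zv 𝕜)).mulVec w := by
  refine exists_hom_to_VT_of_acts 𝕜 (R := weylRep (a + 1)) (S := weylRep a) (weyl_acts (a + 1))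
    (weyl_acts a) _ _
    (p0 := fun w : Fin (a + 2) → Qv => res (a + 1) fun z => 1 * extz w (z + 0))
    (p1 := fun w : Fin (a + 2) → Qv => res (a + 1) fun z => v ^ (z - a) * extz w (z + 1))
    (shiftMat_mulVec' (a + 1) (a + 2) fun _ => map_one _)
    (shiftMat_mulVec' (a + 1) (a + 2) fun _ => alg_T _)
    ?_ ?_ ?_ ?_ ?_ ?_ ?_ ?_ <;> intro (w : Fin (a + 2) → Qv) (s : Fin (a + 1)) <;>
    (have h0 : (0 : ℤ) ≤ (s : ℕ) := by omega) <;>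
    (have h1 : ((s : ℕ) : ℤ) < a + 1 := by omega) <;>
    simp only [res_apply, extz_res', one_mul, add_zero] <;>
    generalize ((s : ℕ) : ℤ) = z at h0 h1 ⊢ <;>
    push_cast <;>
    try simp only [add_neg_cancel_right, neg_add_cancel_right]
  all_goals split_ifs <;> try omega
  all_goals have hv := v_ne_zero
  all_goals have hd := v_sub_inv_ne_zero
  -- the cases in which an index leaves the range, and its coefficient vanishes
  all_goals try first
    | rfl
    | (have hz : z = a := by omega
       subst hz
       simp (disch := omega) only [extz_eq_zero, sub_self, qint_zero, mul_zero])
    | (have hz : z = 0 := by omega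
       subst hz
       simp (disch := omega) only [extz_eq_zero, qint_zero, mul_zero])
  -- what remains are identities between Laurent polynomials in `v`
  all_goals try simp only [qint]
  all_goals generalize hdd : v - v⁻¹ = d at hd ⊢
  all_goals try simp only [neg_sub, neg_add_rev, zpow_add₀ hv, zpow_sub₀ hv, zpow_neg, zpow_one, two_mul]
  all_goals try field_simp
  all_goals subst hdd
  all_goals try field_simp
  all_goals try ring

/-- The projection of `V ⊗ Weyl (b + 1)` to the Weyl module of highest weight `b`. -/
theorem exists_weyl_down (b : ℕ) : ∃ f : VT (Weyl 𝕜 (b + 1)) →ₗ[Uq 𝕜] Weyl 𝕜 b,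
    ∀ w, f w = ((shiftMat (b + 1) (b + 2) (fun z => -LaurentPolynomial.T (z - (b + 1))) 1).map
        (algebraMap Zv 𝕜)).mulVec (w 0)
      + ((shiftMat (b + 1) (b + 2) (fun _ => 1) 0).map (algebraMap Zv 𝕜)).mulVec (w 1) := by
  refine exists_hom_of_VT_of_acts 𝕜 (R := weylRep b) (S := weylRep (b + 1)) (weyl_acts b)
    (weyl_acts (b + 1)) _ _
    (p0 := fun w : Fin (b + 2) → Qv => res (b + 1) fun z => -v ^ (z - (b + 1)) * extz w (z + 1))
    (p1 := fun w : Fin (b + 2) → Qv => res (b + 1) fun z => 1 * extz w (z + 0))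
    (shiftMat_mulVec' (b + 1) (b + 2) fun _ => (map_neg _ _).trans (congrArg _ (alg_T _)))
    (shiftMat_mulVec' (b + 1) (b + 2) fun _ => map_one _)
    ?_ ?_ ?_ ?_ ?_ ?_ ?_ ?_ <;> intro (w : Fin (b + 2) → Qv) (s : Fin (b + 1)) <;>
    (have h0 : (0 : ℤ) ≤ (s : ℕ) := by omega) <;>
    (have h1 : ((s : ℕ) : ℤ) < b + 1 := by omega) <;>
    simp only [res_apply, extz_res', one_mul, add_zero] <;>
    generalize ((s : ℕ) : ℤ) = z at h0 h1 ⊢ <;>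
    push_cast <;>
    try simp only [add_neg_cancel_right, neg_add_cancel_right]
  all_goals split_ifs <;> try omega
  all_goals have hv := v_ne_zero
  all_goals have hd := v_sub_inv_ne_zero
  -- the cases in which an index leaves the range, and its coefficient vanishes
  all_goals try first
    | rfl
    | (have hz : z = b := by omega
       subst hz
       simp (disch := omega) only [extz_eq_zero, sub_self, qint_zero, mul_zero])
    | (have hz : z = 0 := by omega
       subst hz
       simp (disch := omega) only [extz_eq_zero, qint_zero, mul_zero])
  -- what remains are identities between Laurent polynomials in `v`
  all_goals try simp only [qint]
  all_goals generalize hdd : v - v⁻¹ = d at hd ⊢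
  all_goals try simp only [neg_sub, neg_add_rev, zpow_add₀ hv, zpow_sub₀ hv, zpow_neg, zpow_one, two_mul]
  all_goals try field_simp
  all_goals subst hdd
  all_goals try field_simp
  all_goals try ring

/-- The embedding of the dual Weyl module of highest weight `b` in `V ⊗ DualWeyl (b + 1)`. -/
theorem exists_dualWeyl_down (b : ℕ) : ∃ f : DualWeyl 𝕜 b →ₗ[Uq 𝕜] VT (DualWeyl 𝕜 (b + 1)),
    (∀ w, f w 0 = ((shiftMat (b + 2) (b + 1) (fun z => LaurentPolynomial.T (-z)) 0).map
        (algebraMap Zv 𝕜)).mulVec w) ∧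
    ∀ w, f w 1 = ((shiftMat (b + 2) (b + 1) (fun _ => 1) (-1)).map
        (algebraMap Zv 𝕜)).mulVec w := by
  refine exists_hom_to_VT_of_acts 𝕜 (R := (weylRep b).dual) (S := (weylRep (b + 1)).dual)
    (dualWeyl_acts b) (dualWeyl_acts (b + 1)) _ _
    (p0 := fun w : Fin (b + 1) → Qv => res (b + 2) fun z => v ^ (-z) * extz w (z + 0))
    (p1 := fun w : Fin (b + 1) → Qv => res (b + 2) fun z => 1 * extz w (z + -1))
    (shiftMat_mulVec' (b + 2) (b + 1) fun _ => alg_T _)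
    (shiftMat_mulVec' (b + 2) (b + 1) fun _ => map_one _)
    ?_ ?_ ?_ ?_ ?_ ?_ ?_ ?_ <;> intro (w : Fin (b + 1) → Qv) (s : Fin (b + 2)) <;>
    (have h0 : (0 : ℤ) ≤ (s : ℕ) := by omega) <;>
    (have h1 : ((s : ℕ) : ℤ) < b + 2 := by omega) <;>
    simp only [res_apply, extz_res', one_mul, add_zero] <;>
    generalize ((s : ℕ) : ℤ) = z at h0 h1 ⊢ <;>
    push_cast <;>
    try simp only [add_neg_cancel_right, neg_add_cancel_right]
  all_goals split_ifs <;> try omega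
  all_goals have hv := v_ne_zero
  all_goals have hd := v_sub_inv_ne_zero
  -- the cases in which an index leaves the range, and its coefficient vanishes
  all_goals try first
    | rfl
    | (have hz : z = b + 1 := by omega
       subst hz
       simp (disch := omega) only [extz_eq_zero, sub_self, mul_zero])
    | (have hz : z = 0 := by omega
       subst hz
       simp (disch := omega) only [extz_eq_zero, mul_zero])
  -- what remains are identities between Laurent polynomials in `v`
  all_goals try simp only [qint]
  all_goals generalize hdd : v - v⁻¹ = d at hd ⊢
  all_goals try simp only [neg_sub, neg_add_rev, zpow_add₀ hv, zpow_sub₀ hv, zpow_neg, zpow_one, two_mul]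
  all_goals try field_simp
  all_goals subst hdd
  all_goals try field_simp
  all_goals try ring

/-- The projection of `V ⊗ DualWeyl a` to the dual Weyl module of highest weight `a + 1`. -/
theorem exists_dualWeyl_up (a : ℕ) : ∃ f : VT (DualWeyl 𝕜 a) →ₗ[Uq 𝕜] DualWeyl 𝕜 (a + 1),
    ∀ w, f w = ((shiftMat (a + 2) (a + 1) (fun _ => -LaurentPolynomial.T (-1)) (-1)).map
        (algebraMap Zv 𝕜)).mulVec (w 0)
      + ((shiftMat (a + 2) (a + 1) (fun z => LaurentPolynomial.T (-z)) 0).map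
        (algebraMap Zv 𝕜)).mulVec (w 1) := by
  refine exists_hom_of_VT_of_acts 𝕜 (R := (weylRep (a + 1)).dual) (S := (weylRep a).dual)
    (dualWeyl_acts (a + 1)) (dualWeyl_acts a) _ _
    (p0 := fun w : Fin (a + 1) → Qv => res (a + 2) fun z => -v ^ (-1 : ℤ) * extz w (z + -1))
    (p1 := fun w : Fin (a + 1) → Qv => res (a + 2) fun z => v ^ (-z) * extz w (z + 0))
    (shiftMat_mulVec' (a + 2) (a + 1) fun _ => (map_neg _ _).trans (congrArg _ (alg_T _)))
    (shiftMat_mulVec' (a + 2) (a + 1) fun _ => alg_T _)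
    ?_ ?_ ?_ ?_ ?_ ?_ ?_ ?_ <;> intro (w : Fin (a + 1) → Qv) (s : Fin (a + 2)) <;>
    (have h0 : (0 : ℤ) ≤ (s : ℕ) := by omega) <;>
    (have h1 : ((s : ℕ) : ℤ) < a + 2 := by omega) <;>
    simp only [res_apply, extz_res', add_zero] <;>
    generalize ((s : ℕ) : ℤ) = z at h0 h1 ⊢ <;>
    push_cast <;>
    try simp only [add_neg_cancel_right, neg_add_cancel_right]
  all_goals split_ifs <;> try omega
  all_goals have hv := v_ne_zero
  all_goals have hd := v_sub_inv_ne_zero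
  -- the cases in which an index leaves the range, and its coefficient vanishes
  all_goals try first
    | rfl
    | (have hz : z = a + 1 := by omega
       subst hz
       simp (disch := omega) only [extz_eq_zero, sub_self, mul_zero])
    | (have hz : z = 0 := by omega
       subst hz
       simp (disch := omega) only [extz_eq_zero, mul_zero])
  -- what remains are identities between Laurent polynomials in `v`
  all_goals try simp only [qint]
  all_goals generalize hdd : v - v⁻¹ = d at hd ⊢
  all_goals try simp only [neg_sub, neg_add_rev, zpow_add₀ hv, zpow_sub₀ hv, zpow_neg, zpow_one, two_mul]
  all_goals try field_simp
  all_goals subst hdd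
  all_goals try field_simp
  all_goals try ring

end WeylMaps

section WeylSequences

variable (𝕜 : Type u) [Field 𝕜] [Algebra Zv 𝕜]

/-- An element of `V ⊗ R` from its coordinates. -/
def VT.ofCoord {𝕜 : Type u} [Field 𝕜] (R : LatticeRep) (w0 w1 : R.ι → 𝕜) : VT (R.Spec 𝕜) :=
  VT.of fun i => if i = 0 then w0 else w1

theorem VT.ofCoord_ext {𝕜 : Type u} [Field 𝕜] {R : LatticeRep} {x : VT (R.Spec 𝕜)} {w0 w1 : R.ι → 𝕜}
    (h0 : ∀ s, x 0 s = w0 s) (h1 : ∀ s, x 1 s = w1 s) : x = VT.ofCoord R w0 w1 := by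
  refine VT.ext fun i => ?_
  fin_cases i
  · exact funext h0
  · exact funext h1

theorem weyl_up_spec (a : ℕ) : ∃ f : Weyl 𝕜 (a + 1) →ₗ[Uq 𝕜] VT (Weyl 𝕜 a),
    ∀ w : Fin (a + 2) → 𝕜, f w = VT.ofCoord (weylRep a) (res (a + 1) fun z => extz w z)
      (res (a + 1) fun z => qv 𝕜 ^ (z - a) * extz w (z + 1)) := by
  obtain ⟨f, hf0, hf1⟩ := exists_weyl_up 𝕜 a
  refine ⟨f, fun w => VT.ofCoord_ext (fun s => ?_) fun s => ?_⟩
  · refine (congrFun ((hf0 w).trans (shiftMat_mulVec _ _ _)) s).trans ?_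
    simp only [map_one, one_mul, add_zero]
    rfl
  · refine (congrFun ((hf1 w).trans (shiftMat_mulVec _ _ _)) s).trans ?_
    simp only [T_zpow]
    rfl

theorem weyl_down_spec (b : ℕ) : ∃ f : VT (Weyl 𝕜 (b + 1)) →ₗ[Uq 𝕜] Weyl 𝕜 b,
    ∀ w0 w1 : Fin (b + 2) → 𝕜, f (VT.ofCoord (weylRep (b + 1)) w0 w1) = res (b + 1) fun z =>
      extz w1 z - qv 𝕜 ^ (z - (b + 1)) * extz w0 (z + 1) := by
  obtain ⟨f, hf⟩ := exists_weyl_down 𝕜 b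
  refine ⟨f, fun w0 w1 => (hf _).trans ?_⟩
  refine (congrArg₂ (· + ·) (shiftMat_mulVec _ _ w0) (shiftMat_mulVec _ _ w1)).trans ?_
  refine funext fun (s : Fin (b + 1)) => ?_
  refine Eq.trans (b := -qv 𝕜 ^ ((s : ℤ) - (b + 1)) * extz w0 (s + 1) + 1 * extz w1 (s + 0)) ?_ ?_
  · exact congrArg₂ (· + ·) (congrArg (fun c : 𝕜 => c * _) ((map_neg _ _).trans (congrArg _ (T_zpow _))))
      (congrArg (fun c : 𝕜 => c * _) (map_one _))
  · rw [res_apply, add_zero]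
    ring

theorem dualWeyl_down_spec (b : ℕ) : ∃ f : DualWeyl 𝕜 b →ₗ[Uq 𝕜] VT (DualWeyl 𝕜 (b + 1)),
    ∀ w : Fin (b + 1) → 𝕜, f w = VT.ofCoord (weylRep (b + 1)).dual
      (res (b + 2) fun z => qv 𝕜 ^ (-z) * extz w z) (res (b + 2) fun z => extz w (z + -1)) := by
  obtain ⟨f, hf0, hf1⟩ := exists_dualWeyl_down 𝕜 b
  refine ⟨f, fun w => VT.ofCoord_ext (fun s => ?_) fun s => ?_⟩
  · refine (congrFun ((hf0 w).trans (shiftMat_mulVec _ _ _)) s).trans ?_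
    simp only [T_zpow, add_zero]
    rfl
  · refine (congrFun ((hf1 w).trans (shiftMat_mulVec _ _ _)) s).trans ?_
    simp only [map_one, one_mul]
    rfl

theorem dualWeyl_up_spec (a : ℕ) : ∃ f : VT (DualWeyl 𝕜 a) →ₗ[Uq 𝕜] DualWeyl 𝕜 (a + 1),
    ∀ w0 w1 : Fin (a + 1) → 𝕜, f (VT.ofCoord (weylRep a).dual w0 w1) = res (a + 2) fun z =>
      qv 𝕜 ^ (-z) * extz w1 z - qv 𝕜 ^ (-1 : ℤ) * extz w0 (z + -1) := by
  obtain ⟨f, hf⟩ := exists_dualWeyl_up 𝕜 a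
  refine ⟨f, fun w0 w1 => (hf _).trans ?_⟩
  refine (congrArg₂ (· + ·) (shiftMat_mulVec _ _ w0) (shiftMat_mulVec _ _ w1)).trans ?_
  refine funext fun (s : Fin (a + 2)) => ?_
  refine Eq.trans (b := -qv 𝕜 ^ (-1 : ℤ) * extz w0 (s + -1) + qv 𝕜 ^ (-(s : ℤ)) * extz w1 (s + 0))
    ?_ ?_
  · exact congrArg₂ (· + ·) (congrArg (fun c : 𝕜 => c * _) ((map_neg _ _).trans (congrArg _ (T_zpow _))))
      (congrArg (fun c : 𝕜 => c * _) (T_zpow _))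
  · rw [res_apply, add_zero]
    ring

theorem VT.exists_ofCoord {𝕜 : Type u} [Field 𝕜] {R : LatticeRep} (x : VT (R.Spec 𝕜)) :
    ∃ w0 w1 : R.ι → 𝕜, x = VT.ofCoord R w0 w1 :=
  ⟨x 0, x 1, VT.ofCoord_ext (fun _ => rfl) fun _ => rfl⟩

theorem VT.ofCoord_inj {𝕜 : Type u} [Field 𝕜] {R : LatticeRep} {w0 w1 w0' w1' : R.ι → 𝕜}
    (h : VT.ofCoord R w0 w1 = VT.ofCoord R w0' w1') : w0 = w0' ∧ w1 = w1' :=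
  ⟨congrFun h 0, congrFun h 1⟩

theorem weyl_up_injective (a : ℕ) {f : Weyl 𝕜 (a + 1) →ₗ[Uq 𝕜] VT (Weyl 𝕜 a)}
    (hf : ∀ w : Fin (a + 2) → 𝕜, f w = VT.ofCoord (weylRep a) (res (a + 1) fun z => extz w z)
      (res (a + 1) fun z => qv 𝕜 ^ (z - a) * extz w (z + 1))) : Function.Injective f := by
  intro (w : Fin (a + 2) → 𝕜) (w' : Fin (a + 2) → 𝕜) h
  obtain ⟨h0, h1⟩ := VT.ofCoord_inj ((hf w).symm.trans (h.trans (hf w')))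
  refine funext fun (s : Fin (a + 2)) => ?_
  rw [← extz_apply w, ← extz_apply w']
  by_cases hs : (s : ℕ) < a + 1
  · exact congrFun h0 ⟨s, hs⟩
  · have e : ((s : ℕ) : ℤ) = (Fin.last a : ℕ) + 1 := by
      have := s.2
      simp only [Fin.val_last]
      omega
    rw [e]
    exact mul_left_cancel₀ (zpow_ne_zero _ (qv_ne_zero (𝕜 := 𝕜))) (congrFun h1 (Fin.last a))

/-- `V ⊗ Weyl (b + 1)` is an extension of Weyl modules, over any field. -/
theorem ses_weyl (b : ℕ) :
    SES (Uq 𝕜) (Weyl 𝕜 (b + 2)) (VT (Weyl 𝕜 (b + 1))) (Weyl 𝕜 b) := by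
  obtain ⟨f, hf⟩ := weyl_up_spec 𝕜 (b + 1)
  obtain ⟨g, hg⟩ := weyl_down_spec 𝕜 b
  refine ⟨f, g, weyl_up_injective 𝕜 _ hf, fun w => ⟨fun h => ?_, ?_⟩, fun (y : Fin (b + 1) → 𝕜) => ?_⟩
  · obtain ⟨w0, w1, rfl⟩ := VT.exists_ofCoord w
    have h' : ∀ s : Fin (b + 1), extz (n := b + 2) w1 s
        - qv 𝕜 ^ ((s : ℤ) - (b + 1)) * extz (n := b + 2) w0 (s + 1) = 0 :=
      fun s => congrFun ((hg w0 w1).symm.trans h) s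
    refine ⟨res (b + 3) fun z =>
      if z = b + 2 then extz (n := b + 2) w1 (b + 1) else extz (n := b + 2) w0 z, (hf _).trans ?_⟩
    refine (VT.ofCoord_ext (fun (s : Fin (b + 2)) => ?_) fun (s : Fin (b + 2)) => ?_).symm
    · rw [res_apply, extz_res', if_pos (by omega), if_neg (by omega)]
      exact (extz_apply (n := b + 2) w0 s).symm
    · rw [res_apply, extz_res', if_pos (by omega)]
      refine (extz_apply (n := b + 2) w1 s).symm.trans ?_
      split_ifs with hs
      · have e : ((s : ℕ) : ℤ) = b + 1 := by omega
        rw [e]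
        simp
      · have e := h' ⟨s, by omega⟩
        rw [sub_eq_zero] at e
        push_cast
        exact e
  · rintro ⟨w, rfl⟩
    refine (congrArg g (hf w)).trans ((hg _ _).trans (funext fun (s : Fin (b + 1)) => ?_))
    rw [res_apply, extz_res', extz_res', if_pos (by omega), if_pos (by omega)]
    push_cast
    exact sub_self _
  · refine ⟨VT.ofCoord (weylRep (b + 1)) (0 : Fin (b + 2) → 𝕜) (res (b + 2) fun z => extz y z),
      (hg _ _).trans (funext fun (s : Fin (b + 1)) => ?_)⟩
    rw [res_apply, extz_res', if_pos (by omega), extz_apply]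
    simp [extz]

theorem weyl_zero_equiv : Nonempty (VT (Weyl 𝕜 0) ≃ₗ[Uq 𝕜] Weyl 𝕜 1) := by
  obtain ⟨f, hf⟩ := weyl_up_spec 𝕜 0
  refine ⟨(LinearEquiv.ofBijective f ⟨weyl_up_injective 𝕜 _ hf, fun w => ?_⟩).symm⟩
  obtain ⟨w0, w1, rfl⟩ := VT.exists_ofCoord w
  refine ⟨res 2 fun z => if z = 1 then extz (n := 1) w1 0 else extz (n := 1) w0 z, (hf _).trans ?_⟩
  refine (VT.ofCoord_ext (fun (s : Fin 1) => ?_) fun (s : Fin 1) => ?_).symm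
  · rw [res_apply, extz_res', if_pos (by omega), if_neg (by omega)]
    exact (extz_apply (n := 1) w0 s).symm
  · have e : ((s : ℕ) : ℤ) = 0 := by omega
    rw [res_apply, extz_res', if_pos (by omega), if_pos (by omega), e]
    refine (extz_apply (n := 1) w1 s).symm.trans ?_
    rw [e]
    simp

theorem dualWeyl_up_surjective (a : ℕ) {g : VT (DualWeyl 𝕜 a) →ₗ[Uq 𝕜] DualWeyl 𝕜 (a + 1)}
    (hg : ∀ w0 w1 : Fin (a + 1) → 𝕜, g (VT.ofCoord (weylRep a).dual w0 w1) = res (a + 2) fun z =>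
      qv 𝕜 ^ (-z) * extz w1 z - qv 𝕜 ^ (-1 : ℤ) * extz w0 (z + -1)) : Function.Surjective g := by
  intro (y : Fin (a + 2) → 𝕜)
  have q0 := qv_ne_zero (𝕜 := 𝕜)
  refine ⟨VT.ofCoord (weylRep a).dual
    (res (a + 1) fun z => if z = a then -qv 𝕜 * extz y (a + 1) else 0)
    (res (a + 1) fun z => qv 𝕜 ^ z * extz y z), (hg _ _).trans (funext fun (s : Fin (a + 2)) => ?_)⟩
  rw [res_apply, extz_res', extz_res']
  by_cases hs : (s : ℕ) < a + 1
  · rw [if_pos (by omega), ← mul_assoc, ← zpow_add₀ q0, neg_add_cancel, zpow_zero, one_mul,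
      extz_apply, sub_eq_self]
    split_ifs <;> first | omega | simp
  · have e : ((s : ℕ) : ℤ) = a + 1 := by omega
    rw [if_neg (by omega), if_pos (by omega), if_pos (by omega), ← e, extz_apply]
    simp [q0]

theorem ses_dualWeyl (b : ℕ) :
    SES (Uq 𝕜) (DualWeyl 𝕜 b) (VT (DualWeyl 𝕜 (b + 1))) (DualWeyl 𝕜 (b + 2)) := by
  obtain ⟨f, hf⟩ := dualWeyl_down_spec 𝕜 b
  obtain ⟨g, hg⟩ := dualWeyl_up_spec 𝕜 (b + 1)
  have q0 := qv_ne_zero (𝕜 := 𝕜)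
  refine ⟨f, g, ?_, fun w => ⟨fun h => ?_, ?_⟩, dualWeyl_up_surjective 𝕜 _ hg⟩
  · intro (w : Fin (b + 1) → 𝕜) (w' : Fin (b + 1) → 𝕜) h
    obtain ⟨h0, -⟩ := VT.ofCoord_inj ((hf w).symm.trans (h.trans (hf w')))
    refine funext fun (s : Fin (b + 1)) => ?_
    rw [← extz_apply w, ← extz_apply w']
    exact mul_left_cancel₀ (zpow_ne_zero _ q0) (congrFun h0 s.castSucc)
  · obtain ⟨(w0 : Fin (b + 2) → 𝕜), (w1 : Fin (b + 2) → 𝕜), rfl⟩ := VT.exists_ofCoord w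
    have h' : ∀ s : Fin (b + 3), qv 𝕜 ^ (-(s : ℤ)) * extz (n := b + 2) w1 s
        - qv 𝕜 ^ (-1 : ℤ) * extz (n := b + 2) w0 (s + -1) = 0 :=
      fun s => congrFun ((hg w0 w1).symm.trans h) s
    refine ⟨res (b + 1) fun z => qv 𝕜 ^ z * extz (n := b + 2) w0 z, (hf _).trans ?_⟩
    refine (VT.ofCoord_ext (fun (s : Fin (b + 2)) => ?_) fun (s : Fin (b + 2)) => ?_).symm
    · refine (extz_apply (n := b + 2) w0 s).symm.trans ?_
      rw [res_apply, extz_res']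
      split_ifs with hs
      · rw [← mul_assoc, ← zpow_add₀ q0]
        simp
      · have e := h' (Fin.last (b + 2))
        rw [extz_eq_zero _ (by simp), mul_zero, zero_sub, neg_eq_zero] at e
        have e2 := (mul_eq_zero.mp e).resolve_left (zpow_ne_zero _ q0)
        have e3 : ((Fin.last (b + 2) : ℕ) : ℤ) + -1 = (s : ℕ) := by
          simp only [Fin.val_last]
          omega
        rw [e3] at e2
        rw [mul_zero]
        exact e2
    · refine (extz_apply (n := b + 2) w1 s).symm.trans ?_
      rw [res_apply, extz_res']
      have e := h' s.castSucc
      rw [sub_eq_zero, Fin.val_castSucc] at e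
      have e1 : extz (n := b + 2) w1 s
          = qv 𝕜 ^ ((s : ℤ) + -1) * extz (n := b + 2) w0 (s + -1) := by
        rw [zpow_add₀ q0, mul_assoc, ← e, ← mul_assoc, ← zpow_add₀ q0]
        simp
      rw [e1]
      split_ifs with hs
      · rfl
      · rw [extz_eq_zero _ (by omega), mul_zero]
  · rintro ⟨w, rfl⟩
    let w' : Fin (b + 1) → 𝕜 := w
    refine (congrArg g (hf w')).trans ((hg _ _).trans (funext fun (s : Fin (b + 3)) => ?_))
    rw [res_apply, extz_res', extz_res']
    refine Eq.trans ?_ (sub_self (qv 𝕜 ^ (-(s : ℤ)) * extz w' (s + -1)))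
    congr 1
    · split_ifs with hs
      · rfl
      · rw [extz_eq_zero _ (by omega)]
    · split_ifs with hs
      · rw [← mul_assoc, ← zpow_add₀ q0]
        congr 2
        ring
      · rw [extz_eq_zero _ (by omega), mul_zero, mul_zero]

theorem dualWeyl_zero_equiv : Nonempty (VT (DualWeyl 𝕜 0) ≃ₗ[Uq 𝕜] DualWeyl 𝕜 1) := by
  obtain ⟨g, hg⟩ := dualWeyl_up_spec 𝕜 0
  have q0 := qv_ne_zero (𝕜 := 𝕜)
  refine ⟨LinearEquiv.ofBijective g ⟨(injective_iff_map_eq_zero _).mpr fun w h => ?_,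
    dualWeyl_up_surjective 𝕜 _ hg⟩⟩
  obtain ⟨w0, w1, rfl⟩ := VT.exists_ofCoord w
  have h' : ∀ s : Fin 2, qv 𝕜 ^ (-(s : ℤ)) * extz (n := 1) w1 s
      - qv 𝕜 ^ (-1 : ℤ) * extz (n := 1) w0 (s + -1) = 0 :=
    fun s => congrFun ((hg w0 w1).symm.trans h) s
  have e0 := h' 0
  have e1 := h' 1
  rw [extz_eq_zero w0 (by simp)] at e0
  rw [extz_eq_zero w1 (by simp)] at e1
  simp [q0] at e0 e1
  refine (VT.ofCoord_ext (fun s => ?_) fun s => ?_).symm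
  · have e2 := (extz_apply (n := 1) w0 s).symm
    rw [Subsingleton.elim (α := Fin 1) s 0] at e2 ⊢
    exact (e2.trans e1).symm
  · have e2 := (extz_apply (n := 1) w1 s).symm
    rw [Subsingleton.elim (α := Fin 1) s 0] at e2 ⊢
    exact (e2.trans e0).symm

end WeylSequences

/-! ### Divided powers on Weyl modules -/

section DividedPowers

theorem exists_bz (a n : ℕ) : ∃ b : Zv, algebraMap Zv Qv b
    = (qfact n)⁻¹ * ∏ s ∈ Finset.range n, qint ((a : ℤ) + s + 1) :=
  qbinom_mem a n

/-- The quantum binomial coefficient `[a + n choose n]` as a Laurent polynomial. -/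
noncomputable def bz (a n : ℕ) : Zv := (exists_bz a n).choose

theorem bz_spec (a n : ℕ) : algebraMap Zv Qv (bz a n)
    = (qfact n)⁻¹ * ∏ s ∈ Finset.range n, qint ((a : ℤ) + s + 1) :=
  (exists_bz a n).choose_spec

theorem bz_zero_left (n : ℕ) : bz 0 n = 1 := by
  apply IsFractionRing.injective Zv Qv
  rw [bz_spec, map_one]
  have : ∏ s ∈ Finset.range n, qint (((0 : ℕ) : ℤ) + s + 1) = qfact n := by simp [qfact]
  rw [this, inv_mul_cancel₀ (qfact_ne_zero n)]

theorem bz_zero_right (a : ℕ) : bz a 0 = 1 := by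
  apply IsFractionRing.injective Zv Qv
  simp [bz_spec, qfact]

/-- The element `Σ_{i < j} v^{l (j - 1 - 2 i)}`; for `l = 1` it is the quantum integer `[j]`. -/
noncomputable def qz (l j : ℕ) : Zv :=
  ∑ i ∈ Finset.range j, LaurentPolynomial.T ((l : ℤ) * (j - 1 - 2 * i))

theorem qz_mul (l j : ℕ) : qz l j * (LaurentPolynomial.T l - LaurentPolynomial.T (-l))
    = LaurentPolynomial.T (l * j) - LaurentPolynomial.T (-(l * j)) := by
  have h : ∀ i : ℕ, (LaurentPolynomial.T ((l : ℤ) * (j - 1 - 2 * i)) : Zv)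
      * (LaurentPolynomial.T l - LaurentPolynomial.T (-l))
      = (LaurentPolynomial.T ((l : ℤ) * (j - 2 * i)) : Zv)
        - LaurentPolynomial.T ((l : ℤ) * (j - 2 * (i + 1 : ℕ))) := fun i => by
    rw [mul_sub, ← LaurentPolynomial.T_add, ← LaurentPolynomial.T_add]
    congr 2 <;> (push_cast; ring)
  rw [qz, Finset.sum_mul, Finset.sum_congr rfl fun i _ => h i, Finset.sum_range_sub']
  congr 2
  ring

/-- With `qz_mul`, this allows cancelling `v^l - v^{-l}` in the domain `ℤ[v, v⁻¹]` before
specializing, where it may become zero. -/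
theorem T_sub_T_ne_zero (l : ℕ) (hl : l ≠ 0) :
    (LaurentPolynomial.T l - LaurentPolynomial.T (-l) : Zv) ≠ 0 := by
  intro h
  have := congrArg (algebraMap Zv Qv) h
  rw [map_sub, alg_T, alg_T, map_zero] at this
  exact v_sub_ne_zero l (by exact_mod_cast hl) this

theorem alg_qz_one (j : ℕ) : algebraMap Zv Qv (qz 1 j) = qint j := by
  have h := congrArg (algebraMap Zv Qv) (qz_mul 1 j)
  simp only [map_mul, map_sub, alg_T, Nat.cast_one, one_mul, zpow_one, zpow_neg_one] at h
  rw [qint, eq_div_iff v_sub_inv_ne_zero, h]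

theorem qz_one_mul (l j : ℕ) : qz 1 (l * j) = qz 1 l * qz l j := by
  rcases Nat.eq_zero_or_pos l with rfl | hl
  · simp [qz]
  refine mul_right_cancel₀ (T_sub_T_ne_zero 1 one_ne_zero) ?_
  have h1 := qz_mul 1 (l * j)
  have h2 := qz_mul 1 l
  have h3 := qz_mul l j
  rw [mul_right_comm, h2, h1]
  push_cast at h3 ⊢
  rw [one_mul, one_mul, ← h3]
  ring

theorem bz_succ (a t : ℕ) : bz a (t + 1) * qz 1 (t + 1) = qz 1 (a + 1) * bz (a + 1) t := by
  apply IsFractionRing.injective Zv Qv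
  rw [map_mul, map_mul, bz_spec, bz_spec, alg_qz_one, alg_qz_one, qfact_succ,
    Finset.prod_range_succ']
  have h1 : ∀ s : ℕ, qint ((a : ℤ) + ((s + 1 : ℕ) : ℤ) + 1) = qint (((a + 1 : ℕ) : ℤ) + s + 1) :=
    fun s => congrArg qint (by push_cast; ring)
  simp only [h1]
  have h2 : qint ((t : ℤ) + 1) ≠ 0 := qint_ne_zero _ (by omega)
  have h3 := qfact_ne_zero t
  push_cast
  rw [add_zero]
  field_simp

end DividedPowers

section Specialization

variable {𝕜 : Type u} [Field 𝕜] [Algebra Zv 𝕜]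

theorem alg_qz_ne_zero {j : ℕ} (h : qv 𝕜 ^ (2 * j) ≠ 1) : algebraMap Zv 𝕜 (qz 1 j) ≠ 0 := by
  intro h0
  have h1 := congrArg (algebraMap Zv 𝕜) (qz_mul 1 j)
  rw [map_mul, h0, zero_mul, map_sub, T_zpow, T_zpow] at h1
  have q0 := qv_ne_zero (𝕜 := 𝕜)
  apply h
  have h2 := sub_eq_zero.mp h1.symm
  rw [Nat.cast_one, one_mul, zpow_neg, zpow_natCast] at h2
  rw [two_mul, pow_add]
  nth_rw 1 [h2]
  exact inv_mul_cancel₀ (pow_ne_zero _ q0)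

theorem alg_qz_ne_zero_of_pow [CharZero 𝕜] {l j : ℕ} (hj : j ≠ 0) (h : qv 𝕜 ^ l = -1) :
    algebraMap Zv 𝕜 (qz l j) ≠ 0 := by
  have q0 := qv_ne_zero (𝕜 := 𝕜)
  have h1 : ∀ i : ℕ, algebraMap Zv 𝕜 (LaurentPolynomial.T ((l : ℤ) * (j - 1 - 2 * i)))
      = (-1) ^ ((j : ℤ) - 1) := fun i => by
    rw [T_zpow, zpow_mul, zpow_natCast, h, zpow_sub₀ (by simp), zpow_mul]
    simp
  rw [qz, map_sum, Finset.sum_congr rfl fun i _ => h1 i, Finset.sum_const, Finset.card_range,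
    nsmul_eq_mul]
  exact mul_ne_zero (Nat.cast_ne_zero.mpr hj) (zpow_ne_zero _ (by simp))

/-- For `a + t + 1` at most `l` or a multiple of `l`, the quantum binomial coefficient
`[a + t choose t]` does not vanish at the root of unity. -/
theorem alg_bz_ne_zero [CharZero 𝕜] {l : ℕ} (hl : 0 < l) (h : qv 𝕜 ^ l = -1)
    (hq : ∀ j, qv 𝕜 ^ (2 * j) = 1 → l ∣ j) (n : ℕ) (hn : n ≤ l ∨ l ∣ n) (a t : ℕ)
    (hat : a + t + 1 = n) : algebraMap Zv 𝕜 (bz a t) ≠ 0 := by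
  induction t generalizing a with
  | zero => simp [bz_zero_right]
  | succ t ih =>
    have ih := ih (a + 1) (by omega)
    have hs := congrArg (algebraMap Zv 𝕜) (bz_succ a t)
    rw [map_mul, map_mul] at hs
    -- if `l` divides both indices, the common factor `[l]` has to be cancelled over `ℤ[v, v⁻¹]`;
    -- the quotients specialize, up to sign, to integers
    by_cases ht : l ∣ t + 1
    · have ha : l ∣ a + 1 := by
        rcases hn with hn | hn
        · have := Nat.le_of_dvd (by omega) ht
          omega
        · refine (Nat.dvd_add_right ht).mp ?_
          rw [← hat] at hn
          convert hn using 1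
          omega
      obtain ⟨x, hx⟩ := ht
      obtain ⟨y, hy⟩ := ha
      have hs := bz_succ a t
      have hl0 : qz 1 l ≠ 0 := fun h0 => by
        have := alg_qz_one l
        rw [h0, map_zero] at this
        exact qint_ne_zero l (by omega) this.symm
      rw [hx, hy, qz_one_mul, qz_one_mul, mul_left_comm, mul_assoc] at hs
      have hs := congrArg (algebraMap Zv 𝕜) (mul_left_cancel₀ hl0 hs)
      rw [map_mul, map_mul] at hs
      have hy0 : y ≠ 0 := by rintro rfl; omega
      intro h0
      rw [← hx, ← hy, h0, zero_mul] at hs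
      exact mul_ne_zero (alg_qz_ne_zero_of_pow hy0 h) ih hs.symm
    · have ha : ¬ l ∣ a + 1 := by
        rcases hn with hn | hn
        · exact Nat.not_dvd_of_pos_of_lt (by omega) (by omega)
        · intro ha
          rw [← hat] at hn
          refine ht ((Nat.dvd_add_right ha).mp ?_)
          convert hn using 1
          omega
      intro h0
      rw [h0, zero_mul] at hs
      exact mul_ne_zero (alg_qz_ne_zero fun h1 => ha (hq _ h1)) ih hs.symm

variable (𝕜)

/-- The divided power `E⁽ⁿ⁾` in `U_q(sl₂)`. -/
noncomputable def dE (n : ℕ) : Uq 𝕜 := inq 𝕜 ⟨_, divPow_E_mem n⟩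

/-- The divided power `F⁽ⁿ⁾` in `U_q(sl₂)`. -/
noncomputable def dF (n : ℕ) : Uq 𝕜 := inq 𝕜 ⟨_, divPow_F_mem n⟩

variable {𝕜}

theorem ρq_inq (R : LatticeRep) (x : UA) :
    R.ρq 𝕜 (inq 𝕜 x) = (R.ρA x).map (algebraMap Zv 𝕜) := by
  rw [inq, LatticeRep.ρq_tmul, one_smul]

theorem ρA_divE (m n : ℕ) (i j : Fin (m + 1)) :
    (weylRep m).ρA ⟨_, divPow_E_mem n⟩ i j = if (i : ℕ) + n = j then bz (m - j) n else 0 := by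
  apply IsFractionRing.injective Zv Qv
  have h := congrFun (congrFun ((weylRep m).ρA_map ⟨_, divPow_E_mem n⟩) i) j
  refine h.trans ?_
  have h2 : (weylRep m).ρ (divPow (gen Gen.E) n) = divPow (weylE m) n := by
    rw [divPow, map_smul, map_pow, weylRep_E]
    rfl
  refine (congrFun (congrFun h2 i) j).trans ?_
  simp only [divPow, Matrix.smul_apply, weylE_pow, smul_eq_mul]
  split_ifs
  · rw [bz_spec]
  · simp

theorem ρA_divF (m n : ℕ) (i j : Fin (m + 1)) :
    (weylRep m).ρA ⟨_, divPow_F_mem n⟩ i j = if (i : ℕ) = j + n then bz j n else 0 := by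
  apply IsFractionRing.injective Zv Qv
  have h := congrFun (congrFun ((weylRep m).ρA_map ⟨_, divPow_F_mem n⟩) i) j
  refine h.trans ?_
  have h2 : (weylRep m).ρ (divPow (gen Gen.F) n) = divPow (weylF m) n := by
    rw [divPow, map_smul, map_pow, weylRep_F]
    rfl
  refine (congrFun (congrFun h2 i) j).trans ?_
  simp only [divPow, Matrix.smul_apply, weylF_pow, smul_eq_mul]
  split_ifs
  · rw [bz_spec]
  · simp

/-- The element of a Weyl module with the given coordinates. -/
def wv {m : ℕ} (w : Fin (m + 1) → 𝕜) : Weyl 𝕜 m := w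

theorem dE_smul (m n : ℕ) (w : Fin (m + 1) → 𝕜) (s : Fin (m + 1)) :
    (dE 𝕜 n • wv w) s
      = algebraMap Zv 𝕜 (bz (m - (s + n)) n) * extz w (s + n) := by
  have h : ((weylRep m).ρq 𝕜 (dE 𝕜 n)) = ((weylRep m).ρA ⟨_, divPow_E_mem n⟩).map _ := ρq_inq _ _
  refine (congrArg (fun A : Matrix (Fin (m + 1)) (Fin (m + 1)) 𝕜 => A.mulVec w s) h).trans ?_
  refine congrFun (mulVec_eq_extz (c := fun z => algebraMap Zv 𝕜 (bz (m - (z.toNat + n)) n))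
    (d := n) (fun i j => ?_) w) s
  refine (congrArg (algebraMap Zv 𝕜) (ρA_divE m n i j)).trans ?_
  by_cases hij : (i : ℕ) + n = j
  · rw [if_pos hij, if_pos (by omega), ← hij]
    simp
  · rw [if_neg hij, if_neg (by omega), map_zero]

theorem dF_smul (m n : ℕ) (w : Fin (m + 1) → 𝕜) (s : Fin (m + 1)) :
    (dF 𝕜 n • wv w) s
      = algebraMap Zv 𝕜 (bz (s - n) n) * extz w (s + -n) := by
  have h : ((weylRep m).ρq 𝕜 (dF 𝕜 n)) = ((weylRep m).ρA ⟨_, divPow_F_mem n⟩).map _ := ρq_inq _ _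
  refine (congrArg (fun A : Matrix (Fin (m + 1)) (Fin (m + 1)) 𝕜 => A.mulVec w s) h).trans ?_
  refine congrFun (mulVec_eq_extz (c := fun z => algebraMap Zv 𝕜 (bz (z.toNat - n) n))
    (d := -n) (fun i j => ?_) w) s
  refine (congrArg (algebraMap Zv 𝕜) (ρA_divF m n i j)).trans ?_
  by_cases hij : (i : ℕ) = j + n
  · rw [if_pos hij, if_pos (by omega), hij, Int.toNat_natCast, Nat.add_sub_cancel]
  · rw [if_neg hij, if_neg (by omega), map_zero]

theorem sc_smul_spec {R : LatticeRep} (c : 𝕜) (w : R.Spec 𝕜) (s : R.ι) :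
    (sc 𝕜 c • w) s = c * w s := by
  have h : R.ρq 𝕜 (sc 𝕜 c) = algebraMap 𝕜 _ c := AlgHom.commutes _ c
  refine (congrArg (fun A : Matrix R.ι R.ι 𝕜 => A.mulVec w s) h).trans ?_
  rw [Algebra.algebraMap_eq_smul_one]
  refine (congrFun (Matrix.smul_mulVec c (1 : Matrix R.ι R.ι 𝕜) w) s).trans ?_
  exact congrArg (c * ·) (congrFun (Matrix.one_mulVec (α := 𝕜) (m := R.ι) w) s)

/-- The module `R.Spec 𝕜` is the vector space of coordinate vectors. -/
noncomputable def specEquiv (R : LatticeRep) : Rs 𝕜 (Uq 𝕜) (R.Spec 𝕜) ≃ₗ[𝕜] (R.ι → 𝕜) where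
  toFun w := w
  invFun w := w
  map_add' _ _ := rfl
  map_smul' c w := funext fun s => sc_smul_spec c w s
  left_inv _ := rfl
  right_inv _ := rfl

theorem fd_spec (R : LatticeRep) : FD 𝕜 (Uq 𝕜) (R.Spec 𝕜) :=
  Module.Finite.equiv (specEquiv R).symm

theorem rk_spec (R : LatticeRep) : rk 𝕜 (Uq 𝕜) (R.Spec 𝕜) = Fintype.card R.ι := by
  rw [rk, (specEquiv R).finrank_eq, Module.finrank_fintype_fun_eq_card]

theorem rk_weyl (m : ℕ) : rk 𝕜 (Uq 𝕜) (Weyl 𝕜 m) = m + 1 :=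
  (rk_spec _).trans (Fintype.card_fin (m + 1))

theorem rk_dualWeyl (m : ℕ) : rk 𝕜 (Uq 𝕜) (DualWeyl 𝕜 m) = m + 1 :=
  (rk_spec _).trans (Fintype.card_fin (m + 1))

theorem tr_spec (R : LatticeRep) (u : Uq 𝕜) : tr 𝕜 u (R.Spec 𝕜) = (R.ρq 𝕜 u).trace := by
  rw [tr, ← LinearMap.trace_conj' _ (specEquiv R), ← Matrix.trace_toLin'_eq]
  rfl

theorem tr_dF_dE_of_lt {m n : ℕ} (h : m < n) : tr 𝕜 (dF 𝕜 n * dE 𝕜 n) (Weyl 𝕜 m) = 0 := by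
  have h0 : rsSmul 𝕜 (Weyl 𝕜 m) (dF 𝕜 n * dE 𝕜 n) = 0 := by
    refine LinearMap.ext fun (w : Fin (m + 1) → 𝕜) => ?_
    have h1 : dE 𝕜 n • wv w = 0 := funext fun (s : Fin (m + 1)) => by
      refine (dE_smul m n w s).trans ?_
      rw [extz_eq_zero _ (by omega), mul_zero]
      rfl
    refine (mul_smul (dF 𝕜 n) (dE 𝕜 n) (wv w)).trans ?_
    rw [h1, smul_zero]
    rfl
  rw [tr, h0, map_zero]

/-- Only the highest weight vector contributes to the trace. -/
theorem tr_dF_dE_self (m : ℕ) : tr 𝕜 (dF 𝕜 m * dE 𝕜 m) (Weyl 𝕜 m) = 1 := by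
  rw [tr_spec, Matrix.trace]
  have h : ∀ s : Fin (m + 1), (((weylRep m).ρq 𝕜 (dF 𝕜 m * dE 𝕜 m) :
      Matrix (Fin (m + 1)) (Fin (m + 1)) 𝕜) s s) = if s = Fin.last m then 1 else 0 := fun s => by
    have e1 : ∀ A : Matrix (Fin (m + 1)) (Fin (m + 1)) 𝕜, A s s = A.mulVec (Pi.single s 1) s :=
      fun A => by simp
    refine (e1 _).trans ?_
    have e2 : ((weylRep m).ρq 𝕜 (dF 𝕜 m * dE 𝕜 m)).mulVec (Pi.single s 1 : Fin (m + 1) → 𝕜)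
        = dF 𝕜 m • dE 𝕜 m • wv (Pi.single s 1 : Fin (m + 1) → 𝕜) := by
      rw [← mul_smul]
      rfl
    refine (congrFun e2 s).trans ?_
    have e3 := dE_smul m m (Pi.single s 1 : Fin (m + 1) → 𝕜) 0
    generalize hx : (dE 𝕜 m • wv (Pi.single s 1 : Fin (m + 1) → 𝕜)) = x at e3 ⊢
    refine (dF_smul m m x s).trans ?_
    split_ifs with hs
    · subst hs
      have e4 : (((Fin.last m : Fin (m + 1)) : ℕ) : ℤ) + -m = ((0 : Fin (m + 1)) : ℕ) := by simp
      rw [e4, extz_of_eq (n := m + 1) x 0 rfl]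
      refine (congrArg _ e3).trans ?_
      rw [extz_of_eq _ (Fin.last m) (by simp)]
      simp [bz_zero_left]
    · rw [extz_eq_zero (n := m + 1) x, mul_zero]
      have : (s : ℕ) ≠ m := fun h => hs (Fin.ext h)
      omega
  refine (Finset.sum_congr rfl fun s _ => h s).trans ?_
  exact (Finset.sum_ite_eq' _ _ _).trans (if_pos (Finset.mem_univ (Fin.last m)))

theorem wv_single_same {𝕜 : Type u} [Field 𝕜] {m : ℕ} (t : Fin (m + 1)) (c : 𝕜) :
    wv (Pi.single t c : Fin (m + 1) → 𝕜) t = c :=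
  Pi.single_eq_same (M := fun _ : Fin (m + 1) => 𝕜) t c

theorem wv_single_ne {𝕜 : Type u} [Field 𝕜] {m : ℕ} {t s : Fin (m + 1)} (h : s ≠ t) (c : 𝕜) :
    wv (Pi.single t c : Fin (m + 1) → 𝕜) s = 0 :=
  Pi.single_eq_of_ne (M := fun _ : Fin (m + 1) => 𝕜) h c

/-- The highest weight vector of a Weyl module. -/
noncomputable def hw (m : ℕ) : Weyl 𝕜 m := wv (Pi.single (0 : Fin (m + 1)) 1)

theorem dF_hw (m : ℕ) (t : Fin (m + 1)) : dF 𝕜 t • (hw m : Weyl 𝕜 m) = wv (Pi.single t 1) := by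
  refine funext fun (s : Fin (m + 1)) => (dF_smul m t _ s).trans ?_
  by_cases hs : (t : ℕ) ≤ s
  · have e : ((s : ℕ) : ℤ) + -((t : ℕ) : ℤ) = ((⟨s - t, by omega⟩ : Fin (m + 1)) : ℕ) := by
      simp only
      omega
    rw [e, extz_apply]
    by_cases hst : s = t
    · subst hst
      refine Eq.trans ?_ (wv_single_same _ _).symm
      have e2 : (⟨(s : ℕ) - s, by omega⟩ : Fin (m + 1)) = 0 := Fin.ext (by simp)
      rw [e2, Nat.sub_self, bz_zero_left, map_one, one_mul, Pi.single_eq_same]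
    · have h1 : (s : ℕ) ≠ t := fun h => hst (Fin.ext h)
      have h2 : (⟨s - t, by omega⟩ : Fin (m + 1)) ≠ 0 := fun h => by
        have := congrArg Fin.val h
        simp only [Fin.val_zero] at this
        omega
      rw [Pi.single_eq_of_ne h2, mul_zero]
      exact (wv_single_ne hst _).symm
  · have hst : s ≠ t := fun h => hs (by rw [h])
    rw [extz_eq_zero _ (by omega), mul_zero]
    exact (wv_single_ne hst _).symm

theorem weyl_eq_sum (m : ℕ) (y : Fin (m + 1) → 𝕜) :
    wv y = (∑ t : Fin (m + 1), sc 𝕜 (y t) * dF 𝕜 t) • (hw m : Weyl 𝕜 m) := by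
  rw [Finset.sum_smul]
  have h : ∀ t : Fin (m + 1), (sc 𝕜 (y t) * dF 𝕜 t) • (hw m : Weyl 𝕜 m) = wv (Pi.single t (y t)) :=
    fun t => by
      rw [mul_smul, dF_hw]
      refine funext fun s => (sc_smul_spec _ _ s).trans ?_
      refine (congrFun (Pi.single_smul (f := fun _ : Fin (m + 1) => 𝕜) t (y t) 1) s).symm.trans ?_
      rw [smul_eq_mul, mul_one]
      rfl
  simp only [h]
  exact (Finset.univ_sum_single y).symm

/-- All the binomial coefficients `[m choose t]` are nonzero in `𝕜`. -/
def BinomNe (𝕜 : Type u) [Field 𝕜] [Algebra Zv 𝕜] (m : ℕ) : Prop :=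
  ∀ a t, a + t = m → algebraMap Zv 𝕜 (bz a t) ≠ 0

/-- A divided power of `E` takes a vector with a nonzero last coordinate to a multiple of the
highest weight vector. -/
theorem dE_to_hw {m : ℕ} (w : Fin (m + 1) → 𝕜) (t : Fin (m + 1)) (ht : ∀ s, t < s → w s = 0) :
    dE 𝕜 t • wv w = sc 𝕜 (algebraMap Zv 𝕜 (bz (m - t) t) * w t) • hw m := by
  refine funext fun (s : Fin (m + 1)) => ?_
  refine (dE_smul m t w s).trans ?_
  have e := sc_smul_spec (algebraMap Zv 𝕜 (bz (m - t) t) * w t) (hw m : Weyl 𝕜 m) s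
  refine Eq.trans ?_ e.symm
  by_cases hs : s = 0
  · subst hs
    have e2 : (hw m : Weyl 𝕜 m) (0 : Fin (m + 1)) = (1 : 𝕜) := wv_single_same _ _
    refine Eq.trans ?_ (congrArg (algebraMap Zv 𝕜 (bz (m - t) t) * w t * ·) e2.symm)
    rw [extz_of_eq _ t (by simp), Fin.val_zero, zero_add, mul_one]
  · have e2 : (hw m : Weyl 𝕜 m) s = (0 : 𝕜) := wv_single_ne hs _
    refine Eq.trans ?_ (congrArg (algebraMap Zv 𝕜 (bz (m - t) t) * w t * ·) e2.symm)
    have h0 : (s : ℕ) ≠ 0 := fun h => hs (Fin.ext h)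
    refine Eq.trans ?_ (mul_zero _).symm
    by_cases hst : (s : ℕ) + t < m + 1
    · rw [extz_of_eq _ ⟨s + t, hst⟩ (by simp), ht _ (by
        rw [Fin.lt_def]
        simp only
        omega), mul_zero]
    · rw [extz_eq_zero _ (by omega), mul_zero]

theorem exists_top {𝕜 : Type*} [Field 𝕜] {m : ℕ} {w : Fin (m + 1) → 𝕜} (hw : w ≠ 0) :
    ∃ t, w t ≠ 0 ∧ ∀ s, t < s → w s = 0 := by
  classical
  obtain ⟨i, hi⟩ := Function.ne_iff.mp hw
  have hne : (Finset.univ.filter fun s => w s ≠ 0).Nonempty := ⟨i, by simpa using hi⟩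
  refine ⟨Finset.max' _ hne, (Finset.mem_filter.mp (Finset.max'_mem _ hne)).2, fun s hs => ?_⟩
  by_contra h
  exact absurd (Finset.le_max' _ s (Finset.mem_filter.mpr ⟨Finset.mem_univ _, h⟩)) (not_le.mpr hs)

theorem hw_ne_zero {𝕜 : Type u} [Field 𝕜] (m : ℕ) : (hw m : Weyl 𝕜 m) ≠ 0 := fun h => by
  have := congrFun h (0 : Fin (m + 1))
  exact one_ne_zero ((wv_single_same (0 : Fin (m + 1)) (1 : 𝕜)).symm.trans this)

theorem weyl_simple {m : ℕ} (h : BinomNe 𝕜 m) : IsSimpleModule (Uq 𝕜) (Weyl 𝕜 m) := by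
  rw [isSimpleModule_iff_toSpanSingleton_surjective]
  refine ⟨⟨hw m, 0, hw_ne_zero m⟩, fun (w : Fin (m + 1) → 𝕜) hw0 (y : Fin (m + 1) → 𝕜) => ?_⟩
  obtain ⟨t, ht, hts⟩ := exists_top hw0
  have hc := mul_ne_zero (h (m - t) t (by omega)) ht
  refine ⟨(∑ s : Fin (m + 1), sc 𝕜 (y s) * dF 𝕜 s) * sc 𝕜 (algebraMap Zv 𝕜 (bz (m - t) t) * w t)⁻¹
    * dE 𝕜 t, ?_⟩
  refine (LinearMap.toSpanSingleton_apply (Uq 𝕜) (Weyl 𝕜 m) (wv w) _).trans ?_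
  rw [mul_smul, mul_smul]
  refine (congrArg _ (congrArg _ (dE_to_hw w t hts))).trans ?_
  rw [← mul_smul (sc 𝕜 _) (sc 𝕜 _), ← map_mul, inv_mul_cancel₀ hc, map_one, one_smul]
  exact (weyl_eq_sum m y).symm

/-- The endomorphisms of a simple Weyl module are scalars. -/
theorem weyl_end {m : ℕ} (h : BinomNe 𝕜 m) (f : Weyl 𝕜 m →ₗ[Uq 𝕜] Weyl 𝕜 m) :
    ∃ c : 𝕜, ∀ x, f x = sc 𝕜 c • x := by
  -- the image of the highest weight vector is killed by all `E⁽ᵗ⁾` with `t > 0`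
  have key : ∃ c : 𝕜, f (hw m) = sc 𝕜 c • hw m := by
    by_cases h0 : f (hw m) = 0
    · exact ⟨0, by rw [h0, map_zero, zero_smul (Uq 𝕜) (hw m : Weyl 𝕜 m)]⟩
    let w : Fin (m + 1) → 𝕜 := f (hw m)
    obtain ⟨t, ht, hts⟩ := exists_top (w := w) h0
    have hE := dE_to_hw w t hts
    by_cases ht0 : t = 0
    · subst ht0
      have h1 : dE 𝕜 ((0 : Fin (m + 1)) : ℕ) • wv w = wv w :=
        funext fun s => (dE_smul m _ w s).trans (by
          simpa [bz_zero_right, wv] using extz_apply w s)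
      exact ⟨_, h1.symm.trans hE⟩
    · exfalso
      have h1 : dE 𝕜 t • (hw m : Weyl 𝕜 m) = 0 := by
        refine funext fun (s : Fin (m + 1)) => (dE_smul m t _ s).trans ?_
        have ht1 : (t : ℕ) ≠ 0 := fun h => ht0 (Fin.ext h)
        by_cases hst : (s : ℕ) + t < m + 1
        · rw [extz_of_eq _ ⟨s + t, hst⟩ (by simp), Pi.single_eq_of_ne, mul_zero]
          · rfl
          · intro h
            have := congrArg Fin.val h
            simp only [Fin.val_zero] at this
            omega
        · rw [extz_eq_zero _ (by omega), mul_zero]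
          rfl
      have h2 : dE 𝕜 t • wv w = 0 := by
        have : dE 𝕜 t • f (hw m) = 0 := by rw [← map_smul, h1, map_zero]
        exact this
      have h3 := congrFun (hE.symm.trans h2) (0 : Fin (m + 1))
      have h4 := (sc_smul_spec _ _ _).symm.trans h3
      have h5 : (hw m : Weyl 𝕜 m) (0 : Fin (m + 1)) = (1 : 𝕜) := wv_single_same _ _
      refine mul_ne_zero (h (m - t) t (by omega)) ht ?_
      refine (mul_one _).symm.trans ((congrArg _ h5.symm).trans h4)
  obtain ⟨c, hc⟩ := key
  refine ⟨c, fun (x : Fin (m + 1) → 𝕜) => ?_⟩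
  have hx : (x : Weyl 𝕜 m) = _ := weyl_eq_sum m x
  refine (congrArg f hx).trans ?_
  rw [map_smul, hc, ← sc_smul_comm]
  exact congrArg _ hx.symm

end Specialization


/-! ### The Casimir element on Weyl modules; self-duality -/

section Casimir

variable {𝕜 : Type u} [Field 𝕜] [Algebra Zv 𝕜]

variable (𝕜) in
/-- The eigenvalue `qⁿ + q⁻ⁿ` of the Casimir element on the Weyl module of highest weight
`n - 1`. -/
noncomputable def lam (n : ℕ) : 𝕜 := qv 𝕜 ^ n + (qv 𝕜)⁻¹ ^ n

/-- The Casimir element acts by a scalar after specialization if it does so over `ℚ(v)`. -/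
theorem kills_of_acts {R : LatticeRep} {rE rF rK rKi : (R.ι → Qv) → R.ι → Qv}
    (hR : Acts R rE rF rK rKi) (n : ℕ)
    (h : ∀ w s, (v - v⁻¹) ^ 2 * rF (rE w) s + v * rK w s + v⁻¹ * rKi w s
      = (v ^ (n : ℤ) + v ^ (-(n : ℤ))) * w s) : Kills (cl (lam 𝕜 n)) (R.Spec 𝕜) := by
  have h1 : R.ρ cas = (v ^ (n : ℤ) + v ^ (-(n : ℤ))) • (1 : Matrix R.ι R.ι Qv) := by
    refine Matrix.toLin'.injective (LinearMap.ext fun w => funext fun s => ?_)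
    rw [Matrix.toLin'_apply, Matrix.toLin'_apply, Matrix.smul_mulVec, Matrix.one_mulVec,
      Pi.smul_apply, smul_eq_mul, ← h w s, cas]
    simp only [map_add, map_smul, map_mul, Matrix.add_mulVec, Matrix.smul_mulVec,
      ← Matrix.mulVec_mulVec, hR.E, hR.F, hR.K, hR.Ki, Pi.add_apply, Pi.smul_apply, smul_eq_mul]
  have h2 : R.ρA casA = (LaurentPolynomial.T n + LaurentPolynomial.T (-n) : Zv)
      • (1 : Matrix R.ι R.ι Zv) := by
    refine LatticeRep.integralMatrices_injective R.ι ((R.ρA_map casA).trans ?_)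
    rw [casA_coe, h1]
    refine Matrix.ext fun s t => ?_
    change _ = algebraMap Zv Qv _
    simp only [Matrix.smul_apply, smul_eq_mul, map_mul, map_add, alg_T, Matrix.one_apply]
    split_ifs <;> simp
  rw [kills_cl_iff]
  intro x
  have h3 : R.ρq 𝕜 (casq 𝕜) = lam 𝕜 n • 1 := by
    rw [casq, ρq_inq, h2]
    refine Matrix.ext fun s t => ?_
    simp only [Matrix.map_apply, Matrix.smul_apply, smul_eq_mul, map_mul, map_add, T_zpow, lam,
      Matrix.one_apply, zpow_neg, zpow_natCast, inv_pow]
    split_ifs <;> simp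
  refine funext fun s => Eq.trans ?_ (sc_smul_spec _ x s).symm
  refine (congrArg (fun A : Matrix R.ι R.ι 𝕜 => A.mulVec x s) h3).trans ?_
  refine (congrFun (Matrix.smul_mulVec _ (1 : Matrix R.ι R.ι 𝕜) x) s).trans ?_
  exact congrArg (lam 𝕜 n * ·) (congrFun (Matrix.one_mulVec (α := 𝕜) (m := R.ι) x) s)

theorem kills_weyl (a : ℕ) : Kills (cl (lam 𝕜 (a + 1))) (Weyl 𝕜 a) := by
  refine kills_of_acts (weyl_acts a) (a + 1) ?_
  intro (w : Fin (a + 1) → Qv) (s : Fin (a + 1))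
  rw [← extz_apply w s]
  have h0 : (0 : ℤ) ≤ (s : ℕ) := by omega
  have h1 : ((s : ℕ) : ℤ) < a + 1 := by omega
  simp only [res_apply, extz_res']
  generalize ((s : ℕ) : ℤ) = z at h0 h1 ⊢
  push_cast
  simp only [neg_add_cancel_right]
  have hv := v_ne_zero
  have hd := v_sub_inv_ne_zero
  split_ifs <;> try omega
  all_goals try
    (have hz : z = 0 := by omega
     subst hz
     simp only [qint_zero, mul_zero])
  all_goals try simp only [qint]
  all_goals generalize hdd : v - v⁻¹ = d at hd ⊢
  all_goals try simp only [neg_sub, neg_add_rev, zpow_add₀ hv, zpow_sub₀ hv, zpow_neg, zpow_one,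
    two_mul]
  all_goals try field_simp
  all_goals subst hdd
  all_goals try field_simp
  all_goals try ring

theorem kills_dualWeyl (a : ℕ) : Kills (cl (lam 𝕜 (a + 1))) (DualWeyl 𝕜 a) := by
  refine kills_of_acts (dualWeyl_acts a) (a + 1) ?_
  intro (w : Fin (a + 1) → Qv) (s : Fin (a + 1))
  rw [← extz_apply w s]
  have h0 : (0 : ℤ) ≤ (s : ℕ) := by omega
  have h1 : ((s : ℕ) : ℤ) < a + 1 := by omega
  simp only [res_apply, extz_res']
  generalize ((s : ℕ) : ℤ) = z at h0 h1 ⊢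
  push_cast
  simp only [add_neg_cancel_right]
  have hv := v_ne_zero
  have hd := v_sub_inv_ne_zero
  split_ifs <;> try omega
  all_goals try
    (have hz : z = a := by omega
     subst hz
     simp only [mul_zero])
  all_goals try simp only [qint]
  all_goals generalize hdd : v - v⁻¹ = d at hd ⊢
  all_goals try simp only [neg_sub, neg_add_rev, zpow_add₀ hv, zpow_sub₀ hv, zpow_neg, zpow_one,
    two_mul]
  all_goals try field_simp
  all_goals subst hdd
  all_goals try field_simp
  all_goals try ring

theorem exists_hom_of_acts {R S : LatticeRep} {rE rF rK rKi : (R.ι → Qv) → R.ι → Qv}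
    {sE sF sK sKi : (S.ι → Qv) → S.ι → Qv} (hR : Acts R rE rF rK rKi)
    (hS : Acts S sE sF sK sKi) (P : Matrix S.ι R.ι Zv) {p : (R.ι → Qv) → S.ι → Qv}
    (h : ∀ w, (P.map (algebraMap Zv Qv)).mulVec w = p w)
    (hE : ∀ w s, p (rE w) s = sE (p w) s) (hF : ∀ w s, p (rF w) s = sF (p w) s)
    (hK : ∀ w s, p (rK w) s = sK (p w) s) (hKi : ∀ w s, p (rKi w) s = sKi (p w) s) :
    ∃ f : R.Spec 𝕜 →ₗ[Uq 𝕜] S.Spec 𝕜, ∀ w, f w = (P.map (algebraMap Zv 𝕜)).mulVec w := by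
  refine ⟨latHom 𝕜 P fun g => ?_, fun w => latHom_apply 𝕜 P _ w⟩
  refine Matrix.toLin'.injective (LinearMap.ext fun w => funext fun s => ?_)
  rw [Matrix.toLin'_apply, Matrix.toLin'_apply, ← Matrix.mulVec_mulVec, ← Matrix.mulVec_mulVec]
  cases g
  · rw [hR.E, hS.E, h, h, hE]
  · rw [hR.F, hS.F, h, h, hF]
  · rw [hR.K, hS.K, h, h, hK]
  · rw [hR.Ki, hS.Ki, h, h, hKi]

/-- The coefficients of the homomorphism from a Weyl module to the dual Weyl module of the same
highest weight. -/
noncomputable def dualCoeff (a t : ℕ) : Zv :=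
  (-1) ^ t * LaurentPolynomial.T ((t : ℤ) * (t + 1) - (a + 2) * t) * bz (a - t) t

theorem dualCoeff_succ {a t : ℕ} (h : t < a) : algebraMap Zv Qv (dualCoeff a (t + 1))
      * qint (t + 1)
    = -v ^ (2 * (t : ℤ) - a) * qint (a - t) * algebraMap Zv Qv (dualCoeff a t) := by
  obtain ⟨b, rfl⟩ : ∃ b, a = t + 1 + b := ⟨a - (t + 1), by omega⟩
  have h1 := congrArg (algebraMap Zv Qv) (bz_succ b t)
  rw [map_mul, map_mul, alg_qz_one, alg_qz_one] at h1
  have e1 : t + 1 + b - (t + 1) = b := by omega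
  have e2 : t + 1 + b - t = b + 1 := by omega
  simp only [dualCoeff, e1, e2, map_mul, map_pow, map_neg, map_one, alg_T]
  have e3 : ((t + 1 + b : ℕ) : ℤ) - t = ((b + 1 : ℕ) : ℤ) := by push_cast; ring
  have e4 : qint ((t : ℤ) + 1) = qint ((t + 1 : ℕ) : ℤ) := by push_cast; rfl
  have e5 : (((t + 1 : ℕ) : ℤ) * ((t + 1 : ℕ) + 1) - (((t + 1 + b : ℕ) : ℤ) + 2) * (t + 1 : ℕ))
      = (2 * (t : ℤ) - (t + 1 + b : ℕ)) + ((t : ℤ) * (t + 1) - (((t + 1 + b : ℕ) : ℤ) + 2) * t) := by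
    push_cast
    ring
  rw [e3, e4, mul_assoc, h1, e5, zpow_add₀ v_ne_zero, pow_succ]
  ring

/-- The homomorphism reverses the order of the coordinates; it exists over `ℤ[v, v⁻¹]` because its
coefficients are quantum binomial coefficients up to units. -/
theorem exists_hom_weyl_dualWeyl (a : ℕ) : ∃ f : Weyl 𝕜 a →ₗ[Uq 𝕜] DualWeyl 𝕜 a, f ≠ 0 := by
  let A : Matrix (Fin (a + 1)) (Fin (a + 1)) Zv :=
    Matrix.of fun s r => if (s : ℕ) + r = a then dualCoeff a s else 0
  let c : ℤ → Qv := fun z => algebraMap Zv Qv (dualCoeff a z.toNat)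
  -- the recursion that compatibility with `E` and `F` imposes
  have hc : ∀ z : ℤ, 0 ≤ z → z < a → c (z + 1) * qint (z + 1)
      = -v ^ (2 * z - a) * qint (a - z) * c z := by
    intro z h0 h1
    obtain ⟨t, rfl⟩ := Int.eq_ofNat_of_zero_le h0
    exact dualCoeff_succ (by omega)
  have hA : ∀ w : Fin (a + 1) → Qv, (A.map (algebraMap Zv Qv)).mulVec w
      = res (a + 1) fun z => c z * extz w (a - z) := fun w => by
    refine funext fun s => ?_
    simp only [Matrix.mulVec, dotProduct, res_apply]
    have hs : (a : ℤ) - s = ((⟨a - s, by omega⟩ : Fin (a + 1)) : ℕ) := by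
      simp only
      omega
    rw [hs, extz_apply, Finset.sum_eq_single (⟨a - s, by omega⟩ : Fin (a + 1))]
    · have : (s : ℕ) + (a - s) = a := by omega
      simp [A, this, c]
    · intro t _ ht
      have : (s : ℕ) + t ≠ a := fun h => ht (Fin.ext (by simp only; omega))
      simp [A, this]
    · simp
  obtain ⟨f, hf⟩ := exists_hom_of_acts (𝕜 := 𝕜) (weyl_acts a) (dualWeyl_acts a) A hA
    (fun (w : Fin (a + 1) → Qv) (s : Fin (a + 1)) => by
      have h0 : (0 : ℤ) ≤ (s : ℕ) := by omega
      have h1 : ((s : ℕ) : ℤ) < a + 1 := by omega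
      simp only [res_apply, extz_res']
      generalize ((s : ℕ) : ℤ) = z at h0 h1 ⊢
      rw [if_pos (by omega), sub_sub_cancel]
      split_ifs with h
      · have e := hc (z + -1) (by omega) (by omega)
        rw [neg_add_cancel_right] at e
        rw [← mul_assoc, e, show -((a : ℤ) - 2 * z + 2) = 2 * (z + -1) - a by ring,
          show (a : ℤ) - z + 1 = a - (z + -1) by ring]
        ring
      · have hz : z = 0 := by omega
        subst hz
        simp)
    (fun (w : Fin (a + 1) → Qv) (s : Fin (a + 1)) => by
      have h0 : (0 : ℤ) ≤ (s : ℕ) := by omega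
      have h1 : ((s : ℕ) : ℤ) < a + 1 := by omega
      simp only [res_apply, extz_res']
      generalize ((s : ℕ) : ℤ) = z at h0 h1 ⊢
      rw [if_pos (by omega)]
      split_ifs with h
      · have e := hc z (by omega) (by omega)
        rw [neg_mul, mul_assoc, ← mul_assoc (qint (z + 1)), mul_comm (qint (z + 1)), e,
          show (a : ℤ) - z + -1 = a - (z + 1) by ring,
          show (a : ℤ) - 2 * z = -(2 * z - a) by ring, zpow_neg]
        have := zpow_ne_zero (2 * z - (a : ℤ)) v_ne_zero
        field_simp
      · have hz : z = a := by omega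
        subst hz
        simp)
    (fun (w : Fin (a + 1) → Qv) (s : Fin (a + 1)) => by
      have h0 : (0 : ℤ) ≤ (s : ℕ) := by omega
      have h1 : ((s : ℕ) : ℤ) < a + 1 := by omega
      simp only [res_apply, extz_res']
      generalize ((s : ℕ) : ℤ) = z at h0 h1 ⊢
      rw [if_pos (by omega), if_pos (by omega),
        show (a : ℤ) - 2 * (a - z) = -(a - 2 * z) by ring]
      ring)
    (fun (w : Fin (a + 1) → Qv) (s : Fin (a + 1)) => by
      have h0 : (0 : ℤ) ≤ (s : ℕ) := by omega
      have h1 : ((s : ℕ) : ℤ) < a + 1 := by omega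
      simp only [res_apply, extz_res']
      generalize ((s : ℕ) : ℤ) = z at h0 h1 ⊢
      rw [if_pos (by omega), if_pos (by omega),
        show -((a : ℤ) - 2 * (a - z)) = a - 2 * z by ring]
      ring)
  refine ⟨f, fun h0 => ?_⟩
  have h1 := (hf (Pi.single (Fin.last a) 1 : Fin (a + 1) → 𝕜)).symm.trans
    (LinearMap.congr_fun h0 _)
  have h2 := congrFun h1 (0 : Fin (a + 1))
  have h3 : ∀ B : Matrix (Fin (a + 1)) (Fin (a + 1)) 𝕜,
      B.mulVec (Pi.single (Fin.last a) 1) 0 = B 0 (Fin.last a) := fun B => by simp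
  have h4 := (h3 (A.map (algebraMap Zv 𝕜))).symm.trans h2
  simp only [A, Matrix.map_apply, Matrix.of_apply, Fin.val_zero, Fin.val_last, zero_add, if_true,
    dualCoeff, pow_zero, bz_zero_right, Nat.cast_zero, mul_zero, sub_zero,
    mul_one, LaurentPolynomial.T_zero, map_one] at h4
  exact one_ne_zero h4

end Casimir

section Families

variable (𝕜 : Type u) [Field 𝕜] [Algebra Zv 𝕜]

/-- The parameter `q` is a primitive `2 l`-th root of unity, with `l` odd. -/
structure IsRoot (l : ℕ) : Prop where
  odd : Odd l
  pow : qv 𝕜 ^ l = -1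
  dvd : ∀ j, qv 𝕜 ^ (2 * j) = 1 → l ∣ j

/-- The Weyl modules, indexed by dimension: `Wm n` has highest weight `n - 1`, and `Wm 0 = 0`. -/
noncomputable def Wm : ℕ → ModuleCat.{u} (Uq 𝕜)
  | 0 => ModuleCat.of _ PUnit
  | n + 1 => ModuleCat.of _ (Weyl 𝕜 n)

/-- The dual Weyl modules, indexed by dimension. -/
noncomputable def Wd : ℕ → ModuleCat.{u} (Uq 𝕜)
  | 0 => ModuleCat.of _ PUnit
  | n + 1 => ModuleCat.of _ (DualWeyl 𝕜 n)

instance : Subsingleton (Wm 𝕜 0) := inferInstanceAs (Subsingleton PUnit)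

instance : Subsingleton (Wd 𝕜 0) := inferInstanceAs (Subsingleton PUnit)

theorem fd_Wm (n : ℕ) : FD 𝕜 (Uq 𝕜) (Wm 𝕜 n) := by
  cases n
  · exact FD.of_subsingleton
  · exact fd_spec _

theorem rk_Wm (n : ℕ) : rk 𝕜 (Uq 𝕜) (Wm 𝕜 n) = n := by
  cases n
  · exact rk_of_subsingleton
  · exact rk_weyl _

theorem kills_Wm (n : ℕ) : Kills (cl (lam 𝕜 n)) (Wm 𝕜 n) := by
  cases n
  · exact fun x => Subsingleton.elim _ _
  · exact kills_weyl _

theorem kills_Wd (n : ℕ) : Kills (cl (lam 𝕜 n)) (Wd 𝕜 n) := by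
  cases n
  · exact fun x => Subsingleton.elim _ _
  · exact kills_dualWeyl _

theorem ses_of_equiv_left {U A M B : Type*} [Ring U] [AddCommGroup A] [Module U A]
    [AddCommGroup M] [Module U M] [AddCommGroup B] [Module U B] [Subsingleton B]
    (e : M ≃ₗ[U] A) : SES U A M B :=
  ⟨e.symm.toLinearMap, 0, e.symm.injective, fun x => ⟨fun _ => e.symm.surjective x,
    fun _ => Subsingleton.elim _ _⟩, fun _ => ⟨0, Subsingleton.elim _ _⟩⟩

theorem ses_of_equiv_right {U A M B : Type*} [Ring U] [AddCommGroup A] [Module U A]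
    [AddCommGroup M] [Module U M] [AddCommGroup B] [Module U B] [Subsingleton A]
    (e : M ≃ₗ[U] B) : SES U A M B :=
  ⟨0, e.toLinearMap, fun _ _ _ => Subsingleton.elim _ _, fun x => ⟨fun h => ⟨0, by
    rw [LinearMap.zero_apply]
    exact (e.injective (h.trans (map_zero e).symm)).symm⟩, by
    rintro ⟨y, rfl⟩
    simp⟩, e.surjective⟩

/-- `V ⊗ W` has a Weyl filtration with two factors. -/
theorem ses_Wm (n : ℕ) : SES (Uq 𝕜) (Wm 𝕜 (n + 2)) (VT (Wm 𝕜 (n + 1))) (Wm 𝕜 n) := by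
  cases n with
  | zero => exact ses_of_equiv_left (weyl_zero_equiv 𝕜).some
  | succ n => exact ses_weyl 𝕜 n

theorem ses_Wd (n : ℕ) : SES (Uq 𝕜) (Wd 𝕜 n) (VT (Wd 𝕜 (n + 1))) (Wd 𝕜 (n + 2)) := by
  cases n with
  | zero => exact ses_of_equiv_right (dualWeyl_zero_equiv 𝕜).some
  | succ n => exact ses_dualWeyl 𝕜 n

variable {𝕜} {l : ℕ}

theorem IsRoot.pos (h : IsRoot 𝕜 l) : 0 < l := h.odd.pos

/-- The dimensions `n ≤ l` and the multiples of `l`, for which the Weyl module of dimension `n` is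
simple. -/
def Good (l n : ℕ) : Prop := 0 < n ∧ (n ≤ l ∨ l ∣ n)

/-- The two factors of `V ⊗ Wm (n + 1)` lie in different blocks unless `l` divides `n + 1`. -/
theorem IsRoot.lam_ne (h : IsRoot 𝕜 l) {n : ℕ} (hn : ¬ l ∣ n + 1) :
    lam 𝕜 (n + 2) ≠ lam 𝕜 n := by
  have q0 := qv_ne_zero (𝕜 := 𝕜)
  intro he
  have h1 : (qv 𝕜 ^ (2 * 1) - 1) * (qv 𝕜 ^ (2 * (n + 1)) - 1) = 0 := by
    have h2 : (qv 𝕜 ^ (2 * 1) - 1) * (qv 𝕜 ^ (2 * (n + 1)) - 1)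
        = qv 𝕜 ^ (n + 2) * (lam 𝕜 (n + 2) - lam 𝕜 n) := by
      simp only [lam, inv_pow]
      field_simp
      ring
    rw [h2, he, sub_self, mul_zero]
  rcases mul_eq_zero.mp h1 with h2 | h2
  · exact hn ((h.dvd _ (sub_eq_zero.mp h2)).trans (one_dvd _))
  · exact hn (h.dvd _ (sub_eq_zero.mp h2))

/-- The linkage principle: Weyl modules whose dimensions are reflections of each other in a multiple
of `l` lie in the same block. -/
theorem IsRoot.lam_reflect (h : IsRoot 𝕜 l) {K a b : ℕ} (hab : a + b = 2 * (K * l)) :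
    lam 𝕜 a = lam 𝕜 b := by
  have q0 := qv_ne_zero (𝕜 := 𝕜)
  have h1 : qv 𝕜 ^ a * qv 𝕜 ^ b = 1 := by
    rw [← pow_add, hab, show 2 * (K * l) = l * (2 * K) by ring, pow_mul, h.pow, pow_mul]
    simp
  have h2 : qv 𝕜 ^ b = (qv 𝕜 ^ a)⁻¹ := eq_inv_of_mul_eq_one_right h1
  rw [lam, lam, inv_pow, inv_pow, h2, inv_inv, add_comm]

/-- The contraction of the block idempotent acts on a Weyl module by a nonzero scalar, for the
block of the smaller Weyl module in the tensor product. -/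
theorem IsRoot.theta_down (h : IsRoot 𝕜 l) {n : ℕ} (hn : ¬ l ∣ n) (hn1 : ¬ l ∣ n + 1) :
    ∃ c : 𝕜, c ≠ 0 ∧ ∀ x : Wm 𝕜 (n + 1),
      theta (eb 𝕜 (lam 𝕜 n) (lam 𝕜 (n + 2)) : Uq 𝕜) • x = sc 𝕜 c • x := by
  have q0 := qv_ne_zero (𝕜 := 𝕜)
  have hne := h.lam_ne hn1
  refine ⟨_, div_ne_zero ?_ (sub_ne_zero.mpr hne.symm), fun x =>
    theta_eb_smul hne.symm (kills_Wm 𝕜 (n + 1)) ?_ x⟩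
  · have h1 : (qv 𝕜 ^ 2 + (qv 𝕜)⁻¹ ^ 2) * lam 𝕜 (n + 1) - lam 𝕜 (n + 2) * (qv 𝕜 + (qv 𝕜)⁻¹)
        = -((qv 𝕜)⁻¹ ^ (n + 1) * (qv 𝕜 ^ (2 * 1) - 1) * (qv 𝕜 ^ (2 * n) - 1)) := by
      simp only [lam, inv_pow]
      field_simp
      ring
    rw [h1]
    refine neg_ne_zero.mpr (mul_ne_zero (mul_ne_zero (pow_ne_zero _ (inv_ne_zero q0)) ?_) ?_)
    · exact fun h2 => hn ((h.dvd _ (sub_eq_zero.mp h2)).trans (one_dvd _))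
    · exact fun h2 => hn (h.dvd _ (sub_eq_zero.mp h2))
  · rw [mul_comm]
    exact (ses_Wm 𝕜 n).kills (kills_Wm 𝕜 _) (kills_Wm 𝕜 _)

/-- The same for the block of the larger Weyl module. -/
theorem IsRoot.theta_up (h : IsRoot 𝕜 l) {n : ℕ} (hn2 : ¬ l ∣ n + 2) (hn1 : ¬ l ∣ n + 1) :
    ∃ c : 𝕜, c ≠ 0 ∧ ∀ x : Wm 𝕜 (n + 1),
      theta (eb 𝕜 (lam 𝕜 (n + 2)) (lam 𝕜 n) : Uq 𝕜) • x = sc 𝕜 c • x := by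
  have q0 := qv_ne_zero (𝕜 := 𝕜)
  have hne := h.lam_ne hn1
  refine ⟨_, div_ne_zero ?_ (sub_ne_zero.mpr hne), fun x =>
    theta_eb_smul hne (kills_Wm 𝕜 (n + 1)) ((ses_Wm 𝕜 n).kills (kills_Wm 𝕜 _) (kills_Wm 𝕜 _)) x⟩
  have h1 : (qv 𝕜 ^ 2 + (qv 𝕜)⁻¹ ^ 2) * lam 𝕜 (n + 1) - lam 𝕜 n * (qv 𝕜 + (qv 𝕜)⁻¹)
      = (qv 𝕜)⁻¹ ^ (n + 3) * (qv 𝕜 ^ (2 * 1) - 1) * (qv 𝕜 ^ (2 * (n + 2)) - 1) := by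
    simp only [lam, inv_pow]
    field_simp
    ring
  rw [h1]
  refine mul_ne_zero (mul_ne_zero (pow_ne_zero _ (inv_ne_zero q0)) ?_) ?_
  · exact fun h2 => hn1 ((h.dvd _ (sub_eq_zero.mp h2)).trans (one_dvd _))
  · exact fun h2 => hn2 (h.dvd _ (sub_eq_zero.mp h2))

variable [CharZero 𝕜]

theorem IsRoot.binomNe (h : IsRoot 𝕜 l) {m : ℕ} (hm : Good l (m + 1)) : BinomNe 𝕜 m :=
  fun a t hat => alg_bz_ne_zero h.pos h.pow h.dvd (m + 1) hm.2 a t (by omega)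

theorem IsRoot.simple (h : IsRoot 𝕜 l) {n : ℕ} (hn : Good l n) :
    IsSimpleModule (Uq 𝕜) (Wm 𝕜 n) := by
  obtain ⟨m, rfl⟩ : ∃ m, n = m + 1 := ⟨n - 1, by have := hn.1; omega⟩
  exact weyl_simple (h.binomNe hn)

theorem IsRoot.end_scalar (h : IsRoot 𝕜 l) {n : ℕ} (hn : Good l n)
    (f : Wm 𝕜 n →ₗ[Uq 𝕜] Wm 𝕜 n) : ∃ c : 𝕜, ∀ x, f x = sc 𝕜 c • x := by
  obtain ⟨m, rfl⟩ : ∃ m, n = m + 1 := ⟨n - 1, by have := hn.1; omega⟩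
  exact weyl_end (h.binomNe hn) f

/-- A simple Weyl module is isomorphic to the dual Weyl module of the same highest weight. -/
theorem IsRoot.self_dual (h : IsRoot 𝕜 l) {n : ℕ} (hn : n ≤ l ∨ l ∣ n) :
    Nonempty (Wm 𝕜 n ≃ₗ[Uq 𝕜] Wd 𝕜 n) := by
  rcases n with _ | m
  · exact ⟨LinearEquiv.refl _ _⟩
  obtain ⟨f, hf⟩ := exists_hom_weyl_dualWeyl (𝕜 := 𝕜) m
  have := weyl_simple (h.binomNe (m := m) ⟨by omega, hn⟩)
  have hinj : Function.Injective f := (LinearMap.injective_or_eq_zero f).resolve_right hf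
  exact ⟨LinearEquiv.ofBijective f (bijective_of_injective_of_rk (fd_spec _) (fd_spec _)
    ((rk_weyl m).trans (rk_dualWeyl m).symm) hinj)⟩

/-- The quantum dimension of `V` is nonzero, because `l` is odd. -/
theorem IsRoot.two_ne (h : IsRoot 𝕜 l) : qv 𝕜 + (qv 𝕜)⁻¹ ≠ 0 := by
  have q0 := qv_ne_zero (𝕜 := 𝕜)
  intro h0
  have h1 : qv 𝕜 ^ 2 = -1 := by
    field_simp at h0
    rw [mul_zero] at h0
    exact eq_neg_of_add_eq_zero_left h0
  have h2 := h.dvd 2 (by rw [pow_mul, h1]; simp)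
  have h3 : l = 1 := by
    rcases (Nat.dvd_prime Nat.prime_two).mp h2 with h3 | h3
    · exact h3
    · have := h.odd
      rw [h3] at this
      exact absurd this (by decide)
  have h4 := h.pow
  rw [h3, pow_one] at h4
  rw [h4] at h1
  norm_num at h1

end Families


/-! ### The indecomposable tilting modules -/

section Tilt

variable {𝕜 : Type u} [Field 𝕜] [Algebra Zv 𝕜] {l : ℕ}

section Blocks

variable {A M B : Type*} [AddCommGroup A] [Module (Uq 𝕜) A] [AddCommGroup M] [Module (Uq 𝕜) M]
  [AddCommGroup B] [Module (Uq 𝕜) B] {a b : 𝕜}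

theorem Kills.sq (h : Kills (cl a) M) : Kills (cl a ^ 2) M := h.dvd (dvd_pow_self _ two_ne_zero)

theorem SES.blk_equiv_left (h : SES (Uq 𝕜) A M B) (hab : a ≠ b) (hA : Kills (cl a) A)
    (hB : Kills (cl b) B) : Nonempty (QuantumSL2.blk (eb 𝕜 a b) M ≃ₗ[Uq 𝕜] A) := by
  have hM : Kills (cl a ^ 2 * cl b ^ 2) M := (h.kills hA hB).dvd
    (mul_dvd_mul (dvd_pow_self _ two_ne_zero) (dvd_pow_self _ two_ne_zero))
  have := blk_subsingleton (e := eb 𝕜 a b) (eb_smul_of_kills (a := a) hB.sq)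
  obtain ⟨e⟩ := (h.blk (idemOn_eb hab hM)).equiv_left
  exact ⟨e.trans (blkEquivOfOne (eb_smul_of_kills' hab hA.sq))⟩

theorem SES.blk_equiv_right (h : SES (Uq 𝕜) A M B) (hab : a ≠ b) (hA : Kills (cl b) A)
    (hB : Kills (cl a) B) : Nonempty (QuantumSL2.blk (eb 𝕜 a b) M ≃ₗ[Uq 𝕜] B) := by
  have hM : Kills (cl a ^ 2 * cl b ^ 2) M := (h.kills hA hB).dvd (by
    rw [mul_comm]
    exact mul_dvd_mul (dvd_pow_self _ two_ne_zero) (dvd_pow_self _ two_ne_zero))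
  have := blk_subsingleton (e := eb 𝕜 a b) (eb_smul_of_kills (a := a) hA.sq)
  obtain ⟨e⟩ := (h.blk (idemOn_eb hab hM)).equiv_right
  exact ⟨e.trans (blkEquivOfOne (eb_smul_of_kills' hab hB.sq))⟩

/-- An element that acts by nonzero scalars on both factors of an extension acts injectively. -/
theorem SES.smul_injective (h : SES (Uq 𝕜) A M B) {z : Uq 𝕜} {c d : 𝕜} (hc : c ≠ 0) (hd : d ≠ 0)
    (hA : ∀ x : A, z • x = sc 𝕜 c • x) (hB : ∀ x : B, z • x = sc 𝕜 d • x) (x : M)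
    (hx : z • x = 0) : x = 0 := by
  have key : ∀ {N : Type _} [AddCommGroup N] [Module (Uq 𝕜) N] {e : 𝕜} (_ : e ≠ 0) (y : N),
      sc 𝕜 e • y = 0 → y = 0 := fun he y hy => by
    rw [← sc_one_smul (𝕜 := 𝕜) y, ← inv_mul_cancel₀ he, map_mul, mul_smul, hy, smul_zero]
  obtain ⟨f, g, hf, hfg, hg⟩ := h
  have h1 : g x = 0 := key hd _ (by rw [← hB, ← map_smul, hx, map_zero])
  obtain ⟨y, rfl⟩ := (hfg x).mp h1
  have h2 : y = 0 := by
    refine hf ?_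
    rw [map_zero]
    have h3 : f (sc 𝕜 c • y) = 0 := by rw [← hA, map_smul, hx]
    rw [map_smul] at h3
    rw [← sc_one_smul (𝕜 := 𝕜) (f y), ← inv_mul_cancel₀ hc, map_mul, mul_smul, h3, smul_zero]
  rw [h2, map_zero]

end Blocks

theorem kills_VT_Wm (n : ℕ) :
    Kills (cl (lam 𝕜 (n + 2)) * cl (lam 𝕜 n)) (VT (Wm 𝕜 (n + 1))) :=
  (ses_Wm 𝕜 n).kills (kills_Wm 𝕜 _) (kills_Wm 𝕜 _)

variable (𝕜 l) in
/-- The modules of highest weight `K l + r - 1` for `r ≤ l`, obtained from the Steinberg-type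
module of highest weight `K l - 1` by translation: tensor with `V`, and cut down to the block of
the highest weight. The first tensor product lies in a single block. -/
noncomputable def tiltX (K : ℕ) : ℕ → ModuleCat.{u} (Uq 𝕜)
  | 0 => Wm 𝕜 (K * l)
  | 1 => ModuleCat.of _ (VT (Wm 𝕜 (K * l)))
  | r + 2 => ModuleCat.of _ (blk (eb 𝕜 (lam 𝕜 (K * l + r + 2)) (lam 𝕜 (K * l + r)))
      (VT (tiltX K (r + 1))))

variable (𝕜 l) in
/-- The other block of `V ⊗ tiltX K (r + 1)`. -/
noncomputable def downX (K r : ℕ) : ModuleCat.{u} (Uq 𝕜) :=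
  ModuleCat.of _ (blk (eb 𝕜 (lam 𝕜 (K * l + r)) (lam 𝕜 (K * l + r + 2)))
    (VT (tiltX 𝕜 l K (r + 1))))

variable [CharZero 𝕜]

theorem not_dvd_of_lt {l K r : ℕ} (h0 : 0 < r) (h : r < l) : ¬ l ∣ K * l + r := fun hd =>
  Nat.not_dvd_of_pos_of_lt h0 h ((Nat.dvd_add_right (Dvd.intro_left K rfl)).mp hd)

theorem not_dvd_of_add {l K r m : ℕ} (hm : m + r = K * l) (h0 : 0 < r) (h : r < l) : ¬ l ∣ m :=
  fun hd => Nat.not_dvd_of_pos_of_lt h0 h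
    ((Nat.dvd_add_right hd).mp (hm ▸ Dvd.intro_left K rfl))

/-- The tensor product of a translated module with `V` has two generalized eigenvalues of the
Casimir element. -/
theorem IsRoot.kills_VT (h : IsRoot 𝕜 l) {K r m : ℕ} (hm : m + (r + 1) = K * l) {M : Type*}
    [AddCommGroup M] [Module (Uq 𝕜) M]
    (hs : SES (Uq 𝕜) (Wm 𝕜 (K * l + (r + 1))) M (Wm 𝕜 m)) :
    Kills (cl (lam 𝕜 (K * l + r + 2)) ^ 2 * cl (lam 𝕜 (K * l + r)) ^ 2) (VT M) := by
  rcases m with _ | m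
  · have hk : Kills (cl (lam 𝕜 (K * l + r + 2)) * cl (lam 𝕜 (K * l + r))) (VT (Wm 𝕜 0)) :=
      fun x => Subsingleton.elim _ _
    have := hs.VT.kills (kills_VT_Wm (K * l + r)) hk
    convert this using 1
    ring
  · have e1 : lam 𝕜 (m + 2) = lam 𝕜 (K * l + r) := h.lam_reflect (K := K) (by omega)
    have e2 : lam 𝕜 m = lam 𝕜 (K * l + r + 2) := h.lam_reflect (K := K) (by omega)
    have hk := kills_VT_Wm (𝕜 := 𝕜) m
    rw [e1, e2] at hk
    have := hs.VT.kills (kills_VT_Wm (K * l + r)) hk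
    convert this using 1
    ring

/-- The translated modules have two-step filtrations by Weyl modules and by dual Weyl modules. -/
theorem IsRoot.ses_tiltX (h : IsRoot 𝕜 l) (K r m : ℕ) (hr : r + 1 ≤ l) (hm : m + (r + 1) = K * l) :
    SES (Uq 𝕜) (Wm 𝕜 (K * l + (r + 1))) (tiltX 𝕜 l K (r + 1)) (Wm 𝕜 m) ∧
    SES (Uq 𝕜) (Wd 𝕜 m) (tiltX 𝕜 l K (r + 1)) (Wd 𝕜 (K * l + (r + 1))) := by
  induction r generalizing m with
  | zero =>
    have e : m + 1 = K * l := hm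
    have h1 := ses_Wm 𝕜 m
    have h2 := ses_Wd 𝕜 m
    obtain ⟨f⟩ := h.self_dual (n := m + 1) (Or.inr (e ▸ Dvd.intro_left K rfl))
    have e2 : m + 2 = K * l + (0 + 1) := by omega
    rw [e2] at h1 h2
    have e3 : tiltX 𝕜 l K (0 + 1) = ModuleCat.of _ (VT (Wm 𝕜 (m + 1))) := by
      rw [e]
      rfl
    rw [e3]
    exact ⟨h1, h2.congr (LinearEquiv.refl _ _) (VT.congr f.symm) (LinearEquiv.refl _ _)⟩
  | succ r ih =>
    obtain ⟨i1, i2⟩ := ih (m + 1) (by omega) (by omega)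
    have hab : lam 𝕜 (K * l + r + 2) ≠ lam 𝕜 (K * l + r) :=
      h.lam_ne (not_dvd_of_lt (r := r + 1) (by omega) (by omega))
    have e1 : lam 𝕜 (m + 2) = lam 𝕜 (K * l + r) := h.lam_reflect (K := K) (by omega)
    have e2 : lam 𝕜 m = lam 𝕜 (K * l + r + 2) := h.lam_reflect (K := K) (by omega)
    have hk := h.kills_VT (m := m + 1) (by omega) i1
    have hid := idemOn_eb hab hk
    obtain ⟨f1⟩ := (ses_Wm 𝕜 (K * l + r)).blk_equiv_left hab (kills_Wm 𝕜 _) (kills_Wm 𝕜 _)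
    obtain ⟨f2⟩ := (ses_Wm 𝕜 m).blk_equiv_right hab (e1 ▸ kills_Wm 𝕜 _) (e2 ▸ kills_Wm 𝕜 _)
    obtain ⟨f3⟩ := (ses_Wd 𝕜 (K * l + r)).blk_equiv_right hab (kills_Wd 𝕜 _) (kills_Wd 𝕜 _)
    obtain ⟨f4⟩ := (ses_Wd 𝕜 m).blk_equiv_left hab (e2 ▸ kills_Wd 𝕜 _) (e1 ▸ kills_Wd 𝕜 _)
    exact ⟨(i1.VT.blk hid).congr f1 (LinearEquiv.refl _ _) f2,
      (i2.VT.blk hid).congr f4 (LinearEquiv.refl _ _) f3⟩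

/-- The other block is filtered by the two middle Weyl modules of the four in the tensor product. -/
theorem IsRoot.ses_downX (h : IsRoot 𝕜 l) (K r m : ℕ) (hr : r + 2 ≤ l) (hm : m + r = K * l)
    (hm0 : 0 < m) : SES (Uq 𝕜) (Wm 𝕜 (K * l + r)) (downX 𝕜 l K r) (Wm 𝕜 m) := by
  rcases m with _ | m
  · omega
  have hab : lam 𝕜 (K * l + r + 2) ≠ lam 𝕜 (K * l + r) :=
    h.lam_ne (not_dvd_of_lt (r := r + 1) (by omega) (by omega))
  obtain ⟨i1, -⟩ := h.ses_tiltX K r m (by omega) (by omega)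
  have hk := h.kills_VT (m := m) (by omega) i1
  rw [mul_comm] at hk
  have hid := idemOn_eb hab.symm hk
  obtain ⟨f1⟩ := (ses_Wm 𝕜 (K * l + r)).blk_equiv_right hab.symm (kills_Wm 𝕜 _) (kills_Wm 𝕜 _)
  rcases m with _ | m
  · -- then `K = 1` and `r + 1 = l`, which is excluded
    exfalso
    have : ¬ l ∣ r + 1 := Nat.not_dvd_of_pos_of_lt (by omega) (by omega)
    exact this ⟨K, by rw [mul_comm]; omega⟩
  have e1 : lam 𝕜 (m + 2) = lam 𝕜 (K * l + r) := h.lam_reflect (K := K) (by omega)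
  have e2 : lam 𝕜 m = lam 𝕜 (K * l + r + 2) := h.lam_reflect (K := K) (by omega)
  obtain ⟨f2⟩ := (ses_Wm 𝕜 m).blk_equiv_left hab.symm (e1 ▸ kills_Wm 𝕜 _) (e2 ▸ kills_Wm 𝕜 _)
  exact (i1.VT.blk hid).congr f1 (LinearEquiv.refl _ _) f2

/-- `V ⊗ tiltX K (r + 1)` is the sum of its two blocks. -/
theorem IsRoot.VT_tiltX (h : IsRoot 𝕜 l) (K r : ℕ) (hK : 0 < K) (hr : r + 2 ≤ l) :
    Nonempty (VT (tiltX 𝕜 l K (r + 1)) ≃ₗ[Uq 𝕜] tiltX 𝕜 l K (r + 2) × downX 𝕜 l K r) := by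
  have hKl : l ≤ K * l := Nat.le_mul_of_pos_left l hK
  obtain ⟨m, hm⟩ : ∃ m, m + (r + 1) = K * l := ⟨K * l - (r + 1), by omega⟩
  have hab : lam 𝕜 (K * l + r + 2) ≠ lam 𝕜 (K * l + r) :=
    h.lam_ne (not_dvd_of_lt (r := r + 1) (by omega) (by omega))
  obtain ⟨i1, -⟩ := h.ses_tiltX K r m (by omega) hm
  exact blk_prod (eb_add hab) (idemOn_eb hab (h.kills_VT hm i1))

theorem IsRoot.fd_tiltX (h : IsRoot 𝕜 l) (K r : ℕ) (hK : 0 < K) (hr : r ≤ l) :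
    FD 𝕜 (Uq 𝕜) (tiltX 𝕜 l K r) := by
  rcases r with _ | r
  · exact fd_Wm 𝕜 _
  have hKl : l ≤ K * l := Nat.le_mul_of_pos_left l hK
  exact (h.ses_tiltX K r (K * l - (r + 1)) hr (by omega)).1.fd (fd_Wm 𝕜 _) (fd_Wm 𝕜 _)

theorem IsRoot.rk_tiltX (h : IsRoot 𝕜 l) (K r : ℕ) (hK : 0 < K) (hr : r + 1 ≤ l) :
    rk 𝕜 (Uq 𝕜) (tiltX 𝕜 l K (r + 1)) = 2 * (K * l) := by
  have hKl : l ≤ K * l := Nat.le_mul_of_pos_left l hK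
  rw [(h.ses_tiltX K r (K * l - (r + 1)) hr (by omega)).1.rk (fd_Wm 𝕜 _) (fd_Wm 𝕜 _), rk_Wm, rk_Wm]
  omega

/-- At the upper wall the translated module splits: both factors are simple, and the quotient in
the Weyl filtration is self-dual, so that it is also a submodule. -/
theorem IsRoot.tiltX_wall (h : IsRoot 𝕜 l) (K : ℕ) :
    Nonempty (tiltX 𝕜 l (K + 1) l ≃ₗ[Uq 𝕜] Wm 𝕜 ((K + 2) * l) × Wm 𝕜 (K * l)) := by
  obtain ⟨r, hr⟩ : ∃ r, l = r + 1 := ⟨l - 1, by have := h.pos; omega⟩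
  obtain ⟨i1, i2⟩ := h.ses_tiltX (K + 1) r (K * l) (by omega) (by rw [← hr]; ring)
  rw [← hr] at i1 i2
  have e : (K + 1) * l + l = (K + 2) * l := by ring
  rw [e] at i1 i2
  rcases Nat.eq_zero_or_pos K with rfl | hK
  · rw [zero_mul] at *
    obtain ⟨f⟩ := i1.equiv_left
    exact ⟨f.trans (LinearEquiv.ofBijective (LinearMap.inl _ _ _)
      ⟨LinearMap.inl_injective, fun x => ⟨x.1, Prod.ext rfl (Subsingleton.elim _ _)⟩⟩)⟩
  · have hs1 := h.simple (n := (K + 2) * l) ⟨Nat.mul_pos (by omega) h.pos, Or.inr (Dvd.intro_left _ rfl)⟩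
    have hs2 := h.simple (n := K * l) ⟨Nat.mul_pos hK h.pos, Or.inr (Dvd.intro_left _ rfl)⟩
    obtain ⟨f⟩ := h.self_dual (n := K * l) (Or.inr (Dvd.intro_left _ rfl))
    obtain ⟨j, -, hj, -, -⟩ := i2
    refine i1.split_of_embedding ?_ (j := j ∘ₗ f.toLinearMap) (hj.comp f.injective)
    rintro ⟨g⟩
    have := rk_congr (𝕜 := 𝕜) g
    rw [rk_Wm, rk_Wm] at this
    have := Nat.eq_of_mul_eq_mul_right h.pos this
    omega

/-- The evaluation and coevaluation split `M = Wm (K l)` off `V ⊗ V ⊗ M`, since the quantum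
dimension of `V` is nonzero; the other factor of the block is also `M`. -/
theorem IsRoot.downX_zero (h : IsRoot 𝕜 l) (K : ℕ) (hK : 0 < K) (hl : 2 ≤ l) :
    Nonempty (downX 𝕜 l K 0 ≃ₗ[Uq 𝕜] Wm 𝕜 (K * l) × Wm 𝕜 (K * l)) := by
  have hKl : l ≤ K * l := Nat.le_mul_of_pos_left l hK
  have hs := h.ses_downX K 0 (K * l) hl (by omega) (by omega)
  rw [add_zero] at hs
  have := h.simple (n := K * l) ⟨by omega, Or.inr (Dvd.intro_left _ rfl)⟩
  have hab : lam 𝕜 (K * l + 0 + 2) ≠ lam 𝕜 (K * l + 0) :=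
    h.lam_ne (not_dvd_of_lt (r := 1) (by omega) (by omega))
  let e1 := blkEquivOfOne (M := Wm 𝕜 (K * l))
    (eb_smul_of_kills' hab.symm (kills_Wm 𝕜 (K * l)).sq)
  refine hs.split_of_retract
    (blkMap (eb 𝕜 (lam 𝕜 (K * l + 0)) (lam 𝕜 (K * l + 0 + 2))) (coev 𝕜 (Wm 𝕜 (K * l)))
      ∘ₗ e1.symm.toLinearMap) (ev 𝕜 (Wm 𝕜 (K * l)) ∘ₗ Submodule.subtype _) ?_
  have key : ∀ x : Wm 𝕜 (K * l), ev 𝕜 (Wm 𝕜 (K * l)) (coev 𝕜 (Wm 𝕜 (K * l)) x)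
      = sc 𝕜 (qv 𝕜 + (qv 𝕜)⁻¹) • x := fun x => by
    rw [← theta_one, ← ev_coev]
    congr 1
    exact VT.ext fun i => by rw [VT.of_apply, one_smul]
  have key2 : ∀ x, (ev 𝕜 (Wm 𝕜 (K * l)) ∘ₗ Submodule.subtype _) ((blkMap (eb 𝕜 (lam 𝕜 (K * l + 0))
      (lam 𝕜 (K * l + 0 + 2))) (coev 𝕜 (Wm 𝕜 (K * l)))) (e1.symm x))
      = sc 𝕜 (qv 𝕜 + (qv 𝕜)⁻¹) • x := key
  have h2 := h.two_ne
  constructor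
  · intro x y hxy
    have h3 := (key2 x).symm.trans (Eq.trans hxy (key2 y))
    rw [← sc_one_smul (𝕜 := 𝕜) x, ← sc_one_smul (𝕜 := 𝕜) y, ← inv_mul_cancel₀ h2, map_mul,
      mul_smul, h3, mul_smul]
  · intro y
    refine ⟨sc 𝕜 (qv 𝕜 + (qv 𝕜)⁻¹)⁻¹ • y, (key2 _).trans ?_⟩
    rw [← mul_smul, ← map_mul, mul_inv_cancel₀ h2, map_one, one_smul]

/-- The contraction of the upper block idempotent is injective on the translated modules. -/
theorem IsRoot.theta_up_injective (h : IsRoot 𝕜 l) (K r : ℕ) (hK : 0 < K) (hr : r + 3 ≤ l)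
    (x : tiltX 𝕜 l K (r + 1))
    (hx : theta (eb 𝕜 (lam 𝕜 (K * l + r + 2)) (lam 𝕜 (K * l + r)) : Uq 𝕜) • x = 0) : x = 0 := by
  have hKl : l ≤ K * l := Nat.le_mul_of_pos_left l hK
  obtain ⟨m, hm⟩ : ∃ m, m + 1 + (r + 1) = K * l := ⟨K * l - (r + 2), by omega⟩
  obtain ⟨i1, -⟩ := h.ses_tiltX K r (m + 1) (by omega) hm
  obtain ⟨c, hc, hc'⟩ := h.theta_up (n := K * l + r)
    (not_dvd_of_lt (r := r + 2) (by omega) (by omega))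
    (not_dvd_of_lt (r := r + 1) (by omega) (by omega))
  have e1 : lam 𝕜 (m + 2) = lam 𝕜 (K * l + r) := h.lam_reflect (K := K) (by omega)
  have e2 : lam 𝕜 m = lam 𝕜 (K * l + r + 2) := h.lam_reflect (K := K) (by omega)
  obtain ⟨d, hd, hd'⟩ := h.theta_down (n := m)
    (not_dvd_of_add (K := K) (r := r + 2) (by omega) (by omega) (by omega))
    (not_dvd_of_add (K := K) (r := r + 1) (by omega) (by omega) (by omega))
  rw [e1, e2] at hd'
  exact i1.smul_injective hc hd hc' hd' x hx

theorem IsRoot.theta_down_injective (h : IsRoot 𝕜 l) (K r : ℕ) (hK : 0 < K) (hr : r + 3 ≤ l)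
    (x : tiltX 𝕜 l K (r + 2))
    (hx : theta (eb 𝕜 (lam 𝕜 (K * l + (r + 1))) (lam 𝕜 (K * l + (r + 1) + 2)) : Uq 𝕜) • x = 0) :
    x = 0 := by
  have hKl : l ≤ K * l := Nat.le_mul_of_pos_left l hK
  obtain ⟨m, hm⟩ : ∃ m, m + 1 + (r + 2) = K * l := ⟨K * l - (r + 3), by omega⟩
  obtain ⟨i1, -⟩ := h.ses_tiltX K (r + 1) (m + 1) (by omega) hm
  obtain ⟨c, hc, hc'⟩ := h.theta_down (n := K * l + (r + 1))
    (not_dvd_of_lt (r := r + 1) (by omega) (by omega))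
    (not_dvd_of_lt (r := r + 2) (by omega) (by omega))
  have e1 : lam 𝕜 (m + 2) = lam 𝕜 (K * l + (r + 1)) := h.lam_reflect (K := K) (by omega)
  have e2 : lam 𝕜 m = lam 𝕜 (K * l + (r + 1) + 2) := h.lam_reflect (K := K) (by omega)
  obtain ⟨d, hd, hd'⟩ := h.theta_up (n := m)
    (not_dvd_of_add (K := K) (r := r + 1) (by omega) (by omega) (by omega))
    (not_dvd_of_add (K := K) (r := r + 2) (by omega) (by omega) (by omega))
  rw [e1, e2] at hd'
  exact i1.smul_injective hc hd hc' hd' x hx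

/-- Away from the walls, translating up and then down gives back the module: the unit of the
adjunction between the translation functors is injective, and the dimensions agree. -/
theorem IsRoot.downX_succ (h : IsRoot 𝕜 l) (K r : ℕ) (hK : 0 < K) (hr : r + 3 ≤ l) :
    Nonempty (tiltX 𝕜 l K (r + 1) ≃ₗ[Uq 𝕜] downX 𝕜 l K (r + 1)) := by
  have hKl : l ≤ K * l := Nat.le_mul_of_pos_left l hK
  obtain ⟨m, hm⟩ : ∃ m, m + (r + 1) = K * l := ⟨K * l - (r + 1), by omega⟩
  have hab : lam 𝕜 (K * l + r + 2) ≠ lam 𝕜 (K * l + r) :=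
    h.lam_ne (not_dvd_of_lt (r := r + 1) (by omega) (by omega))
  have hab' : lam 𝕜 (K * l + (r + 1) + 2) ≠ lam 𝕜 (K * l + (r + 1)) :=
    h.lam_ne (not_dvd_of_lt (r := r + 2) (by omega) (by omega))
  obtain ⟨i1, -⟩ := h.ses_tiltX K r m (by omega) hm
  have hid := idemOn_eb hab (h.kills_VT hm i1)
  have hone : ∀ x : tiltX 𝕜 l K (r + 1),
      (eb 𝕜 (lam 𝕜 (K * l + (r + 1))) (lam 𝕜 (K * l + (r + 1) + 2)) : Uq 𝕜) • x = x := by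
    have hm' : lam 𝕜 m = lam 𝕜 (K * l + (r + 1)) := h.lam_reflect (K := K) (by omega)
    have hk := i1.kills (kills_Wm 𝕜 _) (hm' ▸ kills_Wm 𝕜 m)
    rw [← pow_two] at hk
    exact eb_smul_of_kills' hab'.symm hk
  -- the projection onto the upper block
  let pr : VT (tiltX 𝕜 l K (r + 1)) →ₗ[Uq 𝕜] tiltX 𝕜 l K (r + 2) :=
    { toFun := fun w => (⟨(eb 𝕜 (lam 𝕜 (K * l + r + 2)) (lam 𝕜 (K * l + r)) : Uq 𝕜) • w, hid w⟩ :
        blk (eb 𝕜 (lam 𝕜 (K * l + r + 2)) (lam 𝕜 (K * l + r))) (VT (tiltX 𝕜 l K (r + 1))))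
      map_add' := fun w w' => Subtype.ext (smul_add _ w w')
      map_smul' := fun x w => Subtype.ext (by
        change _ • x • w = x • _ • w
        rw [← mul_smul, ← mul_smul,
          Subalgebra.mem_center_iff.mp (eb 𝕜 (lam 𝕜 (K * l + r + 2)) (lam 𝕜 (K * l + r))).2]) }
  let α : tiltX 𝕜 l K (r + 1) →ₗ[Uq 𝕜] downX 𝕜 l K (r + 1) :=
    blkMap (eb 𝕜 (lam 𝕜 (K * l + (r + 1))) (lam 𝕜 (K * l + (r + 1) + 2)))
      (VT.map pr ∘ₗ coev 𝕜 (tiltX 𝕜 l K (r + 1))) ∘ₗ (blkEquivOfOne hone).symm.toLinearMap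
  have hinj : Function.Injective α := by
    rw [injective_iff_map_eq_zero]
    intro x hx
    refine h.theta_up_injective K r hK hr x ?_
    have h0 : VT.map pr (coev 𝕜 (tiltX 𝕜 l K (r + 1)) x) = 0 := congrArg Subtype.val hx
    rw [← ev_coev]
    have h1 : (VT.of fun i => (eb 𝕜 (lam 𝕜 (K * l + r + 2)) (lam 𝕜 (K * l + r)) : Uq 𝕜)
        • coev 𝕜 (tiltX 𝕜 l K (r + 1)) x i) = 0 :=
      VT.ext fun i => congrArg Subtype.val (congrFun h0 i)
    rw [h1, map_zero]
  have hd := h.ses_downX K (r + 1) m (by omega) hm (by omega)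
  refine ⟨LinearEquiv.ofBijective α (bijective_of_injective_of_rk (h.fd_tiltX K (r + 1) hK (by omega))
    (hd.fd (fd_Wm 𝕜 _) (fd_Wm 𝕜 _)) ?_ hinj)⟩
  rw [h.rk_tiltX K r hK (by omega), hd.rk (fd_Wm 𝕜 _) (fd_Wm 𝕜 _), rk_Wm, rk_Wm]
  omega

/-- Below the first wall all modules are simple. -/
theorem IsRoot.VT_Wm_small (h : IsRoot 𝕜 l) (n : ℕ) (hn : n + 2 ≤ l) :
    Nonempty (VT (Wm 𝕜 (n + 1)) ≃ₗ[Uq 𝕜] Wm 𝕜 (n + 2) × Wm 𝕜 n) := by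
  have hab : lam 𝕜 (n + 2) ≠ lam 𝕜 n :=
    h.lam_ne (Nat.not_dvd_of_pos_of_lt (by omega) (by omega))
  have hk : Kills (cl (lam 𝕜 (n + 2)) ^ 2 * cl (lam 𝕜 n) ^ 2) (VT (Wm 𝕜 (n + 1))) :=
    (kills_VT_Wm n).dvd (mul_dvd_mul (dvd_pow_self _ two_ne_zero) (dvd_pow_self _ two_ne_zero))
  obtain ⟨e⟩ := blk_prod (eb_add hab) (idemOn_eb hab hk)
  obtain ⟨f1⟩ := (ses_Wm 𝕜 n).blk_equiv_left hab (kills_Wm 𝕜 _) (kills_Wm 𝕜 _)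
  obtain ⟨f2⟩ := (ses_Wm 𝕜 n).blk_equiv_right hab.symm (kills_Wm 𝕜 _) (kills_Wm 𝕜 _)
  exact ⟨e.trans (LinearEquiv.prodCongr f1 f2)⟩

end Tilt


/-! ### Indecomposability -/

section Indecomposable

variable {𝕜 : Type u} [Field 𝕜] [Algebra Zv 𝕜] {l : ℕ}

theorem vComulA_casA : vComulA casA 0 1
    = ((LaurentPolynomial.T 1 - LaurentPolynomial.T (-1)) ^ 2 : Zv) • genA Gen.F := by
  apply Subtype.ext
  rw [vComulA_coe, casA_coe]
  have h2 : ((((LaurentPolynomial.T 1 - LaurentPolynomial.T (-1)) ^ 2 : Zv) • genA Gen.F : UA) : Uv)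
      = (v - v⁻¹) ^ 2 • gen Gen.F := by
    have h1 : ((((LaurentPolynomial.T 1 - LaurentPolynomial.T (-1)) ^ 2 : Zv) • genA Gen.F : UA) : Uv)
      = ((LaurentPolynomial.T 1 - LaurentPolynomial.T (-1)) ^ 2 : Zv) • gen Gen.F := rfl
    rw [h1, Zv_smul, map_pow, map_sub, alg_T, alg_T, zpow_one, zpow_neg_one]
  rw [h2, cas]
  simp only [map_add, map_smul, map_mul, vComul_E, vComul_F, vComul_K, vComul_Ki, Matrix.add_apply,
    Matrix.smul_apply, Matrix.mul_apply, Fin.sum_univ_two]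
  simp

/-- The Casimir element does not act by a scalar on `V ⊗ M`, unless `F` acts by zero on `M`. -/
theorem F_smul_eq_zero_of_kills {M : Type*} [AddCommGroup M] [Module (Uq 𝕜) M] {a : 𝕜}
    (hq : qv 𝕜 ^ 2 ≠ 1) (h : Kills (cl a) (VT M)) (m : M) : dF 𝕜 1 • m = 0 := by
  have h1 := congrFun (kills_cl_iff.mp h (VT.of ![0, m])) 0
  rw [VT.smul_apply, VT.sc_smul_apply] at h1
  simp only [VT.of_apply, Matrix.cons_val_zero, Matrix.cons_val_one, smul_zero, zero_add] at h1
  rw [casq, vComulq_inq, vComulA_casA, inq_smul, smul_eq_sc_mul, mul_smul] at h1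
  have hF : inq 𝕜 (genA Gen.F) = dF 𝕜 1 := by
    rw [dF]
    congr 1
    apply Subtype.ext
    change gen Gen.F = divPow (gen Gen.F) 1
    simp [divPow, qfact]
  have q0 := qv_ne_zero (𝕜 := 𝕜)
  have hc : algebraMap Zv 𝕜 ((LaurentPolynomial.T 1 - LaurentPolynomial.T (-1)) ^ 2) ≠ 0 := by
    rw [map_pow, map_sub, T_zpow, T_zpow, zpow_one, zpow_neg_one]
    refine pow_ne_zero _ fun h0 => hq ?_
    field_simp at h0
    rw [mul_zero] at h0
    exact sub_eq_zero.mp h0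
  rw [hF] at h1
  rw [← sc_one_smul (𝕜 := 𝕜) (dF 𝕜 1 • m), ← inv_mul_cancel₀ hc, map_mul, mul_smul, h1, smul_zero]

/-- A map out of `V ⊗ M` is determined by the corresponding map out of `M`. -/
theorem eq_of_coev {M N : Type*} [AddCommGroup M] [Module (Uq 𝕜) M] [AddCommGroup N]
    [Module (Uq 𝕜) N] {f g : VT M →ₗ[Uq 𝕜] N}
    (h : ∀ m, VT.map f (coev 𝕜 M m) = VT.map g (coev 𝕜 M m)) : f = g := by
  have q0 := qv_ne_zero (𝕜 := 𝕜)
  have hT : algebraMap Zv 𝕜 (LaurentPolynomial.T 1) = qv 𝕜 := rfl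
  refine LinearMap.ext fun w => ?_
  have hw : w = coev 𝕜 M (w 1) 0 + coev 𝕜 M (sc 𝕜 (-qv 𝕜)⁻¹ • w 0) 1 := by
    refine VT.ext fun i => ?_
    rw [VT.add_apply, coev_apply, coev_apply, ← mul_smul, ← map_mul]
    fin_cases i
    · have e : algebraMap Zv 𝕜 (coevZ 1 0) * (-qv 𝕜)⁻¹ = 1 := by
        simp [coevZ, hT, q0]
      have e' : algebraMap Zv 𝕜 (coevZ 0 0) = 0 := by simp [coevZ]
      change w 0 = sc 𝕜 (algebraMap Zv 𝕜 (coevZ 0 0)) • w 1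
        + sc 𝕜 (algebraMap Zv 𝕜 (coevZ 1 0) * (-qv 𝕜)⁻¹) • w 0
      rw [e, e', sc_zero_smul, sc_one_smul, zero_add]
    · have e : algebraMap Zv 𝕜 (coevZ 1 1) * (-qv 𝕜)⁻¹ = 0 := by simp [coevZ]
      have e' : algebraMap Zv 𝕜 (coevZ 0 1) = 1 := by simp [coevZ]
      change w 1 = sc 𝕜 (algebraMap Zv 𝕜 (coevZ 0 1)) • w 1
        + sc 𝕜 (algebraMap Zv 𝕜 (coevZ 1 1) * (-qv 𝕜)⁻¹) • w 0
      rw [e, e', sc_zero_smul, sc_one_smul, add_zero]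
  rw [hw, map_add, map_add]
  exact congrArg₂ (· + ·) (congrFun (h _) 0) (congrFun (h _) 1)

/-- A multiple of a homomorphism. -/
noncomputable def scMap {A M : Type*} [AddCommGroup A] [Module (Uq 𝕜) A] [AddCommGroup M]
    [Module (Uq 𝕜) M] (c : 𝕜) (f : A →ₗ[Uq 𝕜] M) : A →ₗ[Uq 𝕜] M where
  toFun x := sc 𝕜 c • f x
  map_add' x y := by rw [map_add, smul_add]
  map_smul' u x := by rw [map_smul, sc_smul_comm, RingHom.id_apply]

theorem exists_relation {𝕜 : Type*} [Field 𝕜] (a b c : Fin 2 → 𝕜) : ∃ x y z : 𝕜, (x ≠ 0 ∨ y ≠ 0 ∨ z ≠ 0) ∧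
    ∀ i, x * a i + y * b i + z * c i = 0 := by
  obtain ⟨w, hw, hw0⟩ := Matrix.exists_mulVec_eq_zero_iff.mpr
    (show (!![a 0, b 0, c 0; a 1, b 1, c 1; 0, 0, 0] : Matrix (Fin 3) (Fin 3) 𝕜).det = 0 by
      simp [Matrix.det_fin_three])
  refine ⟨w 0, w 1, w 2, ?_, Fin.forall_fin_two.mpr ⟨?_, ?_⟩⟩
  · by_contra hcon
    push Not at hcon
    refine hw (funext fun i => ?_)
    fin_cases i
    · exact hcon.1
    · exact hcon.2.1
    · exact hcon.2.2
  · have := congrFun hw0 0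
    simp [Matrix.mulVec, dotProduct, Fin.sum_univ_three] at this
    linear_combination this
  · have := congrFun hw0 1
    simp [Matrix.mulVec, dotProduct, Fin.sum_univ_three] at this
    linear_combination this

/-- If the endomorphisms of `M` depend on two parameters and `M` has a nonzero endomorphism `n` with
`n² = 0`, then `M` is indecomposable. -/
theorem isIndecomposable_of_coeff {M : Type u} [AddCommGroup M] [Module (Uq 𝕜) M] [Nontrivial M]
    (n : M →ₗ[Uq 𝕜] M) (hn : n ≠ 0) (hnn : n ∘ₗ n = 0)
    (C : (M →ₗ[Uq 𝕜] M) → Fin 2 → 𝕜)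
    (hC : ∀ (f g k : M →ₗ[Uq 𝕜] M) (x y z : 𝕜), (∀ i, x * C f i + y * C g i + z * C k i = 0) →
      scMap x f + scMap y g + scMap z k = 0) : IsIndecomposable (Uq 𝕜) M := by
  have key : ∀ {e : 𝕜} (_ : e ≠ 0) {y : M}, sc 𝕜 e • y = 0 → y = 0 := fun he y hy => by
    rw [← sc_one_smul (𝕜 := 𝕜) y, ← inv_mul_cancel₀ he, map_mul, mul_smul, hy, smul_zero]
  have hnn' : ∀ w, n (n w) = 0 := LinearMap.congr_fun hnn
  have hind : ∀ y z : 𝕜, (∀ w : M, sc 𝕜 y • w + sc 𝕜 z • n w = 0) → y = 0 ∧ z = 0 := by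
    intro y z hyz
    have hy : y = 0 := by
      by_contra hy
      refine hn (LinearMap.ext fun w => key hy ?_)
      have := congrArg n (hyz w)
      rw [map_add, map_smul, map_smul, hnn', smul_zero, add_zero, map_zero] at this
      exact this
    refine ⟨hy, ?_⟩
    by_contra hz
    refine hn (LinearMap.ext fun w => key hz ?_)
    have := hyz w
    rw [hy, sc_zero_smul, zero_add] at this
    exact this
  refine isIndecomposable_iff.mpr ⟨inferInstance, fun p hp => ?_⟩
  have hp' : ∀ w, p (p w) = p w := LinearMap.congr_fun hp
  obtain ⟨x, y, z, hne, hrel⟩ := exists_relation (C p) (C LinearMap.id) (C n)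
  have h0 : ∀ w, sc 𝕜 x • p w + sc 𝕜 y • w + sc 𝕜 z • n w = 0 :=
    LinearMap.congr_fun (hC _ _ _ x y z hrel)
  have hx : x ≠ 0 := by
    rintro rfl
    obtain ⟨rfl, rfl⟩ := hind y z fun w => by
      have := h0 w
      rwa [sc_zero_smul, zero_add] at this
    simp at hne
  -- so the idempotent `p` has the form `c + d n`
  have hpw : ∀ w, p w = sc 𝕜 (-(x⁻¹ * y)) • w + sc 𝕜 (-(x⁻¹ * z)) • n w := by
    intro w
    have h1 : p w = sc 𝕜 x⁻¹ • sc 𝕜 x • p w := by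
      rw [← mul_smul, ← map_mul, inv_mul_cancel₀ hx, sc_one_smul]
    have h2 : sc 𝕜 x • p w = -(sc 𝕜 y • w + sc 𝕜 z • n w) := by
      rw [eq_neg_iff_add_eq_zero, ← add_assoc]
      exact h0 w
    rw [h1, h2, smul_neg, smul_add, ← mul_smul, ← mul_smul, ← map_mul, ← map_mul, map_neg, map_neg,
      neg_smul, neg_smul, neg_add]
  generalize -(x⁻¹ * y) = c at hpw
  generalize -(x⁻¹ * z) = d at hpw
  have h3 := hind (c * c - c) (2 * c * d - d) fun w => by
    have h4 := hp' w
    rw [hpw (p w), hpw w, map_add, map_smul, map_smul, hnn', smul_zero, add_zero, smul_add,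
      ← mul_smul, ← mul_smul, ← mul_smul, ← map_mul, ← map_mul, ← map_mul] at h4
    rw [map_sub, map_sub, sub_smul, sub_smul, two_mul, add_mul, map_add, add_smul]
    rw [mul_comm d c] at h4
    rw [← sub_eq_zero.mpr h4]
    abel
  have hc : c = 0 ∨ c = 1 := by
    have : c * (c - 1) = 0 := by linear_combination h3.1
    rcases mul_eq_zero.mp this with h5 | h5
    · exact Or.inl h5
    · exact Or.inr (sub_eq_zero.mp h5)
  have hd : d = 0 := by
    rcases hc with rfl | rfl
    · linear_combination -h3.2
    · linear_combination h3.2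
  subst hd
  rcases hc with rfl | rfl
  · left
    exact LinearMap.ext fun w => by rw [hpw, sc_zero_smul, sc_zero_smul, add_zero,
      LinearMap.zero_apply]
  · right
    exact LinearMap.ext fun w => by rw [hpw, sc_zero_smul, sc_one_smul, add_zero,
      LinearMap.id_apply]

theorem nontrivial_of_rk {M : Type*} [AddCommGroup M] [Module (Uq 𝕜) M] (h : rk 𝕜 (Uq 𝕜) M ≠ 0) :
    Nontrivial M := by
  by_contra h0
  rw [not_nontrivial_iff_subsingleton] at h0
  exact h rk_of_subsingleton

variable [CharZero 𝕜]

theorem IsRoot.kills_tiltX (h : IsRoot 𝕜 l) (K r : ℕ) (hK : 0 < K) (hr : r + 1 ≤ l) :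
    Kills (cl (lam 𝕜 (K * l + (r + 1))) ^ 2) (tiltX 𝕜 l K (r + 1)) := by
  have hKl : l ≤ K * l := Nat.le_mul_of_pos_left l hK
  obtain ⟨m, hm⟩ : ∃ m, m + (r + 1) = K * l := ⟨K * l - (r + 1), by omega⟩
  have hm' : lam 𝕜 m = lam 𝕜 (K * l + (r + 1)) := h.lam_reflect (K := K) (by omega)
  rw [pow_two]
  exact (h.ses_tiltX K r m hr hm).1.kills (kills_Wm 𝕜 _) (hm' ▸ kills_Wm 𝕜 m)

/-- By adjunction the endomorphisms of `V ⊗ Wm (K l)` depend on two parameters, the coordinates of a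
map from `Wm (K l)` to `Wm (K l) × Wm (K l)`. The Casimir element minus its eigenvalue is a nonzero
endomorphism with square zero. -/
theorem IsRoot.indec_one (h : IsRoot 𝕜 l) (K : ℕ) (hK : 0 < K) (hl : 2 ≤ l) :
    IsIndecomposable (Uq 𝕜) (tiltX 𝕜 l K 1) := by
  have hKl : l ≤ K * l := Nat.le_mul_of_pos_left l hK
  have hgood : Good l (K * l) := ⟨by omega, Or.inr (Dvd.intro_left _ rfl)⟩
  have : Nontrivial (tiltX 𝕜 l K 1) := nontrivial_of_rk (𝕜 := 𝕜) (by
    rw [h.rk_tiltX K 0 hK (by omega)]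
    omega)
  have hq : qv 𝕜 ^ 2 ≠ 1 := fun hq => by
    have := Nat.le_of_dvd one_pos (h.dvd 1 hq)
    omega
  have hab : lam 𝕜 (K * l + 0 + 2) ≠ lam 𝕜 (K * l + 0) :=
    h.lam_ne (not_dvd_of_lt (r := 1) (by omega) (by omega))
  obtain ⟨θ⟩ := h.downX_zero K hK hl
  let e1 := blkEquivOfOne (M := Wm 𝕜 (K * l))
    (eb_smul_of_kills' hab.symm (kills_Wm 𝕜 (K * l)).sq)
  -- the map `Wm (K l) → V ⊗ V ⊗ Wm (K l)` corresponding to an endomorphism of `V ⊗ Wm (K l)`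
  let Ψ : (tiltX 𝕜 l K 1 →ₗ[Uq 𝕜] tiltX 𝕜 l K 1) → Wm 𝕜 (K * l) →ₗ[Uq 𝕜] downX 𝕜 l K 0 :=
    fun f => blkMap (eb 𝕜 (lam 𝕜 (K * l + 0)) (lam 𝕜 (K * l + 0 + 2)))
      (VT.map f ∘ₗ coev 𝕜 (Wm 𝕜 (K * l))) ∘ₗ e1.symm.toLinearMap
  have hex : ∀ f, ∃ c : Fin 2 → 𝕜, ∀ x, θ (Ψ f x) = (sc 𝕜 (c 0) • x, sc 𝕜 (c 1) • x) := by
    intro f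
    obtain ⟨c0, h0⟩ := h.end_scalar hgood
      (LinearMap.fst (Uq 𝕜) _ _ ∘ₗ θ.toLinearMap ∘ₗ Ψ f)
    obtain ⟨c1, h1⟩ := h.end_scalar hgood
      (LinearMap.snd (Uq 𝕜) _ _ ∘ₗ θ.toLinearMap ∘ₗ Ψ f)
    exact ⟨![c0, c1], fun x => Prod.ext (h0 x) (h1 x)⟩
  choose C hC using hex
  let n : tiltX 𝕜 l K 1 →ₗ[Uq 𝕜] tiltX 𝕜 l K 1 :=
    { toFun := fun w => pa 𝕜 (cl (lam 𝕜 (K * l + 1))) • w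
      map_add' := fun w w' => smul_add _ w w'
      map_smul' := fun x w => by
        rw [RingHom.id_apply, ← mul_smul, ← mul_smul, ← pol_coe,
          Subalgebra.mem_center_iff.mp (pol 𝕜 _).2] }
  refine isIndecomposable_of_coeff n (fun hn => ?_) (LinearMap.ext fun w => ?_) C ?_
  · have hk : Kills (cl (lam 𝕜 (K * l + 1))) (VT (Wm 𝕜 (K * l))) := LinearMap.congr_fun hn
    obtain ⟨m, hm⟩ : ∃ m, K * l = m + 2 := ⟨K * l - 2, by omega⟩
    rw [hm] at hk
    have h0 := F_smul_eq_zero_of_kills hq hk (hw (m + 1) : Weyl 𝕜 (m + 1))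
    have h1 := (dF_hw (m + 1) (1 : Fin (m + 2))).symm.trans h0
    have h2 := congrFun h1 (1 : Fin (m + 2))
    exact one_ne_zero ((wv_single_same (1 : Fin (m + 2)) (1 : 𝕜)).symm.trans h2)
  · have := h.kills_tiltX K 0 hK (by omega) w
    rw [pow_two, pa_mul, mul_smul] at this
    exact this
  · intro f g k x y z hxyz
    refine eq_of_coev fun m => ?_
    have h1 : θ (sc 𝕜 x • Ψ f m + sc 𝕜 y • Ψ g m + sc 𝕜 z • Ψ k m) = 0 := by
      rw [map_add, map_add, map_smul, map_smul, map_smul, hC, hC, hC]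
      refine Prod.ext ?_ ?_
      · change sc 𝕜 x • sc 𝕜 _ • m + sc 𝕜 y • sc 𝕜 _ • m + sc 𝕜 z • sc 𝕜 _ • m = 0
        rw [← mul_smul, ← mul_smul, ← mul_smul, ← map_mul, ← map_mul, ← map_mul, ← add_smul,
          ← add_smul, ← map_add, ← map_add, hxyz 0, sc_zero_smul]
      · change sc 𝕜 x • sc 𝕜 _ • m + sc 𝕜 y • sc 𝕜 _ • m + sc 𝕜 z • sc 𝕜 _ • m = 0
        rw [← mul_smul, ← mul_smul, ← mul_smul, ← map_mul, ← map_mul, ← map_mul, ← add_smul,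
          ← add_smul, ← map_add, ← map_add, hxyz 1, sc_zero_smul]
    have h2 := congrArg Subtype.val (θ.injective (h1.trans (map_zero θ).symm))
    refine Eq.trans (VT.ext fun i => ?_) (h2.trans (VT.ext fun i => rfl))
    refine Eq.trans ?_ (congrArg₂ (· + ·) (congrArg₂ (· + ·)
      (VT.sc_smul_apply x (Ψ f m).1 i) (VT.sc_smul_apply y (Ψ g m).1 i))
      (VT.sc_smul_apply z (Ψ k m).1 i)).symm
    rfl

/-- Translating back is faithful on endomorphisms, so it takes a nontrivial idempotent to a
nontrivial idempotent. -/
theorem IsRoot.indec_succ (h : IsRoot 𝕜 l) (K r : ℕ) (hK : 0 < K) (hr : r + 3 ≤ l)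
    (ih : IsIndecomposable (Uq 𝕜) (tiltX 𝕜 l K (r + 1))) :
    IsIndecomposable (Uq 𝕜) (tiltX 𝕜 l K (r + 2)) := by
  obtain ⟨e⟩ := h.downX_succ K r hK hr
  have hd := (isIndecomposable_iff.mp (isIndecomposable_congr e ih)).2
  have : Nontrivial (tiltX 𝕜 l K (r + 2)) := nontrivial_of_rk (𝕜 := 𝕜) (by
    rw [h.rk_tiltX K (r + 1) hK (by omega)]
    have := Nat.mul_pos hK h.pos
    omega)
  -- an endomorphism that vanishes on the lower block of `V ⊗ M` vanishes
  have key : ∀ f : tiltX 𝕜 l K (r + 2) →ₗ[Uq 𝕜] tiltX 𝕜 l K (r + 2),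
      blkMap (eb 𝕜 (lam 𝕜 (K * l + (r + 1))) (lam 𝕜 (K * l + (r + 1) + 2))) (VT.map f) = 0 →
        f = 0 := by
    intro f hf
    refine LinearMap.ext fun x => h.theta_down_injective K r hK hr _ ?_
    have hKl : l ≤ K * l := Nat.le_mul_of_pos_left l hK
    have hab : lam 𝕜 (K * l + (r + 1) + 2) ≠ lam 𝕜 (K * l + (r + 1)) :=
      h.lam_ne (not_dvd_of_lt (r := r + 2) (by omega) (by omega))
    obtain ⟨m, hm⟩ : ∃ m, m + (r + 2) = K * l := ⟨K * l - (r + 2), by omega⟩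
    obtain ⟨i1, -⟩ := h.ses_tiltX K (r + 1) m (by omega) hm
    have hk := h.kills_VT hm i1
    rw [mul_comm] at hk
    have hid := idemOn_eb hab.symm hk
    rw [← ev_coev]
    refine (congrArg _ (VT.ext (w' := 0) fun i => ?_)).trans (map_zero _)
    rw [VT.of_apply, coev_naturality, VT.map_apply, ← map_smul]
    exact congrArg Subtype.val (LinearMap.congr_fun hf ⟨_, hid (coev 𝕜 _ x i)⟩)
  refine isIndecomposable_iff.mpr ⟨inferInstance, fun p hp => ?_⟩
  have hp' : ∀ w, p (p w) = p w := LinearMap.congr_fun hp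
  rcases hd (blkMap (eb 𝕜 (lam 𝕜 (K * l + (r + 1))) (lam 𝕜 (K * l + (r + 1) + 2))) (VT.map p))
    (LinearMap.ext fun w => Subtype.ext (VT.ext fun i => hp' _)) with h0 | h0
  · exact Or.inl (key p h0)
  · right
    have := key (p - LinearMap.id) (LinearMap.ext fun w => Subtype.ext (VT.ext fun i => by
      have := congrFun (congrArg Subtype.val (LinearMap.congr_fun h0 w)) i
      exact sub_eq_zero.mpr this))
    exact sub_eq_zero.mp this

/-- The translated modules are indecomposable up to the wall. -/
theorem IsRoot.indec (h : IsRoot 𝕜 l) (K r : ℕ) (hK : 0 < K) (hr : r < l) :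
    IsIndecomposable (Uq 𝕜) (tiltX 𝕜 l K r) := by
  rcases r with _ | r
  · have : IsSimpleModule (Uq 𝕜) (tiltX 𝕜 l K 0) := h.simple (n := K * l) ⟨Nat.mul_pos hK h.pos, Or.inr (Dvd.intro_left _ rfl)⟩
    exact isIndecomposable_of_simple
  · induction r with
    | zero => exact h.indec_one K hK hr
    | succ r ih => exact h.indec_succ K r hK hr (ih (by omega))

end Indecomposable


/-! ### Filtrations and the tilting property -/

section Filtration

variable {U : Type u} [Ring U] {X : ℕ → Type u} [∀ k, AddCommGroup (X k)] [∀ k, Module U (X k)]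
  {M : Type u} [AddCommGroup M] [Module U M]

/-- A surjection from `Q` with kernel `P` computes the subquotient `Q / P`. -/
theorem subquotient_equiv {B : Type u} [AddCommGroup B] [Module U B] {P Q : Submodule U M}
    (f : Q →ₗ[U] B) (hf : Function.Surjective f) (hk : ∀ x : Q, f x = 0 ↔ (x : M) ∈ P) :
    Nonempty ((Q ⧸ P.comap Q.subtype) ≃ₗ[U] B) := by
  have : P.comap Q.subtype = LinearMap.ker f := by
    ext x
    rw [LinearMap.mem_ker, hk]
    rfl
  rw [this]
  exact ⟨f.quotKerEquivOfSurjective hf⟩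

theorem isFiltration_one {a : ℕ} (e : M ≃ₗ[U] X a) : IsFiltration (U := U) X M ![⊥, ⊤] ![a] := by
  refine ⟨?_, rfl, rfl, fun i => ?_⟩
  · intro i j hij
    fin_cases i <;> fin_cases j <;> simp_all
  · fin_cases i
    refine subquotient_equiv (P := ⊥) (Q := ⊤) (e.toLinearMap ∘ₗ (⊤ : Submodule U M).subtype)
      (fun y => ⟨⟨e.symm y, trivial⟩, e.apply_symm_apply y⟩) fun x => ?_
    rw [Submodule.mem_bot]
    exact e.map_eq_zero_iff

theorem isFiltration_two {a b : ℕ} (h : SES U (X a) M (X b)) :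
    ∃ S : Fin 3 → Submodule U M, IsFiltration X M S ![a, b] := by
  obtain ⟨f, g, hf, hfg, hg⟩ := h
  refine ⟨![⊥, LinearMap.range f, ⊤], ?_, rfl, rfl, Fin.forall_fin_two.mpr ⟨?_, ?_⟩⟩
  · intro i j hij
    fin_cases i <;> fin_cases j <;> simp_all
  · let e := LinearEquiv.ofInjective f hf
    refine subquotient_equiv (P := ⊥) (Q := LinearMap.range f) e.symm.toLinearMap
      e.symm.surjective fun x => ?_
    rw [Submodule.mem_bot, Submodule.coe_eq_zero]
    exact e.symm.map_eq_zero_iff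
  · refine subquotient_equiv (P := LinearMap.range f) (Q := ⊤) (g ∘ₗ (⊤ : Submodule U M).subtype)
      (fun y => ?_) fun x => hfg x
    obtain ⟨x, rfl⟩ := hg y
    exact ⟨⟨x, trivial⟩, rfl⟩

/-- A filtration step is a short exact sequence. -/
theorem IsFiltration.ses {n : ℕ} {S : Fin (n + 1) → Submodule U M} {k : Fin n → ℕ}
    (h : IsFiltration X M S k) (i : Fin n) : SES U (S i.castSucc) (S i.succ) (X (k i)) := by
  obtain ⟨e⟩ := h.2.2.2 i
  have hle : S i.castSucc ≤ S i.succ := h.1 (Fin.castSucc_lt_succ).le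
  refine ⟨Submodule.inclusion hle, e.toLinearMap ∘ₗ Submodule.mkQ _,
    Submodule.inclusion_injective hle, fun x => ?_,
    e.surjective.comp (Submodule.mkQ_surjective _)⟩
  change e _ = 0 ↔ _
  rw [LinearEquiv.map_eq_zero_iff, Submodule.mkQ_apply, Submodule.Quotient.mk_eq_zero]
  exact ⟨fun hx => ⟨⟨x, hx⟩, rfl⟩, by rintro ⟨y, rfl⟩; exact y.2⟩

variable {𝕜 : Type u} [Field 𝕜] [Algebra 𝕜 U]

/-- Traces are additive along filtrations. -/
theorem IsFiltration.tr {n : ℕ} {S : Fin (n + 1) → Submodule U M} {k : Fin n → ℕ}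
    (h : IsFiltration X M S k) (hX : ∀ k, FD 𝕜 U (X k)) :
    FD 𝕜 U M ∧ ∀ u : U, tr 𝕜 u M = ∑ i, QuantumSL2.tr 𝕜 u (X (k i)) := by
  have key : ∀ (j : ℕ) (hj : j < n + 1), FD 𝕜 U (S ⟨j, hj⟩) ∧ ∀ u : U,
      QuantumSL2.tr 𝕜 u (S ⟨j, hj⟩)
        = ∑ i : Fin j, QuantumSL2.tr 𝕜 u (X (k ⟨i, by omega⟩)) := by
    intro j
    induction j with
    | zero =>
      intro hj
      have : Subsingleton (S ⟨0, hj⟩) := by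
        have h0 : S ⟨0, hj⟩ = ⊥ := h.2.1
        rw [h0]
        infer_instance
      exact ⟨FD.of_subsingleton, fun u => tr_of_subsingleton u⟩
    | succ j ih =>
      intro hj
      obtain ⟨i1, i2⟩ := ih (by omega)
      have hs : SES U (S ⟨j, by omega⟩) (S ⟨j + 1, hj⟩) (X (k ⟨j, by omega⟩)) :=
        h.ses ⟨j, by omega⟩
      refine ⟨hs.fd i1 (hX _), fun u => ?_⟩
      rw [hs.tr i1 (hX _), i2, Fin.sum_univ_castSucc]
      rfl
  have hT : S ⟨n, n.lt_succ_self⟩ = ⊤ := h.2.2.1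
  obtain ⟨h1, h2⟩ := key n n.lt_succ_self
  have e : S ⟨n, n.lt_succ_self⟩ ≃ₗ[U] M := (LinearEquiv.ofEq _ _ hT).trans Submodule.topEquiv
  exact ⟨h1.congr e, fun u => by rw [← tr_congr e, h2]⟩

end Filtration

section Tilt

variable {𝕜 : Type u} [Field 𝕜] [Algebra Zv 𝕜] {l : ℕ}

variable (𝕜 l) in
/-- The indecomposable tilting module of highest weight `k`: a simple Weyl module below the first
wall, and the translated module `tiltX K r` for `k + 1 = K l + r` with `K > 0` and `r < l`. -/
noncomputable def tiltT (k : ℕ) : ModuleCat.{u} (Uq 𝕜) :=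
  if (k + 1) / l = 0 then Wm 𝕜 (k + 1) else tiltX 𝕜 l ((k + 1) / l) ((k + 1) % l)

theorem tiltT_of_lt {k : ℕ} (h : k + 1 < l) : tiltT 𝕜 l k = Wm 𝕜 (k + 1) := by
  rw [tiltT, if_pos (Nat.div_eq_of_lt h)]

theorem tiltT_eq {k K r : ℕ} (hK : 0 < K) (hr : r < l) (h : k + 1 = K * l + r) :
    tiltT 𝕜 l k = tiltX 𝕜 l K r := by
  have h1 : (k + 1) / l = K := by
    rw [h, mul_comm, Nat.mul_add_div (by omega), Nat.div_eq_of_lt hr, add_zero]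
  have h2 : (k + 1) % l = r := by
    rw [h, mul_comm, Nat.mul_add_mod, Nat.mod_eq_of_lt hr]
  rw [tiltT, h1, h2, if_neg hK.ne']

theorem isT_of_weyl {k : ℕ} {M : Type u} [AddCommGroup M] [Module (Uq 𝕜) M]
    (h : IsIndecomposable (Uq 𝕜) M) (e : M ≃ₗ[Uq 𝕜] Weyl 𝕜 k) (e' : M ≃ₗ[Uq 𝕜] DualWeyl 𝕜 k) :
    IsT 𝕜 k M := by
  have h1 := isFiltration_one (X := Weyl 𝕜) e
  refine ⟨⟨⟨_, _, _, h1⟩, ⟨_, _, _, isFiltration_one (X := DualWeyl 𝕜) e'⟩⟩, h, ⟨_, _, _, h1, ?_⟩⟩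
  refine ⟨⟨0, rfl, fun y _ => Subsingleton.elim _ _⟩, fun i => ?_⟩
  fin_cases i
  exact le_rfl

/-- The weights `k` written as `K l + r - 1`. -/
theorem weight_cases (hl : 0 < l) (k : ℕ) :
    k + 1 < l ∨ ∃ K r, 0 < K ∧ r < l ∧ k + 1 = K * l + r := by
  rcases lt_or_ge (k + 1) l with h | h
  · exact Or.inl h
  · exact Or.inr ⟨(k + 1) / l, (k + 1) % l, Nat.div_pos h hl, Nat.mod_lt _ hl,
      (Nat.div_add_mod' _ _).symm⟩

theorem IsRoot.isT [CharZero 𝕜] (h : IsRoot 𝕜 l) (k : ℕ) : IsT 𝕜 k (tiltT 𝕜 l k) := by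
  rcases weight_cases h.pos k with hk | ⟨K, r, hK, hr, hk⟩
  · rw [tiltT_of_lt hk]
    have : IsSimpleModule (Uq 𝕜) (Wm 𝕜 (k + 1)) := h.simple ⟨by omega, Or.inl hk.le⟩
    exact isT_of_weyl isIndecomposable_of_simple (LinearEquiv.refl _ _)
      (h.self_dual (Or.inl hk.le)).some
  · have hi := h.indec K r hK hr
    rw [tiltT_eq hK hr hk]
    rcases r with _ | r
    · rw [add_zero] at hk
      have e : Wm 𝕜 (k + 1) = tiltX 𝕜 l K 0 := by rw [hk]; rfl
      rw [← e] at hi ⊢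
      exact isT_of_weyl hi (LinearEquiv.refl _ _)
        (h.self_dual (Or.inr (hk ▸ Dvd.intro_left _ rfl))).some
    · have hKl : l ≤ K * l := Nat.le_mul_of_pos_left l hK
      obtain ⟨m, hm⟩ : ∃ m, m + 1 + (r + 1) = K * l := ⟨K * l - (r + 2), by omega⟩
      obtain ⟨i1, i2⟩ := h.ses_tiltX K r (m + 1) (by omega) hm
      rw [← hk] at i1 i2
      obtain ⟨S, hS⟩ := isFiltration_two (X := Weyl 𝕜) (a := k) (b := m) i1
      obtain ⟨S', hS'⟩ := isFiltration_two (X := DualWeyl 𝕜) (a := m) (b := k) i2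
      refine ⟨⟨⟨_, _, _, hS⟩, ⟨_, _, _, hS'⟩⟩, hi, ⟨_, _, _, hS, ?_⟩⟩
      refine ⟨⟨0, rfl, Fin.forall_fin_two.mpr ⟨fun _ => rfl, fun h => ?_⟩⟩,
        Fin.forall_fin_two.mpr ⟨le_rfl, ?_⟩⟩
      · change m = k at h
        omega
      · change m ≤ k
        omega

/-! ### Decomposition of tensor powers -/

variable (l) in
/-- The character of the tilting module of highest weight `k` at the angle `φ`, multiplied by
`sin φ`. -/
noncomputable def tiltChar (k : ℕ) (φ : ℝ) : ℝ :=
  if (k + 1) / l = 0 ∨ (k + 1) % l = 0 then Real.sin ((k + 1) * φ)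
  else 2 * Real.sin (((k + 1) / l * l : ℕ) * φ) * Real.cos (((k + 1) % l : ℕ) * φ)

theorem tiltChar_of_lt {k : ℕ} (h : k + 1 < l) (φ : ℝ) :
    tiltChar l k φ = Real.sin ((k + 1) * φ) := by
  rw [tiltChar, if_pos (Or.inl (Nat.div_eq_of_lt h))]

theorem tiltChar_wall {k K : ℕ} (hk : k + 1 = K * l) (φ : ℝ) :
    tiltChar l k φ = Real.sin ((k + 1) * φ) := by
  rw [tiltChar, if_pos (Or.inr (by rw [hk, Nat.mul_mod_left]))]

theorem tiltChar_eq {k K r : ℕ} (hK : 0 < K) (hr : r + 1 < l) (h : k + 1 = K * l + (r + 1))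
    (φ : ℝ) : tiltChar l k φ = 2 * Real.sin ((K * l : ℕ) * φ) * Real.cos ((r + 1 : ℕ) * φ) := by
  have h1 : (k + 1) / l = K := by
    rw [h, mul_comm, Nat.mul_add_div (by omega), Nat.div_eq_of_lt hr, add_zero]
  have h2 : (k + 1) % l = r + 1 := by
    rw [h, mul_comm, Nat.mul_add_mod, Nat.mod_eq_of_lt hr]
  rw [tiltChar, h1, h2, if_neg (by omega)]

variable (𝕜 l) in
/-- `X` is a finite direct sum of the modules `tiltT`, and the sum of their characters is `g`. -/
def TiltDec (X : Type u) [AddCommGroup X] [Module (Uq 𝕜) X] (g : ℝ → ℝ) : Prop :=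
  ∃ (J : Type) (_ : Fintype J) (κ : J → ℕ),
    Nonempty (X ≃ₗ[Uq 𝕜] ∀ j, tiltT 𝕜 l (κ j)) ∧ ∀ φ, ∑ j, tiltChar l (κ j) φ = g φ

section

variable {X Y : Type u} [AddCommGroup X] [Module (Uq 𝕜) X] [AddCommGroup Y] [Module (Uq 𝕜) Y]
  {f g : ℝ → ℝ}

theorem TiltDec.congr (h : TiltDec 𝕜 l X g) (e : X ≃ₗ[Uq 𝕜] Y) (hfg : ∀ φ, g φ = f φ) :
    TiltDec 𝕜 l Y f := by
  obtain ⟨J, hJ, κ, ⟨e'⟩, hg⟩ := h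
  exact ⟨J, hJ, κ, ⟨e.symm.trans e'⟩, fun φ => (hg φ).trans (hfg φ)⟩

theorem tiltDec_tiltT (k : ℕ) : TiltDec 𝕜 l (tiltT 𝕜 l k) (tiltChar l k) :=
  ⟨Unit, inferInstance, fun _ => k, ⟨(LinearEquiv.funUnique Unit (Uq 𝕜) (tiltT 𝕜 l k)).symm⟩,
    fun φ => by simp⟩

theorem tiltDec_of_subsingleton [Subsingleton X] : TiltDec 𝕜 l X fun _ => 0 :=
  ⟨Empty, inferInstance, Empty.elim, ⟨LinearEquiv.ofSubsingleton _ _⟩, fun φ => by simp⟩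

theorem tiltDec_pi {J : Type} [Fintype J] {Z : J → Type u} [∀ j, AddCommGroup (Z j)]
    [∀ j, Module (Uq 𝕜) (Z j)] {g : J → ℝ → ℝ} (h : ∀ j, TiltDec 𝕜 l (Z j) (g j)) :
    TiltDec 𝕜 l (∀ j, Z j) fun φ => ∑ j, g j φ := by
  choose I hI κ e hg using h
  refine ⟨Σ j, I j, inferInstance, fun p => κ p.1 p.2, ⟨?_⟩, fun φ => ?_⟩
  · exact (LinearEquiv.piCongrRight fun j => (e j).some).trans
      (LinearEquiv.piCurry (Uq 𝕜) (fun j i => tiltT 𝕜 l (κ j i))).symm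
  · rw [Fintype.sum_sigma]
    exact Finset.sum_congr rfl fun j _ => hg j φ

theorem TiltDec.prod (hX : TiltDec 𝕜 l X f) (hY : TiltDec 𝕜 l Y g) :
    TiltDec 𝕜 l (X × Y) fun φ => f φ + g φ := by
  obtain ⟨J, hJ, κ, ⟨e⟩, hf⟩ := hX
  obtain ⟨I, hI, ν, ⟨e'⟩, hg⟩ := hY
  refine ⟨J ⊕ I, inferInstance, Sum.elim κ ν, ⟨?_⟩, fun φ => ?_⟩
  · exact (e.prodCongr e').trans
      (LinearEquiv.sumPiEquivProdPi (Uq 𝕜) J I (fun x => tiltT 𝕜 l (Sum.elim κ ν x))).symm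
  · rw [Fintype.sum_sum_type]
    exact congrArg₂ (· + ·) (hf φ) (hg φ)

end

theorem tiltDec_Wm (hl : 0 < l) {n : ℕ} (hn : n ≤ l ∨ l ∣ n) :
    TiltDec 𝕜 l (Wm 𝕜 n) fun φ => Real.sin (n * φ) := by
  rcases n with _ | n
  · exact (tiltDec_of_subsingleton (X := Wm 𝕜 0)).congr (LinearEquiv.refl _ _) (by simp)
  · have h2 := tiltDec_tiltT (𝕜 := 𝕜) (l := l) n
    by_cases hlt : n + 1 < l
    · rw [tiltT_of_lt hlt] at h2
      refine h2.congr (LinearEquiv.refl _ _) fun φ => ?_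
      rw [tiltChar_of_lt hlt]
      push_cast
      rfl
    · obtain ⟨K, hK⟩ : l ∣ n + 1 := by
        rcases hn with hn | hn
        · exact (show l = n + 1 by omega) ▸ dvd_rfl
        · exact hn
      rw [mul_comm] at hK
      have hK0 : 0 < K := Nat.pos_of_ne_zero fun h => by simp [h] at hK
      rw [tiltT_eq hK0 hl (hK.trans (add_zero _).symm)] at h2
      have e : Wm 𝕜 (n + 1) = tiltX 𝕜 l K 0 := by rw [hK]; rfl
      rw [e]
      refine h2.congr (LinearEquiv.refl _ _) fun φ => ?_
      rw [tiltChar_wall hK]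
      push_cast
      rfl

theorem tiltDec_tiltX {K r : ℕ} (hK : 0 < K) (hr : r + 1 < l) :
    TiltDec 𝕜 l (tiltX 𝕜 l K (r + 1))
      fun φ => 2 * Real.sin ((K * l : ℕ) * φ) * Real.cos ((r + 1 : ℕ) * φ) := by
  obtain ⟨k, hk⟩ : ∃ k, k + 1 = K * l + (r + 1) := ⟨K * l + r, rfl⟩
  have h2 := tiltDec_tiltT (𝕜 := 𝕜) (l := l) k
  rw [tiltT_eq hK hr hk] at h2
  exact h2.congr (LinearEquiv.refl _ _) (tiltChar_eq hK hr hk)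

end Tilt


section Fusion

variable {𝕜 : Type u} [Field 𝕜] [Algebra Zv 𝕜] {l : ℕ}

theorem two_cos_mul_sin (n : ℝ) (φ : ℝ) :
    2 * Real.cos φ * Real.sin ((n + 1) * φ) = Real.sin ((n + 2) * φ) + Real.sin (n * φ) := by
  have h1 : (n + 2) * φ = (n + 1) * φ + φ := by ring
  have h2 : n * φ = (n + 1) * φ - φ := by ring
  rw [h1, h2, Real.sin_add, Real.sin_sub]
  ring

theorem two_cos_mul_cos (n : ℝ) (φ : ℝ) :
    2 * Real.cos φ * Real.cos ((n + 1) * φ) = Real.cos ((n + 2) * φ) + Real.cos (n * φ) := by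
  have h1 : (n + 2) * φ = (n + 1) * φ + φ := by ring
  have h2 : n * φ = (n + 1) * φ - φ := by ring
  rw [h1, h2, Real.cos_add, Real.cos_sub]
  ring

/-- The product of two modules, up to a zero factor. -/
noncomputable def prodSubsingleton (X Y : Type*) [AddCommGroup X] [Module (Uq 𝕜) X] [AddCommGroup Y]
    [Module (Uq 𝕜) Y] [Subsingleton Y] : X ≃ₗ[Uq 𝕜] X × Y :=
  LinearEquiv.ofLinearMap (LinearMap.inl _ _ _) (LinearMap.fst _ _ _)
    (LinearMap.ext fun _ => Prod.ext rfl (Subsingleton.elim _ _)) (LinearMap.ext fun _ => rfl)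

/-- Tensoring the tilting module of highest weight `k` with `V` gives the tilting module of highest
weight `k + 1`, once, and further tilting modules. -/
theorem IsRoot.exists_VT_tiltT [CharZero 𝕜] (h : IsRoot 𝕜 l) (k : ℕ) : ∃ R : ModuleCat.{u} (Uq 𝕜),
    Nonempty (VT (tiltT 𝕜 l k) ≃ₗ[Uq 𝕜] tiltT 𝕜 l (k + 1) × R) ∧
      TiltDec 𝕜 l R fun φ => 2 * Real.cos φ * tiltChar l k φ - tiltChar l (k + 1) φ := by
  have hl := h.pos
  rcases weight_cases hl k with hk | ⟨K, r, hK, hr, hk⟩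
  · -- below the first wall the Clebsch–Gordan rule holds
    obtain ⟨e⟩ := h.VT_Wm_small k (by omega)
    have hd := tiltDec_Wm (𝕜 := 𝕜) hl (n := k) (Or.inl (by omega))
    have e1 : tiltT 𝕜 l (k + 1) = Wm 𝕜 (k + 2) := by
      rcases Nat.lt_or_ge (k + 2) l with h2 | h2
      · exact tiltT_of_lt h2
      · have h3 : k + 2 = 1 * l := by omega
        rw [tiltT_eq one_pos hl (h3.trans (add_zero _).symm), h3]
        rfl
    have e2 : ∀ φ, tiltChar l (k + 1) φ = Real.sin ((k + 2) * φ) := fun φ => by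
      have : ((k + 1 : ℕ) : ℝ) + 1 = k + 2 := by push_cast; ring
      rw [← this]
      rcases Nat.lt_or_ge (k + 2) l with h2 | h2
      · exact tiltChar_of_lt h2 φ
      · exact tiltChar_wall (K := 1) (by omega) φ
    refine ⟨Wm 𝕜 k, ?_, hd.congr (LinearEquiv.refl _ _) fun φ => ?_⟩
    · rw [tiltT_of_lt hk, e1]
      exact ⟨e⟩
    · rw [e2, tiltChar_of_lt hk, two_cos_mul_sin]
      ring
  have hchar0 : r = 0 → ∀ φ, tiltChar l k φ = Real.sin ((K * l : ℕ) * φ) := by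
    rintro rfl φ
    rw [tiltChar_wall (by simpa using hk), ← Nat.cast_add_one, hk, add_zero]
  -- at the wall `r = l` the module of highest weight `K l + r - 1` splits
  have hwall : ∀ k', k' + 1 = K * l + l → ∃ R : ModuleCat.{u} (Uq 𝕜),
      Nonempty (tiltX 𝕜 l K l ≃ₗ[Uq 𝕜] tiltT 𝕜 l k' × R) ∧
        TiltDec 𝕜 l R (fun φ => 2 * Real.sin ((K * l : ℕ) * φ) * Real.cos (l * φ)
          - tiltChar l k' φ) := by
    intro k' hk'
    obtain ⟨K, rfl⟩ : ∃ K', K = K' + 1 := ⟨K - 1, by omega⟩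
    obtain ⟨e⟩ := h.tiltX_wall K
    have h3 : k' + 1 = (K + 2) * l := by rw [hk']; ring
    refine ⟨Wm 𝕜 (K * l), ?_, (tiltDec_Wm hl (Or.inr (Dvd.intro_left _ rfl))).congr
      (LinearEquiv.refl _ _) fun φ => ?_⟩
    · rw [tiltT_eq (by omega) hl (h3.trans (add_zero _).symm)]
      exact ⟨e⟩
    · rw [tiltChar_wall h3, ← Nat.cast_add_one, h3]
      have h1 : (((K + 2) * l : ℕ) : ℝ) * φ = ((K + 1) * l : ℕ) * φ + l * φ := by push_cast; ring
      have h2 : ((K * l : ℕ) : ℝ) * φ = ((K + 1) * l : ℕ) * φ - l * φ := by push_cast; ring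
      rw [h1, h2, Real.sin_add, Real.sin_sub]
      ring
  -- on the wall, `V ⊗ T(k)` is itself a translated module; for `l = 1` it lies on the next wall
  rcases r with _ | r
  · have h0 := tiltT_eq (𝕜 := 𝕜) hK hr hk
    have e0 : Nonempty (VT (tiltT 𝕜 l k) ≃ₗ[Uq 𝕜] tiltX 𝕜 l K 1) := by
      rw [h0]
      exact ⟨LinearEquiv.refl _ _⟩
    obtain ⟨e0⟩ := e0
    have hc : ∀ φ, 2 * Real.cos φ * tiltChar l k φ
        = 2 * Real.sin ((K * l : ℕ) * φ) * Real.cos φ := fun φ => by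
      rw [hchar0 rfl]
      ring
    rcases Nat.lt_or_ge 1 l with hl1 | hl1
    · have h1 : k + 1 + 1 = K * l + (0 + 1) := by omega
      refine ⟨ModuleCat.of _ PUnit, ?_, (tiltDec_of_subsingleton (X := PUnit)).congr
        (LinearEquiv.refl _ _) fun φ => ?_⟩
      · rw [tiltT_eq (k := k + 1) hK hl1 h1]
        exact ⟨e0.trans (prodSubsingleton _ PUnit)⟩
      · rw [tiltChar_eq hK hl1 h1, hc]
        simp
    · obtain rfl : l = 1 := by omega
      obtain ⟨R, ⟨e⟩, hR⟩ := hwall (k + 1) (by omega)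
      refine ⟨R, ⟨e0.trans e⟩, hR.congr (LinearEquiv.refl _ _) fun φ => ?_⟩
      rw [hc]
      simp
  · -- off the wall, `V ⊗ T(k)` is the sum of the translates up and down
    obtain ⟨e0⟩ := h.VT_tiltX K r hK (by omega)
    have hd : TiltDec 𝕜 l (downX 𝕜 l K r)
        fun φ => 2 * Real.sin ((K * l : ℕ) * φ) * Real.cos (r * φ) := by
      rcases r with _ | r
      · obtain ⟨e⟩ := h.downX_zero K hK (by omega)
        have hw := tiltDec_Wm (𝕜 := 𝕜) hl (n := K * l) (Or.inr (Dvd.intro_left _ rfl))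
        refine (hw.prod hw).congr e.symm fun φ => ?_
        simp
        ring
      · obtain ⟨e⟩ := h.downX_succ K r hK (by omega)
        exact (tiltDec_tiltX hK (by omega)).congr e fun φ => rfl
    have hup : ∃ R : ModuleCat.{u} (Uq 𝕜),
        Nonempty (tiltX 𝕜 l K (r + 2) ≃ₗ[Uq 𝕜] tiltT 𝕜 l (k + 1) × R) ∧
          TiltDec 𝕜 l R (fun φ => 2 * Real.sin ((K * l : ℕ) * φ) * Real.cos ((r + 2 : ℕ) * φ)
            - tiltChar l (k + 1) φ) := by
      rcases Nat.lt_or_ge (r + 2) l with hr2 | hr2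
      · have h1 : k + 1 + 1 = K * l + (r + 1 + 1) := by omega
        refine ⟨ModuleCat.of _ PUnit, ?_, (tiltDec_of_subsingleton (X := PUnit)).congr
          (LinearEquiv.refl _ _) fun φ => ?_⟩
        · rw [tiltT_eq (k := k + 1) hK hr2 h1]
          exact ⟨prodSubsingleton _ PUnit⟩
        · rw [tiltChar_eq hK hr2 h1]
          exact (sub_self _).symm
      · obtain rfl : l = r + 2 := by omega
        exact hwall (k + 1) (by omega)
    obtain ⟨R, ⟨e⟩, hR⟩ := hup
    refine ⟨ModuleCat.of _ (R × downX 𝕜 l K r), ?_, (hR.prod hd).congr (LinearEquiv.refl _ _)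
      fun φ => ?_⟩
    · rw [tiltT_eq hK hr hk]
      exact ⟨e0.trans ((e.prodCongr (LinearEquiv.refl _ _)).trans
        (LinearEquiv.prodAssoc (Uq 𝕜) (tiltT 𝕜 l (k + 1)) R (downX 𝕜 l K r)))⟩
    · have := two_cos_mul_cos r φ
      rw [tiltChar_eq (k := k) hK hr hk]
      push_cast at this ⊢
      linear_combination (-2 * Real.sin (K * l * φ)) * this

/-- Tensoring with `V` multiplies the character of a tilting module by `2 cos φ`. -/
theorem IsRoot.tiltDec_VT [CharZero 𝕜] (h : IsRoot 𝕜 l) {X : Type u} [AddCommGroup X] [Module (Uq 𝕜) X]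
    {g : ℝ → ℝ} (hX : TiltDec 𝕜 l X g) : TiltDec 𝕜 l (VT X) fun φ => 2 * Real.cos φ * g φ := by
  obtain ⟨J, hJ, κ, ⟨e⟩, hg⟩ := hX
  have h1 : ∀ j, TiltDec 𝕜 l (VT (tiltT 𝕜 l (κ j)))
      fun φ => 2 * Real.cos φ * tiltChar l (κ j) φ := fun j => by
    obtain ⟨R, ⟨e1⟩, hR⟩ := h.exists_VT_tiltT (κ j)
    exact ((tiltDec_tiltT (κ j + 1)).prod hR).congr e1.symm fun φ => by ring
  refine (tiltDec_pi h1).congr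
    ((VT.piEquiv (𝕜 := 𝕜) fun j => tiltT 𝕜 l (κ j)).symm.trans (VT.congr e.symm)) fun φ => ?_
  rw [← Finset.mul_sum, hg]

/-- The trivial representation is the Weyl module of highest weight `0`. -/
theorem exists_tensorPower_zero_equiv : Nonempty (TensorPower 𝕜 0 ≃ₗ[Uq 𝕜] Weyl 𝕜 0) := by
  let P : Matrix (Fin 1) Unit Zv := Matrix.of fun _ _ => 1
  have key : ∀ c : Qv, P.map (algebraMap Zv Qv) * algebraMap Qv (Matrix Unit Unit Qv) c
      = algebraMap Qv (Matrix (Fin 1) (Fin 1) Qv) c * P.map (algebraMap Zv Qv) := fun c => by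
    ext i j
    simp [P, Matrix.algebraMap_eq_diagonal]
  have hw : ∀ g, (weylRep 0).ρ (gen g)
      = (algebraMap Qv (Matrix (Fin 1) (Fin 1) Qv) (counit (gen g)) :
        Matrix (Fin 1) (Fin 1) Qv) := by
    intro g
    cases g
    · refine (weylRep_E 0).trans (Matrix.ext fun (i : Fin 1) (j : Fin 1) => ?_)
      simp [weylE, counit, Subsingleton.elim i 0, Subsingleton.elim j 0]
    · refine (weylRep_F 0).trans (Matrix.ext fun (i : Fin 1) (j : Fin 1) => ?_)
      simp [weylF, counit, Subsingleton.elim i 0, Subsingleton.elim j 0]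
    · refine (weylRep_K 0).trans (Matrix.ext fun (i : Fin 1) (j : Fin 1) => ?_)
      simp [weylK, counit, Subsingleton.elim i 0, Subsingleton.elim j 0]
    · refine (weylRep_Ki 0).trans (Matrix.ext fun (i : Fin 1) (j : Fin 1) => ?_)
      simp [weylKi, counit, Subsingleton.elim i 0, Subsingleton.elim j 0]
  let f : LatticeRep.triv.Spec 𝕜 →ₗ[Uq 𝕜] (weylRep 0).Spec 𝕜 := latHom 𝕜 P fun g =>
    (key (counit (gen g))).trans
      (congrArg (fun A : Matrix (Fin 1) (Fin 1) Qv => A * P.map (algebraMap Zv Qv)) (hw g).symm)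
  have hf : ∀ (w : Unit → 𝕜) (i : Fin 1), f w i = w () := fun w i => by
    change ((P.map (algebraMap Zv 𝕜)).mulVec w) i = w ()
    simp [P, Matrix.mulVec, dotProduct]
  refine ⟨LinearEquiv.ofBijective f ⟨fun (w : Unit → 𝕜) (w' : Unit → 𝕜) hw => ?_,
    fun (w : Fin 1 → 𝕜) => ⟨(fun _ => w 0 : Unit → 𝕜), ?_⟩⟩⟩
  · exact funext fun _ => (hf w 0).symm.trans ((congrFun hw (0 : Fin 1)).trans (hf w' 0))
  · exact funext fun (i : Fin 1) => (hf _ i).trans (congrArg w (Subsingleton.elim 0 i))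

/-- `V^{⊗(N+1)} = V ⊗ V^{⊗N}`. -/
noncomputable def tensorPowerSucc (N : ℕ) : VT (TensorPower 𝕜 N) ≃ₗ[Uq 𝕜] TensorPower 𝕜 (N + 1) :=
  IsTensorV.equiv 𝕜 (isTensorV_tensor ((weylRep 1).tensorPow N))

theorem IsRoot.exists_tiltT_zero_equiv [CharZero 𝕜] (h : IsRoot 𝕜 l) :
    Nonempty (TensorPower 𝕜 0 ≃ₗ[Uq 𝕜] tiltT 𝕜 l 0) := by
  obtain ⟨e⟩ := exists_tensorPower_zero_equiv (𝕜 := 𝕜)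
  have e1 : tiltT 𝕜 l 0 = Wm 𝕜 1 := by
    have hl := h.pos
    rcases Nat.lt_or_ge 1 l with h1 | h1
    · exact tiltT_of_lt h1
    · obtain rfl : l = 1 := by omega
      exact tiltT_eq (K := 1) (r := 0) one_pos one_pos rfl
  rw [e1]
  exact ⟨e⟩

theorem tiltChar_zero (l : ℕ) (φ : ℝ) : tiltChar l 0 φ = Real.sin φ := by
  rcases l with _ | _ | l
  · rw [tiltChar, if_pos (Or.inl (by simp))]
    simp
  · rw [tiltChar, if_pos (Or.inr (by simp))]
    simp
  · rw [tiltChar_of_lt (by omega)]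
    simp

theorem IsRoot.tiltDec_tensorPower [CharZero 𝕜] (h : IsRoot 𝕜 l) (N : ℕ) :
    TiltDec 𝕜 l (TensorPower 𝕜 N) fun φ => Real.sin φ * (2 * Real.cos φ) ^ N := by
  induction N with
  | zero =>
    obtain ⟨e⟩ := h.exists_tiltT_zero_equiv
    exact (tiltDec_tiltT 0).congr e.symm fun φ => by rw [tiltChar_zero]; ring
  | succ N ih => exact (h.tiltDec_VT ih).congr (tensorPowerSucc N) fun φ => by ring

/-- The tilting module of highest weight `N` is a direct summand of `V^{⊗N}`. -/
theorem IsRoot.exists_retract_tensorPower [CharZero 𝕜] (h : IsRoot 𝕜 l) (N : ℕ) :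
    ∃ (i : tiltT 𝕜 l N →ₗ[Uq 𝕜] TensorPower 𝕜 N) (p : TensorPower 𝕜 N →ₗ[Uq 𝕜] tiltT 𝕜 l N),
      p ∘ₗ i = LinearMap.id := by
  induction N with
  | zero =>
    obtain ⟨e⟩ := h.exists_tiltT_zero_equiv
    exact ⟨e.symm.toLinearMap, e.toLinearMap, LinearMap.ext e.apply_symm_apply⟩
  | succ N ih =>
    obtain ⟨i, p, hpi⟩ := ih
    obtain ⟨R, ⟨e⟩, -⟩ := h.exists_VT_tiltT N
    refine ⟨(tensorPowerSucc N).toLinearMap ∘ₗ VT.map i ∘ₗ e.symm.toLinearMap ∘ₗ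
      LinearMap.inl (Uq 𝕜) (tiltT 𝕜 l (N + 1)) R, LinearMap.fst (Uq 𝕜) (tiltT 𝕜 l (N + 1)) R ∘ₗ
      e.toLinearMap ∘ₗ VT.map p ∘ₗ (tensorPowerSucc N).symm.toLinearMap, LinearMap.ext fun x => ?_⟩
    have h1 : ∀ w, VT.map p (VT.map i w) = w := fun w => VT.ext fun j => by
      rw [VT.map_apply, VT.map_apply]
      exact LinearMap.congr_fun hpi _
    simp [h1]

end Fusion


/-! ### Uniqueness of the decomposition -/

section TracePi

variable {𝕜 U : Type*} [Field 𝕜] [Ring U] [Algebra 𝕜 U]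

theorem fd_pi {J : Type*} [Fintype J] {Z : J → Type*} [∀ j, AddCommGroup (Z j)]
    [∀ j, Module U (Z j)] (h : ∀ j, FD 𝕜 U (Z j)) : FD 𝕜 U (∀ j, Z j) := by
  unfold FD at *
  exact Module.Finite.pi (M := fun j => Rs 𝕜 U (Z j))

theorem tr_pi {J : Type*} [Fintype J] {Z : J → Type*} [∀ j, AddCommGroup (Z j)]
    [∀ j, Module U (Z j)] (h : ∀ j, FD 𝕜 U (Z j)) (u : U) :
    tr 𝕜 u (∀ j, Z j) = ∑ j, tr 𝕜 u (Z j) := by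
  classical
  have h0 := fd_pi h
  unfold FD at h h0
  have key : rsSmul 𝕜 (∀ j, Z j) u = ∑ j, (rsMap 𝕜 (LinearMap.single U Z j) ∘ₗ rsSmul 𝕜 (Z j) u) ∘ₗ
      rsMap 𝕜 (LinearMap.proj (R := U) (φ := Z) j) := by
    refine LinearMap.ext fun x => ?_
    rw [LinearMap.sum_apply]
    exact (Finset.univ_sum_single (u • (id (α := ∀ j, Z j) x))).symm
  rw [tr, key, map_sum]
  refine Finset.sum_congr rfl fun j _ => ?_
  rw [LinearMap.trace_comp_comm', ← LinearMap.comp_assoc, tr]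
  congr 1
  refine LinearMap.ext fun x => ?_
  exact Pi.single_eq_same (M := Z) j _

end TracePi

/-- Two finite families of indices with the same sums of a unitriangular array have the same
multiplicities. -/
theorem card_eq_of_unitriangular {K : Type*} [Field K] [CharZero K] {J J' : Type u} [Fintype J]
    [Fintype J'] (κ : J → ℕ) (κ' : J' → ℕ) (τ : ℕ → ℕ → K) (h0 : ∀ n k, k < n → τ n k = 0)
    (h1 : ∀ n, τ n n = 1) (h : ∀ n, ∑ j, τ n (κ j) = ∑ j, τ n (κ' j)) (k : ℕ) :
    Fintype.card {j // κ j = k} = Fintype.card {j // κ' j = k} := by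
  classical
  let c : ℕ → K := fun k => Fintype.card {j // κ j = k}
  let c' : ℕ → K := fun k => Fintype.card {j // κ' j = k}
  obtain ⟨B, hB, hB'⟩ : ∃ B, (∀ j, κ j < B) ∧ ∀ j, κ' j < B :=
    ⟨(∑ j, κ j) + (∑ j, κ' j) + 1, fun j => by
      have := Finset.single_le_sum (f := κ) (fun i _ => Nat.zero_le _) (Finset.mem_univ j)
      omega, fun j => by
      have := Finset.single_le_sum (f := κ') (fun i _ => Nat.zero_le _) (Finset.mem_univ j)
      omega⟩
  have hsum : ∀ (I : Type u) [Fintype I] (ν : I → ℕ) (_ : ∀ j, ν j < B) (f : ℕ → K),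
      ∑ j, f (ν j) = ∑ k ∈ Finset.range B, (Fintype.card {j // ν j = k} : K) * f k := by
    intro I _ ν hν f
    rw [← Finset.sum_fiberwise_of_maps_to (g := ν) (t := Finset.range B)
      (fun j _ => Finset.mem_range.mpr (hν j))]
    refine Finset.sum_congr rfl fun k _ => ?_
    rw [Finset.sum_congr rfl (g := fun _ => f k) (fun j hj => by
      rw [(Finset.mem_filter.mp hj).2]), Finset.sum_const, nsmul_eq_mul, Fintype.card_subtype]
  have hz : ∀ n, ∑ k ∈ Finset.range B, (c k - c' k) * τ n k = 0 := fun n => by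
    simp only [sub_mul, Finset.sum_sub_distrib]
    rw [sub_eq_zero, ← hsum J κ hB, ← hsum J' κ' hB', h]
  -- downward induction on `k`
  have key : ∀ d k, B ≤ k + d → c k - c' k = 0 := by
    intro d
    induction d using Nat.strong_induction_on with
    | _ d ih =>
      intro k hk
      rcases Nat.lt_or_ge k B with hkB | hkB
      · have := hz k
        rw [Finset.sum_eq_single_of_mem k (Finset.mem_range.mpr hkB)] at this
        · rwa [h1, mul_one] at this
        · intro b hb hbk
          rcases lt_or_gt_of_ne hbk with h2 | h2
          · rw [h0 _ _ h2, mul_zero]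
          · rw [ih (d - 1) (by omega) b (by omega), zero_mul]
      · have e1 : c k = 0 := by
          simp only [c, Nat.cast_eq_zero, Fintype.card_eq_zero_iff]
          exact ⟨fun ⟨j, hj⟩ => by have := hB j; omega⟩
        have e2 : c' k = 0 := by
          simp only [c', Nat.cast_eq_zero, Fintype.card_eq_zero_iff]
          exact ⟨fun ⟨j, hj⟩ => by have := hB' j; omega⟩
        rw [e1, e2, sub_zero]
  have := key B k (by omega)
  exact Nat.cast_injective (R := K) (sub_eq_zero.mp this)

section Uniqueness

variable {𝕜 : Type u} [Field 𝕜] [Algebra Zv 𝕜] {l : ℕ}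

/-- The traces of `F⁽ⁿ⁾E⁽ⁿ⁾` detect the highest weight of an indecomposable tilting module. -/
theorem IsT.tr {k : ℕ} {M : Type u} [AddCommGroup M] [Module (Uq 𝕜) M] (h : IsT 𝕜 k M) :
    FD 𝕜 (Uq 𝕜) M ∧ tr 𝕜 (dF 𝕜 k * dE 𝕜 k) M = 1 ∧
      ∀ n, k < n → QuantumSL2.tr 𝕜 (dF 𝕜 n * dE 𝕜 n) M = 0 := by
  obtain ⟨-, -, n, S, a, hS, ⟨i, hi, hi'⟩, ha⟩ := h
  obtain ⟨h1, h2⟩ := hS.tr (𝕜 := 𝕜) fun k => fd_spec _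
  refine ⟨h1, ?_, fun n hn => ?_⟩
  · rw [h2, Finset.sum_eq_single_of_mem i (Finset.mem_univ i), hi, tr_dF_dE_self]
    intro j _ hj
    exact tr_dF_dE_of_lt (lt_of_le_of_ne (ha j) fun h => hj (hi' j h))
  · rw [h2]
    exact Finset.sum_eq_zero fun j _ => tr_dF_dE_of_lt ((ha j).trans_lt hn)

theorem IsT.weight_eq {j k : ℕ} {M M' : Type u} [AddCommGroup M] [Module (Uq 𝕜) M]
    [AddCommGroup M'] [Module (Uq 𝕜) M'] (h : IsT 𝕜 j M) (h' : IsT 𝕜 k M')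
    (e : M ≃ₗ[Uq 𝕜] M') : j = k := by
  obtain ⟨-, h1, h2⟩ := h.tr
  obtain ⟨-, h3, h4⟩ := h'.tr
  rcases lt_trichotomy j k with hjk | hjk | hjk
  · have := h2 k hjk
    rw [tr_congr e, h3] at this
    exact absurd this one_ne_zero
  · exact hjk
  · have := h4 j hjk
    rw [← tr_congr e, h1] at this
    exact absurd this one_ne_zero

theorem exists_pi_tensorPower {T : ℕ → ModuleCat.{u} (Uq 𝕜)} {M : ℕ → ℕ → ℕ}
    (h : IsTiltingDecomposition 𝕜 T M) (N : ℕ) : ∃ F : Finset ℕ, (∀ k ∉ F, M N k = 0) ∧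
      Nonempty (TensorPower 𝕜 N ≃ₗ[Uq 𝕜] ∀ p : (Σ k : F, Fin (M N k)), T p.1) := by
  have : IsNoetherian (Uq 𝕜) (TensorPower 𝕜 N) := (fd_spec (𝕜 := 𝕜) _).isNoetherian
  obtain ⟨e⟩ := h.2 N
  exact exists_pi_of_directSum (T := fun k => T k) (fun k => (h.1 k).2.1.1) (M N) e

/-- The indecomposable tilting modules are unique, since each is a summand of a tensor power. -/
theorem IsRoot.tiltT_unique [CharZero 𝕜] (h : IsRoot 𝕜 l) {T : ℕ → ModuleCat.{u} (Uq 𝕜)} {M : ℕ → ℕ → ℕ}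
    (hTM : IsTiltingDecomposition 𝕜 T M) (k : ℕ) : Nonempty (tiltT 𝕜 l k ≃ₗ[Uq 𝕜] T k) := by
  obtain ⟨F, -, ⟨e⟩⟩ := exists_pi_tensorPower hTM k
  obtain ⟨i, p, hpi⟩ := h.exists_retract_tensorPower k
  have hT := h.isT k
  have := hT.tr.1.isNoetherian
  have := hT.tr.1.isArtinian
  obtain ⟨j, ⟨f⟩⟩ := exists_equiv_of_retract hT.2.1 (Y := fun p : (Σ k' : F, Fin (M k k')) => T p.1)
    (fun j => (hTM.1 _).2.1) (e.toLinearMap ∘ₗ i) (p ∘ₗ e.symm.toLinearMap)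
    (LinearMap.ext fun x => by simpa using LinearMap.congr_fun hpi x)
  have hj := hT.weight_eq (hTM.1 _) f
  have : ∀ k', k = k' → (tiltT 𝕜 l k ≃ₗ[Uq 𝕜] T k') → Nonempty (tiltT 𝕜 l k ≃ₗ[Uq 𝕜] T k) := by
    rintro k' rfl f
    exact ⟨f⟩
  exact this _ hj f

variable (l) in
/-- The dimension of the indecomposable tilting module of highest weight `k`. -/
def tiltDim (k : ℕ) : ℕ :=
  if (k + 1) / l = 0 ∨ (k + 1) % l = 0 then k + 1 else 2 * ((k + 1) / l * l)

theorem IsRoot.rk_tiltT [CharZero 𝕜] (h : IsRoot 𝕜 l) (k : ℕ) : rk 𝕜 (Uq 𝕜) (tiltT 𝕜 l k) = tiltDim l k := by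
  have hl := h.pos
  rcases weight_cases hl k with hk | ⟨K, r, hK, hr, hk⟩
  · rw [tiltT_of_lt hk, tiltDim, if_pos (Or.inl (Nat.div_eq_of_lt hk)), rk_Wm]
  · have h1 : (k + 1) / l = K := by
      rw [hk, mul_comm, Nat.mul_add_div hl, Nat.div_eq_of_lt hr, add_zero]
    have h2 : (k + 1) % l = r := by
      rw [hk, mul_comm, Nat.mul_add_mod, Nat.mod_eq_of_lt hr]
    rw [tiltT_eq hK hr hk, tiltDim, h1, h2]
    rcases r with _ | r
    · rw [if_pos (Or.inr rfl), hk]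
      exact rk_Wm 𝕜 _
    · rw [if_neg (by omega)]
      exact h.rk_tiltX K r hK hr.le

theorem dim_eq_rk (X : ModuleCat.{u} (Uq 𝕜)) : dim 𝕜 X = rk 𝕜 (Uq 𝕜) X := rfl

theorem IsRoot.dim_eq [CharZero 𝕜] (h : IsRoot 𝕜 l) {T : ℕ → ModuleCat.{u} (Uq 𝕜)} {M : ℕ → ℕ → ℕ}
    (hTM : IsTiltingDecomposition 𝕜 T M) (k : ℕ) : dim 𝕜 (T k) = tiltDim l k := by
  obtain ⟨e⟩ := h.tiltT_unique hTM k
  rw [dim_eq_rk, ← rk_congr e, h.rk_tiltT]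

theorem rk_tensorPower (N : ℕ) : rk 𝕜 (Uq 𝕜) (TensorPower 𝕜 N) = 2 ^ N := by
  rw [rk_spec]
  induction N with
  | zero => exact Fintype.card_unit
  | succ N ih =>
    have : Fintype.card (Fin 2 × ((weylRep 1).tensorPow N).ι) = 2 ^ (N + 1) := by
      rw [Fintype.card_prod, Fintype.card_fin, ih, pow_succ']
    exact (Fintype.card_congr (tensorIx ((weylRep 1).tensorPow N))).symm.trans this

/-- A decomposition of all tensor powers exists. -/
theorem IsRoot.exists_tiltingDecomposition [CharZero 𝕜] (h : IsRoot 𝕜 l) :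
    ∃ (T : ℕ → ModuleCat.{u} (Uq 𝕜)) (M : ℕ → ℕ → ℕ), IsTiltingDecomposition 𝕜 T M := by
  classical
  choose J hJ κ e hκ using h.tiltDec_tensorPower (𝕜 := 𝕜)
  refine ⟨tiltT 𝕜 l, fun N k => Fintype.card {j // κ N j = k}, h.isT, fun N => ?_⟩
  obtain ⟨f⟩ := pi_equiv_directSum (U := Uq 𝕜) (T := fun k => tiltT 𝕜 l k) (κ N)
    (fun k => Fintype.card {j // κ N j = k}) fun k => rfl
  exact ⟨(e N).some.trans f⟩

/-- The multiplicities are determined by the decomposition of the character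
`sin φ (2 cos φ)^N` into the characters of the tilting modules. -/
theorem IsRoot.exists_multiplicities [CharZero 𝕜] (h : IsRoot 𝕜 l) {T : ℕ → ModuleCat.{u} (Uq 𝕜)}
    {M : ℕ → ℕ → ℕ} (hTM : IsTiltingDecomposition 𝕜 T M) (N : ℕ) :
    ∃ F : Finset ℕ, (∀ k ∉ F, M N k = 0) ∧
      (∀ φ, ∑ k ∈ F, M N k * tiltChar l k φ = Real.sin φ * (2 * Real.cos φ) ^ N) ∧
      ∑ k ∈ F, M N k * tiltDim l k = 2 ^ N := by
  classical
  obtain ⟨F, hF, ⟨e⟩⟩ := exists_pi_tensorPower hTM N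
  obtain ⟨J, hJ, κ, ⟨e'⟩, hκ⟩ := h.tiltDec_tensorPower (𝕜 := 𝕜) N
  let P := Σ k : F, Fin (M N k)
  let ν : P → ℕ := fun p => p.1
  let τ : ℕ → ℕ → 𝕜 := fun n k => tr 𝕜 (dF 𝕜 n * dE 𝕜 n) (tiltT 𝕜 l k)
  have hu : ∀ k (u : Uq 𝕜), tr 𝕜 u (T k) = tr 𝕜 u (tiltT 𝕜 l k) := fun k u =>
    (tr_congr (h.tiltT_unique hTM k).some u).symm
  have htr : ∀ u : Uq 𝕜, ∑ j, tr 𝕜 u (tiltT 𝕜 l (ν j)) = tr 𝕜 u (TensorPower 𝕜 N) := fun u => by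
    rw [tr_congr e, tr_pi (Z := fun p : P => T p.1) fun p => (hTM.1 _).tr.1]
    exact Finset.sum_congr rfl fun p _ => (hu _ _).symm
  have htr' : ∀ u : Uq 𝕜, ∑ j, tr 𝕜 u (tiltT 𝕜 l (κ j)) = tr 𝕜 u (TensorPower 𝕜 N) := fun u => by
    rw [tr_congr e', tr_pi fun p => (h.isT _).tr.1]
  have hsum : ∀ f : ℕ → ℝ, ∑ p, f (ν p) = ∑ k ∈ F, M N k * f k := fun f => by
    rw [Fintype.sum_sigma, ← Finset.sum_coe_sort F fun k => (M N k : ℝ) * f k]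
    refine Finset.sum_congr rfl fun k _ => ?_
    simp [ν]
  have hcard := card_eq_of_unitriangular ν κ τ (fun n k hk => (h.isT k).tr.2.2 n hk)
    (fun n => (h.isT n).tr.2.1) fun n => (htr _).trans (htr' _).symm
  have hbij : ∀ f : ℕ → ℝ, ∑ p, f (ν p) = ∑ j, f (κ j) := fun f => by
    let E : P ≃ J := (Equiv.sigmaFiberEquiv ν).symm.trans
      ((Equiv.sigmaCongrRight fun k => Fintype.equivOfCardEq (hcard k)).trans
        (Equiv.sigmaFiberEquiv κ))
    have hE : ∀ p, κ (E p) = ν p := fun p =>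
      (Fintype.equivOfCardEq (hcard (ν p)) ⟨p, rfl⟩).2
    rw [← E.sum_comp]
    exact Finset.sum_congr rfl fun p _ => by rw [hE]
  refine ⟨F, hF, fun φ => ?_, ?_⟩
  · exact (hsum fun k => tiltChar l k φ).symm.trans ((hbij fun k => tiltChar l k φ).trans (hκ φ))
  · have h1 := htr 1
    rw [tr_one (fd_spec _), rk_tensorPower] at h1
    have h2 : ∀ k, tr 𝕜 (1 : Uq 𝕜) (tiltT 𝕜 l k) = tiltDim l k := fun k => by
      rw [tr_one (h.isT k).tr.1, h.rk_tiltT]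
    simp only [h2] at h1
    have h3 : ∑ p, tiltDim l (ν p) = 2 ^ N := by exact_mod_cast h1
    have h4 := hsum fun k => tiltDim l k
    have h5 : ∑ p, (tiltDim l (ν p) : ℝ) = 2 ^ N := by exact_mod_cast h3
    rw [h5] at h4
    exact_mod_cast h4.symm

theorem isRoot_of_isPrimitiveRoot (hl : Odd l) {q : 𝕜} (hq : IsPrimitiveRoot q (2 * l))
    (hv : algebraMap Zv 𝕜 (LaurentPolynomial.T 1) = q) : IsRoot 𝕜 l where
  odd := hl
  pow := by
    rw [qv, hv]
    have h1 : (q ^ l) ^ 2 = 1 := by rw [← pow_mul, mul_comm, hq.pow_eq_one]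
    refine (sq_eq_one_iff.mp h1).resolve_left fun h2 => ?_
    have := Nat.le_of_dvd hl.pos (hq.dvd_of_pow_eq_one l h2)
    have := hl.pos
    omega
  dvd j hj := by
    rw [qv, hv] at hj
    exact Nat.dvd_of_mul_dvd_mul_left two_pos (hq.dvd_of_pow_eq_one _ hj)

end Uniqueness


section Extraction

/-! ### Extraction of the multiplicities by a discrete Fourier transform -/

/-- The angles `φ_j = ε + 2πj/l`. -/
noncomputable def angle (l : ℕ) (ε : ℝ) (j : ℕ) : ℝ := ε + 2 * Real.pi * j / l

variable {l : ℕ}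

theorem sum_exp_angle {a : ℤ} (hl : 0 < l) (ha : ¬ (l : ℤ) ∣ a) (ε : ℝ) :
    ∑ j ∈ Finset.range l, Complex.exp ((a * angle l ε j : ℝ) * Complex.I) = 0 := by
  have hl0 : (l : ℂ) ≠ 0 := by exact_mod_cast hl.ne'
  let z := Complex.exp (2 * Real.pi * Complex.I * a / l)
  have h1 : ∀ j : ℕ, Complex.exp ((a * angle l ε j : ℝ) * Complex.I)
      = Complex.exp (a * ε * Complex.I) * z ^ j := fun j => by
    rw [← Complex.exp_nat_mul, ← Complex.exp_add, angle]
    congr 1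
    push_cast
    field_simp
  have hz : z ^ l = 1 := by
    rw [← Complex.exp_nat_mul, Complex.exp_eq_one_iff]
    exact ⟨a, by field_simp⟩
  have hz1 : z ≠ 1 := by
    intro h
    obtain ⟨n, hn⟩ := Complex.exp_eq_one_iff.mp h
    refine ha ⟨n, ?_⟩
    have h2 : (a : ℂ) = l * n := by
      have := Complex.two_pi_I_ne_zero
      field_simp at hn
      linear_combination hn
    exact_mod_cast h2
  have h2 : (∑ j ∈ Finset.range l, z ^ j) * (z - 1) = 0 := by rw [geom_sum_mul, hz, sub_self]
  simp only [h1, ← Finset.mul_sum]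
  rw [(mul_eq_zero.mp h2).resolve_right (sub_ne_zero.mpr hz1), mul_zero]

theorem sum_sin_angle {a : ℤ} (hl : 0 < l) (ha : ¬ (l : ℤ) ∣ a) (ε : ℝ) :
    ∑ j ∈ Finset.range l, Real.sin (a * angle l ε j) = 0 := by
  have := congrArg Complex.im (sum_exp_angle hl ha ε)
  rw [Complex.im_sum] at this
  simpa only [Complex.exp_ofReal_mul_I_im, Complex.zero_im] using this

theorem sum_cos_angle {a : ℤ} (hl : 0 < l) (ha : ¬ (l : ℤ) ∣ a) (ε : ℝ) :
    ∑ j ∈ Finset.range l, Real.cos (a * angle l ε j) = 0 := by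
  have := congrArg Complex.re (sum_exp_angle hl ha ε)
  rw [Complex.re_sum] at this
  simpa only [Complex.exp_ofReal_mul_I_re, Complex.zero_re] using this

theorem sin_mul_angle (hl : 0 < l) (K : ℕ) (ε : ℝ) (j : ℕ) :
    Real.sin ((K * l : ℕ) * angle l ε j) = Real.sin ((K * l : ℕ) * ε) := by
  have hl0 : (l : ℝ) ≠ 0 := by exact_mod_cast hl.ne'
  have : ((K * l : ℕ) : ℝ) * angle l ε j = (K * l : ℕ) * ε + (K * j : ℕ) * (2 * Real.pi) := by
    rw [angle]
    push_cast
    field_simp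
  rw [this, Real.sin_add_nat_mul_two_pi]

/-- The sum of the character over the angles detects the weights on the walls. -/
theorem sum_tiltChar (hl : 0 < l) {k : ℕ} (hk : (k + 1) / l ≠ 0) (ε : ℝ) :
    ∑ j ∈ Finset.range l, tiltChar l k (angle l ε j)
      = if (k + 1) % l = 0 then l * Real.sin (((k + 1) / l * l : ℕ) * ε) else 0 := by
  split_ifs with h
  · have hk' : k + 1 = (k + 1) / l * l := by
      rw [Nat.div_mul_cancel (Nat.dvd_of_mod_eq_zero h)]
    have : ∀ j, tiltChar l k (angle l ε j) = Real.sin (((k + 1) / l * l : ℕ) * ε) := fun j => by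
      rw [tiltChar_wall hk', ← Nat.cast_add_one, ← sin_mul_angle hl _ ε j, ← hk']
    simp [this]
  · have : ∀ j, tiltChar l k (angle l ε j) = 2 * Real.sin (((k + 1) / l * l : ℕ) * ε)
        * Real.cos ((((k + 1) % l : ℕ) : ℤ) * angle l ε j) := fun j => by
      rw [tiltChar, if_neg (by tauto), sin_mul_angle hl, Int.cast_natCast]
    simp only [this, ← Finset.mul_sum]
    rw [sum_cos_angle hl, mul_zero]
    rw [Int.natCast_dvd_natCast]
    exact Nat.not_dvd_of_pos_of_lt (Nat.pos_of_ne_zero h) (Nat.mod_lt _ hl)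

/-- The sine transform of the character detects the weights in a residue class off the walls. -/
theorem sum_sin_mul_tiltChar {r : ℕ} (hr : 0 < r) (hrl : r < l) {k : ℕ} (hk : (k + 1) / l ≠ 0)
    (ε : ℝ) : ∑ j ∈ Finset.range l, Real.sin ((l - r : ℝ) * angle l ε j)
        * tiltChar l k (angle l ε j)
      = if (k + 1) % l = r then l * Real.sin (l * ε) * Real.sin (((k + 1) / l * l : ℕ) * ε)
        else 0 := by
  have hl : 0 < l := hr.trans hrl
  by_cases h : (k + 1) % l = 0
  · rw [if_neg (by omega)]
    have hk' : k + 1 = (k + 1) / l * l := by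
      rw [Nat.div_mul_cancel (Nat.dvd_of_mod_eq_zero h)]
    have : ∀ j, tiltChar l k (angle l ε j) = Real.sin (((k + 1) / l * l : ℕ) * ε) := fun j => by
      rw [tiltChar_wall hk', ← Nat.cast_add_one, ← sin_mul_angle hl _ ε j, ← hk']
    simp only [this, ← Finset.sum_mul]
    have h2 := sum_sin_angle (a := (l : ℤ) - r) hl (by
      rw [dvd_sub_right dvd_rfl, Int.natCast_dvd_natCast]
      exact Nat.not_dvd_of_pos_of_lt hr hrl) ε
    push_cast at h2
    rw [h2, zero_mul]
  · set t := (k + 1) % l with ht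
    have htl : t < l := Nat.mod_lt _ hl
    have h1 : ∀ j, Real.sin ((l - r : ℝ) * angle l ε j) * tiltChar l k (angle l ε j)
        = Real.sin (((k + 1) / l * l : ℕ) * ε) * (Real.sin (((l - r + t : ℤ) : ℝ) * angle l ε j)
          + Real.sin (((l - r - t : ℤ) : ℝ) * angle l ε j)) := fun j => by
      have e1 : ((l - r + t : ℤ) : ℝ) * angle l ε j
          = (l - r : ℝ) * angle l ε j + t * angle l ε j := by push_cast; ring
      have e2 : ((l - r - t : ℤ) : ℝ) * angle l ε j
          = (l - r : ℝ) * angle l ε j - t * angle l ε j := by push_cast; ring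
      rw [tiltChar, if_neg (by tauto), sin_mul_angle hl, e1, e2, Real.sin_add, Real.sin_sub]
      ring
    simp only [h1, ← Finset.mul_sum, Finset.sum_add_distrib]
    have h3 : ∑ j ∈ Finset.range l, Real.sin (((l - r - t : ℤ) : ℝ) * angle l ε j) = 0 := by
      by_cases h4 : (l : ℤ) - r - t = 0
      · rw [h4]
        simp
      · refine sum_sin_angle hl (fun hd => h4 ?_) ε
        exact Int.eq_zero_of_abs_lt_dvd hd (by rw [abs_lt]; omega)
    rw [h3, add_zero]
    split_ifs with h5
    · have : ∀ j, Real.sin (((l - r + t : ℤ) : ℝ) * angle l ε j) = Real.sin (l * ε) := fun j => by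
        have e : ((l - r + t : ℤ) : ℝ) = ((1 * l : ℕ) : ℝ) := by rw [h5]; push_cast; ring
        rw [e, sin_mul_angle hl, one_mul]
      simp only [this, Finset.sum_const, Finset.card_range, nsmul_eq_mul]
      ring
    · rw [sum_sin_angle hl _ ε, mul_zero]
      intro hd
      have h6 : (l : ℤ) ∣ t - r := by
        have := (Int.dvd_add_right (dvd_refl (l : ℤ))).mp
          (show (l : ℤ) ∣ l + (t - r) by rwa [show (l : ℤ) + (t - r) = l - r + t by ring])
        exact this
      have := Int.eq_zero_of_abs_lt_dvd h6 (by rw [abs_lt]; omega)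
      omega

/-- `m k` is a family of multiplicities, vanishing outside of `F`, of the tilting modules of highest
weight `k` in a module with the character and the dimension of `V^{⊗N}`. -/
structure IsMult (l N : ℕ) (m : ℕ → ℕ) (F : Finset ℕ) : Prop where
  zero : ∀ k ∉ F, m k = 0
  char : ∀ φ, ∑ k ∈ F, m k * tiltChar l k φ = Real.sin φ * (2 * Real.cos φ) ^ N
  dim : ∑ k ∈ F, m k * tiltDim l k = 2 ^ N

/-- The weights `k` with `k + 1 = K l + r` and `K > 0`. -/
def cls (l : ℕ) (F : Finset ℕ) (r : ℕ) : Finset ℕ :=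
  F.filter fun k => (k + 1) % l = r ∧ (k + 1) / l ≠ 0

variable {N : ℕ} {m : ℕ → ℕ} {F : Finset ℕ}

/-- The contribution to the character of the weights beyond the first wall. -/
noncomputable def charRem (l N : ℕ) (m : ℕ → ℕ) (F : Finset ℕ) (φ : ℝ) : ℝ :=
  Real.sin φ * (2 * Real.cos φ) ^ N
    - ∑ k ∈ F.filter fun k => (k + 1) / l = 0, m k * Real.sin ((k + 1) * φ)

theorem IsMult.charRem_eq (h : IsMult l N m F) (φ : ℝ) :
    charRem l N m F φ = ∑ k ∈ F.filter fun k => (k + 1) / l ≠ 0, m k * tiltChar l k φ := by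
  rw [charRem, ← h.char, ← Finset.sum_filter_add_sum_filter_not F fun k => (k + 1) / l = 0]
  rw [Finset.sum_congr rfl (fun k hk => by
    rw [tiltChar, if_pos (Or.inl (Finset.mem_filter.mp hk).2)]), add_sub_cancel_left]

theorem sum_filter_ite (r : ℕ) (f : ℕ → ℝ) :
    ∑ k ∈ F.filter (fun k => (k + 1) / l ≠ 0), (if (k + 1) % l = r then f k else 0)
      = ∑ k ∈ cls l F r, f k := by
  rw [← Finset.sum_filter, Finset.filter_filter, cls]
  simp only [and_comm]

theorem IsMult.sum_wall (h : IsMult l N m F) (hl : 0 < l) (ε : ℝ) :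
    l * ∑ k ∈ cls l F 0, m k * Real.sin (((k + 1) / l * l : ℕ) * ε)
      = ∑ j ∈ Finset.range l, charRem l N m F (angle l ε j) := by
  simp only [h.charRem_eq]
  rw [Finset.sum_comm, ← sum_filter_ite, Finset.mul_sum]
  refine Finset.sum_congr rfl fun k hk => ?_
  rw [← Finset.mul_sum, sum_tiltChar hl (Finset.mem_filter.mp hk).2]
  split_ifs <;> ring

theorem IsMult.sum_off_wall (h : IsMult l N m F) {r : ℕ} (hr : 0 < r) (hrl : r < l) (ε : ℝ) :
    l * Real.sin (l * ε) * ∑ k ∈ cls l F r, m k * Real.sin (((k + 1) / l * l : ℕ) * ε)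
      = ∑ j ∈ Finset.range l, Real.sin ((l - r : ℝ) * angle l ε j)
        * charRem l N m F (angle l ε j) := by
  have e : ∀ j, Real.sin ((l - r : ℝ) * angle l ε j) * charRem l N m F (angle l ε j)
      = ∑ k ∈ F.filter fun k => (k + 1) / l ≠ 0, m k * (Real.sin ((l - r : ℝ) * angle l ε j)
        * tiltChar l k (angle l ε j)) := fun j => by
    rw [h.charRem_eq, Finset.mul_sum]
    exact Finset.sum_congr rfl fun k _ => by ring
  simp only [e]
  rw [Finset.sum_comm, ← sum_filter_ite, Finset.mul_sum]
  refine Finset.sum_congr rfl fun k hk => ?_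
  rw [← Finset.mul_sum, sum_sin_mul_tiltChar hr hrl (Finset.mem_filter.mp hk).2 ε]
  split_ifs <;> ring

/-- The multiplicities below the first wall are exponentially smaller than `2^N`; this is the
character at the angle `π / l`, where the characters beyond the first wall vanish. -/
theorem IsMult.small_le (h : IsMult l N m F) {k : ℕ} (hk : k + 1 < l) :
    (m k : ℝ) * Real.sin ((k + 1) * (Real.pi / l))
      ≤ Real.sin (Real.pi / l) * (2 * Real.cos (Real.pi / l)) ^ N := by
  have hl : (0 : ℝ) < l := by exact_mod_cast (by omega : 0 < l)
  have hpos : ∀ i : ℕ, i + 1 < l → 0 < Real.sin ((i + 1) * (Real.pi / l)) := fun i hi => by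
    have hi' : (i : ℝ) + 1 < l := by exact_mod_cast hi
    refine Real.sin_pos_of_pos_of_lt_pi (by positivity) ?_
    rw [← mul_div_assoc, div_lt_iff₀ hl, mul_comm]
    exact mul_lt_mul_of_pos_left hi' Real.pi_pos
  have hterm : ∀ i ∈ F, 0 ≤ (m i : ℝ) * tiltChar l i (Real.pi / l) := fun i _ => by
    refine mul_nonneg (Nat.cast_nonneg _) ?_
    rcases Nat.lt_or_ge (i + 1) l with hi | hi
    · rw [tiltChar_of_lt hi]
      exact (hpos i hi).le
    · have h0 : ∀ n : ℕ, Real.sin ((n * l : ℕ) * (Real.pi / l)) = 0 := fun n => by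
        have : ((n * l : ℕ) : ℝ) * (Real.pi / l) = n * Real.pi := by
          push_cast
          field_simp
        rw [this, Real.sin_nat_mul_pi]
      rw [tiltChar]
      split_ifs with h1
      · have h2 := h1.resolve_left (Nat.div_pos hi (by omega)).ne'
        have h3 := h0 ((i + 1) / l)
        rw [Nat.div_mul_cancel (Nat.dvd_of_mod_eq_zero h2)] at h3
        push_cast at h3
        exact h3.ge
      · rw [h0]
        simp
  rw [← h.char]
  by_cases hkF : k ∈ F
  · have := Finset.single_le_sum hterm hkF
    rwa [tiltChar_of_lt hk] at this
  · rw [h.zero k hkF]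
    simpa using Finset.sum_nonneg hterm

end Extraction


section Asymptotics

open Filter Topology

/-! ### Asymptotics of the sine transforms -/

theorem mul_sinc (x : ℝ) : x * Real.sinc x = Real.sin x := by
  rcases eq_or_ne x 0 with rfl | hx
  · simp
  · rw [Real.sinc_of_ne_zero hx, mul_div_cancel₀ _ hx]

/-- The angle at which the sine transform in the scaled variable is evaluated:
`K l ε = s K / √(2 n)`. -/
noncomputable def eps (l : ℕ) (s : ℝ) (n : ℕ) : ℝ := s / (l * √(2 * n))

variable {l : ℕ} {s : ℝ}

theorem tendsto_eps (hl : 0 < l) : Tendsto (eps l s) atTop (𝓝 0) := by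
  have hl' : (0 : ℝ) < l := by exact_mod_cast hl
  refine Tendsto.div_atTop tendsto_const_nhds (Tendsto.const_mul_atTop hl' ?_)
  exact Real.tendsto_sqrt_atTop.comp
    (Tendsto.const_mul_atTop two_pos tendsto_natCast_atTop_atTop)

theorem mul_eps_sq (hl : 0 < l) {n : ℕ} (hn : 0 < n) :
    n * eps l s n ^ 2 = s ^ 2 / (2 * l ^ 2) := by
  have hl' : (0 : ℝ) < l := by exact_mod_cast hl
  have hn' : (0 : ℝ) < n := by exact_mod_cast hn
  rw [eps, div_pow, mul_pow, Real.sq_sqrt (by positivity)]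
  field_simp

theorem eps_ne_zero (hl : 0 < l) (hs : s ≠ 0) {n : ℕ} (hn : 0 < n) : eps l s n ≠ 0 := by
  have hl' : (0 : ℝ) < l := by exact_mod_cast hl
  have hn' : (0 : ℝ) < n := by exact_mod_cast hn
  exact div_ne_zero hs (by positivity)

theorem tendsto_sinc_eps (hl : 0 < l) (a : ℝ) :
    Tendsto (fun n => Real.sinc (a * eps l s n)) atTop (𝓝 1) := by
  have h := (Real.continuous_sinc.tendsto 0).comp
    ((tendsto_eps (s := s) hl).const_mul a |>.trans (by rw [mul_zero]))
  rwa [Real.sinc_zero] at h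

theorem tendsto_cos_pow (hl : 0 < l) (N₀ : ℕ) :
    Tendsto (fun n => Real.cos (eps l s n) ^ (2 * l * n + N₀)) atTop
      (𝓝 (Real.exp (-(s ^ 2 / (2 * l))))) := by
  have hl' : (l : ℝ) ≠ 0 := by exact_mod_cast hl.ne'
  have h1 : Tendsto (fun n : ℕ => n * (Real.cos (eps l s n) - 1)) atTop
      (𝓝 (-(s ^ 2 / (4 * l ^ 2)))) := by
    have h2 := ((tendsto_sinc_eps (s := s) hl (1 / 2)).pow 2).mul_const (-(s ^ 2 / (4 * l ^ 2)))
    rw [one_pow, one_mul] at h2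
    refine h2.congr' ?_
    filter_upwards [eventually_gt_atTop 0] with n hn
    have h3 : Real.cos (eps l s n) - 1 = -2 * Real.sin (1 / 2 * eps l s n) ^ 2 := by
      rw [show eps l s n = 2 * (1 / 2 * eps l s n) by ring, Real.cos_two_mul, Real.cos_sq']
      ring_nf
    rw [h3, ← mul_sinc (1 / 2 * eps l s n)]
    have h4 := mul_eps_sq (s := s) hl hn
    have h5 : s ^ 2 / (4 * l ^ 2) = n * eps l s n ^ 2 / 2 := by
      rw [h4]
      field_simp
      ring
    rw [h5]
    ring
  have h2 := (Real.tendsto_one_add_pow_exp_of_tendsto h1).pow (2 * l)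
  have h3 : Tendsto (fun n => Real.cos (eps l s n) ^ N₀) atTop (𝓝 1) := by
    have := ((Real.continuous_cos.tendsto 0).comp (tendsto_eps (s := s) hl)).pow N₀
    simpa using this
  have h4 := h2.mul h3
  rw [mul_one, ← Real.exp_nat_mul] at h4
  have h5 : ((2 * l : ℕ) : ℝ) * -(s ^ 2 / (4 * l ^ 2)) = -(s ^ 2 / (2 * l)) := by
    push_cast
    field_simp
    ring
  rw [h5] at h4
  refine h4.congr fun n => ?_
  rw [add_sub_cancel, ← pow_mul, ← pow_add]
  congr 1
  ring

theorem tendsto_mul_pow_of_lt_one (hl : 0 < l) (N₀ : ℕ) {ρ : ℝ} (h0 : 0 ≤ ρ) (h1 : ρ < 1) :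
    Tendsto (fun n : ℕ => n * ρ ^ (2 * l * n + N₀)) atTop (𝓝 0) := by
  refine squeeze_zero (fun n => by positivity) (fun n => ?_)
    (tendsto_self_mul_const_pow_of_lt_one h0 h1)
  refine mul_le_mul_of_nonneg_left (pow_le_pow_of_le_one h0 h1.le ?_) (Nat.cast_nonneg n)
  nlinarith [Nat.zero_le n]

/-- Since `l` is odd, `-1` is not among the cosines of `2πj/l`, and all of them but the first are
smaller than `1` in absolute value. -/
theorem abs_cos_lt_one (hl : Odd l) {j : ℕ} (hj : 0 < j) (hjl : j < l) :
    |Real.cos (2 * Real.pi * j / l)| < 1 := by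
  have hl' : (l : ℝ) ≠ 0 := by exact_mod_cast hl.pos.ne'
  refine lt_of_le_of_ne (Real.abs_cos_le_one _) fun h => ?_
  have h1 : Real.sin (2 * Real.pi * j / l) = 0 := by
    have := Real.sin_sq_add_cos_sq (2 * Real.pi * j / l)
    rw [← sq_abs (Real.cos _), h] at this
    exact pow_eq_zero_iff two_ne_zero |>.mp (by linarith)
  obtain ⟨n, hn⟩ := Real.sin_eq_zero_iff.mp h1
  have h2 : (n : ℝ) * l = 2 * j := by
    have := Real.pi_ne_zero
    field_simp at hn
    linarith
  have h3 : (l : ℤ) ∣ (2 * j : ℕ) := ⟨n, by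
    have h4 : ((2 * j : ℕ) : ℤ) = n * l := by exact_mod_cast h2.symm
    rw [h4, mul_comm]⟩
  have h4 := (Nat.coprime_two_right.mpr hl).dvd_of_dvd_mul_left (Int.natCast_dvd_natCast.mp h3)
  exact Nat.not_dvd_of_pos_of_lt hj hjl h4

theorem tendsto_mul_cos_pow (hl : Odd l) (N₀ : ℕ) {j : ℕ} (hj : 0 < j) (hjl : j < l) :
    Tendsto (fun n : ℕ => n * Real.cos (angle l (eps l s n) j) ^ (2 * l * n + N₀)) atTop (𝓝 0) := by
  obtain ⟨ρ, h1, h2⟩ := exists_between (abs_cos_lt_one hl hj hjl)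
  have h0 : 0 ≤ ρ := (abs_nonneg _).trans h1.le
  have h3 : Tendsto (fun n => |Real.cos (angle l (eps l s n) j)|) atTop
      (𝓝 |Real.cos (2 * Real.pi * j / l)|) := by
    have := (tendsto_eps (s := s) hl.pos).add_const (2 * Real.pi * j / l)
    rw [zero_add] at this
    exact ((continuous_abs.comp Real.continuous_cos).tendsto _).comp this
  refine squeeze_zero_norm' ?_ (tendsto_mul_pow_of_lt_one hl.pos N₀ h0 h2)
  filter_upwards [h3.eventually_lt_const h1] with n hn
  rw [norm_mul, norm_pow, Real.norm_natCast]
  exact mul_le_mul_of_nonneg_left (pow_le_pow_left₀ (abs_nonneg _) hn.le _) (Nat.cast_nonneg n)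

variable {N₀ : ℕ} {m : ℕ → ℕ → ℕ} {F : ℕ → Finset ℕ}

/-- The weights below the first wall are negligible, even after multiplication by `n`. -/
theorem tendsto_small (hl : 0 < l) (h : ∀ n, IsMult l (2 * l * n + N₀) (m n) (F n)) {k : ℕ}
    (hk : k + 1 < l) :
    Tendsto (fun n : ℕ => n * (m n k / (2 : ℝ) ^ (2 * l * n + N₀))) atTop (𝓝 0) := by
  have hl' : (2 : ℝ) ≤ l := by exact_mod_cast (by omega : 2 ≤ l)
  have hk' : (k : ℝ) + 1 < l := by exact_mod_cast hk
  have hpos : 0 < Real.sin ((k + 1) * (Real.pi / l)) := by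
    refine Real.sin_pos_of_pos_of_lt_pi (by positivity) ?_
    rw [← mul_div_assoc, div_lt_iff₀ (by linarith), mul_comm]
    exact mul_lt_mul_of_pos_left hk' Real.pi_pos
  have hc0 : 0 ≤ Real.cos (Real.pi / l) := by
    refine Real.cos_nonneg_of_mem_Icc ⟨?_, ?_⟩
    · have := Real.pi_pos
      have : 0 ≤ Real.pi / l := by positivity
      linarith
    · exact div_le_div_of_nonneg_left Real.pi_pos.le two_pos hl'
  have hc1 : Real.cos (Real.pi / l) < 1 := by
    have h1 : 0 < Real.pi / l := by have := Real.pi_pos; positivity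
    have h2 : Real.pi / l ≤ Real.pi := div_le_self Real.pi_pos.le (by linarith)
    have := Real.cos_lt_cos_of_nonneg_of_le_pi le_rfl h2 h1
    rwa [Real.cos_zero] at this
  have h1 := (tendsto_mul_pow_of_lt_one hl N₀ hc0 hc1).const_mul
    (Real.sin (Real.pi / l) / Real.sin ((k + 1) * (Real.pi / l)))
  rw [mul_zero] at h1
  refine squeeze_zero (fun n => by positivity) (fun n => ?_) h1
  have h2 := (h n).small_le hk
  have h3 : (m n k : ℝ) / 2 ^ (2 * l * n + N₀) ≤ Real.sin (Real.pi / l)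
      / Real.sin ((k + 1) * (Real.pi / l)) * Real.cos (Real.pi / l) ^ (2 * l * n + N₀) := by
    rw [div_le_iff₀ (by positivity), div_mul_eq_mul_div, div_mul_eq_mul_div, le_div_iff₀ hpos]
    rw [mul_pow] at h2
    linarith
  calc _ ≤ n * (Real.sin (Real.pi / l) / Real.sin ((k + 1) * (Real.pi / l))
        * Real.cos (Real.pi / l) ^ (2 * l * n + N₀)) :=
        mul_le_mul_of_nonneg_left h3 (Nat.cast_nonneg n)
    _ = _ := by ring

/-- The contribution of the weights below the first wall, divided by `2^N`. -/
noncomputable def smallSum (l N : ℕ) (m : ℕ → ℕ) (F : Finset ℕ) (φ : ℝ) : ℝ :=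
  ∑ k ∈ F.filter fun k => (k + 1) / l = 0, m k / 2 ^ N * Real.sin ((k + 1) * φ)

theorem charRem_div (l N : ℕ) (m : ℕ → ℕ) (F : Finset ℕ) (φ : ℝ) :
    charRem l N m F φ / 2 ^ N = Real.sin φ * Real.cos φ ^ N - smallSum l N m F φ := by
  rw [charRem, smallSum, sub_div, mul_pow, Finset.sum_div]
  congr 1
  · field_simp
  · exact Finset.sum_congr rfl fun k _ => by ring

theorem tendsto_smallSum (hl : 0 < l) (h : ∀ n, IsMult l (2 * l * n + N₀) (m n) (F n))
    (φ : ℕ → ℝ) : Tendsto (fun n : ℕ => n * smallSum l (2 * l * n + N₀) (m n) (F n) (φ n))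
      atTop (𝓝 0) := by
  have h1 : Tendsto (fun n : ℕ => ∑ k ∈ Finset.range (l - 1),
      n * (m n k / (2 : ℝ) ^ (2 * l * n + N₀))) atTop (𝓝 0) := by
    have := tendsto_finsetSum (Finset.range (l - 1)) fun k hk =>
      tendsto_small hl h (k := k) (by have := Finset.mem_range.mp hk; omega)
    simpa using this
  refine squeeze_zero_norm (fun n => ?_) h1
  rw [smallSum, norm_mul, Real.norm_natCast, ← Finset.mul_sum]
  refine mul_le_mul_of_nonneg_left ((norm_sum_le _ _).trans ?_) (Nat.cast_nonneg n)
  refine (Finset.sum_le_sum (g := fun k => (m n k / (2 : ℝ) ^ (2 * l * n + N₀)))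
    fun k _ => ?_).trans (Finset.sum_le_sum_of_subset_of_nonneg (fun k hk => ?_)
      fun k _ _ => by positivity)
  · rw [norm_mul, Real.norm_of_nonneg (by positivity)]
    exact mul_le_of_le_one_right (by positivity) (Real.abs_sin_le_one _)
  · have := (Nat.div_eq_zero_iff_lt hl).mp (Finset.mem_filter.mp hk).2
    exact Finset.mem_range.mpr (by omega)

/-- At the angles close to `2πj/l` with `0 < j < l` the character is exponentially smaller than the
dimension. -/
theorem tendsto_charRem (hl : Odd l) (h : ∀ n, IsMult l (2 * l * n + N₀) (m n) (F n)) {j : ℕ}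
    (hj : 0 < j) (hjl : j < l) :
    Tendsto (fun n : ℕ => n * (charRem l (2 * l * n + N₀) (m n) (F n) (angle l (eps l s n) j)
      / 2 ^ (2 * l * n + N₀))) atTop (𝓝 0) := by
  have h1 := tendsto_smallSum hl.pos h fun n => angle l (eps l s n) j
  have h2 : Tendsto (fun n : ℕ => Real.sin (angle l (eps l s n) j)
      * (n * Real.cos (angle l (eps l s n) j) ^ (2 * l * n + N₀))) atTop (𝓝 0) := by
    refine squeeze_zero_norm (fun n => ?_) (tendsto_norm_zero.comp
      (tendsto_mul_cos_pow (s := s) hl N₀ hj hjl))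
    rw [norm_mul]
    exact mul_le_of_le_one_left (norm_nonneg _) (Real.abs_sin_le_one _)
  have h3 := h2.sub h1
  rw [sub_zero] at h3
  refine h3.congr fun n => ?_
  rw [charRem_div]
  ring

/-- The limit of the probability of the residue class `r` of `k + 1`. -/
noncomputable def resProb (l r : ℕ) : ℝ := if r = 0 then 1 / l else 2 * (l - r) / l ^ 2

/-- The term of the sine transforms at the angle `ε` itself. -/
theorem tendsto_charRem_zero (hl : 0 < l) (hs : s ≠ 0)
    (h : ∀ n, IsMult l (2 * l * n + N₀) (m n) (F n)) :
    Tendsto (fun n : ℕ => (eps l s n)⁻¹ * (charRem l (2 * l * n + N₀) (m n) (F n) (eps l s n)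
      / 2 ^ (2 * l * n + N₀))) atTop (𝓝 (Real.exp (-(s ^ 2 / (2 * l))))) := by
  have hl' : (l : ℝ) ≠ 0 := by exact_mod_cast hl.ne'
  have h1 := (tendsto_sinc_eps (s := s) hl 1).mul (tendsto_cos_pow (s := s) hl N₀)
  have h2 := ((tendsto_eps (s := s) hl).mul (tendsto_smallSum hl h (eps l s))).const_mul
    (2 * l ^ 2 / s ^ 2)
  have h3 := h1.sub h2
  rw [one_mul, zero_mul, mul_zero, sub_zero] at h3
  refine h3.congr' ?_
  filter_upwards [eventually_gt_atTop 0] with n hn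
  have he := eps_ne_zero hl hs hn
  have hn' : (n : ℝ) ≠ 0 := by exact_mod_cast hn.ne'
  have h4 := mul_eps_sq (s := s) hl hn
  have h5 : s ^ 2 = n * eps l s n ^ 2 * (2 * l ^ 2) := by
    rw [h4]
    field_simp
  rw [charRem_div, one_mul, Real.sinc_of_ne_zero he, h5]
  field_simp

/-- The expectation of `sinc (s K / √(2 n))` over the weights `k` with `k + 1 = K l + r`. Since the
dimension of the tilting module is proportional to `K`, and `K sinc (s K / √(2 n))` is proportional
to `sin (K l ε)`, this is a discrete Fourier transform of the character; only the angle `ε` itself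
contributes to the limit. -/
theorem tendsto_sinc (hl : Odd l) (hs : s ≠ 0) (h : ∀ n, IsMult l (2 * l * n + N₀) (m n) (F n))
    {r : ℕ} (hr : r < l) :
    Tendsto (fun n : ℕ => ∑ k ∈ cls l (F n) r,
      (m n k * tiltDim l k / (2 : ℝ) ^ (2 * l * n + N₀))
        * Real.sinc (s * (((k + 1) / l : ℕ) / √(2 * n)))) atTop
      (𝓝 (resProb l r * Real.exp (-(s ^ 2 / (2 * l))))) := by
  have hl0 := hl.pos
  have hl' : (l : ℝ) ≠ 0 := by exact_mod_cast hl0.ne'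
  have hsum : ∀ f : ℕ → ℝ, ∑ j ∈ Finset.range l, f j
      = f 0 + ∑ j ∈ Finset.range (l - 1), f (j + 1) := fun f => by
    obtain ⟨l', rfl⟩ : ∃ l', l = l' + 1 := ⟨l - 1, by omega⟩
    rw [Finset.sum_range_succ', add_comm, Nat.add_sub_cancel]
  have hang : ∀ ε, angle l ε 0 = ε := fun ε => by simp [angle]
  have hterm : ∀ {n : ℕ} (_ : 0 < n) (K : ℕ) (_ : K ≠ 0),
      (K * l : ℝ) * Real.sinc (s * (K / √(2 * n)))
        = (eps l s n)⁻¹ * Real.sin ((K * l : ℕ) * eps l s n) := by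
    intro n hn K hK
    have hn' : (0 : ℝ) < n := by exact_mod_cast hn
    have hK' : (K : ℝ) ≠ 0 := by exact_mod_cast hK
    have he := eps_ne_zero hl0 hs hn
    have e : s * (K / √(2 * n)) = (K * l : ℕ) * eps l s n := by
      have : √(2 * (n : ℝ)) ≠ 0 := by positivity
      rw [eps]
      push_cast
      field_simp
    have e0 : ((K * l : ℕ) : ℝ) * eps l s n ≠ 0 := by
      push_cast
      exact mul_ne_zero (mul_ne_zero hK' hl') he
    rw [e, Real.sinc_of_ne_zero e0]
    push_cast
    field_simp
  have hj : ∀ j ∈ Finset.range (l - 1), j + 1 < l := fun j hj => by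
    have := Finset.mem_range.mp hj
    omega
  rcases Nat.eq_zero_or_pos r with rfl | hr0
  · have h1 : Tendsto (fun n : ℕ => ∑ j ∈ Finset.range (l - 1), 2 * l ^ 2 / s ^ 2 * (eps l s n *
        (n * (charRem l (2 * l * n + N₀) (m n) (F n) (angle l (eps l s n) (j + 1))
          / 2 ^ (2 * l * n + N₀))))) atTop (𝓝 0) := by
      have := tendsto_finsetSum (Finset.range (l - 1)) fun j hj' =>
        ((tendsto_eps (s := s) hl0).mul
          (tendsto_charRem (s := s) hl h (Nat.succ_pos j) (hj j hj'))).const_mul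
            (2 * (l : ℝ) ^ 2 / s ^ 2)
      simpa using this
    have h2 := ((tendsto_charRem_zero hl0 hs h).add h1).const_mul (1 / (l : ℝ))
    rw [add_zero] at h2
    rw [resProb, if_pos rfl]
    refine h2.congr' ?_
    filter_upwards [eventually_gt_atTop 0] with n hn
    have he := eps_ne_zero hl0 hs hn
    have hn' : (n : ℝ) ≠ 0 := by exact_mod_cast hn.ne'
    -- `n ε²` is constant, which turns the powers of `ε⁻¹` into powers of `n`
    have h5 : s ^ 2 = n * eps l s n ^ 2 * (2 * l ^ 2) := by
      rw [mul_eps_sq hl0 hn]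
      field_simp
    have h6 := (h n).sum_wall hl0 (eps l s n)
    rw [hsum, hang] at h6
    have h7 : ∑ k ∈ cls l (F n) 0, (m n k * tiltDim l k / (2 : ℝ) ^ (2 * l * n + N₀))
        * Real.sinc (s * (((k + 1) / l : ℕ) / √(2 * n)))
        = (eps l s n)⁻¹ / 2 ^ (2 * l * n + N₀)
          * ∑ k ∈ cls l (F n) 0, m n k * Real.sin (((k + 1) / l * l : ℕ) * eps l s n) := by
      rw [Finset.mul_sum]
      refine Finset.sum_congr rfl fun k hk => ?_
      obtain ⟨-, h8, h9⟩ := Finset.mem_filter.mp hk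
      have h10 : (tiltDim l k : ℝ) = ((k + 1) / l : ℕ) * l := by
        rw [tiltDim, if_pos (Or.inr h8), ← Nat.cast_mul, Nat.div_mul_cancel
          (Nat.dvd_of_mod_eq_zero h8)]
      have := hterm hn _ h9
      rw [h10]
      linear_combination (m n k / (2 : ℝ) ^ (2 * l * n + N₀)) * this
    have h8 : ∑ k ∈ cls l (F n) 0, m n k * Real.sin (((k + 1) / l * l : ℕ) * eps l s n)
        = (1 / l : ℝ) * (charRem l (2 * l * n + N₀) (m n) (F n) (eps l s n)
          + ∑ j ∈ Finset.range (l - 1),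
            charRem l (2 * l * n + N₀) (m n) (F n) (angle l (eps l s n) (j + 1))) := by
      rw [← h6, one_div, inv_mul_cancel_left₀ hl']
    rw [h7, h8, mul_left_comm]
    congr 1
    rw [mul_add, Finset.mul_sum]
    congr 1
    · ring
    · refine Finset.sum_congr rfl fun j _ => ?_
      rw [h5]
      field_simp
  · have h0 : Tendsto (fun n : ℕ => (Real.sinc (l * eps l s n))⁻¹) atTop (𝓝 1) := by
      have := (tendsto_sinc_eps (s := s) hl0 l).inv₀ one_ne_zero
      rwa [inv_one] at this
    have h1 : Tendsto (fun n : ℕ => ∑ j ∈ Finset.range (l - 1), 4 / s ^ 2 *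
        (Real.sin ((l - r : ℝ) * angle l (eps l s n) (j + 1)) *
        (n * (charRem l (2 * l * n + N₀) (m n) (F n) (angle l (eps l s n) (j + 1))
          / 2 ^ (2 * l * n + N₀))))) atTop (𝓝 0) := by
      have := tendsto_finsetSum (Finset.range (l - 1)) fun j hj' =>
        (squeeze_zero_norm (fun n => by
            rw [norm_mul]
            exact mul_le_of_le_one_left (norm_nonneg _) (Real.abs_sin_le_one
              ((l - r : ℝ) * angle l (eps l s n) (j + 1)))) (tendsto_norm_zero.comp
          (tendsto_charRem (s := s) hl h (Nat.succ_pos j) (hj j hj')))).const_mul (4 / s ^ 2)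
      simpa using this
    have h2 := (((tendsto_sinc_eps (s := s) hl0 (l - r)).const_mul (2 * (l - r) / (l : ℝ) ^ 2)).mul
      (tendsto_charRem_zero hl0 hs h)).add h1 |>.mul h0
    rw [add_zero, mul_one, mul_one] at h2
    rw [resProb, if_neg hr0.ne']
    refine h2.congr' ?_
    have hpos : ∀ᶠ n : ℕ in atTop, 0 < Real.sinc (l * eps l s n) :=
      (tendsto_sinc_eps (s := s) hl0 l).eventually_const_lt one_pos
    filter_upwards [eventually_gt_atTop 0, hpos] with n hn hsinc
    have he := eps_ne_zero hl0 hs hn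
    have hn' : (n : ℝ) ≠ 0 := by exact_mod_cast hn.ne'
    -- `n ε²` is constant, which turns the powers of `ε⁻¹` into powers of `n`
    have h5 : s ^ 2 = n * eps l s n ^ 2 * (2 * l ^ 2) := by
      rw [mul_eps_sq hl0 hn]
      field_simp
    have h6 := (h n).sum_off_wall hr0 hr (eps l s n)
    rw [hsum, hang, ← mul_sinc (l * eps l s n)] at h6
    have h7 : ∑ k ∈ cls l (F n) r, (m n k * tiltDim l k / (2 : ℝ) ^ (2 * l * n + N₀))
        * Real.sinc (s * (((k + 1) / l : ℕ) / √(2 * n)))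
        = 2 * (eps l s n)⁻¹ / 2 ^ (2 * l * n + N₀)
          * ∑ k ∈ cls l (F n) r, m n k * Real.sin (((k + 1) / l * l : ℕ) * eps l s n) := by
      rw [Finset.mul_sum]
      refine Finset.sum_congr rfl fun k hk => ?_
      obtain ⟨-, h8, h9⟩ := Finset.mem_filter.mp hk
      have h10 : (tiltDim l k : ℝ) = 2 * (((k + 1) / l : ℕ) * l) := by
        rw [tiltDim, if_neg (by omega), ← Nat.cast_mul]
        push_cast
        ring
      have := hterm hn _ h9
      rw [h10]
      linear_combination (2 * m n k / (2 : ℝ) ^ (2 * l * n + N₀)) * this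
    have h8 : ∑ k ∈ cls l (F n) r, m n k * Real.sin (((k + 1) / l * l : ℕ) * eps l s n)
        = (l ^ 2 * eps l s n)⁻¹ * (Real.sinc (l * eps l s n))⁻¹ *
          (Real.sin ((l - r : ℝ) * eps l s n)
            * charRem l (2 * l * n + N₀) (m n) (F n) (eps l s n)
          + ∑ j ∈ Finset.range (l - 1), Real.sin ((l - r : ℝ) * angle l (eps l s n) (j + 1))
            * charRem l (2 * l * n + N₀) (m n) (F n) (angle l (eps l s n) (j + 1))) := by
      rw [← h6]
      have e : ∀ S x : ℝ, x ≠ 0 → S = (l ^ 2 * eps l s n)⁻¹ * x⁻¹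
          * (l * (l * eps l s n * x) * S) := fun S x hx => by
        field_simp
      exact e _ _ hsinc.ne'
    rw [h7, h8, ← mul_sinc ((l - r) * eps l s n), h5]
    have e3 : ∀ A B C D E : ℝ, A * (B * C * (D + E)) = (A * B * D + A * B * E) * C :=
      fun A B C D E => by ring
    rw [e3]
    congr 1
    rw [Finset.mul_sum]
    congr 1
    · field_simp
    · refine Finset.sum_congr rfl fun j _ => ?_
      field_simp
      ring

end Asymptotics


section Gaussian

open Filter Topology

/-! ### Gaussian averages of `sinc` -/

/-- The density `s² e^{-s²/2} / √(2π)`. -/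
noncomputable def maxwell (s : ℝ) : ℝ := (√(2 * Real.pi))⁻¹ * (s ^ 2 * Real.exp (-(1 / 2) * s ^ 2))

theorem continuous_maxwell : Continuous maxwell := by
  unfold maxwell
  fun_prop

theorem maxwell_nonneg (s : ℝ) : 0 ≤ maxwell s := by
  unfold maxwell
  positivity

theorem integrable_exp_half : Integrable fun s : ℝ => Real.exp (-(1 / 2) * s ^ 2) :=
  integrable_exp_neg_mul_sq (by norm_num)

theorem integrable_maxwell : Integrable maxwell := by
  have := integrable_rpow_mul_exp_neg_mul_sq (b := 1 / 2) (s := 2) (by norm_num) (by norm_num)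
  simp only [Real.rpow_two] at this
  exact this.const_mul _

theorem integral_cos_mul_exp (a : ℝ) :
    ∫ s : ℝ, Real.cos (a * s) * Real.exp (-(1 / 2) * s ^ 2)
      = √(2 * Real.pi) * Real.exp (-(a ^ 2 / 2)) := by
  have h := fourierIntegral_gaussian (b := ((1 / 2 : ℝ) : ℂ)) (by norm_num) (a : ℂ)
  have h1 : ∀ s : ℝ, Complex.exp (Complex.I * a * s) * Complex.exp (-((1 / 2 : ℝ) : ℂ) * s ^ 2)
      = Complex.exp ((a * s : ℝ) * Complex.I) * (Real.exp (-(1 / 2) * s ^ 2) : ℝ) := fun s => by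
    push_cast
    congr 2
    ring
  simp only [h1] at h
  have h2 : (Real.pi / ((1 / 2 : ℝ) : ℂ)) ^ (1 / 2 : ℂ) * Complex.exp (-(a : ℂ) ^ 2
      / (4 * ((1 / 2 : ℝ) : ℂ))) = ((√(2 * Real.pi) * Real.exp (-(a ^ 2 / 2)) : ℝ) : ℂ) := by
    rw [Real.sqrt_eq_rpow, Complex.ofReal_mul, Complex.ofReal_cpow (by positivity)]
    congr 1
    · push_cast
      congr 1
      ring
    · push_cast
      congr 1
      ring
  rw [h2] at h
  have hint : Integrable fun s : ℝ =>
      Complex.exp ((a * s : ℝ) * Complex.I) * (Real.exp (-(1 / 2) * s ^ 2) : ℝ) := by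
    refine (integrable_exp_half.ofReal (𝕜 := ℂ)).bdd_mul (c := 1) ?_ ?_
    · exact (by fun_prop : Continuous fun s : ℝ =>
        Complex.exp ((a * s : ℝ) * Complex.I)).aestronglyMeasurable
    · exact ae_of_all _ fun s => (Complex.norm_exp_ofReal_mul_I _).le
  have h3 := congrArg Complex.re h
  rw [Complex.ofReal_re, ← RCLike.re_eq_complex_re, ← integral_re hint] at h3
  rw [← h3]
  refine integral_congr_ae (ae_of_all _ fun s => ?_)
  simp only [RCLike.re_eq_complex_re, Complex.re_mul_ofReal, Complex.exp_ofReal_mul_I_re]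

/-- The average of `sinc (a s)` against `maxwell`; integration by parts turns it into the
characteristic function of a Gaussian. -/
theorem integral_sinc_mul_maxwell (a : ℝ) :
    ∫ s : ℝ, Real.sinc (a * s) * maxwell s = Real.exp (-(a ^ 2 / 2)) := by
  have hd : ∀ s : ℝ, HasDerivAt (fun s => s * Real.sinc (a * s)) (Real.cos (a * s)) s := by
    intro s
    rcases eq_or_ne a 0 with rfl | ha
    · simpa using hasDerivAt_id' s
    · have h1 : (fun s => s * Real.sinc (a * s)) = fun s => Real.sin (a * s) / a := by
        funext s
        rw [← mul_sinc]
        field_simp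
      rw [h1]
      have h2 := ((hasDerivAt_id s).const_mul a).sin.div_const a
      simpa [ha] using h2
  have hg : ∀ s : ℝ, HasDerivAt (fun s => Real.exp (-(1 / 2) * s ^ 2))
      (-s * Real.exp (-(1 / 2) * s ^ 2)) s := fun s => by
    have := ((hasDerivAt_pow 2 s).const_mul (-(1 / 2) : ℝ)).exp
    refine this.congr_deriv ?_
    push_cast
    ring
  have hcont : Continuous fun s : ℝ => Real.sinc (a * s) :=
    Real.continuous_sinc.comp (continuous_const.mul continuous_id)
  have i1 : Integrable fun s : ℝ => Real.cos (a * s) * Real.exp (-(1 / 2) * s ^ 2) := by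
    refine integrable_exp_half.bdd_mul (c := 1)
      (by fun_prop : Continuous fun s : ℝ => Real.cos (a * s)).aestronglyMeasurable
      (ae_of_all _ fun s => Real.abs_cos_le_one _)
  have i2 : Integrable fun s : ℝ => Real.sinc (a * s) * (s ^ 2 * Real.exp (-(1 / 2) * s ^ 2)) := by
    have := integrable_rpow_mul_exp_neg_mul_sq (b := 1 / 2) (s := 2) (by norm_num) (by norm_num)
    simp only [Real.rpow_two] at this
    exact this.bdd_mul (c := 1) hcont.aestronglyMeasurable
      (ae_of_all _ fun s => Real.abs_sinc_le_one _)
  have i3 : Integrable fun s : ℝ => s * Real.sinc (a * s) * Real.exp (-(1 / 2) * s ^ 2) := by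
    have := integrable_mul_exp_neg_mul_sq (b := 1 / 2) (by norm_num)
    refine (this.bdd_mul (c := 1) hcont.aestronglyMeasurable
      (ae_of_all _ fun s => Real.abs_sinc_le_one _)).congr (ae_of_all _ fun s => ?_)
    ring
  have h := integral_eq_zero_of_hasDerivAt_of_integrable
    (f' := fun s => Real.cos (a * s) * Real.exp (-(1 / 2) * s ^ 2)
      - Real.sinc (a * s) * (s ^ 2 * Real.exp (-(1 / 2) * s ^ 2)))
    (fun s => ((hd s).mul (hg s)).congr_deriv (by ring)) (i1.sub i2) i3
  rw [integral_sub i1 i2, sub_eq_zero, integral_cos_mul_exp] at h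
  have hpi : √(2 * Real.pi) ≠ 0 := by
    have := Real.pi_pos
    positivity
  calc ∫ s : ℝ, Real.sinc (a * s) * maxwell s
      = (√(2 * Real.pi))⁻¹ * ∫ s : ℝ, Real.sinc (a * s) * (s ^ 2 * Real.exp (-(1 / 2) * s ^ 2)) := by
        rw [← integral_const_mul]
        refine integral_congr_ae (ae_of_all _ fun s => ?_)
        simp only [maxwell]
        ring
    _ = _ := by rw [← h, inv_mul_cancel_left₀ hpi]

/-- The Laplace transform, in `c / 2`, of the square of a variable with density `p₂`. -/
noncomputable def laplace (l : ℕ) (c : ℝ) : ℝ :=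
  ∫ s : ℝ, Real.exp (-(c * s ^ 2 / (2 * l))) * maxwell s

theorem laplace_zero (l : ℕ) : laplace l 0 = 1 := by
  have := integral_sinc_mul_maxwell 0
  simpa [laplace] using this

variable {l N₀ : ℕ} {m : ℕ → ℕ → ℕ} {F : ℕ → Finset ℕ}

/-- The probability of the weight `k`. -/
noncomputable def prob (l N : ℕ) (m : ℕ → ℕ) (k : ℕ) : ℝ := m k * tiltDim l k / 2 ^ N

theorem prob_nonneg (l N : ℕ) (m : ℕ → ℕ) (k : ℕ) : 0 ≤ prob l N m k := by
  unfold prob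
  positivity

theorem IsMult.sum_prob {N : ℕ} {m : ℕ → ℕ} {F : Finset ℕ} (h : IsMult l N m F) :
    ∑ k ∈ F, prob l N m k = 1 := by
  have h1 : (∑ k ∈ F, (m k * tiltDim l k : ℝ)) = 2 ^ N := by exact_mod_cast h.dim
  simp only [prob, ← Finset.sum_div]
  rw [h1, div_self (by positivity)]

theorem IsMult.sum_prob_le {N : ℕ} {m : ℕ → ℕ} {F F' : Finset ℕ} (h : IsMult l N m F)
    (hF : F' ⊆ F) : ∑ k ∈ F', prob l N m k ≤ 1 := by
  rw [← h.sum_prob]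
  exact Finset.sum_le_sum_of_subset_of_nonneg hF fun k _ _ => prob_nonneg _ _ _ _

/-- Averaging the limits of `tendsto_sinc` over `s` against `maxwell`, by dominated convergence. -/
theorem tendsto_exp_cls (hl : Odd l) (h : ∀ n, IsMult l (2 * l * n + N₀) (m n) (F n))
    {r : ℕ} (hr : r < l) {c : ℝ} (hc : 0 < c) :
    Tendsto (fun n : ℕ => ∑ k ∈ cls l (F n) r, prob l (2 * l * n + N₀) (m n) k
        * Real.exp (-(c * (((k + 1) / l : ℕ) / √(2 * n)) ^ 2 / 2))) atTop
      (𝓝 (resProb l r * laplace l c)) := by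
  have hb : ∀ n s, |∑ k ∈ cls l (F n) r, prob l (2 * l * n + N₀) (m n) k
      * Real.sinc (√c * s * (((k + 1) / l : ℕ) / √(2 * n)))| ≤ 1 := fun n s => by
    refine (Finset.abs_sum_le_sum_abs _ _).trans
      (le_trans (Finset.sum_le_sum fun k _ => ?_) ((h n).sum_prob_le (Finset.filter_subset _ _)))
    rw [abs_mul, abs_of_nonneg (prob_nonneg _ _ _ _)]
    exact mul_le_of_le_one_right (prob_nonneg _ _ _ _) (Real.abs_sinc_le_one _)
  have hcont : ∀ x : ℝ, Continuous fun s : ℝ => Real.sinc (√c * s * x) := fun x =>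
    Real.continuous_sinc.comp (by fun_prop)
  have key : Tendsto (fun n : ℕ => ∫ s : ℝ, (∑ k ∈ cls l (F n) r,
      prob l (2 * l * n + N₀) (m n) k * Real.sinc (√c * s * (((k + 1) / l : ℕ) / √(2 * n))))
        * maxwell s) atTop
      (𝓝 (∫ s : ℝ, resProb l r * Real.exp (-((√c * s) ^ 2 / (2 * l))) * maxwell s)) := by
    refine tendsto_integral_of_dominated_convergence maxwell (fun n => ?_) integrable_maxwell
      (fun n => ae_of_all _ fun s => ?_) ?_
    · refine (Continuous.mul (continuous_finsetSum _ fun k _ => ?_)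
        continuous_maxwell).aestronglyMeasurable
      exact continuous_const.mul (hcont _)
    · rw [norm_mul, Real.norm_of_nonneg (maxwell_nonneg s)]
      exact mul_le_of_le_one_left (maxwell_nonneg s) (hb n s)
    · filter_upwards [Measure.ae_ne volume 0] with s hs
      exact (tendsto_sinc hl (mul_ne_zero (Real.sqrt_pos.mpr hc).ne' hs) h hr).mul_const _
  have e1 : ∫ s : ℝ, resProb l r * Real.exp (-((√c * s) ^ 2 / (2 * l))) * maxwell s
      = resProb l r * laplace l c := by
    rw [laplace, ← integral_const_mul]
    refine integral_congr_ae (ae_of_all _ fun s => ?_)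
    simp only [mul_pow, Real.sq_sqrt hc.le, mul_assoc]
  rw [e1] at key
  refine key.congr fun n => ?_
  simp only [Finset.sum_mul]
  have hint : ∀ x : ℝ, Integrable fun s : ℝ => Real.sinc (x * s) * maxwell s := fun x =>
    integrable_maxwell.bdd_mul (c := 1)
      (Real.continuous_sinc.comp (continuous_const.mul continuous_id)).aestronglyMeasurable
      (ae_of_all _ fun s => Real.abs_sinc_le_one _)
  have e2 : ∀ (k : ℕ) (s : ℝ), prob l (2 * l * n + N₀) (m n) k
      * Real.sinc (√c * s * (((k + 1) / l : ℕ) / √(2 * n))) * maxwell s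
      = prob l (2 * l * n + N₀) (m n) k
        * (Real.sinc (√c * (((k + 1) / l : ℕ) / √(2 * n)) * s) * maxwell s) := fun k s => by
    rw [mul_assoc, mul_right_comm (√c)]
  simp only [e2]
  rw [integral_finsetSum _ fun k _ => (hint _).const_mul _]
  refine Finset.sum_congr rfl fun k _ => ?_
  rw [integral_const_mul, integral_sinc_mul_maxwell, mul_pow, Real.sq_sqrt hc.le]

end Gaussian


section Residue

open Filter Topology

/-! ### From residue classes of `k + 1` to residue classes of `k` -/

theorem abs_exp_neg_sq_sub_le {c : ℝ} (hc : 0 < c) (x y : ℝ) :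
    |Real.exp (-(c * y ^ 2 / 2)) - Real.exp (-(c * x ^ 2 / 2))| ≤ (c + 2) * |y - x| := by
  have hd : ∀ x : ℝ, HasDerivAt (fun x => Real.exp (-(c * x ^ 2 / 2)))
      (-(c * x) * Real.exp (-(c * x ^ 2 / 2))) x := fun x => by
    have := (((hasDerivAt_pow 2 x).const_mul c).div_const 2).fun_neg.exp
    refine this.congr_deriv ?_
    push_cast
    ring
  refine convex_univ.norm_image_sub_le_of_norm_hasDerivWithin_le
    (fun x _ => (hd x).hasDerivWithinAt) (fun x _ => ?_) (Set.mem_univ x) (Set.mem_univ y)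
  have h0 : 0 ≤ c * x ^ 2 / 2 := by positivity
  have h1 : c * x ^ 2 / 2 * Real.exp (-(c * x ^ 2 / 2)) ≤ 1 := by
    rw [Real.exp_neg, ← div_eq_mul_inv, div_le_one (Real.exp_pos _)]
    linarith [Real.add_one_le_exp (c * x ^ 2 / 2)]
  have h2 : Real.exp (-(c * x ^ 2 / 2)) ≤ 1 := Real.exp_le_one_iff.mpr (by linarith)
  have h3 : |x| ≤ 1 + x ^ 2 := abs_le.mpr ⟨by nlinarith, by nlinarith⟩
  rw [norm_mul, norm_neg, norm_mul, Real.norm_of_nonneg hc.le, Real.norm_of_nonneg (Real.exp_pos _).le,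
    Real.norm_eq_abs]
  calc c * |x| * Real.exp (-(c * x ^ 2 / 2))
      ≤ c * (1 + x ^ 2) * Real.exp (-(c * x ^ 2 / 2)) := by gcongr
    _ = c * Real.exp (-(c * x ^ 2 / 2)) + 2 * (c * x ^ 2 / 2 * Real.exp (-(c * x ^ 2 / 2))) := by
        ring
    _ ≤ c * 1 + 2 * 1 := by gcongr
    _ = c + 2 := by ring

variable {l N₀ : ℕ} {m : ℕ → ℕ → ℕ} {F : ℕ → Finset ℕ}

theorem tendsto_prob_small (hl : 0 < l) (h : ∀ n, IsMult l (2 * l * n + N₀) (m n) (F n)) {k : ℕ}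
    (hk : k + 1 < l) : Tendsto (fun n => prob l (2 * l * n + N₀) (m n) k) atTop (𝓝 0) := by
  have h1 := (tendsto_small hl h hk).const_mul (tiltDim l k : ℝ)
  rw [mul_zero] at h1
  refine squeeze_zero' (Eventually.of_forall fun n => prob_nonneg _ _ _ _) ?_ h1
  filter_upwards [eventually_ge_atTop 1] with n hn
  have hn' : (1 : ℝ) ≤ n := by exact_mod_cast hn
  have h2 : 0 ≤ prob l (2 * l * n + N₀) (m n) k := prob_nonneg _ _ _ _
  calc _ ≤ n * prob l (2 * l * n + N₀) (m n) k := le_mul_of_one_le_left h2 hn'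
    _ = _ := by rw [prob]; ring

/-- The expectation of `e^{-c α² / 2}` over the weights with remainder `k₀` modulo `l`, where
`α = ⌊k / l⌋ / √(2 n)`. -/
theorem tendsto_exp_mod (hl : Odd l) (h : ∀ n, IsMult l (2 * l * n + N₀) (m n) (F n))
    {k₀ : ℕ} (hk₀ : k₀ < l) {c : ℝ} (hc : 0 < c) :
    Tendsto (fun n : ℕ => ∑ k ∈ (F n).filter fun k => k % l = k₀, prob l (2 * l * n + N₀) (m n) k
        * Real.exp (-(c * ((k / l : ℕ) / √(2 * n)) ^ 2 / 2))) atTop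
      (𝓝 (p₁ l k₀ * laplace l c)) := by
  have hl0 := hl.pos
  have hl' : (0 : ℝ) < l := by exact_mod_cast hl0
  -- the residue class of `k` is that of `k + 1` shifted; apart from the weight `k₀` itself, all
  -- weights in it lie beyond the first wall
  rcases Nat.lt_or_ge (k₀ + 1) l with hk | hk
  · have h1 := tendsto_exp_cls hl h hk hc
    have hp : resProb l (k₀ + 1) = p₁ l k₀ := by
      rw [resProb, p₁, if_neg (by omega), if_neg (by omega)]
      push_cast
      ring
    rw [hp] at h1
    have h2 := (tendsto_prob_small hl0 h hk).add h1
    rw [zero_add] at h2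
    refine h2.congr fun n => ?_
    have hset : (F n).filter (fun k => k % l = k₀)
        = (F n).filter (fun k => k = k₀) ∪ cls l (F n) (k₀ + 1) := by
      ext k
      simp only [Finset.mem_filter, Finset.mem_union, cls]
      have e1 := Nat.div_add_mod k l
      have key : k % l = k₀ ↔ k = k₀ ∨ (k + 1) % l = k₀ + 1 ∧ (k + 1) / l ≠ 0 := by
        constructor
        · intro hkl
          have e2 : k + 1 = l * (k / l) + (k₀ + 1) := by omega
          have e3 : (k + 1) / l = k / l := by
            rw [e2, Nat.mul_add_div hl0, Nat.div_eq_of_lt hk, add_zero]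
          have e4 : (k + 1) % l = k₀ + 1 := by
            rw [e2, Nat.mul_add_mod, Nat.mod_eq_of_lt hk]
          by_cases h0 : k / l = 0
          · left
            rw [h0] at e1
            omega
          · right
            exact ⟨e4, e3 ▸ h0⟩
        · rintro (rfl | ⟨e2, -⟩)
          · exact Nat.mod_eq_of_lt hk₀
          · have e3 := Nat.div_add_mod (k + 1) l
            have e4 : k = l * ((k + 1) / l) + k₀ := by omega
            rw [e4, Nat.mul_add_mod, Nat.mod_eq_of_lt hk₀]
      tauto
    rw [hset, Finset.sum_union]
    · congr 1
      · rw [Finset.filter_eq']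
        have e0 : k₀ / l = 0 := Nat.div_eq_of_lt hk₀
        split_ifs with hF
        · rw [Finset.sum_singleton, e0]
          simp
        · rw [Finset.sum_empty, prob, (h n).zero k₀ hF]
          simp
      · refine Finset.sum_congr rfl fun k hk' => ?_
        obtain ⟨-, e2, -⟩ := Finset.mem_filter.mp hk'
        have e3 := Nat.div_add_mod (k + 1) l
        have e4 : k = l * ((k + 1) / l) + k₀ := by omega
        have e5 : k / l = (k + 1) / l := by
          conv_lhs => rw [e4, Nat.mul_add_div hl0, Nat.div_eq_of_lt hk₀, add_zero]
        rw [e5]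
    · rw [Finset.disjoint_left]
      intro k hk1 hk2
      obtain ⟨-, rfl⟩ := Finset.mem_filter.mp hk1
      exact (Finset.mem_filter.mp hk2).2.2 (Nat.div_eq_of_lt hk)
  · obtain rfl : k₀ = l - 1 := by omega
    have h1 := tendsto_exp_cls hl h hl0 hc
    have hp : resProb l 0 = p₁ l (l - 1) := by
      rw [resProb, p₁, if_pos rfl, if_pos rfl]
    rw [hp] at h1
    have hset : ∀ n, (F n).filter (fun k => k % l = l - 1) = cls l (F n) 0 := fun n => by
      ext k
      simp only [Finset.mem_filter, cls]
      have e1 := Nat.div_add_mod k l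
      have e3 := Nat.div_add_mod (k + 1) l
      have key : k % l = l - 1 ↔ (k + 1) % l = 0 ∧ (k + 1) / l ≠ 0 := by
        constructor
        · intro hkl
          have e2 : k + 1 = l * (k / l + 1) := by rw [mul_add]; omega
          rw [e2, Nat.mul_mod_right, Nat.mul_div_cancel_left _ hl0]
          simp
        · rintro ⟨e2, e4⟩
          obtain ⟨q, hq⟩ : ∃ q, (k + 1) / l = q + 1 := Nat.exists_eq_succ_of_ne_zero e4
          rw [hq, e2, mul_add] at e3
          have e5 : k = l * q + (l - 1) := by omega
          rw [e5, Nat.mul_add_mod, Nat.mod_eq_of_lt (by omega)]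
      tauto
    -- here `⌊k / l⌋` is smaller than `(k + 1) / l` by one, which does not matter in the limit
    have h2 : Tendsto (fun n : ℕ => (c + 2) * (√(2 * n))⁻¹) atTop (𝓝 0) := by
      have := (tendsto_inv_atTop_zero.comp (Real.tendsto_sqrt_atTop.comp
        (Tendsto.const_mul_atTop two_pos tendsto_natCast_atTop_atTop))).const_mul (c + 2)
      rw [mul_zero] at this
      exact this
    have h3 : Tendsto (fun n : ℕ => ∑ k ∈ cls l (F n) 0, prob l (2 * l * n + N₀) (m n) k
        * (Real.exp (-(c * ((k / l : ℕ) / √(2 * n)) ^ 2 / 2))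
          - Real.exp (-(c * (((k + 1) / l : ℕ) / √(2 * n)) ^ 2 / 2)))) atTop (𝓝 0) := by
      refine squeeze_zero_norm (fun n => ?_) h2
      calc _ ≤ ∑ k ∈ cls l (F n) 0, prob l (2 * l * n + N₀) (m n) k * ((c + 2) * (√(2 * n))⁻¹) := by
            refine (norm_sum_le _ _).trans (Finset.sum_le_sum fun k hk' => ?_)
            rw [norm_mul, Real.norm_of_nonneg (prob_nonneg _ _ _ _)]
            refine mul_le_mul_of_nonneg_left ((abs_exp_neg_sq_sub_le hc _ _).trans ?_)
              (prob_nonneg _ _ _ _)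
            refine mul_le_mul_of_nonneg_left ?_ (by linarith)
            obtain ⟨-, e2, e4⟩ := Finset.mem_filter.mp hk'
            have e3 := Nat.div_add_mod (k + 1) l
            obtain ⟨q, hq⟩ : ∃ q, (k + 1) / l = q + 1 := Nat.exists_eq_succ_of_ne_zero e4
            have e5 : k / l = q := by
              rw [hq, e2, mul_add] at e3
              have e5 : k = l * q + (l - 1) := by omega
              rw [e5, Nat.mul_add_div hl0, Nat.div_eq_of_lt (by omega), add_zero]
            rw [hq, e5, ← sub_div, abs_div, abs_of_nonneg (Real.sqrt_nonneg _), div_eq_mul_inv]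
            refine mul_le_of_le_one_left (inv_nonneg.mpr (Real.sqrt_nonneg _)) ?_
            push_cast
            rw [show (q : ℝ) - (q + 1) = -1 by ring]
            simp
        _ ≤ 1 * ((c + 2) * (√(2 * n))⁻¹) := by
            rw [← Finset.sum_mul]
            exact mul_le_mul_of_nonneg_right ((h n).sum_prob_le (Finset.filter_subset _ _))
              (by positivity)
        _ = _ := one_mul _
    have h4 := h3.add h1
    rw [zero_add] at h4
    refine h4.congr fun n => ?_
    rw [hset, ← Finset.sum_add_distrib]
    exact Finset.sum_congr rfl fun k _ => by ring

end Residue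

section Criterion

open Filter Topology

/-! ### A criterion for weak convergence -/

variable {ι : Type}

/-- The test function `e^{-c α² / 2}` on the component `i`. -/
noncomputable def testFun (i : ι) (c : ℝ) (x : ι × ℝ≥0) : ℝ :=
  open Classical in if x.1 = i then Real.exp (-(c * (x.2 : ℝ) ^ 2 / 2)) else 0

theorem testFun_nonneg (i : ι) (c : ℝ) (x : ι × ℝ≥0) : 0 ≤ testFun i c x := by
  unfold testFun
  split_ifs
  · exact (Real.exp_pos _).le
  · exact le_rfl

theorem testFun_le {c c' : ℝ} (h : c ≤ c') (i : ι) (x : ι × ℝ≥0) :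
    testFun i c' x ≤ testFun i c x := by
  unfold testFun
  split_ifs
  · exact Real.exp_le_exp.mpr (by gcongr)
  · exact le_rfl

theorem testFun_le_one {c : ℝ} (h : 0 ≤ c) (i : ι) (x : ι × ℝ≥0) : testFun i c x ≤ 1 := by
  refine (testFun_le h i x).trans ?_
  unfold testFun
  split_ifs <;> simp

theorem continuous_testFun [TopologicalSpace ι] [DiscreteTopology ι] (i : ι) (c : ℝ) :
    Continuous (testFun i c) := by
  classical
  have h : testFun i c = fun x : ι × ℝ≥0 => (if x.1 = i then (1 : ℝ) else 0)
      * Real.exp (-(c * (x.2 : ℝ) ^ 2 / 2)) := by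
    funext x
    unfold testFun
    split_ifs <;> simp
  rw [h]
  refine Continuous.mul ?_ (by fun_prop)
  exact (continuous_of_discreteTopology (f := fun j : ι => if j = i then (1 : ℝ) else 0)).comp
    continuous_fst

variable [Fintype ι]

theorem sum_testFun (c : ℝ) (x : ι × ℝ≥0) :
    ∑ i, testFun i c x = Real.exp (-(c * (x.2 : ℝ) ^ 2 / 2)) := by
  classical
  simp [testFun]

/-- If no mass is lost from below, the components of a sequence of probability vectors converge. -/
theorem tendsto_of_sum_eq {x : ℕ → ι → ℝ} {L : ι → ℝ} (hsum : ∀ n, ∑ i, x n i = ∑ i, L i)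
    (h : ∀ i, ∀ a < L i, ∀ᶠ n in atTop, a < x n i) (i : ι) :
    Tendsto (fun n => x n i) atTop (𝓝 (L i)) := by
  classical
  refine tendsto_order.mpr ⟨h i, fun b hb => ?_⟩
  let η := (b - L i) / (Fintype.card ι + 1)
  have hη : 0 < η := div_pos (sub_pos.mpr hb) (by positivity)
  have hη' : (Fintype.card ι + 1) * η = b - L i := mul_div_cancel₀ _ (by positivity)
  have h1 : ∀ᶠ n in atTop, ∀ j, L j - η < x n j :=
    eventually_all.mpr fun j => h j _ (by linarith)
  filter_upwards [h1] with n hn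
  have h2 := hsum n
  rw [← Finset.add_sum_erase _ _ (Finset.mem_univ i),
    ← Finset.add_sum_erase _ L (Finset.mem_univ i)] at h2
  have h3 : ∑ j ∈ Finset.univ.erase i, (L j - η) ≤ ∑ j ∈ Finset.univ.erase i, x n j :=
    Finset.sum_le_sum fun j _ => (hn j).le
  rw [Finset.sum_sub_distrib, Finset.sum_const, nsmul_eq_mul] at h3
  have h4 : ((Finset.univ.erase i).card : ℝ) * η ≤ Fintype.card ι * η := by
    refine mul_le_mul_of_nonneg_right ?_ hη.le
    exact_mod_cast Finset.card_le_univ _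
  linarith

theorem eval_exp_eq_sum (p : ι → Polynomial ℝ) (x : ι × ℝ≥0) :
    (p x.1).eval (Real.exp (-((x.2 : ℝ) ^ 2 / 2)))
      = ∑ i, ∑ d ∈ Finset.range ((p i).natDegree + 1), (p i).coeff d * testFun i d x := by
  classical
  rw [Polynomial.eval_eq_sum_range, Finset.sum_eq_single x.1]
  · refine Finset.sum_congr rfl fun d _ => ?_
    rw [testFun, if_pos rfl, ← Real.exp_nat_mul]
    congr 2
    ring
  · intro i _ hi
    refine Finset.sum_eq_zero fun d _ => ?_
    rw [testFun, if_neg (Ne.symm hi), mul_zero]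
  · exact fun h => (h (Finset.mem_univ _)).elim

variable [TopologicalSpace ι] [DiscreteTopology ι] [MeasurableSpace ι] [BorelSpace ι]

theorem integrable_testFun (μ : Measure (ι × ℝ≥0)) [IsFiniteMeasure μ] {c : ℝ} (h : 0 ≤ c) (i : ι) :
    Integrable (testFun i c) μ := by
  refine Integrable.of_bound (continuous_testFun i c).aestronglyMeasurable 1
    (ae_of_all _ fun x => ?_)
  rw [Real.norm_of_nonneg (testFun_nonneg i c x)]
  exact testFun_le_one h i x

/-- The masses of the components are the limits of the integrals of the test functions. -/
theorem tendsto_integral_testFun_zero (μ : Measure (ι × ℝ≥0)) [IsFiniteMeasure μ] (i : ι) :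
    Tendsto (fun n : ℕ => ∫ x, testFun i (1 / ((n : ℝ) + 1)) x ∂μ) atTop
      (𝓝 (∫ x, testFun i 0 x ∂μ)) := by
  refine tendsto_integral_of_dominated_convergence (fun _ => 1)
    (fun n => (continuous_testFun i _).aestronglyMeasurable) (integrable_const _)
    (fun n => ae_of_all _ fun x => ?_) (ae_of_all _ fun x => ?_)
  · rw [Real.norm_of_nonneg (testFun_nonneg i _ x)]
    exact testFun_le_one (by positivity) i x
  · have : Continuous fun c : ℝ => testFun i c x := by
      unfold testFun
      split_ifs <;> fun_prop
    exact (this.tendsto 0).comp tendsto_one_div_add_atTop_nhds_zero_nat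

variable {μ : ℕ → ProbabilityMeasure (ι × ℝ≥0)} {μ₀ : ProbabilityMeasure (ι × ℝ≥0)}

theorem sum_integral_testFun_zero (ν : ProbabilityMeasure (ι × ℝ≥0)) :
    ∑ i, ∫ x, testFun i 0 x ∂(ν : Measure (ι × ℝ≥0)) = 1 := by
  rw [← integral_finsetSum _ fun i _ => integrable_testFun _ le_rfl i]
  simp [sum_testFun]

/-- The masses of the components converge: they are at least the integrals of the test functions,
and add up to one. -/
theorem tendsto_integral_testFun_of_pos
    (h : ∀ i, ∀ c > 0, Tendsto (fun n => ∫ x, testFun i c x ∂(μ n : Measure (ι × ℝ≥0))) atTop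
      (𝓝 (∫ x, testFun i c x ∂(μ₀ : Measure (ι × ℝ≥0))))) (i : ι) :
    Tendsto (fun n => ∫ x, testFun i 0 x ∂(μ n : Measure (ι × ℝ≥0))) atTop
      (𝓝 (∫ x, testFun i 0 x ∂(μ₀ : Measure (ι × ℝ≥0)))) := by
  refine tendsto_of_sum_eq (x := fun n i => ∫ x, testFun i 0 x ∂(μ n : Measure (ι × ℝ≥0)))
    (fun n => by rw [sum_integral_testFun_zero, sum_integral_testFun_zero]) (fun i a ha => ?_) i
  obtain ⟨n, hn⟩ := ((tendsto_integral_testFun_zero (μ₀ : Measure (ι × ℝ≥0)) i).eventually_const_lt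
    ha).exists
  have hc : (0 : ℝ) < 1 / ((n : ℝ) + 1) := by positivity
  filter_upwards [(h i _ hc).eventually_const_lt hn] with k hk
  refine hk.trans_le (integral_mono (integrable_testFun _ hc.le i) (integrable_testFun _ le_rfl i)
    fun x => testFun_le hc.le i x)

theorem isTightMeasureSet_of_finite {S : Set (Measure (ι × ℝ≥0))} (hS : S.Finite)
    (hf : ∀ ν ∈ S, IsFiniteMeasure ν) : IsTightMeasureSet S := by
  induction S, hS using Set.Finite.induction_on with
  | empty =>
    rw [isTightMeasureSet_iff_exists_isCompact_measure_compl_le]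
    exact fun ε _ => ⟨∅, isCompact_empty, fun ν hν => hν.elim⟩
  | insert _ _ ih =>
    rename_i ν S _ _
    have := hf ν (Set.mem_insert _ _)
    rw [Set.insert_eq]
    exact isTightMeasureSet_singleton.union (ih fun ν hν => hf ν (Set.mem_insert_of_mem _ hν))

/-- Convergence of the integrals of `e^{-c α² / 2}` for small `c` prevents the escape of mass to
infinity. -/
theorem isTightMeasureSet_of_testFun
    (h : ∀ i, ∀ c > 0, Tendsto (fun n => ∫ x, testFun i c x ∂(μ n : Measure (ι × ℝ≥0))) atTop
      (𝓝 (∫ x, testFun i c x ∂(μ₀ : Measure (ι × ℝ≥0))))) :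
    IsTightMeasureSet {(μ n : Measure (ι × ℝ≥0)) | n} := by
  rw [isTightMeasureSet_iff_exists_isCompact_measure_compl_le]
  intro ε hε
  obtain ⟨δ, hδ, hδε⟩ : ∃ δ : ℝ, 0 < δ ∧ ENNReal.ofReal (2 * δ) ≤ ε := by
    rcases eq_or_ne ε ⊤ with rfl | hε'
    · exact ⟨1, one_pos, le_top⟩
    · refine ⟨ε.toReal / 2, half_pos (ENNReal.toReal_pos hε.ne' hε'), ?_⟩
      rw [mul_div_cancel₀ _ two_ne_zero, ENNReal.ofReal_toReal hε']
  -- the sum of the test functions for a small parameter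
  have h1 : Tendsto (fun n : ℕ => ∑ i, ∫ x, testFun i (1 / ((n : ℝ) + 1)) x
      ∂(μ₀ : Measure (ι × ℝ≥0))) atTop (𝓝 1) := by
    have h0 := tendsto_finsetSum Finset.univ fun i _ =>
      tendsto_integral_testFun_zero (μ₀ : Measure (ι × ℝ≥0)) i
    rwa [sum_integral_testFun_zero μ₀] at h0
  obtain ⟨k, hk⟩ := (h1.eventually_const_lt (show 1 - δ < 1 by linarith)).exists
  set c : ℝ := 1 / ((k : ℝ) + 1) with hc
  have hc0 : 0 < c := by positivity
  have h2 := tendsto_finsetSum Finset.univ fun i _ => h i c hc0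
  obtain ⟨n₀, hn₀⟩ := eventually_atTop.mp (h2.eventually_const_lt hk)
  obtain ⟨R, hR⟩ : ∃ R : ℝ≥0, Real.exp (-(c * (R : ℝ) ^ 2 / 2)) ≤ 1 / 2 := by
    have h3 : Tendsto (fun R : ℝ≥0 => Real.exp (-(c * (R : ℝ) ^ 2 / 2))) atTop (𝓝 0) := by
      refine Real.tendsto_exp_neg_atTop_nhds_zero.comp (Tendsto.atTop_div_const two_pos
        (Tendsto.const_mul_atTop hc0 ((tendsto_pow_atTop two_ne_zero).comp
          (NNReal.tendsto_coe_atTop.mpr tendsto_id))))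
    exact (h3.eventually_le_const (by norm_num)).exists
  have hfin := isTightMeasureSet_of_finite (S := (fun n => (μ n : Measure (ι × ℝ≥0))) '' Set.Iio n₀)
    ((Set.finite_Iio n₀).image _) (by rintro _ ⟨n, -, rfl⟩; infer_instance)
  rw [isTightMeasureSet_iff_exists_isCompact_measure_compl_le] at hfin
  obtain ⟨K, hK, hKε⟩ := hfin ε hε
  refine ⟨K ∪ Set.univ ×ˢ Set.Icc 0 R, hK.union (isCompact_univ.prod isCompact_Icc), ?_⟩
  rintro _ ⟨n, rfl⟩
  rcases lt_or_ge n n₀ with hn | hn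
  · exact (measure_mono (Set.compl_subset_compl.mpr Set.subset_union_left)).trans
      (hKε _ ⟨n, hn, rfl⟩)
  · let f : ι × ℝ≥0 → ℝ := fun x => 1 - ∑ i, testFun i c x
    have hf0 : ∀ x, 0 ≤ f x := fun x => by
      simp only [f, sum_testFun, sub_nonneg, Real.exp_le_one_iff, Left.neg_nonpos_iff]
      positivity
    have hint : Integrable (fun x => ∑ i, testFun i c x) (μ n : Measure (ι × ℝ≥0)) :=
      integrable_finsetSum _ fun i _ => integrable_testFun _ hc0.le i
    have h3 := mul_meas_ge_le_integral_of_nonneg (μ := (μ n : Measure (ι × ℝ≥0)))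
      (ae_of_all _ hf0) ((integrable_const 1).sub hint) (1 / 2)
    have h4 : ∫ x, f x ∂(μ n : Measure (ι × ℝ≥0)) < δ := by
      rw [integral_sub (integrable_const 1) hint,
        integral_finsetSum _ fun i _ => integrable_testFun _ hc0.le i]
      have := hn₀ n hn
      simp
      linarith
    have h5 : (K ∪ Set.univ ×ˢ Set.Icc 0 R)ᶜ ⊆ {x | 1 / 2 ≤ f x} := by
      intro x hx
      have hx' : R < x.2 := by
        by_contra hcon
        exact hx (Or.inr ⟨Set.mem_univ _, zero_le, not_lt.mp hcon⟩)
      have h6 : Real.exp (-(c * (x.2 : ℝ) ^ 2 / 2)) ≤ Real.exp (-(c * (R : ℝ) ^ 2 / 2)) := by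
        refine Real.exp_le_exp.mpr ?_
        have : (R : ℝ) ≤ x.2 := by exact_mod_cast hx'.le
        gcongr
      change 1 / 2 ≤ 1 - ∑ i, testFun i c x
      rw [sum_testFun]
      linarith
    refine (measure_mono h5).trans (le_trans ?_ hδε)
    rw [← ofReal_measureReal]
    exact ENNReal.ofReal_le_ofReal (by linarith)

/-- The bounded continuous function given by a test function. -/
noncomputable def testBCF (i : ι) {c : ℝ} (hc : 0 ≤ c) : BoundedContinuousFunction (ι × ℝ≥0) ℝ :=
  BoundedContinuousFunction.ofNormedAddCommGroup (testFun i c) (continuous_testFun i c) 1 fun x => by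
    rw [Real.norm_of_nonneg (testFun_nonneg i c x)]
    exact testFun_le_one hc i x

/-- The bounded continuous functions that are, on each component, polynomials in `e^{-α² / 2}`. -/
noncomputable def testAlgebra (ι : Type) [TopologicalSpace ι] :
    StarSubalgebra ℝ (BoundedContinuousFunction (ι × ℝ≥0) ℝ) where
  carrier := {g | ∃ p : ι → Polynomial ℝ,
    ∀ x, g x = (p x.1).eval (Real.exp (-((x.2 : ℝ) ^ 2 / 2)))}
  mul_mem' := by
    rintro g g' ⟨p, hp⟩ ⟨p', hp'⟩
    exact ⟨p * p', fun x => by simp [hp, hp']⟩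
  add_mem' := by
    rintro g g' ⟨p, hp⟩ ⟨p', hp'⟩
    exact ⟨p + p', fun x => by simp [hp, hp']⟩
  algebraMap_mem' a := ⟨fun _ => Polynomial.C a, fun x => by
    rw [Polynomial.eval_C]
    rfl⟩
  star_mem' := by
    rintro g ⟨p, hp⟩
    exact ⟨p, fun x => by simp [hp]⟩

/-- Weak convergence on finitely many copies of `[0, ∞)` can be tested on the functions
`e^{-c α² / 2}`, `c > 0`, on the copies. -/
theorem tendsto_of_testFun
    (h : ∀ i, ∀ c > 0, Tendsto (fun n => ∫ x, testFun i c x ∂(μ n : Measure (ι × ℝ≥0))) atTop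
      (𝓝 (∫ x, testFun i c x ∂(μ₀ : Measure (ι × ℝ≥0))))) :
    Tendsto μ atTop (𝓝 μ₀) := by
  classical
  refine ProbabilityMeasure.tendsto_of_tight_of_separatesPoints ℝ (isTightMeasureSet_of_testFun h)
    (A := testAlgebra ι) ?_ ?_
  · rintro ⟨i, α⟩ ⟨j, β⟩ hne
    by_cases hij : i = j
    · subst hij
      have hαβ : α ≠ β := fun h => hne (by rw [h])
      refine ⟨_, ⟨_, ⟨testBCF i zero_le_one, ⟨fun k => if k = i then Polynomial.X else 0,
        fun x => ?_⟩, rfl⟩, rfl⟩, ?_⟩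
      · change testFun i 1 x = _
        by_cases hx : x.1 = i <;> simp [testFun, hx]
      · change testFun i 1 (i, α) ≠ testFun i 1 (i, β)
        simp only [testFun, if_true]
        intro h0
        have h1 := Real.exp_injective h0
        have h2 : (α : ℝ) ^ 2 = (β : ℝ) ^ 2 := by linarith
        exact hαβ (NNReal.coe_injective
          ((pow_left_inj₀ α.coe_nonneg β.coe_nonneg two_ne_zero).mp h2))
    · refine ⟨_, ⟨_, ⟨testBCF i le_rfl, ⟨fun k => if k = i then 1 else 0,
        fun x => ?_⟩, rfl⟩, rfl⟩, ?_⟩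
      · change testFun i 0 x = _
        by_cases hx : x.1 = i <;> simp [testFun, hx]
      · change testFun i 0 (i, α) ≠ testFun i 0 (j, β)
        simp [testFun, Ne.symm hij]
  · rintro g ⟨p, hp⟩
    have hterm : ∀ (i : ι) (d : ℕ), Tendsto
        (fun n => ∫ x, (p i).coeff d * testFun i d x ∂(μ n : Measure (ι × ℝ≥0))) atTop
        (𝓝 (∫ x, (p i).coeff d * testFun i d x ∂(μ₀ : Measure (ι × ℝ≥0)))) := fun i d => by
      simp only [integral_const_mul]
      refine Tendsto.const_mul _ ?_
      rcases Nat.eq_zero_or_pos d with rfl | hd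
      · simpa using tendsto_integral_testFun_of_pos h i
      · exact h i d (by exact_mod_cast hd)
    have hint : ∀ (ν : ProbabilityMeasure (ι × ℝ≥0)), ∫ x, g x ∂(ν : Measure (ι × ℝ≥0))
        = ∑ i, ∑ d ∈ Finset.range ((p i).natDegree + 1),
          ∫ x, (p i).coeff d * testFun i d x ∂(ν : Measure (ι × ℝ≥0)) := fun ν => by
      have hi : ∀ (i : ι) (d : ℕ), Integrable (fun x => (p i).coeff d * testFun i d x)
          (ν : Measure (ι × ℝ≥0)) := fun i d =>
        (integrable_testFun _ (Nat.cast_nonneg d) i).const_mul _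
      simp only [hp, eval_exp_eq_sum]
      rw [integral_finsetSum _ fun i _ => integrable_finsetSum _ fun d _ => hi i d]
      exact Finset.sum_congr rfl fun i _ => integral_finsetSum _ fun d _ => hi i d
    simp only [hint]
    exact tendsto_finsetSum _ fun i _ => tendsto_finsetSum _ fun d _ => hterm i d

end Criterion


section LimitLaw

open Filter Topology

/-! ### The limit law and the Plancherel measures -/

variable {l : ℕ}

theorem sum_two_mul_sub (n : ℕ) : ∑ k ∈ Finset.range n, 2 * ((n : ℝ) - k) = n * (n + 1) := by
  induction n with
  | zero => simp
  | succ n ih =>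
    have h : ∀ k : ℕ, 2 * (((n + 1 : ℕ) : ℝ) - k) = 2 * ((n : ℝ) - k) + 2 := fun k => by
      push_cast
      ring
    rw [Finset.sum_congr rfl fun k _ => h k, Finset.sum_add_distrib, Finset.sum_range_succ, ih]
    simp
    ring

theorem p₁_nonneg (hl : 0 < l) {k : ℕ} (hk : k < l) : 0 ≤ p₁ l k := by
  unfold p₁
  split_ifs
  · positivity
  · have : (k : ℝ) + 1 ≤ l := by exact_mod_cast hk
    have : 0 ≤ (l : ℝ) - 1 - k := by linarith
    positivity

theorem sum_p₁ (hl : 0 < l) : ∑ k : Fin l, p₁ l k = 1 := by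
  obtain ⟨n, rfl⟩ : ∃ n, l = n + 1 := ⟨l - 1, by omega⟩
  rw [Fin.sum_univ_eq_sum_range (fun k => p₁ (n + 1) k), Finset.sum_range_succ]
  have h1 : ∀ k ∈ Finset.range n, p₁ (n + 1) k = 2 * ((n : ℝ) - k) / ((n : ℝ) + 1) ^ 2 :=
    fun k hk => by
      have := Finset.mem_range.mp hk
      rw [p₁, if_neg (by omega)]
      push_cast
      ring
  rw [Finset.sum_congr rfl h1, ← Finset.sum_div, sum_two_mul_sub, p₁, if_pos (by simp)]
  have : (n : ℝ) + 1 ≠ 0 := by positivity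
  push_cast
  field_simp

theorem limitLaw₁_eq (l : ℕ) :
    limitLaw₁ l = ∑ k : Fin l, ENNReal.ofReal (p₁ l k) • Measure.dirac k := by
  rw [limitLaw₁, Measure.sum_fintype]

theorem isProbabilityMeasure_limitLaw₁ (hl : 0 < l) : IsProbabilityMeasure (limitLaw₁ l) := by
  refine ⟨?_⟩
  rw [limitLaw₁_eq, Measure.finsetSum_apply]
  simp only [Measure.smul_apply, measure_univ, smul_eq_mul, mul_one]
  rw [← ENNReal.ofReal_sum_of_nonneg fun k _ => p₁_nonneg hl k.2, sum_p₁ hl, ENNReal.ofReal_one]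

theorem integral_limitLaw₁ (hl : 0 < l) (f : Fin l → ℝ) :
    ∫ k, f k ∂(limitLaw₁ l) = ∑ k : Fin l, p₁ l k * f k := by
  rw [limitLaw₁_eq, integral_finsetSum_measure]
  · refine Finset.sum_congr rfl fun k _ => ?_
    rw [integral_smul_measure, integral_dirac, ENNReal.toReal_ofReal (p₁_nonneg hl k.2), smul_eq_mul]
  · intro k _
    exact (integrable_dirac (by simp)).smul_measure ENNReal.ofReal_ne_top

theorem p₂_nonneg (l : ℕ) (α : ℝ) : 0 ≤ p₂ l α := by
  unfold p₂
  positivity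

theorem continuous_p₂ (l : ℕ) : Continuous (p₂ l) := by
  unfold p₂
  fun_prop

theorem integral_comap_coe (f : ℝ → ℝ) :
    ∫ α : ℝ≥0, f α ∂(Measure.comap ((↑) : ℝ≥0 → ℝ) volume) = ∫ α in Set.Ioi 0, f α := by
  have he : MeasurableEmbedding ((↑) : ℝ≥0 → ℝ) := MeasurableEmbedding.subtype_coe measurableSet_Ici
  rw [← he.integral_map, he.map_comap, NNReal.range_coe, integral_Ici_eq_integral_Ioi]

/-- The Laplace transform of the limit law; the density is rescaled to the one of `maxwell`. -/
theorem integral_exp_mul_p₂ (hl : 0 < l) (c : ℝ) :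
    ∫ α : ℝ≥0, Real.exp (-(c * (α : ℝ) ^ 2 / 2)) * p₂ l α
      ∂(Measure.comap ((↑) : ℝ≥0 → ℝ) volume) = laplace l c := by
  have hl' : (0 : ℝ) < l := by exact_mod_cast hl
  rw [integral_comap_coe fun α => Real.exp (-(c * α ^ 2 / 2)) * p₂ l α]
  let g : ℝ → ℝ := fun s => Real.exp (-(c * s ^ 2 / (2 * l))) * maxwell s
  have h1 : laplace l c = 2 * ∫ s in Set.Ioi 0, g s := by
    rw [← integral_comp_abs]
    refine integral_congr_ae (ae_of_all _ fun s => ?_)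
    simp only [g, maxwell, sq_abs]
  have h2 := integral_comp_mul_left_Ioi' g 0 (Real.sqrt_pos.mpr hl')
  rw [mul_zero] at h2
  rw [h1, ← h2, smul_eq_mul, ← integral_const_mul, ← integral_const_mul]
  refine integral_congr_ae (ae_of_all _ fun α => ?_)
  have e1 : (l : ℝ) ^ (3 / 2 : ℝ) = √l * l := by
    rw [Real.sqrt_eq_rpow, show (3 / 2 : ℝ) = 1 / 2 + 1 by norm_num, Real.rpow_add hl',
      Real.rpow_one]
  have e2 : √(2 / Real.pi) = 2 * (√(2 * Real.pi))⁻¹ := by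
    have hpi := Real.pi_pos
    rw [Real.sqrt_div' _ hpi.le, Real.sqrt_mul' _ hpi.le]
    have : √2 * √2 = (2 : ℝ) := Real.mul_self_sqrt (by norm_num)
    have h2 : √(2 : ℝ) ≠ 0 := by positivity
    have h3 : √Real.pi ≠ 0 := by positivity
    field_simp
    linarith
  simp only [g, maxwell, p₂, mul_pow, Real.sq_sqrt hl'.le, e1, e2]
  have e3 : -(c * (l * α ^ 2) / (2 * l)) = -(c * α ^ 2 / 2) := by field_simp
  have e4 : -(1 / 2) * (l * α ^ 2) = -(α ^ 2 * l / 2) := by ring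
  rw [e3, e4]
  ring

theorem integral_limitLaw₂ (hl : 0 < l) (c : ℝ) :
    ∫ α : ℝ≥0, Real.exp (-(c * (α : ℝ) ^ 2 / 2)) ∂(limitLaw₂ l) = laplace l c := by
  have hm : Measurable fun α : ℝ≥0 => ENNReal.ofReal (p₂ l α) :=
    ((continuous_p₂ l).comp NNReal.continuous_coe).measurable.ennreal_ofReal
  rw [limitLaw₂, integral_withDensity_eq_integral_toReal_smul hm
    (ae_of_all _ fun _ => ENNReal.ofReal_lt_top), ← integral_exp_mul_p₂ hl]
  refine integral_congr_ae (ae_of_all _ fun α => ?_)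
  simp only [ENNReal.toReal_ofReal (p₂_nonneg _ _), smul_eq_mul, mul_comm]

theorem isProbabilityMeasure_limitLaw₂ (hl : 0 < l) : IsProbabilityMeasure (limitLaw₂ l) := by
  have h1 : ∫ α : ℝ≥0, p₂ l α ∂(Measure.comap ((↑) : ℝ≥0 → ℝ) volume) = 1 := by
    rw [← laplace_zero l, ← integral_exp_mul_p₂ hl 0]
    simp
  have h2 : Integrable (fun α : ℝ≥0 => p₂ l α) (Measure.comap ((↑) : ℝ≥0 → ℝ) volume) :=
    Integrable.of_integral_ne_zero (by rw [h1]; exact one_ne_zero)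
  refine ⟨?_⟩
  rw [limitLaw₂, withDensity_apply _ MeasurableSet.univ, Measure.restrict_univ,
    ← ofReal_integral_eq_lintegral_ofReal h2 (ae_of_all _ fun α => p₂_nonneg _ _), h1,
    ENNReal.ofReal_one]

variable {N : ℕ} {m d : ℕ → ℕ} {F : Finset ℕ}

theorem tiltDim_one (hl : Odd l) : tiltDim l 1 = 2 := by
  obtain ⟨k, rfl⟩ := hl
  rw [tiltDim, if_pos]
  rcases Nat.eq_zero_or_pos k with rfl | hk
  · exact Or.inr rfl
  · exact Or.inl (Nat.div_eq_of_lt (by omega))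

/-- The Plancherel measure has finite support. -/
theorem IsMult.plancherel_eq (h : IsMult l N m F) (hl : Odd l) :
    plancherel m (tiltDim l) N
      = ∑ k ∈ F, ENNReal.ofReal (prob l N m k) • Measure.dirac k := by
  refine Measure.ext fun s hs => ?_
  rw [plancherel, Measure.sum_apply _ hs, Measure.finsetSum_apply, tsum_eq_sum (s := F)]
  · refine Finset.sum_congr rfl fun k _ => ?_
    rw [prob, tiltDim_one hl, Nat.cast_ofNat]
  · intro k hk
    simp [h.zero k hk]

theorem IsMult.isProbabilityMeasure (h : IsMult l N m F) (hl : Odd l) :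
    IsProbabilityMeasure (plancherel m (tiltDim l) N) := by
  refine ⟨?_⟩
  rw [h.plancherel_eq hl, Measure.finsetSum_apply]
  simp only [Measure.smul_apply, measure_univ, smul_eq_mul, mul_one]
  rw [← ENNReal.ofReal_sum_of_nonneg fun k _ => prob_nonneg _ _ _ _, h.sum_prob, ENNReal.ofReal_one]

theorem IsMult.integral_plancherel (h : IsMult l N m F) (hl : Odd l) (f : ℕ → ℝ) :
    ∫ k, f k ∂(plancherel m (tiltDim l) N) = ∑ k ∈ F, prob l N m k * f k := by
  rw [h.plancherel_eq hl, integral_finsetSum_measure]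
  · refine Finset.sum_congr rfl fun k _ => ?_
    rw [integral_smul_measure, integral_dirac, ENNReal.toReal_ofReal (prob_nonneg _ _ _ _),
      smul_eq_mul]
  · intro k _
    exact (integrable_dirac (by simp)).smul_measure ENNReal.ofReal_ne_top

theorem testFun_rescale (hl : 0 < l) (i : Fin l) (c : ℝ) (n k : ℕ) :
    testFun i c (rescale l hl n k)
      = if k % l = i then Real.exp (-(c * ((k / l : ℕ) / √(2 * n)) ^ 2 / 2)) else 0 := by
  have h1 : ((rescale l hl n k).1 = i) ↔ k % l = i := Fin.ext_iff
  have h2 : ((rescale l hl n k).2 : ℝ) = (k / l : ℕ) / √(2 * n) := by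
    simp [rescale]
  unfold testFun
  simp only [h1, h2]

theorem integral_testFun_prod (hl : 0 < l) [SFinite (limitLaw₁ l)] [SFinite (limitLaw₂ l)]
    (i : Fin l) (c : ℝ) :
    ∫ x, testFun i c x ∂((limitLaw₁ l).prod (limitLaw₂ l)) = p₁ l i * laplace l c := by
  classical
  have h : testFun i c = fun x : Fin l × ℝ≥0 => (if x.1 = i then (1 : ℝ) else 0)
      * Real.exp (-(c * (x.2 : ℝ) ^ 2 / 2)) := by
    funext x
    unfold testFun
    split_ifs <;> simp
  rw [h, integral_prod_mul (fun j : Fin l => if j = i then (1 : ℝ) else 0)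
    (fun α : ℝ≥0 => Real.exp (-(c * (α : ℝ) ^ 2 / 2))), integral_limitLaw₁ hl, integral_limitLaw₂ hl]
  simp

theorem integral_map_testFun (hl : 0 < l) (i : Fin l) (c : ℝ) (n : ℕ) (ν : ProbabilityMeasure ℕ) :
    ∫ x, testFun i c x ∂(ν.map (f := rescale l hl n)
        (measurable_of_countable _).aemeasurable : ProbabilityMeasure (Fin l × ℝ≥0))
      = ∫ k, testFun i c (rescale l hl n k) ∂(ν : Measure ℕ) := by
  rw [ProbabilityMeasure.toMeasure_map, integral_map (measurable_of_countable _).aemeasurable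
    (continuous_testFun i c).aestronglyMeasurable]

/-- The test functions of `tendsto_of_testFun` have the right limits by `tendsto_exp_mod`. -/
theorem tendsto_map_rescale (hl : Odd l) (N₀ : ℕ) {m : ℕ → ℕ → ℕ} {F : ℕ → Finset ℕ}
    (h : ∀ N, IsMult l N (m N) (F N))
    (hP : ∀ N, IsProbabilityMeasure (plancherel (m N) (tiltDim l) N))
    (h₁ : IsProbabilityMeasure (limitLaw₁ l)) (h₂ : IsProbabilityMeasure (limitLaw₂ l)) :
    Tendsto (fun n : ℕ => ProbabilityMeasure.map
        (⟨_, hP (2 * l * n + N₀)⟩ : ProbabilityMeasure ℕ)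
        (f := rescale l hl.pos n) (measurable_of_countable _).aemeasurable) atTop
      (𝓝 (ProbabilityMeasure.prod ⟨limitLaw₁ l, h₁⟩ ⟨limitLaw₂ l, h₂⟩)) := by
  refine tendsto_of_testFun fun i c hc => ?_
  have e1 := integral_testFun_prod hl.pos i c
  have e2 := tendsto_exp_mod hl (fun n => h (2 * l * n + N₀)) i.2 hc
  rw [← e1] at e2
  refine e2.congr fun n => ?_
  refine Eq.trans ?_ (integral_map_testFun hl.pos i c n _).symm
  refine Eq.trans ?_ ((h (2 * l * n + N₀)).integral_plancherel hl _).symm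
  rw [Finset.sum_filter]
  refine Finset.sum_congr rfl fun k _ => ?_
  rw [testFun_rescale]
  split_ifs <;> simp

end LimitLaw

end QuantumSL2

theorem theorem8p3 (l : ℕ) (hl : Odd l) (𝕜 : Type u) [Field 𝕜] [CharZero 𝕜]
    [Algebra QuantumSL2.Zv 𝕜] (q : 𝕜) (hq : IsPrimitiveRoot q (2 * l))
    (hv : algebraMap QuantumSL2.Zv 𝕜 (LaurentPolynomial.T 1) = q) :
    (∃ (T : ℕ → ModuleCat.{u} (QuantumSL2.Uq 𝕜)) (M : ℕ → ℕ → ℕ),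
      QuantumSL2.IsTiltingDecomposition 𝕜 T M) ∧
    ∀ (T : ℕ → ModuleCat.{u} (QuantumSL2.Uq 𝕜)) (M : ℕ → ℕ → ℕ),
      QuantumSL2.IsTiltingDecomposition 𝕜 T M →
      ∃ (hP : ∀ N : ℕ, IsProbabilityMeasure
          (QuantumSL2.plancherel (M N) (fun k => QuantumSL2.dim 𝕜 (T k)) N))
        (h₁ : IsProbabilityMeasure (QuantumSL2.limitLaw₁ l))
        (h₂ : IsProbabilityMeasure (QuantumSL2.limitLaw₂ l)),
        ∀ N₀ : ℕ, Filter.Tendsto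
          (fun N₁ : ℕ => ProbabilityMeasure.map
            (⟨_, hP (2 * l * N₁ + N₀)⟩ : ProbabilityMeasure ℕ)
            (f := QuantumSL2.rescale l hl.pos N₁) (measurable_of_countable _).aemeasurable)
          Filter.atTop
          (nhds (ProbabilityMeasure.prod ⟨QuantumSL2.limitLaw₁ l, h₁⟩
            ⟨QuantumSL2.limitLaw₂ l, h₂⟩)) := by
  have h := QuantumSL2.isRoot_of_isPrimitiveRoot hl hq hv
  refine ⟨h.exists_tiltingDecomposition, fun T M hTM => ?_⟩
  have hd : (fun k => QuantumSL2.dim 𝕜 (T k)) = QuantumSL2.tiltDim l := funext (h.dim_eq hTM)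
  choose F hF using fun N => h.exists_multiplicities hTM N
  have hM : ∀ N, QuantumSL2.IsMult l N (M N) (F N) := fun N => ⟨(hF N).1, (hF N).2.1, (hF N).2.2⟩
  rw [hd]
  have hP := fun N => (hM N).isProbabilityMeasure hl
  have h₁ := QuantumSL2.isProbabilityMeasure_limitLaw₁ hl.pos
  have h₂ := QuantumSL2.isProbabilityMeasure_limitLaw₂ hl.pos
  exact ⟨hP, h₁, h₂, fun N₀ => QuantumSL2.tendsto_map_rescale hl N₀ hM hP h₁ h₂⟩
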